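/- **Conventions.** Let $\mathbb Z^\times=\mathbb Z\setminus\{0\}$, let $P=\bigoplus_{k\in\mathbb Z^\times}\mathbb Z\epsilon_k\oplus\mathbb Z\Lambda_0$ be the weight lattice of $\mathfrak{gl}_\infty$, with simple roots $\alpha_i=\epsilon_i-\epsilon_{i+1}$ and $\alpha_{-i}=\epsilon_{-i-1}-\epsilon_{-i}$ ($i>0$), $\alpha_0=\epsilon_{-1}-\epsilon_1$, simple coroots $h_i$ defined in the same way with $E_{kk}$ in place of $\epsilon_k$, and $\langle\Lambda_0,h_i\rangle=\delta_{i0}$. For $c>0$ put $\Lambda_c=\Lambda_0+\sum_{k=1}^{c}\epsilon_k$ and $\Lambda_{-c}=\Lambda_0-\sum_{k=-c}^{-1}\epsilon_k$. Crystals are in the sense of Kashiwara, with $\varepsilon_i,\varphi_i$ valued in $\mathbb Z\cup\{-\infty\}$, and with $\widetilde f_i(b\otimes b')=\widetilde f_ib\otimes b'$ if $\varphi_i(b)>\varepsilon_i(b')$ and $b\otimes\widetilde f_ib'$ otherwise. A morphism is a map $\psi:B_1\cup\{\mathbf 0\}\to B_2\cup\{\mathbf 0\}$ with $\psi(\mathbf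 0)=\mathbf 0$ which preserves ${\rm wt},\varepsilon_i,\varphi_i$ on every $b$ with $\psi(b)\ne\mathbf 0$, and satisfies $\psi(\widetilde x_ib)=\widetilde x_i\psi(b)$ ($x=e,f$) whenever $\psi(b)\ne\mathbf 0\ne\psi(\widetilde x_ib)$; it is an embedding if it is injective. $T_\lambda=\{t_\lambda\}$ is the one-point crystal of weight $\lambda$ with $\varepsilon_i=\varphi_i=-\infty$. *Tableaux.* $\mathbf B_{>0}$ is the $\mathfrak{gl}_{>0}$-crystal $1\xrightarrow{1}2\xrightarrow{2}3\cdots$ (${\rm wt}(k)=\epsilon_k$), and $\mathbf B^\vee_{<0}$ the $\mathfrak{gl}_{<0}$-crystal $-1^\vee\xrightarrow{-1}-2^\vee\xrightarrow{-2}\cdots$ (${\rm wt}(-k^\vee)=-\epsilon_{-k}$), ordered by $1<2<\cdots$ and $-1^\vee<-2^\vee<\cdots$. $SST_{\mathcal A}(D)$ is the set of semistandard tableaux of shape $D$ with entries in $\mathcal A$; it is a crystal through the reading word (rows from top to bottom, each row from right to left). $\mu^\pi$ is the diagram of $\mu$ rotated by $180^\circ$. $H_D$ is the tableau whose $l$-th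 entry from the top in each column is $l$ (resp. $-l^\vee$). *The crystal $\mathcal M_{\mu,\nu}$.* $\mathcal M$ is the set of matrices $A=(a_{-i^\vee,j})_{i,j\ge1}$ of finite support with entries in $\mathbb Z_{\ge0}$, and ${\rm wt}(A)=\sum a_{-i^\vee,j}(-\epsilon_{-i}+\epsilon_j)$. List the pairs $(-i^\vee,j)$ with multiplicities $a_{-i^\vee,j}$, by increasing $j$ and, for equal $j$, by decreasing $-i^\vee$, giving words $\mathbf i=i_1\cdots i_r$, $\mathbf j=j_1\cdots j_r$; list them also by increasing $-i^\vee$ and, for equal $-i^\vee$, by decreasing $j$, giving words $\mathbf k,\mathbf l$. The crystal operators with $i<0$ act on the word $\mathbf i$ (fixing $\mathbf j$), those with $i>0$ on $\mathbf l$ (fixing $\mathbf k$), with the corresponding $\varepsilon_i,\varphi_i$; $\widetilde f_0$ adds $1$ to $a_{-1^\vee,1}$, $\widetilde e_0$ subtracts $1$ (and gives $\mathbf 0$ if $a_{-1^\vee,1}=0$), $\varepsilon_0(A)=a_{-1^\vee,1}$ and $\varphi_0(A)=\langle{\rm wt}(A),h_0\rangle+\varepsilon_0(A)$. For partitions $\mu,\nu$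 let $$\mathcal M_{\mu,\nu}=\mathcal M\times SST_{\mathbf B^\vee_{<0}}(\mu^\pi)\times SST_{\mathbf B_{>0}}(\nu),\qquad \mathbb O_{\mu,\nu}=(\mathbb O,H_{\mu^\pi},H_\nu),$$ with ${\rm wt}$ the sum of the three weights; on $(A,S_{<0},S_{>0})$ the crystal structure for $i<0$ is that of $A\otimes S_{<0}$, for $i>0$ that of $A\otimes S_{>0}$, and $\widetilde e_0,\widetilde f_0,\varepsilon_0$ are those of $A$, with $\varphi_0=\langle{\rm wt},h_0\rangle+\varepsilon_0$. *The crystal $\mathbf B(\Lambda_{\mu,\nu;n})$.* For $n\ge\mu_1+\nu_1$ let $\lambda=(\lambda_1\ge\cdots\ge\lambda_n)$ be the integer sequence $\lambda_k=\nu'_k-\mu'_{n-k+1}$, and $\Lambda_{\mu,\nu;n}=\sum_k\Lambda_{\lambda_k}$. $\mathbf B(\Lambda_{\mu,\nu;n})$ is the set of tuples $\mathbf w=(w^{(1)},\dots,w^{(n)})$ of semi-infinite words $w^{(i)}=\cdots w^{(i)}_{-2}w^{(i)}_{-1}$, strictly increasing with letters in $\mathbb Z^\times$, with $w^{(i)}_k=k+\lambda_{n-i+1}$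 for $k\ll0$ and $w^{(i+1)}_{k+d_i}\le w^{(i)}_k$ for $1\le i<n$, $k<0$, where $d_i=\lambda_{n-i+1}-\lambda_{n-i}$. It is a crystal with $\mathbf w=w^{(1)}\otimes\cdots\otimes w^{(n)}$, where $\widetilde f_i$ acts on a semi-infinite word by the tensor product rule for the letters in the crystal $\cdots\xrightarrow{-2}-2\xrightarrow{-1}-1\xrightarrow{0}1\xrightarrow{1}2\xrightarrow{2}\cdots$. The weight of a semi-infinite word $w$ is $\Lambda_0+\sum_{k\in\mathbb Z^\times}m_k\epsilon_k$, with $m_k$ the number of occurrences of $k$ in $w$, minus $1$ if $k<0$. $H_{\Lambda_{\mu,\nu;n}}$ is the tuple of the words $\cdots\,c-2\ c-1$ (if $c\le0$) or $\cdots-2\,{-1}\,1\,2\cdots c$ (if $c>0$), with $c=\lambda_{n-i+1}$ for the $i$-th word. Words are drawn as columns, $w^{(1)}$ being the right-most one, with $w^{(i)}_{-1}$ at the bottom. *Skew RSK.* For a tableau $S$ of anti-normal shape and a letter $a$, $S\leftarrow a$ is obtained thus: in the right-most column let $a'$ be the largest entry $\le a$; replace it by $a$ and insert $a'$ into the next column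 to the left in the same way; if there is no such $a'$, put $a$ on top of the column and stop. For $A\in\mathcal M$ with words $\mathbf i,\mathbf j$ as above, $\mathbf P(S\leftarrow A)=(\cdots(S\leftarrow i_r)\leftarrow\cdots)\leftarrow i_1$, and $\mathbf Q(S\leftarrow A)$ is the skew tableau which has $j_k$ in the box created by $i_k$. For $\mathbf w\in\mathbf B(\Lambda_{\mu,\nu;n})$, let $\mathbf w^\vee_{<0}$ be the tableau whose $k$-th column from the right consists of the $-a^\vee$ ($a>0$) such that $-a$ does not occur in $w^{(k)}$; let $\mathbf w^+_{>0}$ be the part of $\mathbf w$ in the positions where $H_{\Lambda_{\mu,\nu;n}}$ has positive entries, and $\mathbf w^-_{>0}$ the subtableau of the other positive entries of $\mathbf w$. **Proposition.** Let $\mu,\nu$ be partitions. Then $\mathcal M_{\mu,\nu}$ is a $\mathfrak{gl}_\infty$-crystal, and for every $n\ge\mu_1+\nu_1$, $\mathbf B(\Lambda_{\mu,\nu;n})\otimes T_{-n\Lambda_0}$ is a $\mathfrak{gl}_\infty$-crystal and there is an embedding of $\mathfrak{gl}_\infty$-crystals $$\Psi_{\mu,\nu;n}:\mathbf B(\Lambda_{\mu,\nu;n})\otimes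 T_{-n\Lambda_0}\longrightarrow\mathcal M_{\mu,\nu},\qquad H_{\Lambda_{\mu,\nu;n}}\otimes t_{-n\Lambda_0}\longmapsto\mathbb O_{\mu,\nu},$$ such that $\Psi_{\mu,\nu;n}(\mathbf w\otimes t_{-n\Lambda_0})=(A,S_{<0},S_{>0})$ if and only if $$\mathbf P(S_{<0}\leftarrow A)=\mathbf w^\vee_{<0},\qquad \mathbf Q(S_{<0}\leftarrow A)=\mathbf w^-_{>0},\qquad S_{>0}=\mathbf w^+_{>0}.$$ Moreover ${\rm Im}\,\Psi_{\mu,\nu;n}\subset{\rm Im}\,\Psi_{\mu,\nu;n+1}$ for all $n\ge\mu_1+\nu_1$, and $\mathcal M_{\mu,\nu}=\bigcup_{n\ge\mu_1+\nu_1}{\rm Im}\,\Psi_{\mu,\nu;n}$; that is, $\mathcal M_{\mu,\nu}$ is the limit of the crystals $\mathbf B(\Lambda_{\mu,\nu;n})$ as $n\to\infty$, and in this sense the crystal of the generalized Verma module with $\mathfrak l$-dominant highest weight $-\sum_{i>0}\mu_i\epsilon_{-i}+\sum_{j>0}\nu_j\epsilon_j$. -/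

import Mathlib

namespace GlInf

noncomputable section

/-! ## Weights of `gl_∞` -/

/-- The index set `ℤ^×` of non-zero integers, with the usual order; it is also the set of letters
of the vector crystal `𝐁`. -/
abbrev Zx : Type := {k : ℤ // k ≠ 0}

/-- The positive letter `k`. -/
def posL (k : ℕ+) : Zx := ⟨(k : ℤ), by have := k.pos; omega⟩

/-- The negative letter `-k`. -/
def negL (k : ℕ+) : Zx := ⟨-(k : ℤ), by have := k.pos; omega⟩

/-- The weight lattice `P = ⨁_{k ∈ ℤ^×} ℤ ε_k ⊕ ℤ Λ_0`; the second component is the coefficient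
of `Λ_0`. -/
abbrev Wt : Type := (Zx →₀ ℤ) × ℤ

/-- The weight `ε_k`. -/
def epsW (k : Zx) : Wt := (Finsupp.single k 1, 0)

/-- The fundamental weight `Λ_0`. -/
def lamZero : Wt := (0, 1)

/-- The source of the `i`-arrow of `𝐁`: `i` for `i > 0`, and `i - 1` for `i ≤ 0`. -/
def lo (i : ℤ) : Zx := ⟨if 0 < i then i else i - 1, by split_ifs <;> omega⟩

/-- The target of the `i`-arrow of `𝐁`: `i + 1` for `i ≥ 0`, and `i` for `i < 0`. -/
def hi (i : ℤ) : Zx := ⟨if 0 ≤ i then i + 1 else i, by split_ifs <;> omega⟩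

/-- The simple root `α_i`: `ε_i - ε_{i+1}` for `i > 0`, `ε_{-1} - ε_1` for `i = 0`, and
`ε_{i-1} - ε_i` for `i < 0`. -/
def root (i : ℤ) : Wt := epsW (lo i) - epsW (hi i)

/-- The pairing `⟨w, h_i⟩` with the simple coroot `h_i = E_{lo i, lo i} - E_{hi i, hi i}`. Since
`⟨Λ_0, E_{-k,-k}⟩ = -⟨Λ_0, E_{k,k}⟩ = 1/2` for `k > 0`, one has `⟨Λ_0, h_i⟩ = δ_{i0}`. -/
def coroot (i : ℤ) (w : Wt) : ℤ := w.1 (lo i) - w.1 (hi i) + if i = 0 then w.2 else 0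

/-! ## Crystals -/

/-- The data of a crystal on the set `B`. The value `none` plays the role of the formal
symbol `0`, and `⊥ : WithBot ℤ` that of `-∞`. For a `gl_{>0}`-crystal (`gl_{<0}`-crystal) only the
indices `i > 0` (`i < 0`) are meaningful. -/
structure PreCrystal (B : Type) where
  wt : B → Wt
  eps : ℤ → B → WithBot ℤ
  phi : ℤ → B → WithBot ℤ
  e : ℤ → B → Option B
  f : ℤ → B → Option B

namespace PreCrystal

variable {B C : Type}

/-- The axioms of a `gl_∞`-crystal. -/
structure IsCrystal (X : PreCrystal B) : Prop where
  phi_eq : ∀ i b, X.phi i b = ((coroot i (X.wt b) : ℤ) : WithBot ℤ) + X.eps i b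
  e_some : ∀ i b b', X.e i b = some b' →
    X.eps i b' = X.eps i b + ((-1 : ℤ) : WithBot ℤ) ∧
    X.phi i b' = X.phi i b + ((1 : ℤ) : WithBot ℤ) ∧
    X.wt b' = X.wt b + root i
  f_some : ∀ i b b', X.f i b = some b' →
    X.eps i b' = X.eps i b + ((1 : ℤ) : WithBot ℤ) ∧
    X.phi i b' = X.phi i b + ((-1 : ℤ) : WithBot ℤ) ∧
    X.wt b' = X.wt b - root i
  f_iff_e : ∀ i b b', X.f i b = some b' ↔ X.e i b' = some b
  bot : ∀ i b, X.phi i b = ⊥ → X.e i b = none ∧ X.f i b = none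

/-- Morphisms of crystals: maps `B ∪ {0} → C ∪ {0}`. -/
structure IsMorphism (X : PreCrystal B) (Y : PreCrystal C) (ψ : Option B → Option C) : Prop where
  map_zero : ψ none = none
  map_data : ∀ b c, ψ (some b) = some c →
    Y.wt c = X.wt b ∧ ∀ i, Y.eps i c = X.eps i b ∧ Y.phi i c = X.phi i b
  map_e : ∀ i b c, ψ (some b) = some c → ψ (X.e i b) ≠ none → ψ (X.e i b) = Y.e i c
  map_f : ∀ i b c, ψ (some b) = some c → ψ (X.f i b) ≠ none → ψ (X.f i b) = Y.f i c

/-- An embedding of crystals is an injective morphism (of the sets with `0` adjoined). -/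
def IsEmbedding (X : PreCrystal B) (Y : PreCrystal C) (ψ : Option B → Option C) : Prop :=
  X.IsMorphism Y ψ ∧ Function.Injective ψ

/-- The tensor product of crystals. -/
def tensor (X : PreCrystal B) (Y : PreCrystal C) : PreCrystal (B × C) where
  wt b := X.wt b.1 + Y.wt b.2
  eps i b := max (X.eps i b.1) (Y.eps i b.2 + ((-coroot i (X.wt b.1) : ℤ) : WithBot ℤ))
  phi i b := max (X.phi i b.1 + ((coroot i (Y.wt b.2) : ℤ) : WithBot ℤ)) (Y.phi i b.2)
  e i b := if Y.eps i b.2 ≤ X.phi i b.1 then (X.e i b.1).map (fun b' => (b', b.2))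
    else (Y.e i b.2).map (fun c' => (b.1, c'))
  f i b := if Y.eps i b.2 < X.phi i b.1 then (X.f i b.1).map (fun b' => (b', b.2))
    else (Y.f i b.2).map (fun c' => (b.1, c'))

/-- The one-point crystal `T_w`. -/
def single (w : Wt) : PreCrystal Unit where
  wt _ := w
  eps _ _ := ⊥
  phi _ _ := ⊥
  e _ _ := none
  f _ _ := none

/-- `ε_i` of a word `a_1 ⋯ a_r`, regarded as `a_1 ⊗ ⋯ ⊗ a_r`. -/
def wordEps (X : PreCrystal B) (i : ℤ) : List B → WithBot ℤ
  | [] => 0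
  | a :: w => max (X.eps i a) (wordEps X i w + ((-coroot i (X.wt a) : ℤ) : WithBot ℤ))

/-- `φ_i` of a word `a_1 ⋯ a_r`, regarded as `a_1 ⊗ ⋯ ⊗ a_r`. -/
def wordPhi (X : PreCrystal B) (i : ℤ) : List B → WithBot ℤ
  | [] => 0
  | a :: w => max (X.phi i a + ((coroot i (w.map X.wt).sum : ℤ) : WithBot ℤ)) (wordPhi X i w)

/-- `ẽ_i` of a word `a_1 ⋯ a_r`, regarded as `a_1 ⊗ ⋯ ⊗ a_r`. -/
def wordE (X : PreCrystal B) (i : ℤ) : List B → Option (List B)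
  | [] => none
  | a :: w => if wordEps X i w ≤ X.phi i a then (X.e i a).map (fun a' => a' :: w)
      else (wordE X i w).map (fun w' => a :: w')

/-- `f̃_i` of a word `a_1 ⋯ a_r`, regarded as `a_1 ⊗ ⋯ ⊗ a_r`. -/
def wordF (X : PreCrystal B) (i : ℤ) : List B → Option (List B)
  | [] => none
  | a :: w => if wordEps X i w < X.phi i a then (X.f i a).map (fun a' => a' :: w)
      else (wordF X i w).map (fun w' => a :: w')

/-- The crystal of finite words in `B`, a word `a_1 ⋯ a_r` being regarded as the iterated tensor
product `a_1 ⊗ ⋯ ⊗ a_r`; the empty word spans the trivial crystal (weight `0`,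
`ε_i = φ_i = 0`). -/
def words (X : PreCrystal B) : PreCrystal (List B) where
  wt w := (w.map X.wt).sum
  eps := wordEps X
  phi := wordPhi X
  e := wordE X
  f := wordF X

open Classical in
/-- Transport of an operator on `C ∪ {0}` along an injective map `g : B → C`: the result at `b` is
the element whose image is `op (g b)`, or `0` if there is none. -/
def liftOp (g : B → C) (op : C → Option C) (b : B) : Option B :=
  if h : ∃ b', op (g b) = some (g b') then some h.choose else none

/-- The crystal structure on `B` transported from `C` along an injective map `g : B → C` whose
image, together with `0`, is stable under the operators. -/
def pullback (X : PreCrystal C) (g : B → C) : PreCrystal B where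
  wt b := X.wt (g b)
  eps i b := X.eps i (g b)
  phi i b := X.phi i (g b)
  e i := liftOp g (X.e i)
  f i := liftOp g (X.f i)

end PreCrystal

/-! ## The letters `𝐁_{>0}` and `𝐁_{<0}^∨` -/

/-- The `gl_{>0}`-crystal `𝐁_{>0}`: `1 → 2 → 3 → ⋯`, the arrow `k → k + 1` having colour `k`, and
`wt k = ε_k`. -/
def vecPos : PreCrystal ℕ+ where
  wt k := epsW (posL k)
  eps i k := if 0 < i ∧ (k : ℤ) = i + 1 then 1 else 0
  phi i k := if (k : ℤ) = i then 1 else 0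
  e i k := if 0 < i ∧ (k : ℤ) = i + 1 then some (k - 1) else none
  f i k := if (k : ℤ) = i then some (k + 1) else none

/-- The `gl_{<0}`-crystal `𝐁_{<0}^∨`: `-1^∨ → -2^∨ → -3^∨ → ⋯`, the arrow `-k^∨ → -(k+1)^∨` having
colour `-k`, and `wt (-k^∨) = -ε_{-k}`. The letter `-k^∨` is represented by `k : ℕ+`; the order of
the letters is `-1^∨ < -2^∨ < ⋯`. -/
def vecNeg : PreCrystal ℕ+ where
  wt k := -epsW (negL k)
  eps i k := if i < 0 ∧ (k : ℤ) = -i + 1 then 1 else 0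
  phi i k := if (k : ℤ) = -i then 1 else 0
  e i k := if i < 0 ∧ (k : ℤ) = -i + 1 then some (k - 1) else none
  f i k := if (k : ℤ) = -i then some (k + 1) else none

/-! ## The reading order on pairs -/

/-- Lexicographic order on pairs: increasing in the first component, then decreasing in the
second one. -/
def readLE {α β : Type} [LinearOrder α] [LinearOrder β] (p q : α × β) : Prop :=
  p.1 < q.1 ∨ (p.1 = q.1 ∧ q.2 ≤ p.2)

section readLE

variable {α β : Type} [LinearOrder α] [LinearOrder β]

instance : DecidableRel (readLE (α := α) (β := β)) :=
  fun p q => inferInstanceAs (Decidable (p.1 < q.1 ∨ (p.1 = q.1 ∧ q.2 ≤ p.2)))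

instance : IsTrans (α × β) readLE where
  trans := by
    rintro ⟨a, b⟩ ⟨c, d⟩ ⟨x, y⟩ h h'
    simp only [readLE] at h h' ⊢
    rcases h with h | ⟨rfl, h⟩ <;> rcases h' with h' | ⟨rfl, h'⟩
    · exact Or.inl (h.trans h')
    · exact Or.inl h
    · exact Or.inl h'
    · exact Or.inr ⟨rfl, h'.trans h⟩

instance : Std.Antisymm (readLE (α := α) (β := β)) where
  antisymm := by
    rintro ⟨a, b⟩ ⟨c, d⟩ h h'
    simp only [readLE] at h h'
    rcases h with h | ⟨rfl, h⟩
    · rcases h' with h' | ⟨rfl, h'⟩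
      · exact absurd h' h.asymm
      · exact absurd h (lt_irrefl _)
    · rcases h' with h' | ⟨_, h'⟩
      · exact absurd h' (lt_irrefl _)
      · rw [le_antisymm h h']

instance : Std.Total (readLE (α := α) (β := β)) where
  total := by
    rintro ⟨a, b⟩ ⟨c, d⟩
    simp only [readLE]
    rcases lt_trichotomy a c with h | rfl | h
    · exact Or.inl (Or.inl h)
    · rcases le_total b d with h | h
      · exact Or.inr (Or.inr ⟨rfl, h⟩)
      · exact Or.inl (Or.inr ⟨rfl, h⟩)
    · exact Or.inr (Or.inl h)

end readLE

/-! ## Semistandard tableaux -/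

/-- The (normal) Young diagram `ν` as a set of cells (row, column); rows are numbered from top to
bottom and columns from left to right. -/
def normalShape (ν : YoungDiagram) : Finset (ℤ × ℤ) :=
  ν.cells.image (fun p => ((p.1 : ℤ), (p.2 : ℤ)))

/-- The anti-normal shape `μ^π`, obtained from `μ` by the rotation by 180 degrees. Its bottom row
is row `0`, and its right-most column is column `0`. -/
def antinormalShape (μ : YoungDiagram) : Finset (ℤ × ℤ) :=
  μ.cells.image (fun p => (-(p.1 : ℤ), -(p.2 : ℤ)))

/-- Semistandard tableaux of shape `D` with entries in `ℕ+` (that is, in `𝐁_{>0}` or in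
`𝐁_{<0}^∨`). Outside `D` the function `entry` carries no information and is normalized to `1`. -/
@[ext]
structure SST (D : Finset (ℤ × ℤ)) where
  entry : ℤ × ℤ → ℕ+
  row_weak : ∀ r c c' : ℤ, c < c' → (r, c) ∈ D → (r, c') ∈ D → entry (r, c) ≤ entry (r, c')
  col_strict : ∀ r r' c : ℤ, r < r' → (r, c) ∈ D → (r', c) ∈ D → entry (r, c) < entry (r', c)
  outside : ∀ p, p ∉ D → entry p = 1

/-- The reading word: row by row from top to bottom, and from right to left in each row. -/
def SST.word {D : Finset (ℤ × ℤ)} (T : SST D) : List ℕ+ := (D.sort readLE).map T.entry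

/-- The crystal structure on tableaux with entries in the crystal `L`, through reading words. -/
def sstCrystal (L : PreCrystal ℕ+) (D : Finset (ℤ × ℤ)) : PreCrystal (SST D) :=
  L.words.pullback SST.word

/-- The property of a shape which makes the filling "the `l`-th entry of each column is `l`"
semistandard. -/
def IsStacked (D : Finset (ℤ × ℤ)) : Prop :=
  ∀ r' r c c' : ℤ, c < c' → r' ≤ r → (r', c) ∈ D → (r, c') ∈ D → (r', c') ∈ D

theorem isStacked_normalShape (ν : YoungDiagram) : IsStacked (normalShape ν) := by
  intro r' r c c' _ hr h1 h2
  simp only [normalShape, Finset.mem_image, Prod.exists, Prod.mk.injEq,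
    YoungDiagram.mem_cells] at h1 h2 ⊢
  obtain ⟨a, b, _, rfl, rfl⟩ := h1
  obtain ⟨a', b', h', rfl, rfl⟩ := h2
  exact ⟨a, b', ν.up_left_mem (by omega) le_rfl h', rfl, rfl⟩

theorem isStacked_antinormalShape (μ : YoungDiagram) : IsStacked (antinormalShape μ) := by
  intro r' r c c' hc _ h1 h2
  simp only [antinormalShape, Finset.mem_image, Prod.exists, Prod.mk.injEq,
    YoungDiagram.mem_cells] at h1 h2 ⊢
  obtain ⟨a, b, h, rfl, rfl⟩ := h1
  obtain ⟨a', b', _, rfl, rfl⟩ := h2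
  exact ⟨a, b', μ.up_left_mem le_rfl (by omega) h, rfl, rfl⟩

/-- The highest weight tableau `H_D`: in each column, the `l`-th entry from the top is `l`
(meaning `-l^∨` in the case of `𝐁_{<0}^∨`). -/
def SST.highest (D : Finset (ℤ × ℤ)) (hD : IsStacked D) : SST D where
  entry p := if p ∈ D then Nat.toPNat' (D.filter (fun q => q.2 = p.2 ∧ q.1 ≤ p.1)).card else 1
  row_weak := by
    intro r c c' hc h h'
    rw [if_pos h, if_pos h', ← PNat.coe_le_coe, Nat.toPNat'_coe, Nat.toPNat'_coe,
      if_pos (Finset.card_pos.2 ⟨(r, c), by simp [h]⟩),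
      if_pos (Finset.card_pos.2 ⟨(r, c'), by simp [h']⟩)]
    refine Finset.card_le_card_of_injOn (fun q => (q.1, c')) ?_ ?_
    · rintro ⟨a, b⟩ hq
      simp only [Finset.coe_filter, Set.mem_ofPred_eq] at hq ⊢
      obtain ⟨hq, rfl, hr⟩ := hq
      exact ⟨hD a r b c' hc hr hq h', trivial, hr⟩
    · rintro ⟨a, b⟩ hq ⟨a', b'⟩ hq' heq
      simp only [Finset.coe_filter, Set.mem_ofPred_eq] at hq hq'
      simp only [Prod.mk.injEq, and_true] at heq
      simp [heq, hq.2.1, hq'.2.1]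
  col_strict := by
    intro r r' c hr h h'
    rw [if_pos h, if_pos h', ← PNat.coe_lt_coe, Nat.toPNat'_coe, Nat.toPNat'_coe,
      if_pos (Finset.card_pos.2 ⟨(r, c), by simp [h]⟩),
      if_pos (Finset.card_pos.2 ⟨(r', c), by simp [h']⟩)]
    refine Finset.card_lt_card ((Finset.ssubset_iff_of_subset ?_).2 ⟨(r', c), ?_, ?_⟩)
    · intro q hq
      simp only [Finset.mem_filter] at hq ⊢
      exact ⟨hq.1, hq.2.1, hq.2.2.trans hr.le⟩
    · simp [h']
    · simp only [Finset.mem_filter, not_and, not_le]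
      exact fun _ _ => hr
  outside := fun p hp => if_neg hp

/-! ## The crystal `ℳ` of matrices -/

/-- Matrices with non-negative integral entries of finite support; the entry at `(i, j)` is
`a_{-i^∨, j}`. -/
abbrev Mat : Type := ℕ+ × ℕ+ →₀ ℕ

/-- The pairs `(i_1, j_1), …, (i_r, j_r)` of the biword in `Ω` which corresponds to `A`: each pair
`(i, j)` occurs `a_{-i^∨, j}` times, and the pairs are sorted by increasing `j`, and by decreasing
`i` when `j` is the same. -/
def omegaWord (A : Mat) : List (ℕ+ × ℕ+) :=
  (((Finsupp.toMultiset A).map Prod.swap).sort readLE).map Prod.swap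

/-- The pairs `(k_1, l_1), …, (k_r, l_r)` of the biword in `Ω'` which corresponds to `A`: sorted by
increasing `k`, and by decreasing `l` when `k` is the same. -/
def omegaWord' (A : Mat) : List (ℕ+ × ℕ+) := (Finsupp.toMultiset A).sort readLE

/-- The pair of words `(𝐢, 𝐣) ∈ Ω` of `A`. -/
def biword (A : Mat) : List ℕ+ × List ℕ+ :=
  ((omegaWord A).map Prod.fst, (omegaWord A).map Prod.snd)

/-- The pair of words `(𝐤, 𝐥) ∈ Ω'` of `A`. -/
def biword' (A : Mat) : List ℕ+ × List ℕ+ :=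
  ((omegaWord' A).map Prod.fst, (omegaWord' A).map Prod.snd)

/-- The weight of `A`, the sum of `a_{-i^∨, j} (-ε_{-i} + ε_j)`. -/
def matWt (A : Mat) : Wt := A.sum (fun p a => a • (-epsW (negL p.1) + epsW (posL p.2)))

/-- The `gl_∞`-crystal `ℳ`. For `i < 0` the operators act on the word `𝐢` of the biword in `Ω`, for
`i > 0` on the word `𝐥` of the biword in `Ω'`, and for `i = 0` on the entry `a_{-1^∨, 1}`. -/
def matCrystal : PreCrystal Mat where
  wt := matWt
  eps i A := if i < 0 then vecNeg.words.eps i (biword A).1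
    else if 0 < i then vecPos.words.eps i (biword' A).2
    else ((A (1, 1) : ℤ) : WithBot ℤ)
  phi i A := if i < 0 then vecNeg.words.phi i (biword A).1
    else if 0 < i then vecPos.words.phi i (biword' A).2
    else ((coroot 0 (matWt A) + (A (1, 1) : ℤ) : ℤ) : WithBot ℤ)
  e i A := if i < 0 then
      PreCrystal.liftOp biword (fun p => (vecNeg.words.e i p.1).map (fun w => (w, p.2))) A
    else if 0 < i then
      PreCrystal.liftOp biword' (fun p => (vecPos.words.e i p.2).map (fun w => (p.1, w))) A
    else if A (1, 1) ≠ 0 then some (A - Finsupp.single (1, 1) 1) else none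
  f i A := if i < 0 then
      PreCrystal.liftOp biword (fun p => (vecNeg.words.f i p.1).map (fun w => (w, p.2))) A
    else if 0 < i then
      PreCrystal.liftOp biword' (fun p => (vecPos.words.f i p.2).map (fun w => (p.1, w))) A
    else some (A + Finsupp.single (1, 1) 1)

/-! ## The crystal `ℳ_{μ,ν}` -/

/-- `ℳ_{μ,ν} = ℳ × SST_{𝐁_{<0}^∨}(μ^π) × SST_{𝐁_{>0}}(ν)`. -/
abbrev Verma (μ ν : YoungDiagram) : Type := Mat × SST (antinormalShape μ) × SST (normalShape ν)

/-- The weight of `(A, S_{<0}, S_{>0})`. -/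
def vermaWt {μ ν : YoungDiagram} (x : Verma μ ν) : Wt :=
  matWt x.1 + (sstCrystal vecNeg (antinormalShape μ)).wt x.2.1
    + (sstCrystal vecPos (normalShape ν)).wt x.2.2

/-- The crystal structure on `ℳ_{μ,ν}`: for `i < 0` the one of `A ⊗ S_{<0}`, for `i > 0` the one of
`A ⊗ S_{>0}`, and for `i = 0` the operators act on `A` only. -/
def vermaCrystal (μ ν : YoungDiagram) : PreCrystal (Verma μ ν) where
  wt := vermaWt
  eps i x := if i < 0 then
      (matCrystal.tensor (sstCrystal vecNeg (antinormalShape μ))).eps i (x.1, x.2.1)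
    else if 0 < i then
      (matCrystal.tensor (sstCrystal vecPos (normalShape ν))).eps i (x.1, x.2.2)
    else matCrystal.eps 0 x.1
  phi i x := if i < 0 then
      (matCrystal.tensor (sstCrystal vecNeg (antinormalShape μ))).phi i (x.1, x.2.1)
    else if 0 < i then
      (matCrystal.tensor (sstCrystal vecPos (normalShape ν))).phi i (x.1, x.2.2)
    else ((coroot 0 (vermaWt x) : ℤ) : WithBot ℤ) + matCrystal.eps 0 x.1
  e i x := if i < 0 then
      ((matCrystal.tensor (sstCrystal vecNeg (antinormalShape μ))).e i (x.1, x.2.1)).map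
        (fun y => (y.1, y.2, x.2.2))
    else if 0 < i then
      ((matCrystal.tensor (sstCrystal vecPos (normalShape ν))).e i (x.1, x.2.2)).map
        (fun y => (y.1, x.2.1, y.2))
    else (matCrystal.e 0 x.1).map (fun A => (A, x.2))
  f i x := if i < 0 then
      ((matCrystal.tensor (sstCrystal vecNeg (antinormalShape μ))).f i (x.1, x.2.1)).map
        (fun y => (y.1, y.2, x.2.2))
    else if 0 < i then
      ((matCrystal.tensor (sstCrystal vecPos (normalShape ν))).f i (x.1, x.2.2)).map
        (fun y => (y.1, x.2.1, y.2))
    else (matCrystal.f 0 x.1).map (fun A => (A, x.2))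

/-- `𝕆_{μ,ν} = (𝕆, H_{μ^π}, H_ν)`. -/
def vermaTop (μ ν : YoungDiagram) : Verma μ ν :=
  (0, SST.highest _ (isStacked_antinormalShape μ), SST.highest _ (isStacked_normalShape ν))

/-! ## Semi-infinite words -/

/-- Semi-infinite words `⋯ w_{-3} w_{-2} w_{-1}` with letters in `𝐁`, strictly increasing from left
to right, with `w_k = k + c` for `k ≪ 0` and some `c`. Here `letter m` is `w_{-1-m}`. -/
@[ext]
structure FockWord where
  letter : ℕ → Zx
  strict : StrictAnti letter
  tail : ∃ c : ℤ, ∀ᶠ m : ℕ in Filter.atTop, (letter m : ℤ) = c - 1 - m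

namespace FockWord

/-- `w` has charge `c` if `w_k = k + c` for `k ≪ 0`. The words of charge `c` form the connected
component `𝐁(Λ_c)` of the crystal of semi-infinite words. -/
def HasCharge (w : FockWord) (c : ℤ) : Prop :=
  ∀ᶠ m : ℕ in Filter.atTop, (w.letter m : ℤ) = c - 1 - m

theorem exists_bound (w : FockWord) :
    ∃ b : ℤ, ∀ k : Zx, (k : ℤ) < b → k ∈ Set.range w.letter := by
  obtain ⟨c, hc⟩ := w.tail
  obtain ⟨N, hN⟩ := Filter.eventually_atTop.1 hc
  refine ⟨c - 1 - N, fun k hk => ⟨(c - 1 - k).toNat, ?_⟩⟩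
  apply Subtype.ext
  rw [hN _ (by omega)]
  omega

/-- The coefficient `m_k` of `ε_k` in the weight of `w`: the number of occurrences of `k` in `w`,
minus `1` if `k` is negative. -/
def mult (w : FockWord) (k : Zx) : ℤ :=
  ({m : ℕ | w.letter m = k}.ncard : ℤ) - if (k : ℤ) < 0 then 1 else 0

theorem mult_finite (w : FockWord) : (Function.support w.mult).Finite := by
  obtain ⟨b, hb⟩ := w.exists_bound
  refine Set.Finite.subset (s := Subtype.val ⁻¹' (Set.Icc (min b 0) (max (w.letter 0 : ℤ) 0)))
    (Set.Finite.preimage Subtype.val_injective.injOn (Set.finite_Icc _ _)) ?_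
  intro k hk
  by_contra hout
  apply hk
  simp only [Set.mem_preimage, Set.mem_Icc, not_and_or, not_le] at hout
  rcases hout with h | h
  · obtain ⟨m, hm⟩ := hb k (lt_of_lt_of_le h (min_le_left _ _))
    have hs : {m' : ℕ | w.letter m' = k} = {m} := by
      ext m'
      simp only [Set.mem_ofPred_eq, Set.mem_singleton_iff]
      exact ⟨fun h' => w.strict.injective (h'.trans hm.symm), fun h' => h' ▸ hm⟩
    simp only [mult, hs, Set.ncard_singleton]
    rw [if_pos (lt_of_lt_of_le h (min_le_right _ _))]
    norm_num
  · have hs : {m' : ℕ | w.letter m' = k} = ∅ := by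
      ext m'
      simp only [Set.mem_ofPred_eq, Set.mem_empty_iff_false, iff_false]
      rintro rfl
      have h1 : w.letter m' ≤ w.letter 0 := w.strict.antitone (Nat.zero_le m')
      have h2 : (w.letter m' : ℤ) ≤ (w.letter 0 : ℤ) := h1
      exact absurd h (not_lt.2 (h2.trans (le_max_left _ _)))
    have h0 : ¬ ((k : ℤ) < 0) := not_lt.2 ((le_max_right _ _).trans h.le)
    simp [mult, hs, h0]

/-- The weight `Λ_0 + ∑ m_k ε_k` of a semi-infinite word. -/
def wt (w : FockWord) : Wt := lamZero + (Finsupp.ofSupportFinite w.mult w.mult_finite, 0)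

/-- The letters `k` such that `-k` does not occur in `w`. -/
def missing (w : FockWord) : Set ℕ+ := {k | negL k ∉ Set.range w.letter}

theorem missing_finite (w : FockWord) : w.missing.Finite := by
  obtain ⟨b, hb⟩ := w.exists_bound
  refine Set.Finite.subset (Set.finite_Iic (Nat.toPNat' b.natAbs)) ?_
  intro k hk
  by_contra hout
  apply hk
  apply hb
  simp only [Set.mem_Iic, not_le, ← PNat.coe_lt_coe, Nat.toPNat'_coe] at hout
  simp only [negL]
  split_ifs at hout <;> omega

/-- The column of dual letters of `w`: the `-k^∨` with `-k` not in `w`, listed from top to bottom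
in increasing order. -/
def dualColumn (w : FockWord) : List ℕ+ := w.missing_finite.toFinset.sort

/-- The word `H_{Λ_c}`: `⋯ c-3 c-2 c-1` if `c ≤ 0`, and `⋯ -2 -1 1 ⋯ c` if `c > 0`. -/
def highest (c : ℤ) : FockWord where
  letter m := ⟨if c - 1 - m < 0 then c - 1 - m else c - m, by split_ifs <;> omega⟩
  strict := by
    intro m m' h
    rw [← Subtype.coe_lt_coe]
    dsimp only
    split_ifs <;> omega
  tail := ⟨c, by
    filter_upwards [Filter.eventually_ge_atTop c.toNat] with m hm
    rw [if_pos (by omega)]⟩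

theorem highest_hasCharge (c : ℤ) : (highest c).HasCharge c := by
  filter_upwards [Filter.eventually_ge_atTop c.toNat] with m hm
  simp only [highest]
  rw [if_pos (by omega)]

end FockWord

open Classical in
/-- Replace the letter `a` by `b` if `a` occurs and `b` does not. -/
def replaceLetter (a b : Zx) (u : ℕ → Zx) : Option (ℕ → Zx) :=
  if a ∈ Set.range u ∧ b ∉ Set.range u then some (fun m => if u m = a then b else u m) else none

open Classical in
/-- The crystal of semi-infinite words. The letters of a word are strictly increasing, so that
`lo i` and `hi i` occur at most once, and they cancel in the signature rule if both occur. -/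
def fock : PreCrystal FockWord where
  wt := FockWord.wt
  eps i w := if hi i ∈ Set.range w.letter ∧ lo i ∉ Set.range w.letter then 1 else 0
  phi i w := if lo i ∈ Set.range w.letter ∧ hi i ∉ Set.range w.letter then 1 else 0
  e i := PreCrystal.liftOp FockWord.letter (replaceLetter (hi i) (lo i))
  f i := PreCrystal.liftOp FockWord.letter (replaceLetter (lo i) (hi i))

/-! ## The crystal `𝐁(Λ_λ)` -/

/-- Semi-infinite semistandard tableaux `(w^(1), …, w^(n))` of shape `λ`, a generalized partition of
length `n`. The word `w^(i+1)` is `col i`, `λ_{k+1}` is `lam k`, and the row condition is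
`w^(i+1)_{k+d_i} ≤ w^(i)_k` for `k < 0`, where `d_i = λ_{n-i+1} - λ_{n-i} ≤ 0`. -/
@[ext]
structure SemiInfSST {n : ℕ} (lam : Fin n → ℤ) where
  col : Fin n → FockWord
  charge : ∀ i, (col i).HasCharge (lam i.rev)
  row_weak : ∀ i j : Fin n, (j : ℕ) = (i : ℕ) + 1 → ∀ m : ℕ,
    (col j).letter (m + (lam j.rev - lam i.rev).toNat) ≤ (col i).letter m

/-- The crystal `𝐁(Λ_λ)`, a tableau being regarded as `w^(1) ⊗ ⋯ ⊗ w^(n)`. -/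
def semiInfCrystal {n : ℕ} (lam : Fin n → ℤ) : PreCrystal (SemiInfSST lam) :=
  fock.words.pullback (fun w => List.ofFn w.col)

/-- The tableau `H_{Λ_λ}`. -/
def SemiInfSST.highest {n : ℕ} (lam : Fin n → ℤ) (h : Antitone lam) : SemiInfSST lam where
  col i := FockWord.highest (lam i.rev)
  charge i := FockWord.highest_hasCharge _
  row_weak := by
    intro i j hij m
    have hl : lam i.rev ≤ lam j.rev := h (Fin.rev_le_rev.2 (Fin.le_def.2 (by omega)))
    rw [← Subtype.coe_le_coe]
    simp only [FockWord.highest]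
    push_cast
    rw [Int.toNat_of_nonneg (by omega)]
    split_ifs <;> omega

/-- The generalized partition `λ` of length `n` with `λ^+ = ν'` and `λ^- = μ'`; for
`n ≥ μ_1 + ν_1` it is given by `λ_k = ν'_k - μ'_{n-k+1}`. -/
def lamOf (μ ν : YoungDiagram) (n : ℕ) (k : Fin n) : ℤ :=
  (ν.colLen k : ℤ) - (μ.colLen k.rev : ℤ)

theorem lamOf_antitone (μ ν : YoungDiagram) (n : ℕ) : Antitone (lamOf μ ν n) := by
  intro k l hkl
  have h1 := ν.colLen_anti k l hkl
  have h2 := μ.colLen_anti l.rev k.rev (Fin.rev_le_rev.2 hkl)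
  simp only [lamOf]
  omega

/-- `𝐁(Λ_{μ,ν;n})`. -/
abbrev BSet (μ ν : YoungDiagram) (n : ℕ) : Type := SemiInfSST (lamOf μ ν n)

/-- `H_{Λ_{μ,ν;n}}`. -/
def BSet.top (μ ν : YoungDiagram) (n : ℕ) : BSet μ ν n :=
  SemiInfSST.highest (lamOf μ ν n) (lamOf_antitone μ ν n)

/-- The crystal `𝐁(Λ_{μ,ν;n}) ⊗ T_{-nΛ_0}`. -/
def shiftedB (μ ν : YoungDiagram) (n : ℕ) : PreCrystal (BSet μ ν n × Unit) :=
  (semiInfCrystal (lamOf μ ν n)).tensor (PreCrystal.single (-((n : ℤ) • lamZero)))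

/-! ## The skew RSK insertion -/

/-- Column insertion of `a` into an anti-normal shaped tableau, together with recording of `c` in
the new box. The tableaux are given by their columns from right to left, each column listed from
top to bottom; the first component of a pair is the column of the insertion tableau, the second
one the corresponding column of the recording tableau. In each column, the largest entry that is at
most `a` is replaced by `a` and is inserted into the next column; if there is no such entry, then
`a` is put at the top of the column, and the procedure stops. -/
def skewInsert (a c : ℕ+) : List (List ℕ+ × List ℕ+) → List (List ℕ+ × List ℕ+)
  | [] => [([a], [c])]
  | (p, q) :: cols =>
    match (p.filter (fun x => x ≤ a)).max? with
    | none => (a :: p, c :: q) :: cols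
    | some x => (p.replace x a, q) :: skewInsert x c cols

/-- The columns of `S ∈ SST(μ^π)`, with an empty recording tableau. -/
def startColumns {μ : YoungDiagram} (S : SST (antinormalShape μ)) :
    List (List ℕ+ × List ℕ+) :=
  (List.range (μ.rowLen 0)).map (fun k =>
    ((List.range (μ.colLen k)).reverse.map (fun r => S.entry (-(r : ℤ), -(k : ℤ))), []))

/-- The pair `(𝐏(S ← A), 𝐐(S ← A))`: for `A = A(𝐢, 𝐣)`, the letters `i_r, …, i_1` are inserted into
`S` in this order, and the box created by `i_k` is recorded by `j_k`. -/
def skewRSK {μ : YoungDiagram} (S : SST (antinormalShape μ)) (A : Mat) :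
    List (List ℕ+ × List ℕ+) :=
  (omegaWord A).foldr (fun p cols => skewInsert p.1 p.2 cols) (startColumns S)

/-- The relation `𝐏(S_{<0} ← A) = 𝐰_{<0}^∨`, `𝐐(S_{<0} ← A) = 𝐰_{>0}^-`, `S_{>0} = 𝐰_{>0}^+`
between `𝐰 ∈ 𝐁(Λ_{μ,ν;n})` and `(A, S_{<0}, S_{>0}) ∈ ℳ_{μ,ν}`.

The `k`-th column from the right of `𝐰_{<0}^∨` consists of the dual letters of `w^(k)`.
`H_{Λ_{μ,ν;n}}` has positive entries exactly in the lowest `max(λ_{n-k+1}, 0)` positions of its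
`k`-th column from the right; these positions of `𝐰` form `𝐰_{>0}^+`, and the other positive
entries form `𝐰_{>0}^-`. -/
structure SkewRSKRel {μ ν : YoungDiagram} {n : ℕ} (w : BSet μ ν n) (x : Verma μ ν) : Prop where
  length_le : (skewRSK x.2.1 x.1).length ≤ n
  insertion : ∀ k : Fin n,
    ((skewRSK x.2.1 x.1).getD k ([], [])).1 = (w.col k).dualColumn
  recording : ∀ k : Fin n,
    ((skewRSK x.2.1 x.1).getD k ([], [])).2.map posL =
      (((List.range {m : ℕ | 0 < ((w.col k).letter m : ℤ)}.ncard).drop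
        (lamOf μ ν n k.rev).toNat).reverse).map (w.col k).letter
  positive : ∀ c : Fin n, ∀ r : ℕ, r < ν.colLen c →
    posL (x.2.2.entry ((r : ℤ), ((c : ℕ) : ℤ))) = (w.col c.rev).letter (ν.colLen c - 1 - r)

end

end GlInf

/-! Skew RSK insertion can be carried out one column at a time: the whole biword passes through the
right-most column, which bumps a new biword into the next column on the left. For a single column
this is a vertex model on a square grid. A column of letters is a sequence of bits, the matrix
entries sit on the vertices, and every vertex applies `rule`: two incoming bits are absorbed into
the entry, a positive entry without incoming bits emits two, anything else passes through. The old
column enters along one side and nothing enters along the other; the new column and the recorded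
labels leave, and the new entries form the bumped matrix (`columnPass_grid`). Since `rule` is an
involution, a grid can be solved from its outgoing data; since `rule` is symmetric in the two bits,
letters and labels can be interchanged.

The bijection. For two neighbouring columns the pairs of bits are the steps of a walk, and the row
condition says that the walk never sinks below its start. `sgn_exchange` carries such walks across
the vertices of two consecutive grids, so the old columns fit together if and only if the new
columns with their labels satisfy `PairLe` (`ColRel.colLe_iff`), and a result that fits comes from
an insertion with nothing entering from outside (`ColRel.exists_in`). For a semi-infinite word, the
missing negative letters give the new column, and its positive letters are the labels followed by a
column of `S_{>0}`. The row condition on semi-infinite words is exactly `PairLe` together with the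
row condition on `S_{>0}` (`FockWord.row_iff_split`). Undoing the insertion from the left-most
column therefore attaches a unique triple to every semi-infinite tableau (`exists_rel`,
`rel_unique_right`, `rel_unique_left`).

The crystal structure. Two configurations are compared through the monoid `Fac`: an element holds
`ε` and `φ` of a tensor factor, the statement that `f` takes the first configuration to the second,
and the statement that they are equal; multiplication is the tensor product rule. Then `local_fac`
is one identity in a monoid. Iterated over a grid (`IsGrid.fac`) and over all columns
(`Chain.fac_neg`) it says that a negative colour acts on `A ⊗ S_{<0}` as it acts on the insertion
tableau, with fixed labels. The transposed grids give the positive colours (`Chain.fac_pos`), and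
the colour `0` is decided at the corner vertices (`corner_fac`, `Chain.fac_zero_R`).

The crystals of tableaux are defined by row readings, while the grids work by columns.
`IsSkewTableau.prod_congr` removes this discrepancy: a `k` and a `k + 1` in the same column cancel
in every admissible reading, and the remaining letters `k`, `k + 1` are met from right to left. The
same lemma separates the recording tableau from `S_{>0}` at positive colours.

The limit. A triple lies in the image for `n` columns if and only if the insertion leaves no letters
after `n` columns and, in each column, the labels are smaller than the entries of `S_{>0}` beneath
them (`exists_rel_iff`). These conditions persist when `n` grows and hold for large `n`. -/

namespace GlInf

noncomputable section

/-! ## Signatures and the comparison of two configurations -/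

/-- A tensor factor in two configurations, seen at a fixed colour: `e` and `p` are the values of
`ε` and `φ` in the first configuration, `R` says that the second configuration is obtained from
the first one by the operator `f`, and `E` that the two configurations are equal. -/
structure Fac where
  e : ℕ
  p : ℕ
  R : Prop
  E : Prop
  pos : R → 0 < p

namespace Fac

/-- Truncated subtraction cancels the `φ` of the left factor against the `ε` of the right one, and
the strict inequality in `R` is the tensor product rule for `f`. The factor on which `f` does not
act has to be the same in both configurations. -/
instance : Mul Fac where
  mul x y := ⟨x.e + (y.e - x.p), y.p + (x.p - y.e),
    (y.e < x.p ∧ x.R ∧ y.E) ∨ (x.p ≤ y.e ∧ x.E ∧ y.R), x.E ∧ y.E, by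
      rintro (⟨h, -, -⟩ | ⟨-, -, h⟩)
      · omega
      · have := y.pos h; omega⟩

instance : One Fac where
  one := ⟨0, 0, False, True, False.elim⟩

theorem mul_e (x y : Fac) : (x * y).e = x.e + (y.e - x.p) := rfl
theorem mul_p (x y : Fac) : (x * y).p = y.p + (x.p - y.e) := rfl
theorem mul_R (x y : Fac) :
    (x * y).R ↔ (y.e < x.p ∧ x.R ∧ y.E) ∨ (x.p ≤ y.e ∧ x.E ∧ y.R) := Iff.rfl
theorem mul_E (x y : Fac) : (x * y).E ↔ x.E ∧ y.E := Iff.rfl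
@[simp] theorem one_e : (1 : Fac).e = 0 := rfl
@[simp] theorem one_p : (1 : Fac).p = 0 := rfl
@[simp] theorem one_R : (1 : Fac).R ↔ False := Iff.rfl
@[simp] theorem one_E : (1 : Fac).E ↔ True := Iff.rfl

theorem ext' {x y : Fac} (he : x.e = y.e) (hp : x.p = y.p) (hR : x.R ↔ y.R)
    (hE : x.E ↔ y.E) : x = y := by
  cases x; cases y
  simp only at he hp hR hE
  subst he hp
  congr 1
  · exact propext hR
  · exact propext hE

/-- Associativity is that of the tensor product of crystals; the cases are the possible outcomes of
the comparisons that decide where `f` acts. The field `pos` is what makes `1` a right unit: against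
`ε = 0` the left factor is selected only if its `φ` is positive. -/
instance : Monoid Fac where
  one_mul x := by
    apply ext' <;> simp [mul_e, mul_p, mul_R, mul_E]
  mul_one x := by
    apply ext'
    · simp [mul_e]
    · simp [mul_p]
    · simp only [mul_R, one_e, one_E, one_R, and_false, or_false, and_true, and_iff_right_iff_imp]
      exact x.pos
    · simp [mul_E]
  mul_assoc x y z := by
    apply ext'
    · simp only [mul_e, mul_p]; omega
    · simp only [mul_e, mul_p]; omega
    · simp only [mul_R, mul_e, mul_p, mul_E]
      rcases lt_or_ge y.e x.p with h1 | h1 <;> rcases lt_or_ge z.e y.p with h2 | h2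
      · have h3 : z.e < y.p + (x.p - y.e) := by omega
        have h4 : y.e + (z.e - y.p) < x.p := by omega
        simp only [h1, h2, h3, h4, h1.not_ge, h2.not_ge, h3.not_ge, h4.not_ge]
        tauto
      · rcases lt_or_ge z.e (y.p + (x.p - y.e)) with h3 | h3
        · have h4 : y.e + (z.e - y.p) < x.p := by omega
          simp only [h1, h3, h4, h1.not_ge, h2.not_gt, h3.not_ge, h4.not_ge]
          tauto
        · have h4 : x.p ≤ y.e + (z.e - y.p) := by omega
          simp only [h1, h2, h3, h4, h1.not_ge, h2.not_gt, h3.not_gt, h4.not_gt]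
          tauto
      · have h3 : z.e < y.p + (x.p - y.e) := by omega
        have h4 : x.p ≤ y.e + (z.e - y.p) := by omega
        simp only [h1, h2, h3, h4, h1.not_gt, h2.not_ge, h3.not_ge, h4.not_gt]
        tauto
      · have h3 : y.p + (x.p - y.e) ≤ z.e := by omega
        have h4 : x.p ≤ y.e + (z.e - y.p) := by omega
        simp only [h1, h2, h3, h4, h1.not_gt, h2.not_gt, h3.not_gt, h4.not_gt]
        tauto
    · simp only [mul_E, and_assoc]

/-- The factor on which nothing can act, recording only an equality. -/
def ofProp (E : Prop) : Fac := ⟨0, 0, False, E, False.elim⟩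

@[simp] theorem ofProp_e (E : Prop) : (ofProp E).e = 0 := rfl
@[simp] theorem ofProp_p (E : Prop) : (ofProp E).p = 0 := rfl
@[simp] theorem ofProp_R (E : Prop) : (ofProp E).R ↔ False := Iff.rfl
@[simp] theorem ofProp_E (E : Prop) : (ofProp E).E ↔ E := Iff.rfl

theorem ofProp_true : ofProp True = 1 := rfl

theorem ofProp_mul (E E' : Prop) : ofProp E * ofProp E' = ofProp (E ∧ E') := by
  apply ext' <;> simp [mul_e, mul_p, mul_R, mul_E]

/-- With zero signature such a factor never competes for `f`, so it slides past everything; `pos`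
supplies the strict inequality when it stands on the right. Side conditions can thus be collected at
one end of a product. -/
theorem ofProp_comm (E : Prop) (x : Fac) : ofProp E * x = x * ofProp E := by
  apply ext'
  · simp [mul_e]
  · simp [mul_p]
  · simp only [mul_R, ofProp_p, ofProp_e, ofProp_E, ofProp_R]
    constructor
    · rintro (⟨h, -⟩ | ⟨-, h, h'⟩)
      · omega
      · exact Or.inl ⟨x.pos h', h', h⟩
    · rintro (⟨-, h, h'⟩ | ⟨-, -, h⟩)
      · exact Or.inr ⟨Nat.zero_le _, h', h⟩
      · exact h.elim
  · simp [mul_E, and_comm]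

theorem mul_ofProp_R (x : Fac) (E : Prop) : (x * ofProp E).R ↔ x.R ∧ E := by
  simp only [mul_R, ofProp_e, ofProp_E, ofProp_R, and_false, or_false]
  exact ⟨fun h => h.2, fun h => ⟨x.pos h.1, h⟩⟩

theorem ofProp_mul_R (x : Fac) (E : Prop) : (ofProp E * x).R ↔ E ∧ x.R := by
  rw [ofProp_comm, mul_ofProp_R, and_comm]

/-- Implication between comparisons with equal signatures. -/
def Le (x y : Fac) : Prop := x.e = y.e ∧ x.p = y.p ∧ (x.R → y.R) ∧ (x.E → y.E)

theorem Le.refl (x : Fac) : Le x x := ⟨rfl, rfl, id, id⟩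

theorem Le.trans {x y z : Fac} (h : Le x y) (h' : Le y z) : Le x z :=
  ⟨h.1.trans h'.1, h.2.1.trans h'.2.1, h'.2.2.1 ∘ h.2.2.1, h'.2.2.2 ∘ h.2.2.2⟩

/-- Equal signatures select the same branch of the tensor product rule on both sides, so the
implications multiply. -/
theorem Le.mul {x y x' y' : Fac} (h : Le x x') (h' : Le y y') : Le (x * y) (x' * y') := by
  obtain ⟨h1, h2, h3, h4⟩ := h
  obtain ⟨g1, g2, g3, g4⟩ := h'
  refine ⟨?_, ?_, ?_, ?_⟩
  · rw [mul_e, mul_e, h1, h2, g1]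
  · rw [mul_p, mul_p, h2, g1, g2]
  · rw [mul_R, mul_R, h2, g1]; tauto
  · rw [mul_E, mul_E]; tauto

theorem Le.prod_map {ι : Type*} (l : List ι) (F G : ι → Fac) (h : ∀ x ∈ l, Le (F x) (G x)) :
    Le (l.map F).prod (l.map G).prod := by
  induction l with
  | nil => exact Le.refl _
  | cons a l ih =>
    simp only [List.map_cons, List.prod_cons]
    exact (h a (by simp)).mul (ih fun x hx => h x (by simp [hx]))

theorem prod_E {ι : Type*} (l : List ι) (F : ι → Fac) :
    (l.map F).prod.E ↔ ∀ x ∈ l, (F x).E := by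
  induction l with
  | nil => simp
  | cons a l ih => simp [mul_E, ih]

/-- If `f` acts on a product, then it acts on one of the factors, and the other ones are
unchanged. -/
theorem prod_R_split {ι : Type*} (l : List ι) (F : ι → Fac) (h : (l.map F).prod.R) :
    ∃ u x v, l = u ++ x :: v ∧ (F x).R ∧ (v.map F).prod.e < (F x).p ∧
      (∀ z ∈ u, (F z).E) ∧ ∀ z ∈ v, (F z).E := by
  induction l with
  | nil => exact h.elim
  | cons a l ih =>
    rw [List.map_cons, List.prod_cons, mul_R] at h
    rcases h with ⟨h1, h2, h3⟩ | ⟨h1, h2, h3⟩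
    · exact ⟨[], a, l, rfl, h2, h1, by simp, (prod_E l F).1 h3⟩
    · obtain ⟨u, x, v, rfl, hx, hp, hu, hv⟩ := ih h3
      refine ⟨a :: u, x, v, rfl, hx, hp, ?_, hv⟩
      intro z hz
      rcases List.mem_cons.1 hz with rfl | hz
      · exact h2
      · exact hu z hz

theorem prod_ofProp {ι : Type*} (l : List ι) (F : ι → Prop) :
    (l.map fun x => ofProp (F x)).prod = ofProp (∀ x ∈ l, F x) := by
  induction l with
  | nil => simp [ofProp_true]
  | cons a l ih => simp [ih, ofProp_mul]

theorem prod_map_mul_ofProp {ι : Type*} (l : List ι) (G : ι → Fac) (F : ι → Prop) :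
    (l.map fun x => G x * ofProp (F x)).prod = (l.map G).prod * ofProp (∀ x ∈ l, F x) := by
  induction l with
  | nil => simp [ofProp_true]
  | cons a l ih =>
    simp only [List.map_cons, List.prod_cons, ih]
    rw [mul_assoc, ← mul_assoc (ofProp _), ofProp_comm, mul_assoc, ofProp_mul, ← mul_assoc]
    congr 2
    apply propext
    simp

end Fac

/-- If `x_j s_{j+1} = s_j x'_j` for all `j`, then `(∏ x_j) s_m = s_0 ∏ x'_j`. -/
theorem prod_exchange {M : Type*} [Monoid M] (x x' s : ℕ → M) (d : ℕ) :
    ∀ m : ℕ, (∀ j, m ≤ j → j < m + d → x j * s (j + 1) = s j * x' j) →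
    ((List.range' m d).map x).prod * s (m + d) = s m * ((List.range' m d).map x').prod := by
  induction d with
  | zero => intro m _; simp
  | succ d ih =>
    intro m h
    have := ih (m + 1) (fun j h1 h2 => h j (by omega) (by omega))
    rw [List.range'_succ, List.map_cons, List.prod_cons, List.map_cons, List.prod_cons, mul_assoc,
      show m + (d + 1) = m + 1 + d by omega, this, ← mul_assoc, h m le_rfl (by omega), mul_assoc]

end

end GlInf

namespace GlInf

noncomputable section

/-! ## The vertex rule -/

/-- The local rule of the insertion: a matrix entry and two incoming bits are turned into a matrix
entry and two outgoing bits. -/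
def rule : ℕ × Bool × Bool → ℕ × Bool × Bool
  | (a, true, true) => (a + 1, false, false)
  | (a + 1, false, false) => (a, true, true)
  | (0, false, false) => (0, false, false)
  | (a, true, false) => (a, true, false)
  | (a, false, true) => (a, false, true)

/-- The first two clauses undo each other and the other three are fixed points. This is the source
of the invertibility of the insertion. -/
theorem rule_rule (x : ℕ × Bool × Bool) : rule (rule x) = x := by
  obtain ⟨a, c, y⟩ := x
  cases a <;> cases c <;> cases y <;> rfl

theorem rule_eq_iff {x x' : ℕ × Bool × Bool} : rule x = x' ↔ rule x' = x :=
  ⟨fun h => h ▸ rule_rule x, fun h => h ▸ rule_rule x'⟩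

theorem rule_injective : Function.Injective rule :=
  Function.LeftInverse.injective rule_rule

/-- The clauses treat the two bits alike. This permits the transposition of grids, by which the
positive colours are reduced to the argument for the negative ones. -/
theorem rule_swap {a a' : ℕ} {c y c' y' : Bool} (h : rule (a, c, y) = (a', c', y')) :
    rule (a, y, c) = (a', y', c') := by
  cases a <;> cases c <;> cases y <;> simp_all [rule]

/-- Entry and horizontal bit exchange one unit at most; summed over a row this becomes the
conservation of letters under insertion. -/
theorem rule_conserve {a a' : ℕ} {c y c' y' : Bool} (h : rule (a, c, y) = (a', c', y')) :
    a + c.toNat = a' + c'.toNat := by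
  cases a <;> cases c <;> cases y <;> simp_all [rule]

/-- The factor of two neighbouring matrix entries `a0`, `a1`. -/
def pairFac (a0 a1 b0 b1 : ℕ) : Fac where
  e := a1
  p := a0
  R := a0 = b0 + 1 ∧ b1 = a1 + 1
  E := a0 = b0 ∧ a1 = b1
  pos := by omega

/-- The factor of two neighbouring bits `c0`, `c1`. -/
def bitFac (c0 c1 d0 d1 : Bool) : Fac where
  e := (!c0 && c1).toNat
  p := (c0 && !c1).toNat
  R := c0 = true ∧ c1 = false ∧ d0 = false ∧ d1 = true
  E := c0 = d0 ∧ c1 = d1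
  pos := by rintro ⟨rfl, rfl, -, -⟩; decide

/-- The signature half of the exchange relation `local_fac`: entries followed by incoming bits on
one side, outgoing bits followed by new entries on the other. The rule distinguishes only whether an
entry is zero, so finitely many cases remain. -/
theorem local_sig {a0 a1 a0' a1' : ℕ} {c0 c1 c0' c1' y z y' : Bool}
    (h1 : rule (a1, c1, y) = (a1', c1', z)) (h0 : rule (a0, c0, z) = (a0', c0', y')) :
    let c := bitFac c0 c1 c0 c1
    let c' := bitFac c0' c1' c0' c1'
    a1 + (c.e - a0) = c'.e + (a1' - c'.p) ∧ c.p + (a0 - c.e) = a0' + (c'.p - a1') := by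
  cases a1 <;> cases c1 <;> cases y <;> simp only [rule, Prod.mk.injEq] at h1 <;>
  obtain ⟨rfl, rfl, rfl⟩ := h1 <;>
  cases a0 <;> cases c0 <;> simp only [rule, Prod.mk.injEq] at h0 <;>
  obtain ⟨rfl, rfl, rfl⟩ := h0 <;> simp [bitFac] <;> omega

/-- Both configurations receive the same vertical bit `y`. That they also emit the same one (`y' =
w'`) means that the effect of `f` does not leave the two rows. -/
theorem local_fwd {a0 a1 a0' a1' b0 b1 b0' b1' : ℕ} {c0 c1 c0' c1' d0 d1 d0' d1' y z y' w' z' : Bool}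
    (h1 : rule (a1, c1, y) = (a1', c1', z)) (h0 : rule (a0, c0, z) = (a0', c0', y'))
    (g1 : rule (b1, d1, y) = (b1', d1', z')) (g0 : rule (b0, d0, z') = (b0', d0', w'))
    (hR : (pairFac a0 a1 b0 b1 * bitFac c0 c1 d0 d1).R) :
    (bitFac c0' c1' d0' d1' * pairFac a0' a1' b0' b1').R ∧ y' = w' := by
  rw [Fac.mul_R] at hR ⊢
  rcases hR with ⟨h, ⟨rfl, rfl⟩, ⟨rfl, rfl⟩⟩ | ⟨h, ⟨rfl, rfl⟩, ⟨rfl, rfl, rfl, rfl⟩⟩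
  · cases a1 <;> cases c1 <;> cases y <;> simp only [rule, Prod.mk.injEq] at h1 g1 <;>
    obtain ⟨rfl, rfl, rfl⟩ := h1 <;> obtain ⟨rfl, rfl, rfl⟩ := g1 <;>
    cases b0 <;> cases c0 <;> simp only [rule, Prod.mk.injEq] at h0 g0 <;>
    obtain ⟨rfl, rfl, rfl⟩ := h0 <;> obtain ⟨rfl, rfl, rfl⟩ := g0 <;>
    simp_all [bitFac, pairFac]
  · cases a1 <;> cases y <;> simp only [rule, Prod.mk.injEq] at h1 g1 <;>
    obtain ⟨rfl, rfl, rfl⟩ := h1 <;> obtain ⟨rfl, rfl, rfl⟩ := g1 <;>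
    cases a0 <;> simp only [rule, Prod.mk.injEq] at h0 g0 <;>
    obtain ⟨rfl, rfl, rfl⟩ := h0 <;> obtain ⟨rfl, rfl, rfl⟩ := g0 <;>
    simp_all [bitFac, pairFac]

theorem local_bwd {a0 a1 a0' a1' b0 b1 b0' b1' : ℕ} {c0 c1 c0' c1' d0 d1 d0' d1' y z y' w z' : Bool}
    (h1 : rule (a1, c1, y) = (a1', c1', z)) (h0 : rule (a0, c0, z) = (a0', c0', y'))
    (g1 : rule (b1, d1, w) = (b1', d1', z')) (g0 : rule (b0, d0, z') = (b0', d0', y'))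
    (hR : (bitFac c0' c1' d0' d1' * pairFac a0' a1' b0' b1').R) :
    (pairFac a0 a1 b0 b1 * bitFac c0 c1 d0 d1).R ∧ y = w := by
  -- The involution expresses the incoming data by the outgoing ones, so that the case analysis can
  -- start from the primed side.
  rw [rule_eq_iff] at h1 h0 g1 g0
  rw [Fac.mul_R] at hR ⊢
  rcases hR with ⟨h, ⟨rfl, rfl, rfl, rfl⟩, ⟨rfl, rfl⟩⟩ | ⟨h, ⟨rfl, rfl⟩, ⟨rfl, rfl⟩⟩
  · cases a0' <;> cases y' <;> simp only [rule, Prod.mk.injEq] at h0 g0 <;>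
    obtain ⟨rfl, rfl, rfl⟩ := h0 <;> obtain ⟨rfl, rfl, rfl⟩ := g0 <;>
    cases a1' <;> simp only [rule, Prod.mk.injEq] at h1 g1 <;>
    obtain ⟨rfl, rfl, rfl⟩ := h1 <;> obtain ⟨rfl, rfl, rfl⟩ := g1 <;>
    simp_all [bitFac, pairFac]
  · cases b0' <;> cases c0' <;> cases y' <;> simp only [rule, Prod.mk.injEq] at h0 g0 <;>
    obtain ⟨rfl, rfl, rfl⟩ := h0 <;> obtain ⟨rfl, rfl, rfl⟩ := g0 <;>
    cases a1' <;> cases c1' <;> simp only [rule, Prod.mk.injEq] at h1 g1 <;>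
    obtain ⟨rfl, rfl, rfl⟩ := h1 <;> obtain ⟨rfl, rfl, rfl⟩ := g1 <;>
    simp_all [bitFac, pairFac]

/-- The two vertices lie in adjacent rows and share the vertical bit `z` (or `z'`). The colour that
acts on these two rows commutes with the vertices: "entries, then incoming bits" turns into
"outgoing bits, then new entries", with the equality of the vertical bits carried along. All nonzero
colours are handled by iterating this relation. -/
theorem local_fac {a0 a1 a0' a1' b0 b1 b0' b1' : ℕ}
    {c0 c1 c0' c1' d0 d1 d0' d1' y z y' w z' w' : Bool}
    (h1 : rule (a1, c1, y) = (a1', c1', z)) (h0 : rule (a0, c0, z) = (a0', c0', y'))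
    (g1 : rule (b1, d1, w) = (b1', d1', z')) (g0 : rule (b0, d0, z') = (b0', d0', w')) :
    pairFac a0 a1 b0 b1 * Fac.ofProp (y = w) * bitFac c0 c1 d0 d1 =
      bitFac c0' c1' d0' d1' * (pairFac a0' a1' b0' b1' * Fac.ofProp (y' = w')) := by
  rw [mul_assoc, Fac.ofProp_comm, ← mul_assoc, ← mul_assoc]
  apply Fac.ext'
  · simpa [Fac.mul_e, pairFac, bitFac] using (local_sig h1 h0).1
  · simpa [Fac.mul_p, Fac.mul_e, pairFac, bitFac] using (local_sig h1 h0).2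
  · rw [Fac.mul_ofProp_R, Fac.mul_ofProp_R]
    constructor
    · rintro ⟨h, rfl⟩
      exact local_fwd h1 h0 g1 g0 h
    · rintro ⟨h, rfl⟩
      exact local_bwd h1 h0 g1 g0 h
  · simp only [Fac.mul_E, Fac.ofProp_E]
    constructor
    · rintro ⟨⟨⟨rfl, rfl⟩, rfl, rfl⟩, rfl⟩
      rw [h1] at g1
      simp only [Prod.mk.injEq] at g1
      obtain ⟨rfl, rfl, rfl⟩ := g1
      rw [h0] at g0
      simp only [Prod.mk.injEq] at g0
      obtain ⟨rfl, rfl, rfl⟩ := g0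
      simp [bitFac, pairFac]
    · rintro ⟨⟨⟨rfl, rfl⟩, rfl, rfl⟩, rfl⟩
      rw [rule_eq_iff] at h1 h0 g1 g0
      rw [h0] at g0
      simp only [Prod.mk.injEq] at g0
      obtain ⟨rfl, rfl, rfl⟩ := g0
      rw [h1] at g1
      simp only [Prod.mk.injEq] at g1
      obtain ⟨rfl, rfl, rfl⟩ := g1
      simp [bitFac, pairFac]

/-- The corner vertex and the colour `0`. -/
theorem corner_fac {a a' b b' : ℕ} {c y c' y' d w d' w' : Bool}
    (h : rule (a, c, y) = (a', c', y')) (g : rule (b, d, w) = (b', d', w')) :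
    a = (c' && y').toNat + (a' - (!c' && !y').toNat) ∧
    (b = a + 1 ∧ c = d ∧ y = w ↔
      (a' < (!c' && !y').toNat ∧ (c' = false ∧ y' = false ∧ d' = true ∧ w' = true) ∧ a' = b') ∨
      ((!c' && !y').toNat ≤ a' ∧ (c' = d' ∧ y' = w') ∧ b' = a' + 1)) := by
  cases a <;> cases c <;> cases y <;> simp only [rule, Prod.mk.injEq] at h <;>
  obtain ⟨rfl, rfl, rfl⟩ := h <;>
  cases b <;> cases d <;> cases w <;> simp only [rule, Prod.mk.injEq] at g <;>
  obtain ⟨rfl, rfl, rfl⟩ := g <;> simp <;> omega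

end

end GlInf

namespace GlInf

noncomputable section

/-! ## Grids of vertices -/

/-- The mirror image of `prod_exchange`: the transported element starts on the left of the product
and leaves on the right, as a matrix does when it passes through successive columns. -/
theorem prod_exchange' {M : Type*} [Monoid M] (m c p : ℕ → M) (d : ℕ) :
    ∀ t : ℕ, (∀ j, t ≤ j → j < t + d → m j * c j = p j * m (j + 1)) →
    m t * ((List.range' t d).map c).prod = ((List.range' t d).map p).prod * m (t + d) := by
  induction d with
  | zero => intro t _; simp
  | succ d ih =>
    intro t h
    have := ih (t + 1) (fun j h1 h2 => h j (by omega) (by omega))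
    rw [List.range'_succ, List.map_cons, List.prod_cons, List.map_cons, List.prod_cons, ← mul_assoc,
      h t le_rfl (by omega), mul_assoc, this, ← mul_assoc, show t + (d + 1) = t + 1 + d by omega]

/-- A configuration of the vertex model on an `N × N` square. The bit `c k j` crosses the edge
between the vertices `(k, j - 1)` and `(k, j)`, the bit `y k j` the edge between `(k - 1, j)` and
`(k, j)`. The matrix `A` is turned into `A'`. -/
def IsGrid (N : ℕ) (A A' : ℕ → ℕ → ℕ) (c y : ℕ → ℕ → Bool) : Prop :=
  ∀ k j, k < N → j < N → rule (A k j, c k (j + 1), y (k + 1) j) = (A' k j, c k j, y k j)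

/-- By `rule_swap`, horizontal and vertical bits play the same role. -/
theorem IsGrid.transpose {N : ℕ} {A A' : ℕ → ℕ → ℕ} {c y : ℕ → ℕ → Bool}
    (h : IsGrid N A A' c y) :
    IsGrid N (fun k j => A j k) (fun k j => A' j k) (fun k j => y j k) (fun k j => c j k) :=
  fun k j hk hj => rule_swap (h j k hj hk)

/-- The horizontal bits of one row. -/
def genC (a : ℕ → ℕ) (p : Bool) (y : ℕ → Bool) : ℕ → Bool
  | 0 => p
  | j + 1 => (rule (a j, genC a p y j, y j)).2.1

/-- The vertical bits of a grid which is filled from its outgoing bits. -/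
def genY (A : ℕ → ℕ → ℕ) (P Q : ℕ → Bool) : ℕ → ℕ → Bool
  | 0 => Q
  | k + 1 => fun j => (rule (A k j, genC (A k) (P k) (genY A P Q k) j, genY A P Q k j)).2.2

theorem exists_gen (A' : ℕ → ℕ → ℕ) (P Q : ℕ → Bool) :
    ∃ (A : ℕ → ℕ → ℕ) (c y : ℕ → ℕ → Bool),
      (∀ k j, rule (A' k j, c k j, y k j) = (A k j, c k (j + 1), y (k + 1) j)) ∧
      (∀ k, c k 0 = P k) ∧ ∀ j, y 0 j = Q j :=
  ⟨fun k j => (rule (A' k j, genC (A' k) (P k) (genY A' P Q k) j, genY A' P Q k j)).1,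
    fun k => genC (A' k) (P k) (genY A' P Q k), genY A' P Q, fun _ _ => rfl, fun _ => rfl,
    fun _ => rfl⟩

/-- As `rule` is an involution, the outgoing bits and the bumped matrix determine everything, vertex
by vertex from the corner `(0, 0)`. The filling does not see the size of the square, so one solution
serves every `N`. -/
theorem exists_grid_of_out (A' : ℕ → ℕ → ℕ) (P Q : ℕ → Bool) :
    ∃ (A : ℕ → ℕ → ℕ) (c y : ℕ → ℕ → Bool), (∀ N, IsGrid N A A' c y) ∧
      (∀ k, c k 0 = P k) ∧ ∀ j, y 0 j = Q j := by
  obtain ⟨A, c, y, h, hP, hQ⟩ := exists_gen A' P Q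
  exact ⟨A, c, y, fun N k j _ _ => rule_eq_iff.1 (h k j), hP, hQ⟩

/-! ### Comparison of two grids at one colour. -/

section compare

variable {N : ℕ} {A A' B B' : ℕ → ℕ → ℕ} {c y d w : ℕ → ℕ → Bool}

/-- Each vertex is a bijection between incoming and outgoing data, so two rows agree on one side if
and only if they agree on the other. The induction along the row is delegated to `prod_exchange`,
applied to factors which hold nothing but an equality. -/
theorem IsGrid.row_eq_iff (h : IsGrid N A A' c y) (g : IsGrid N B B' d w) {r : ℕ} (hr : r < N) :
    ((∀ j < N, y (r + 1) j = w (r + 1) j) ∧ (∀ j < N, A r j = B r j) ∧ c r N = d r N) ↔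
    (∀ j < N, y r j = w r j) ∧ (∀ j < N, A' r j = B' r j) ∧ c r 0 = d r 0 := by
  have key := prod_exchange (fun j => Fac.ofProp (y (r + 1) j = w (r + 1) j ∧ A r j = B r j))
    (fun j => Fac.ofProp (y r j = w r j ∧ A' r j = B' r j)) (fun j => Fac.ofProp (c r j = d r j))
    N 0 (by
      intro j _ hj
      rw [Fac.ofProp_mul, Fac.ofProp_mul]
      congr 1
      apply propext
      have h1 := h r j hr (by omega)
      have g1 := g r j hr (by omega)
      constructor
      · rintro ⟨⟨e1, e2⟩, e3⟩
        rw [e1, e2, e3, g1] at h1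
        simp only [Prod.mk.injEq] at h1
        obtain ⟨h1, h2, h3⟩ := h1
        exact ⟨h2.symm, h3.symm, h1.symm⟩
      · rintro ⟨e3, e1, e2⟩
        rw [← e1, ← e2, ← e3, ← h1] at g1
        have := rule_injective g1
        simp only [Prod.mk.injEq] at this
        obtain ⟨h1, h2, h3⟩ := this
        exact ⟨⟨h3.symm, h1.symm⟩, h2.symm⟩)
  have key2 := congrArg Fac.E key
  rw [Fac.prod_ofProp, Fac.prod_ofProp, Fac.ofProp_mul, Fac.ofProp_mul] at key2
  simp only [Fac.ofProp_E, List.mem_range'_1, Nat.zero_le, true_and, zero_add] at key2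
  have key3 := key2.to_iff
  constructor
  · rintro ⟨h1, h2, h3⟩
    have := key3.1 ⟨fun j hj => ⟨h1 j hj, h2 j hj⟩, h3⟩
    exact ⟨fun j hj => (this.2 j hj).1, fun j hj => (this.2 j hj).2, this.1⟩
  · rintro ⟨h1, h2, h3⟩
    have := key3.2 ⟨h3, fun j hj => ⟨h1 j hj, h2 j hj⟩⟩
    exact ⟨fun j hj => (this.1 j hj).1, fun j hj => (this.1 j hj).2, this.2⟩

theorem IsGrid.rows_eq_iff (h : IsGrid N A A' c y) (g : IsGrid N B B' d w) (m e : ℕ)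
    (hr : m + e ≤ N) :
    ((∀ j < N, y (m + e) j = w (m + e) j) ∧
      ∀ r, m ≤ r → r < m + e → (∀ j < N, A r j = B r j) ∧ c r N = d r N) ↔
    (∀ j < N, y m j = w m j) ∧
      ∀ r, m ≤ r → r < m + e → (∀ j < N, A' r j = B' r j) ∧ c r 0 = d r 0 := by
  induction e with
  | zero => simp; intro _; constructor <;> intro _ r h1 h2 <;> omega
  | succ e ih =>
    have ih := ih (by omega)
    have h1 := h.row_eq_iff g (r := m + e) (by omega)
    constructor
    · rintro ⟨h2, h3⟩
      obtain ⟨h4, h5⟩ := h1.1 ⟨h2, h3 (m + e) (by omega) (by omega)⟩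
      obtain ⟨h6, h7⟩ := ih.1 ⟨h4, fun r h h' => h3 r h (by omega)⟩
      refine ⟨h6, fun r hr1 hr2 => ?_⟩
      rcases Nat.lt_or_ge r (m + e) with h8 | h8
      · exact h7 r hr1 h8
      · obtain rfl : r = m + e := by omega
        exact h5
    · rintro ⟨h2, h3⟩
      obtain ⟨h4, h5⟩ := ih.2 ⟨h2, fun r h h' => h3 r h (by omega)⟩
      obtain ⟨h6, h7⟩ := h1.2 ⟨h4, h3 (m + e) (by omega) (by omega)⟩
      refine ⟨h6, fun r hr1 hr2 => ?_⟩
      rcases Nat.lt_or_ge r (m + e) with h8 | h8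
      · exact h5 r hr1 h8
      · obtain rfl : r = m + e := by omega
        exact h7

/-- The factor of the rows `k` and `k + 1` of a matrix, together with the equality of the other
rows. -/
def matFac (N k : ℕ) (A B : ℕ → ℕ → ℕ) : Fac :=
  ((List.range' 0 N).map fun j => pairFac (A k j) (A (k + 1) j) (B k j) (B (k + 1) j)).prod *
    Fac.ofProp (∀ r < N, r ≠ k → r ≠ k + 1 → ∀ j < N, A r j = B r j)

/-- The factor of the bits `k` and `k + 1`, together with the equality of the other bits. -/
def bitsFac (N k : ℕ) (C D : ℕ → Bool) : Fac :=
  bitFac (C k) (C (k + 1)) (D k) (D (k + 1)) *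
    Fac.ofProp (∀ r < N, r ≠ k → r ≠ k + 1 → C r = D r)

/-- A train argument: in the rows `k` and `k + 1` the pair of bits travels through all columns by
`local_fac`. The colour does not touch the other rows; they contribute equalities only, which are
transported by `rows_eq_iff`. -/
theorem IsGrid.fac (h : IsGrid N A A' c y) (g : IsGrid N B B' d w) {k : ℕ} (hk : k + 1 < N) :
    Fac.ofProp (∀ j < N, y N j = w N j) *
      (matFac N k A B * bitsFac N k (fun r => c r N) (fun r => d r N)) =
    bitsFac N k (fun r => c r 0) (fun r => d r 0) *
      (matFac N k A' B' * Fac.ofProp (∀ j < N, y 0 j = w 0 j)) := by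
  have key := prod_exchange
    (fun j => pairFac (A k j) (A (k + 1) j) (B k j) (B (k + 1) j) *
      Fac.ofProp (y (k + 2) j = w (k + 2) j))
    (fun j => pairFac (A' k j) (A' (k + 1) j) (B' k j) (B' (k + 1) j) *
      Fac.ofProp (y k j = w k j))
    (fun j => bitFac (c k j) (c (k + 1) j) (d k j) (d (k + 1) j)) N 0 (by
      intro j _ hj
      exact local_fac (h (k + 1) j hk (by omega)) (h k j (by omega) (by omega))
        (g (k + 1) j hk (by omega)) (g k j (by omega) (by omega)))
  rw [Fac.prod_map_mul_ofProp, Fac.prod_map_mul_ofProp] at key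
  simp only [List.mem_range'_1, Nat.zero_le, true_and, zero_add] at key
  -- The rows from `k + 2` on feed their vertical bits into the active pair; the rows below `k` are
  -- fed by it. Both blocks consist of bijective vertices.
  have up := h.rows_eq_iff g (k + 2) (N - (k + 2)) (by omega)
  rw [show k + 2 + (N - (k + 2)) = N by omega] at up
  have dn := h.rows_eq_iff g 0 k (by omega)
  simp only [zero_add] at dn
  unfold matFac bitsFac
  set X := ((List.range' 0 N).map fun j =>
    pairFac (A k j) (A (k + 1) j) (B k j) (B (k + 1) j)).prod
  set X' := ((List.range' 0 N).map fun j =>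
    pairFac (A' k j) (A' (k + 1) j) (B' k j) (B' (k + 1) j)).prod
  set b := bitFac (c k N) (c (k + 1) N) (d k N) (d (k + 1) N)
  set b' := bitFac (c k 0) (c (k + 1) 0) (d k 0) (d (k + 1) 0)
  have e1 : ∀ (E1 E2 E3 : Prop) (x z : Fac), Fac.ofProp E1 * (x * Fac.ofProp E2 *
      (z * Fac.ofProp E3)) = x * z * Fac.ofProp (E1 ∧ E2 ∧ E3) := by
    intro E1 E2 E3 x z
    rw [← Fac.ofProp_mul, ← Fac.ofProp_mul, Fac.ofProp_comm E1, ← mul_assoc (Fac.ofProp E1),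
      Fac.ofProp_comm E1]
    simp only [mul_assoc]
    rw [← mul_assoc _ z, Fac.ofProp_comm E2 z, Fac.ofProp_comm E1]
    simp only [mul_assoc]
  have e2 : ∀ (E1 E2 E3 : Prop) (x z : Fac), x * Fac.ofProp E1 * (z * Fac.ofProp E2 *
      Fac.ofProp E3) = x * z * Fac.ofProp (E1 ∧ E2 ∧ E3) := by
    intro E1 E2 E3 x z
    rw [← Fac.ofProp_mul, ← Fac.ofProp_mul]
    simp only [mul_assoc]
    rw [← mul_assoc _ z, Fac.ofProp_comm E1 z]
    simp only [mul_assoc]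
  have e3 : ∀ (E1 : Prop) (x z : Fac), x * Fac.ofProp E1 * z = x * z * Fac.ofProp E1 := by
    intro E1 x z
    rw [mul_assoc, Fac.ofProp_comm E1 z, mul_assoc]
  rw [e1, e2]
  rw [e3, ← mul_assoc] at key
  have key1 : X * b * Fac.ofProp ((∀ j < N, y N j = w N j) ∧
      (∀ r < N, r ≠ k → r ≠ k + 1 → ∀ j < N, A r j = B r j) ∧
      ∀ r < N, r ≠ k → r ≠ k + 1 → c r N = d r N) =
    X * b * Fac.ofProp (∀ j < N, y (k + 2) j = w (k + 2) j) * Fac.ofProp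
      ((∀ r, k + 2 ≤ r → r < N → (∀ j < N, A' r j = B' r j) ∧ c r 0 = d r 0) ∧
        (∀ r < k, (∀ j < N, A r j = B r j) ∧ c r N = d r N)) := by
    rw [mul_assoc (X * b), Fac.ofProp_mul]
    congr 2
    apply propext
    rw [← and_assoc (a := ∀ j < N, y (k + 2) j = w (k + 2) j), ← up]
    constructor
    · rintro ⟨h1, h2, h3⟩
      exact ⟨⟨h1, fun r hr hr' => ⟨h2 r hr' (by omega) (by omega), h3 r hr' (by omega) (by omega)⟩⟩,
        fun r hr => ⟨h2 r (by omega) (by omega) (by omega), h3 r (by omega) (by omega) (by omega)⟩⟩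
    · rintro ⟨⟨h1, h2⟩, h3⟩
      refine ⟨h1, ?_, ?_⟩
      · intro r hr h4 h5
        rcases Nat.lt_or_ge r k with h6 | h6
        · exact (h3 r h6).1
        · exact (h2 r (by omega) hr).1
      · intro r hr h4 h5
        rcases Nat.lt_or_ge r k with h6 | h6
        · exact (h3 r h6).2
        · exact (h2 r (by omega) hr).2
  rw [key1, key, mul_assoc (b' * X'), Fac.ofProp_mul]
  congr 2
  apply propext
  have dn' : ((∀ j < N, y k j = w k j) ∧ ∀ r < k, (∀ j < N, A r j = B r j) ∧ c r N = d r N) ↔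
    ((∀ j < N, y 0 j = w 0 j) ∧ ∀ r < k, (∀ j < N, A' r j = B' r j) ∧ c r 0 = d r 0) := by
    simpa using dn
  constructor
  · rintro ⟨h1, h2, h3⟩
    obtain ⟨h4, h5⟩ := dn'.1 ⟨h1, h3⟩
    refine ⟨?_, ?_, h4⟩
    · intro r hr h7 h8
      rcases Nat.lt_or_ge r k with h6 | h6
      · exact (h5 r h6).2
      · exact (h2 r (by omega) hr).2
    · intro r hr h7 h8
      rcases Nat.lt_or_ge r k with h6 | h6
      · exact (h5 r h6).1
      · exact (h2 r (by omega) hr).1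
  · rintro ⟨h1, h2, h3⟩
    obtain ⟨h4, h5⟩ := dn'.2 ⟨h3, fun r hr => ⟨h2 r (by omega) (by omega) (by omega),
      h1 r (by omega) (by omega) (by omega)⟩⟩
    exact ⟨h4, fun r hr hr' => ⟨h2 r hr' (by omega) (by omega), h1 r hr' (by omega) (by omega)⟩, h5⟩

theorem IsGrid.eq_iff (h : IsGrid N A A' c y) (g : IsGrid N B B' d w) :
    ((∀ j < N, y N j = w N j) ∧ (∀ r < N, ∀ j < N, A r j = B r j) ∧ ∀ r < N, c r N = d r N) ↔
    (∀ j < N, y 0 j = w 0 j) ∧ (∀ r < N, ∀ j < N, A' r j = B' r j) ∧ ∀ r < N, c r 0 = d r 0 := by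
  have := h.rows_eq_iff g 0 N (by omega)
  simp only [zero_add, Nat.zero_le, true_implies] at this
  constructor
  · rintro ⟨h1, h2, h3⟩
    obtain ⟨h4, h5⟩ := this.1 ⟨h1, fun r hr => ⟨h2 r hr, h3 r hr⟩⟩
    exact ⟨h4, fun r hr => (h5 r hr).1, fun r hr => (h5 r hr).2⟩
  · rintro ⟨h1, h2, h3⟩
    obtain ⟨h4, h5⟩ := this.2 ⟨h1, fun r hr => ⟨h2 r hr, h3 r hr⟩⟩
    exact ⟨h4, fun r hr => (h5 r hr).1, fun r hr => (h5 r hr).2⟩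

end compare

end

end GlInf

namespace GlInf

noncomputable section

/-! ## Insertion of a matrix into a column -/

/-- The matrix `A` is inserted into the column with bits `C`; this gives the column `P`, records
the bits `Q`, and bumps the matrix `A'`. All data are considered on the `N × N` square. -/
def ColRel (N : ℕ) (A : ℕ → ℕ → ℕ) (C : ℕ → Bool) (A' : ℕ → ℕ → ℕ) (P Q : ℕ → Bool) : Prop :=
  ∃ c y, IsGrid N A A' c y ∧ (∀ k < N, c k N = C k ∧ c k 0 = P k) ∧
    ∀ j < N, y N j = false ∧ y 0 j = Q j

/-- Grids are bijective and the vertical bits entering at the edge `N` vanish in both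
configurations. Hence insertion into a column is injective as soon as the labels are remembered. -/
theorem ColRel.eq_iff {N : ℕ} {A A' B B' : ℕ → ℕ → ℕ} {C P Q D P' Q' : ℕ → Bool}
    (h : ColRel N A C A' P Q) (g : ColRel N B D B' P' Q') :
    ((∀ k < N, ∀ j < N, A k j = B k j) ∧ ∀ k < N, C k = D k) ↔
    (∀ k < N, ∀ j < N, A' k j = B' k j) ∧ (∀ k < N, P k = P' k) ∧ ∀ j < N, Q j = Q' j := by
  obtain ⟨c, y, h1, h2, h3⟩ := h
  obtain ⟨d, w, g1, g2, g3⟩ := g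
  have key := h1.eq_iff g1
  constructor
  · rintro ⟨e1, e2⟩
    obtain ⟨e3, e4, e5⟩ := key.1 ⟨fun j hj => (h3 j hj).1.trans (g3 j hj).1.symm, e1,
      fun r hr => (h2 r hr).1.trans ((e2 r hr).trans (g2 r hr).1.symm)⟩
    exact ⟨e4, fun k hk => (h2 k hk).2.symm.trans ((e5 k hk).trans (g2 k hk).2),
      fun k hk => (h3 k hk).2.symm.trans ((e3 k hk).trans (g3 k hk).2)⟩
  · rintro ⟨e1, e2, e3⟩
    obtain ⟨e3, e4, e5⟩ := key.2 ⟨fun j hj => (h3 j hj).2.trans ((e3 j hj).trans (g3 j hj).2.symm),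
      e1, fun r hr => (h2 r hr).2.trans ((e2 r hr).trans (g2 r hr).2.symm)⟩
    exact ⟨e4, fun k hk => (h2 k hk).1.symm.trans ((e5 k hk).trans (g2 k hk).1)⟩

theorem bitsFac_congr {N k : ℕ} (hk : k + 1 < N) {C D C' D' : ℕ → Bool}
    (h : ∀ r < N, C r = C' r) (g : ∀ r < N, D r = D' r) :
    bitsFac N k C D = bitsFac N k C' D' := by
  unfold bitsFac
  rw [h k (by omega), h (k + 1) hk, g k (by omega), g (k + 1) hk]
  congr 2
  apply propext
  constructor <;> intro e r hr h1 h2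
  · rw [← h r hr, ← g r hr, e r hr h1 h2]
  · rw [h r hr, g r hr, e r hr h1 h2]

theorem bitsFac_self_false (N k : ℕ) : bitsFac N k (fun _ => false) (fun _ => false) = 1 := by
  unfold bitsFac
  apply Fac.ext' <;> simp [Fac.mul_e, Fac.mul_p, Fac.mul_R, Fac.mul_E, bitFac]

section compare

variable {N : ℕ} {A A' B B' : ℕ → ℕ → ℕ} {C P Q D P' Q' : ℕ → Bool}

/-- The equality at the edge `N` is void, since no vertical bits enter there. What remains is that
acting on the matrix tensor the old column amounts to acting on the new column tensor the bumped
matrix, with fixed labels. -/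
theorem ColRel.fac_neg (h : ColRel N A C A' P Q) (g : ColRel N B D B' P' Q') {k : ℕ}
    (hk : k + 1 < N) :
    matFac N k A B * bitsFac N k C D =
      bitsFac N k P P' * Fac.ofProp (∀ j < N, Q j = Q' j) * matFac N k A' B' := by
  obtain ⟨c, y, h1, h2, h3⟩ := h
  obtain ⟨d, w, g1, g2, g3⟩ := g
  have key := h1.fac g1 hk
  have e1 : (∀ j < N, y N j = w N j) ↔ True :=
    iff_true_intro fun j hj => (h3 j hj).1.trans (g3 j hj).1.symm
  have e2 : (∀ j < N, y 0 j = w 0 j) ↔ ∀ j < N, Q j = Q' j := by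
    refine forall_congr' fun j => forall_congr' fun hj => ?_
    rw [(h3 j hj).2, (g3 j hj).2]
  rw [propext e1, Fac.ofProp_true, one_mul, propext e2,
    bitsFac_congr hk (fun r hr => (h2 r hr).1) (fun r hr => (g2 r hr).1),
    bitsFac_congr hk (fun r hr => (h2 r hr).2) (fun r hr => (g2 r hr).2), ← Fac.ofProp_comm,
    ← mul_assoc] at key
  exact key

/-- The same relation for the transposed grid. The bits entering at the label side are zero and give
a trivial factor, so the colour acts on the matrix alone and is passed on to the labels and the
bumped matrix, while old and new columns stay fixed. -/
theorem ColRel.fac_pos (h : ColRel N A C A' P Q) (g : ColRel N B D B' P' Q') {k : ℕ}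
    (hk : k + 1 < N) :
    matFac N k (fun k j => A j k) (fun k j => B j k) * Fac.ofProp (∀ j < N, C j = D j) =
      bitsFac N k Q Q' * Fac.ofProp (∀ j < N, P j = P' j) *
        matFac N k (fun k j => A' j k) (fun k j => B' j k) := by
  obtain ⟨c, y, h1, h2, h3⟩ := h
  obtain ⟨d, w, g1, g2, g3⟩ := g
  have key := h1.transpose.fac g1.transpose hk
  have e1 : (∀ j < N, c j N = d j N) ↔ ∀ j < N, C j = D j := by
    refine forall_congr' fun j => forall_congr' fun hj => ?_
    rw [(h2 j hj).1, (g2 j hj).1]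
  have e2 : (∀ j < N, c j 0 = d j 0) ↔ ∀ j < N, P j = P' j := by
    refine forall_congr' fun j => forall_congr' fun hj => ?_
    rw [(h2 j hj).2, (g2 j hj).2]
  rw [propext e1, propext e2,
    bitsFac_congr hk (fun r hr => (h3 r hr).1) (fun r hr => (g3 r hr).1),
    bitsFac_congr hk (fun r hr => (h3 r hr).2) (fun r hr => (g3 r hr).2), bitsFac_self_false,
    mul_one, Fac.ofProp_comm, ← Fac.ofProp_comm (∀ j < N, P j = P' j), ← mul_assoc] at key
  exact key

end compare

/-! ### The colour `0` -/

/-- The version of `row_eq_iff` for the part of a row from column `m` on. It is needed at colour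
`0`, where the corner vertex changes and the rest of its row does not. -/
theorem IsGrid.row_eq_iff_from {N : ℕ} {A A' B B' : ℕ → ℕ → ℕ} {c y d w : ℕ → ℕ → Bool}
    (h : IsGrid N A A' c y) (g : IsGrid N B B' d w) {r : ℕ} (hr : r < N) (m e : ℕ)
    (hm : m + e = N) :
    ((∀ j, m ≤ j → j < N → y (r + 1) j = w (r + 1) j ∧ A r j = B r j) ∧ c r N = d r N) ↔
    c r m = d r m ∧ ∀ j, m ≤ j → j < N → y r j = w r j ∧ A' r j = B' r j := by
  have key := prod_exchange (fun j => Fac.ofProp (y (r + 1) j = w (r + 1) j ∧ A r j = B r j))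
    (fun j => Fac.ofProp (y r j = w r j ∧ A' r j = B' r j)) (fun j => Fac.ofProp (c r j = d r j))
    e m (by
      intro j _ hj
      rw [Fac.ofProp_mul, Fac.ofProp_mul]
      congr 1
      apply propext
      have h1 := h r j hr (by omega)
      have g1 := g r j hr (by omega)
      constructor
      · rintro ⟨⟨e1, e2⟩, e3⟩
        rw [e1, e2, e3, g1] at h1
        simp only [Prod.mk.injEq] at h1
        obtain ⟨h1, h2, h3⟩ := h1
        exact ⟨h2.symm, h3.symm, h1.symm⟩
      · rintro ⟨e3, e1, e2⟩
        rw [← e1, ← e2, ← e3, ← h1] at g1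
        have := rule_injective g1
        simp only [Prod.mk.injEq] at this
        obtain ⟨h1, h2, h3⟩ := this
        exact ⟨⟨h3.symm, h1.symm⟩, h2.symm⟩)
  have key2 := congrArg Fac.E key
  rw [Fac.prod_ofProp, Fac.prod_ofProp, Fac.ofProp_mul, Fac.ofProp_mul] at key2
  simp only [Fac.ofProp_E, List.mem_range'_1, and_imp, hm] at key2
  exact key2.to_iff

/-- The factor of a matrix at the colour `0`; only its components `e`, `R` and `E` are
meaningful. -/
def cornerFac (N : ℕ) (A B : ℕ → ℕ → ℕ) : Fac where
  e := A 0 0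
  p := 1
  R := B 0 0 = A 0 0 + 1 ∧ ∀ k < N, ∀ j < N, (k ≠ 0 ∨ j ≠ 0) → A k j = B k j
  E := ∀ k < N, ∀ j < N, A k j = B k j
  pos _ := Nat.one_pos

/-- The factor of a column of negative bits `P` and positive bits `Q` at the colour `0`. -/
def zeroFac (N : ℕ) (P Q P' Q' : ℕ → Bool) : Fac where
  e := (P 0 && Q 0).toNat
  p := (!P 0 && !Q 0).toNat
  R := (P 0 = false ∧ Q 0 = false ∧ P' 0 = true ∧ Q' 0 = true) ∧
    ∀ k < N, k ≠ 0 → P k = P' k ∧ Q k = Q' k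
  E := ∀ k < N, P k = P' k ∧ Q k = Q' k
  pos := by rintro ⟨⟨h1, h2, -⟩, -⟩; simp [h1, h2]

theorem ColRel.fac_zero_e {N : ℕ} {A A' : ℕ → ℕ → ℕ} {C P Q P' Q' : ℕ → Bool} {B' : ℕ → ℕ → ℕ}
    (h : ColRel N A C A' P Q) (hN : 0 < N) :
    A 0 0 = (zeroFac N P Q P' Q' * cornerFac N A' B').e := by
  obtain ⟨c, y, h1, h2, h3⟩ := h
  have := (corner_fac (h1 0 0 hN hN) (h1 0 0 hN hN)).1
  rw [(h2 0 hN).2, (h3 0 hN).2] at this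
  exact this

/-- The corner vertex decides where `f` acts (`corner_fac`), and bijectivity of the other vertices
makes the remaining data agree. One direction suffices, since the operators only have to be followed
from the tableaux to the triples. -/
theorem ColRel.fac_zero_R {N : ℕ} {A A' B B' : ℕ → ℕ → ℕ} {C P Q D P' Q' : ℕ → Bool}
    (h : ColRel N A C A' P Q) (g : ColRel N B D B' P' Q') (hN : 0 < N)
    (hR : (zeroFac N P Q P' Q' * cornerFac N A' B').R) :
    (cornerFac N A B).R ∧ ∀ k < N, C k = D k := by
  obtain ⟨c, y, h1, h2, h3⟩ := h
  obtain ⟨d, w, g1, g2, g3⟩ := g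
  have key := (corner_fac (h1 0 0 hN hN) (g1 0 0 hN hN)).2
  rw [(h2 0 hN).2, (h3 0 hN).2, (g2 0 hN).2, (g3 0 hN).2] at key
  rw [Fac.mul_R] at hR
  obtain ⟨hc, hA, hP⟩ : ((A' 0 0 < (!P 0 && !Q 0).toNat ∧
      (P 0 = false ∧ Q 0 = false ∧ P' 0 = true ∧ Q' 0 = true) ∧ A' 0 0 = B' 0 0) ∨
      ((!P 0 && !Q 0).toNat ≤ A' 0 0 ∧ (P 0 = P' 0 ∧ Q 0 = Q' 0) ∧ B' 0 0 = A' 0 0 + 1)) ∧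
      (∀ k < N, ∀ j < N, (k ≠ 0 ∨ j ≠ 0) → A' k j = B' k j) ∧
      ∀ k < N, k ≠ 0 → P k = P' k ∧ Q k = Q' k := by
    rcases hR with ⟨r1, ⟨r2, r3⟩, r4⟩ | ⟨r1, r2, r3, r4⟩
    · exact ⟨Or.inl ⟨r1, r2, r4 0 hN 0 hN⟩, fun k hk j hj _ => r4 k hk j hj, r3⟩
    · exact ⟨Or.inr ⟨r1, r2 0 hN, r3⟩, r4, fun k hk _ => r2 k hk⟩
  obtain ⟨e1, e2, e3⟩ := key.2 hc
  -- Row `0` without its corner. Its incoming vertical bits, completed by `e3` at the corner, are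
  -- what the rows `1, …, N - 1` emit.
  have row := (h1.row_eq_iff_from g1 hN 1 (N - 1) (by omega)).2 ⟨e2, fun j hj hj' => ⟨by
    rw [(h3 j hj').2, (g3 j hj').2]; exact (hP j hj' (by omega)).2,
    hA 0 hN j hj' (Or.inr (by omega))⟩⟩
  have rows := (h1.rows_eq_iff g1 1 (N - 1) (by omega)).2 ⟨fun j hj => by
    rcases Nat.eq_zero_or_pos j with rfl | hj0
    · exact e3
    · exact (row.1 j hj0 hj).1, fun r hr hr' => ⟨fun j hj => hA r (by omega) j hj (Or.inl (by omega)),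
      by rw [(h2 r (by omega)).2, (g2 r (by omega)).2]; exact (hP r (by omega) (by omega)).1⟩⟩
  refine ⟨⟨e1, ?_⟩, ?_⟩
  · intro k hk j hj hkj
    rcases Nat.eq_zero_or_pos k with rfl | hk0
    · exact (row.1 j (by omega) hj).2
    · exact (rows.2 k hk0 (by omega)).1 j hj
  · intro k hk
    rw [← (h2 k hk).1, ← (g2 k hk).1]
    rcases Nat.eq_zero_or_pos k with rfl | hk0
    · exact row.2
    · exact (rows.2 k hk0 (by omega)).2

/-! ### Chains of columns -/

/-- The matrix `M 0` is inserted successively into the columns `C 0, …, C (n - 1)`. -/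
def Chain (N n : ℕ) (M : ℕ → ℕ → ℕ → ℕ) (C P Q : ℕ → ℕ → Bool) : Prop :=
  ∀ t < n, ColRel N (M t) (C t) (M (t + 1)) (P t) (Q t)

section chain

variable {N n : ℕ} {M M' : ℕ → ℕ → ℕ → ℕ} {C P Q D P' Q' : ℕ → ℕ → Bool}

theorem matFac_zero {N k : ℕ} {A B : ℕ → ℕ → ℕ} (hk : k + 1 < N)
    (hA : ∀ k < N, ∀ j < N, A k j = 0) (hB : ∀ k < N, ∀ j < N, B k j = 0) :
    matFac N k A B = 1 := by
  unfold matFac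
  have : ((List.range' 0 N).map fun j => pairFac (A k j) (A (k + 1) j) (B k j) (B (k + 1) j)) =
      (List.range' 0 N).map fun _ => (1 : Fac) := by
    refine List.map_congr_left fun j hj => ?_
    simp only [List.mem_range'_1] at hj
    rw [hA k (by omega) j (by omega), hA (k + 1) (by omega) j (by omega),
      hB k (by omega) j (by omega), hB (k + 1) (by omega) j (by omega)]
    apply Fac.ext' <;> simp [pairFac]
  rw [this, List.map_const', List.prod_replicate, one_pow, one_mul, ← Fac.ofProp_true]
  congr 1
  apply propext
  simp only [iff_true]
  intro r hr _ _ j hj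
  rw [hA r hr j hj, hB r hr j hj]

/-- The factor of the matrix is carried through all columns by `prod_exchange'`. It arrives as the
factor of the zero matrix, which is trivial. -/
theorem Chain.fac_neg (h : Chain N n M C P Q) (g : Chain N n M' D P' Q')
    (hM : ∀ k < N, ∀ j < N, M n k j = 0) (hM' : ∀ k < N, ∀ j < N, M' n k j = 0) {k : ℕ}
    (hk : k + 1 < N) :
    matFac N k (M 0) (M' 0) * ((List.range' 0 n).map fun t => bitsFac N k (C t) (D t)).prod =
      ((List.range' 0 n).map fun t => bitsFac N k (P t) (P' t) *
        Fac.ofProp (∀ j < N, Q t j = Q' t j)).prod := by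
  have := prod_exchange' (fun t => matFac N k (M t) (M' t)) (fun t => bitsFac N k (C t) (D t))
    (fun t => bitsFac N k (P t) (P' t) * Fac.ofProp (∀ j < N, Q t j = Q' t j)) n 0
    (fun t _ ht => (h t (by omega)).fac_neg (g t (by omega)) hk)
  rw [this, zero_add, matFac_zero hk hM hM', mul_one]

theorem Chain.fac_pos (h : Chain N n M C P Q) (g : Chain N n M' D P' Q')
    (hM : ∀ k < N, ∀ j < N, M n k j = 0) (hM' : ∀ k < N, ∀ j < N, M' n k j = 0) {k : ℕ}
    (hk : k + 1 < N) :
    matFac N k (fun k j => M 0 j k) (fun k j => M' 0 j k) *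
        Fac.ofProp (∀ t < n, ∀ j < N, C t j = D t j) =
      ((List.range' 0 n).map fun t => bitsFac N k (Q t) (Q' t) *
        Fac.ofProp (∀ j < N, P t j = P' t j)).prod := by
  have := prod_exchange' (fun t => matFac N k (fun k j => M t j k) (fun k j => M' t j k))
    (fun t => Fac.ofProp (∀ j < N, C t j = D t j))
    (fun t => bitsFac N k (Q t) (Q' t) * Fac.ofProp (∀ j < N, P t j = P' t j)) n 0
    (fun t _ ht => (h t (by omega)).fac_pos (g t (by omega)) hk)
  rw [zero_add, matFac_zero hk (fun k hk j hj => hM j hj k hk) (fun k hk j hj => hM' j hj k hk),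
    mul_one, Fac.prod_ofProp] at this
  simpa [List.mem_range'_1] using this

theorem Chain.fac_zero_e (hN : 0 < N) (h : Chain N n M C P Q) (d : ℕ) : ∀ t, t + d = n →
    M t 0 0 = (((List.range' t d).map fun t => zeroFac N (P t) (Q t) (P' t) (Q' t)).prod *
      cornerFac N (M n) (M' n)).e := by
  induction d with
  | zero => intro t ht; simp [show t = n by omega, cornerFac]
  | succ d ih =>
    intro t ht
    rw [(h t (by omega)).fac_zero_e (P' := P' t) (Q' := Q' t) (B' := M' (t + 1)) hN,
      List.range'_succ, List.map_cons, List.prod_cons, mul_assoc, Fac.mul_e, Fac.mul_e,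
      ← ih (t + 1) (by omega)]
    rfl

theorem Chain.fac_zero_R (hN : 0 < N) (h : Chain N n M C P Q) (g : Chain N n M' D P' Q')
    (hR : (((List.range' 0 n).map fun t => zeroFac N (P t) (Q t) (P' t) (Q' t)).prod *
      cornerFac N (M n) (M' n)).R) :
    (cornerFac N (M 0) (M' 0)).R ∧ ∀ t < n, ∀ k < N, C t k = D t k := by
  -- The equality component is part of the induction: if `f` acts on column `t`, then all that is
  -- known about the later columns is that they agree.
  suffices H : ∀ d t, t + d = n →
      ((((List.range' t d).map fun t => zeroFac N (P t) (Q t) (P' t) (Q' t)).prod *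
        cornerFac N (M n) (M' n)).R → (cornerFac N (M t) (M' t)).R ∧
          ∀ s, t ≤ s → s < n → ∀ k < N, C s k = D s k) ∧
      ((((List.range' t d).map fun t => zeroFac N (P t) (Q t) (P' t) (Q' t)).prod *
        cornerFac N (M n) (M' n)).E → (cornerFac N (M t) (M' t)).E ∧
          ∀ s, t ≤ s → s < n → ∀ k < N, C s k = D s k) by
    obtain ⟨h1, h2⟩ := (H n 0 (by omega)).1 hR
    exact ⟨h1, fun t ht => h2 t (Nat.zero_le _) ht⟩
  intro d
  induction d with
  | zero =>
    intro t ht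
    obtain rfl : t = n := by omega
    simp only [List.range'_zero, List.map_nil, List.prod_nil, one_mul]
    exact ⟨fun h => ⟨h, fun s h1 h2 => by omega⟩, fun h => ⟨h, fun s h1 h2 => by omega⟩⟩
  | succ d ih =>
    intro t ht
    obtain ⟨ih1, ih2⟩ := ih (t + 1) (by omega)
    have he := h.fac_zero_e (M' := M') (P' := P') (Q' := Q') hN d (t + 1) (by omega)
    have hs : ∀ s, t ≤ s → s = t ∨ t + 1 ≤ s := by omega
    rw [List.range'_succ, List.map_cons, List.prod_cons, mul_assoc]
    constructor
    · intro hR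
      have hl := (h t (by omega)).fac_zero_R (g t (by omega)) hN
      rw [Fac.mul_R] at hR hl
      rw [← he] at hR
      rcases hR with ⟨r1, r2, r3⟩ | ⟨r1, r2, r3⟩
      · obtain ⟨q1, q2⟩ := ih2 r3
        obtain ⟨q3, q4⟩ := hl (Or.inl ⟨r1, r2, q1⟩)
        refine ⟨q3, fun s h1 h2 => ?_⟩
        rcases hs s h1 with rfl | h3
        · exact q4
        · exact q2 s h3 h2
      · obtain ⟨q1, q2⟩ := ih1 r3
        obtain ⟨q3, q4⟩ := hl (Or.inr ⟨r1, r2, q1⟩)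
        refine ⟨q3, fun s h1 h2 => ?_⟩
        rcases hs s h1 with rfl | h3
        · exact q4
        · exact q2 s h3 h2
    · rintro ⟨r1, r2⟩
      obtain ⟨q1, q2⟩ := ih2 r2
      obtain ⟨q3, q4⟩ := ((h t (by omega)).eq_iff (g t (by omega))).2
        ⟨q1, fun k hk => (r1 k hk).1, fun k hk => (r1 k hk).2⟩
      refine ⟨q3, fun s h1 h2 => ?_⟩
      rcases hs s h1 with rfl | h3
      · exact q4
      · exact q2 s h3 h2

end chain

end

end GlInf

namespace GlInf

noncomputable section

/-! ## Pairs of neighbouring columns -/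

/-- The step of a pair of bits. -/
def sgn (b1 b2 : Bool) : Fac := ⟨(!b1 && b2).toNat, (b1 && !b2).toNat, False, True, False.elim⟩

theorem sgn_self (b : Bool) : sgn b b = 1 := by
  apply Fac.ext' <;> cases b <;> simp [sgn]

/-- Only `e` and `p` matter here: `Fac` serves as a monoid of walks, a product remembering how far
the walk sinks below its start and how far it ends above its lowest point. A vertex of the first
grid and the vertex at the same place of the second one interchange a step along the labels with a
step along the letters. -/
theorem sgn_exchange {a a1 a2 : ℕ} {c1 c2 y1 y2 c1' c2' y1' y2' : Bool}
    (h1 : rule (a, c1, y1) = (a1, c1', y1')) (h2 : rule (a1, c2, y2) = (a2, c2', y2')) :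
    sgn y2 y1 * sgn c1 c2 = sgn c1' c2' * sgn y2' y1' := by
  apply Fac.ext'
  · cases a <;> cases c1 <;> cases y1 <;> simp only [rule, Prod.mk.injEq] at h1 <;>
    obtain ⟨rfl, rfl, rfl⟩ := h1 <;>
    cases c2 <;> cases y2 <;> first
      | (simp only [rule, Prod.mk.injEq] at h2; obtain ⟨rfl, rfl, rfl⟩ := h2
         simp [sgn, Fac.mul_e])
      | (rename_i a; cases a <;> simp only [rule, Prod.mk.injEq] at h2 <;>
         obtain ⟨rfl, rfl, rfl⟩ := h2 <;> simp [sgn, Fac.mul_e])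
  · cases a <;> cases c1 <;> cases y1 <;> simp only [rule, Prod.mk.injEq] at h1 <;>
    obtain ⟨rfl, rfl, rfl⟩ := h1 <;>
    cases c2 <;> cases y2 <;> first
      | (simp only [rule, Prod.mk.injEq] at h2; obtain ⟨rfl, rfl, rfl⟩ := h2
         simp [sgn, Fac.mul_p])
      | (rename_i a; cases a <;> simp only [rule, Prod.mk.injEq] at h2 <;>
         obtain ⟨rfl, rfl, rfl⟩ := h2 <;> simp [sgn, Fac.mul_p])
  · simp [Fac.mul_R, sgn]
  · simp [Fac.mul_E, sgn]

/-- The path of a pair of columns, read from the index `N - 1` down to `0`. -/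
def downPath (N : ℕ) (C1 C2 : ℕ → Bool) : Fac :=
  ((List.range' 0 N).map fun t => sgn (C1 (N - 1 - t)) (C2 (N - 1 - t))).prod

/-- The path of a pair of recording columns. -/
def upPath (N : ℕ) (Q1 Q2 : ℕ → Bool) : Fac :=
  ((List.range' 0 N).map fun j => sgn (Q2 j) (Q1 j)).prod

/-- Crossing all vertices turns "labels, then letters" at the incoming edges into "letters, then
labels" at the outgoing ones. The row `N - 1` is crossed before the others, which is why `downPath`
runs downwards. -/
theorem IsGrid.path_eq {N : ℕ} {A A1 A2 : ℕ → ℕ → ℕ} {c1 c2 y1 y2 : ℕ → ℕ → Bool}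
    (h1 : IsGrid N A A1 c1 y1) (h2 : IsGrid N A1 A2 c2 y2) :
    upPath N (y1 N) (y2 N) * downPath N (fun k => c1 k N) (fun k => c2 k N) =
    downPath N (fun k => c1 k 0) (fun k => c2 k 0) * upPath N (y1 0) (y2 0) := by
  have row : ∀ r < N, upPath N (y1 (r + 1)) (y2 (r + 1)) * sgn (c1 r N) (c2 r N) =
      sgn (c1 r 0) (c2 r 0) * upPath N (y1 r) (y2 r) := by
    intro r hr
    have := prod_exchange (fun j => sgn (y2 (r + 1) j) (y1 (r + 1) j))
      (fun j => sgn (y2 r j) (y1 r j)) (fun j => sgn (c1 r j) (c2 r j)) N 0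
      (fun j _ hj => sgn_exchange (h1 r j hr (by omega)) (h2 r j hr (by omega)))
    rw [zero_add] at this
    exact this
  have := prod_exchange' (fun t => upPath N (y1 (N - t)) (y2 (N - t)))
    (fun t => sgn (c1 (N - 1 - t) N) (c2 (N - 1 - t) N))
    (fun t => sgn (c1 (N - 1 - t) 0) (c2 (N - 1 - t) 0)) N 0 (by
      intro t _ ht
      have := row (N - 1 - t) (by omega)
      rw [show N - 1 - t + 1 = N - t by omega] at this
      rw [this, show N - (t + 1) = N - 1 - t by omega])
  simp only [zero_add, Nat.sub_zero, Nat.sub_self] at this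
  exact this

/-- The component `e` measures how far a walk sinks below its start, so given `x.e = 0` it vanishes
if and only if no partial sum from height `x.p` is negative. The hypothesis `hf` excludes steps that
sink and rise at once. The difference `p - e` is additive and is carried through the induction. -/
theorem path_e_eq_zero_iff (x : Fac) (f : ℕ → Fac) (hf : ∀ t, (f t).e = 0 ∨ (f t).p = 0) (d : ℕ) :
    (x * ((List.range' 0 d).map f).prod).e = 0 ↔ x.e = 0 ∧ ∀ m ≤ d,
      (0 : ℤ) ≤ (x.p : ℤ) + ∑ t ∈ Finset.range m, (((f t).p : ℤ) - (f t).e) := by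
  suffices H : ((x * ((List.range' 0 d).map f).prod).e = 0 ↔ x.e = 0 ∧ ∀ m ≤ d,
      (0 : ℤ) ≤ (x.p : ℤ) + ∑ t ∈ Finset.range m, (((f t).p : ℤ) - (f t).e)) ∧
      ((x * ((List.range' 0 d).map f).prod).p : ℤ) - (x * ((List.range' 0 d).map f).prod).e =
      (x.p : ℤ) - x.e + ∑ t ∈ Finset.range d, (((f t).p : ℤ) - (f t).e) from H.1
  induction d with
  | zero =>
    simp
  | succ d ih =>
    obtain ⟨ih1, ih2⟩ := ih
    rw [List.range'_concat, List.map_append, List.prod_append, ← mul_assoc]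
    simp only [one_mul, zero_add, List.map_cons, List.map_nil, List.prod_cons, List.prod_nil,
      mul_one]
    generalize x * ((List.range' 0 d).map f).prod = z at ih1 ih2 ⊢
    rw [Fac.mul_e, Fac.mul_p, Finset.sum_range_succ]
    constructor
    · have hd := hf d
      constructor
      · intro h
        have hz : z.e = 0 := by omega
        obtain ⟨h1, h2⟩ := ih1.1 hz
        refine ⟨h1, fun m hm => ?_⟩
        rcases Nat.lt_or_ge m (d + 1) with h3 | h3
        · exact h2 m (by omega)
        · obtain rfl : m = d + 1 := by omega
          rw [Finset.sum_range_succ]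
          omega
      · rintro ⟨h1, h2⟩
        have hz := ih1.2 ⟨h1, fun m hm => h2 m (by omega)⟩
        have := h2 (d + 1) le_rfl
        rw [Finset.sum_range_succ] at this
        omega
    · omega

theorem sgn_step (b1 b2 : Bool) : (sgn b1 b2).e = 0 ∨ (sgn b1 b2).p = 0 := by
  cases b1 <;> cases b2 <;> simp [sgn]

theorem sgn_val (b1 b2 : Bool) : ((sgn b1 b2).p : ℤ) - (sgn b1 b2).e = (b1.toNat : ℤ) - b2.toNat := by
  cases b1 <;> cases b2 <;> simp [sgn]

/-- The number of set bits with index at least `k` (and less than `N`). -/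
def countGe (N : ℕ) (C : ℕ → Bool) (k : ℕ) : ℕ := ∑ i ∈ Finset.Ico k N, (C i).toNat

/-- The number of set bits with index less than `k`. -/
def countLt (C : ℕ → Bool) (k : ℕ) : ℕ := ∑ i ∈ Finset.range k, (C i).toNat

theorem sum_downPath (N : ℕ) (C1 C2 : ℕ → Bool) (m : ℕ) (hm : m ≤ N) :
    ∑ t ∈ Finset.range m, (((sgn (C1 (N - 1 - t)) (C2 (N - 1 - t))).p : ℤ) -
      (sgn (C1 (N - 1 - t)) (C2 (N - 1 - t))).e) =
    (countGe N C1 (N - m) : ℤ) - countGe N C2 (N - m) := by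
  induction m with
  | zero => simp [countGe]
  | succ m ih =>
    have e : ∀ C : ℕ → Bool, countGe N C (N - (m + 1)) =
        (C (N - 1 - m)).toNat + countGe N C (N - m) := by
      intro C
      unfold countGe
      rw [Finset.sum_eq_sum_Ico_succ_bot (by omega), show N - (m + 1) + 1 = N - m by omega,
        show N - (m + 1) = N - 1 - m by omega]
    rw [Finset.sum_range_succ, ih (by omega), e, e, sgn_val]
    push_cast
    ring

theorem sum_upPath (Q1 Q2 : ℕ → Bool) (m : ℕ) :
    ∑ t ∈ Finset.range m, (((sgn (Q2 t) (Q1 t)).p : ℤ) - (sgn (Q2 t) (Q1 t)).e) =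
    (countLt Q2 m : ℤ) - countLt Q1 m := by
  simp only [sgn_val, countLt, Finset.sum_sub_distrib]
  push_cast
  rfl

/-- The columns `C1` (right) and `C2` (left), aligned at the bottom, are weakly increasing along
rows. -/
def ColLe (N : ℕ) (C2 C1 : ℕ → Bool) : Prop := ∀ k ≤ N, countGe N C2 k ≤ countGe N C1 k

/-- The condition on neighbouring columns of a pair of an insertion and a recording tableau. -/
def PairLe (N : ℕ) (P2 Q2 P1 Q1 : ℕ → Bool) : Prop :=
  ColLe N P2 P1 ∧ ∀ a ≤ N, countGe N P2 0 + countLt Q1 a ≤ countGe N P1 0 + countLt Q2 a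

theorem downPath_e_iff (N : ℕ) (C1 C2 : ℕ → Bool) :
    (downPath N C1 C2).e = 0 ↔ ColLe N C2 C1 := by
  have := path_e_eq_zero_iff 1 (fun t => sgn (C1 (N - 1 - t)) (C2 (N - 1 - t)))
    (fun t => sgn_step _ _) N
  rw [one_mul] at this
  rw [downPath, this]
  simp only [Fac.one_e, true_and, Fac.one_p, Nat.cast_zero, zero_add]
  constructor
  · intro h k hk
    have := h (N - k) (by omega)
    rw [sum_downPath _ _ _ _ (by omega), show N - (N - k) = k by omega] at this
    omega
  · intro h m hm
    rw [sum_downPath _ _ _ _ hm]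
    have := h (N - m) (by omega)
    omega

theorem downPath_p (N : ℕ) (C1 C2 : ℕ → Bool) (h : (downPath N C1 C2).e = 0) :
    ((downPath N C1 C2).p : ℤ) = (countGe N C1 0 : ℤ) - countGe N C2 0 := by
  suffices H : ∀ (f : ℕ → Fac) (d : ℕ), ((((List.range' 0 d).map f).prod).p : ℤ) -
      (((List.range' 0 d).map f).prod).e = ∑ t ∈ Finset.range d, (((f t).p : ℤ) - (f t).e) by
    have h1 := H (fun t => sgn (C1 (N - 1 - t)) (C2 (N - 1 - t))) N
    have h2 := sum_downPath N C1 C2 N le_rfl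
    rw [Nat.sub_self] at h2
    rw [← h2, ← h1]
    unfold downPath at h ⊢
    rw [h]
    simp
  intro f d
  induction d with
  | zero => simp
  | succ d ih =>
    rw [List.range'_concat, List.map_append, List.prod_append, Finset.sum_range_succ, ← ih]
    simp only [one_mul, zero_add, List.map_cons, List.map_nil, List.prod_cons, List.prod_nil,
      mul_one, Fac.mul_e, Fac.mul_p]
    omega

/-- The walk along the letters ends at the difference of the lengths of the two columns, and the
walk along the labels continues from there. This explains the offset in `PairLe`. -/
theorem path_e_iff (N : ℕ) (P1 P2 Q1 Q2 : ℕ → Bool) :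
    (downPath N P1 P2 * upPath N Q1 Q2).e = 0 ↔ PairLe N P2 Q2 P1 Q1 := by
  rw [upPath, path_e_eq_zero_iff _ _ (fun t => sgn_step _ _), downPath_e_iff, PairLe]
  refine and_congr_right fun h => ?_
  have hp := downPath_p N P1 P2 ((downPath_e_iff N P1 P2).2 h)
  refine forall_congr' fun m => forall_congr' fun hm => ?_
  rw [sum_upPath, hp]
  omega

theorem upPath_false (N : ℕ) (Q1 Q2 : ℕ → Bool) (h1 : ∀ j < N, Q1 j = false)
    (h2 : ∀ j < N, Q2 j = false) : upPath N Q1 Q2 = 1 := by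
  unfold upPath
  have : ((List.range' 0 N).map fun j => sgn (Q2 j) (Q1 j)) =
      (List.range' 0 N).map fun _ => (1 : Fac) := by
    refine List.map_congr_left fun j hj => ?_
    simp only [List.mem_range'_1] at hj
    rw [h1 j (by omega), h2 j (by omega), sgn_self]
  rw [this, List.map_const', List.prod_replicate, one_pow]

theorem downPath_congr {N : ℕ} {C1 C2 D1 D2 : ℕ → Bool} (h1 : ∀ k < N, C1 k = D1 k)
    (h2 : ∀ k < N, C2 k = D2 k) : downPath N C1 C2 = downPath N D1 D2 := by
  unfold downPath
  congr 1
  refine List.map_congr_left fun j hj => ?_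
  simp only [List.mem_range'_1] at hj
  rw [h1 _ (by omega), h2 _ (by omega)]

theorem upPath_congr {N : ℕ} {C1 C2 D1 D2 : ℕ → Bool} (h1 : ∀ k < N, C1 k = D1 k)
    (h2 : ∀ k < N, C2 k = D2 k) : upPath N C1 C2 = upPath N D1 D2 := by
  unfold upPath
  congr 1
  refine List.map_congr_left fun j hj => ?_
  simp only [List.mem_range'_1] at hj
  rw [h1 _ (by omega), h2 _ (by omega)]

/-- Two neighbouring columns form a semistandard tableau if and only if the results of the
insertion do. -/
theorem ColRel.colLe_iff {N : ℕ} {A A1 A2 : ℕ → ℕ → ℕ} {C1 C2 P1 P2 Q1 Q2 : ℕ → Bool}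
    (h1 : ColRel N A C1 A1 P1 Q1) (h2 : ColRel N A1 C2 A2 P2 Q2) :
    ColLe N C2 C1 ↔ PairLe N P2 Q2 P1 Q1 := by
  obtain ⟨c1, y1, g1, e1, f1⟩ := h1
  obtain ⟨c2, y2, g2, e2, f2⟩ := h2
  have := g1.path_eq g2
  rw [upPath_false N _ _ (fun j hj => (f1 j hj).1) (fun j hj => (f2 j hj).1), one_mul,
    downPath_congr (fun k hk => (e1 k hk).1) (fun k hk => (e2 k hk).1),
    downPath_congr (fun k hk => (e1 k hk).2) (fun k hk => (e2 k hk).2),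
    upPath_congr (fun k hk => (f1 k hk).2) (fun k hk => (f2 k hk).2)] at this
  rw [← downPath_e_iff, this, path_e_iff]

/-- The insertion of a matrix into a column can be inverted if the result fits to the next
column. -/
theorem ColRel.exists_in {N : ℕ} {A1 A2 : ℕ → ℕ → ℕ} {C2 P1 P2 Q1 Q2 : ℕ → Bool}
    (h2 : ColRel N A1 C2 A2 P2 Q2) (h : PairLe N P2 Q2 P1 Q1) :
    ∃ A C1, ColRel N A C1 A1 P1 Q1 := by
  obtain ⟨c2, y2, g2, e2, f2⟩ := h2
  obtain ⟨A, c1, y1, g1, e1, f1⟩ := exists_grid_of_out A1 P1 Q1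
  refine ⟨A, fun k => c1 k N, c1, y1, g1 N, fun k _ => ⟨rfl, e1 k⟩, fun j hj => ⟨?_, f1 j⟩⟩
  have := (g1 N).path_eq g2
  rw [downPath_congr (fun k hk => e1 k) (fun k hk => (e2 k hk).2),
    upPath_congr (fun k hk => f1 k) (fun k hk => (f2 k hk).2)] at this
  have h0 := (path_e_iff N P1 P2 Q1 Q2).2 h
  rw [← this, Fac.mul_e] at h0
  -- The outgoing walk does not sink, so neither does the initial segment of the incoming walk,
  -- which runs along the incoming vertical bits. Those of the second grid vanish, hence this
  -- segment has only downward steps, and those of the first grid vanish as well.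
  have h3 : (upPath N (y1 N) (y2 N)).e = 0 := by omega
  have h4 := path_e_eq_zero_iff 1 (fun j => sgn (y2 N j) (y1 N j)) (fun t => sgn_step _ _) N
  rw [one_mul] at h4
  have h5 := (h4.1 h3).2 (j + 1) hj
  rw [sum_upPath] at h5
  have h6 : countLt (y2 N) (j + 1) = 0 := by
    unfold countLt
    refine Finset.sum_eq_zero fun i hi => ?_
    rw [(f2 i (by simp at hi; omega)).1]
    rfl
  rw [h6] at h5
  simp only [Fac.one_p, Nat.cast_zero, zero_add, zero_sub, Left.nonneg_neg_iff] at h5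
  have h7 : countLt (y1 N) (j + 1) = 0 := by omega
  unfold countLt at h7
  rw [Finset.sum_eq_zero_iff] at h7
  have := h7 j (by simp)
  cases hh : y1 N j
  · rfl
  · rw [hh] at this; simp at this

/-- The insertion is undone from the last column to the first. The additional column `n`, empty and
without labels, supplies the neighbour of the last genuine column and the zero matrix to start from.
-/
theorem Chain.exists_of_pairLe {N n : ℕ} {P Q : ℕ → ℕ → Bool} (hP : ∀ k < N, P n k = false)
    (hQ : ∀ j < N, Q n j = false)
    (h : ∀ t < n, PairLe N (P (t + 1)) (Q (t + 1)) (P t) (Q t)) :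
    ∃ M C, Chain N n M C P Q ∧ ∀ k j, M n k j = 0 := by
  suffices H : ∀ d ≤ n, ∃ (M : ℕ → ℕ → ℕ → ℕ) (C : ℕ → ℕ → Bool), (∀ t, n - d ≤ t → t ≤ n →
      ColRel N (M t) (C t) (M (t + 1)) (P t) (Q t)) ∧ ∀ k j, M n k j = 0 by
    obtain ⟨M, C, h1, h2⟩ := H n le_rfl
    exact ⟨M, C, fun t ht => h1 t (by omega) ht.le, h2⟩
  intro d
  induction d with
  | zero =>
    intro _
    refine ⟨fun _ _ _ => 0, fun _ _ => false, fun t h1 h2 => ?_, fun _ _ => rfl⟩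
    obtain rfl : t = n := by omega
    exact ⟨fun _ _ => false, fun _ _ => false, fun _ _ _ _ => rfl,
      fun k hk => ⟨rfl, (hP k hk).symm⟩, fun k hk => ⟨rfl, (hQ k hk).symm⟩⟩
  | succ d ih =>
    intro hd
    obtain ⟨M, C, h1, h2⟩ := ih (by omega)
    have h3 := h (n - (d + 1)) (by omega)
    rw [show n - (d + 1) + 1 = n - d by omega] at h3
    obtain ⟨A, C1, h4⟩ := (h1 (n - d) le_rfl (by omega)).exists_in h3
    refine ⟨Function.update M (n - (d + 1)) A, Function.update C (n - (d + 1)) C1, ?_, ?_⟩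
    · intro t ht ht'
      rw [Function.update_of_ne (a := t + 1) (by omega)]
      rcases Nat.eq_or_lt_of_le ht with rfl | h5
      · rw [Function.update_self, Function.update_self, show n - (d + 1) + 1 = n - d by omega]
        exact h4
      · rw [Function.update_of_ne (by omega), Function.update_of_ne (by omega)]
        exact h1 t (by omega) ht'
    · intro k j
      rw [Function.update_of_ne (by omega)]
      exact h2 k j

theorem Chain.eq_of_out {N n : ℕ} {M M' : ℕ → ℕ → ℕ → ℕ} {C P Q D P' Q' : ℕ → ℕ → Bool}
    (h : Chain N n M C P Q) (g : Chain N n M' D P' Q')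
    (hM : ∀ k < N, ∀ j < N, M n k j = M' n k j)
    (hP : ∀ t < n, ∀ k < N, P t k = P' t k) (hQ : ∀ t < n, ∀ k < N, Q t k = Q' t k) :
    (∀ k < N, ∀ j < N, M 0 k j = M' 0 k j) ∧ ∀ t < n, ∀ k < N, C t k = D t k := by
  suffices H : ∀ d t, t + d = n → (∀ k < N, ∀ j < N, M t k j = M' t k j) ∧
      ∀ s, t ≤ s → s < n → ∀ k < N, C s k = D s k by
    obtain ⟨h1, h2⟩ := H n 0 (by omega)
    exact ⟨h1, fun t ht => h2 t (Nat.zero_le _) ht⟩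
  intro d
  induction d with
  | zero => rintro t rfl; exact ⟨hM, fun s h1 h2 => by omega⟩
  | succ d ih =>
    intro t ht
    obtain ⟨h1, h2⟩ := ih (t + 1) (by omega)
    obtain ⟨h3, h4⟩ := ((h t (by omega)).eq_iff (g t (by omega))).2
      ⟨h1, hP t (by omega), hQ t (by omega)⟩
    refine ⟨h3, fun s hs hs' => ?_⟩
    rcases Nat.eq_or_lt_of_le hs with rfl | h5
    · exact h4
    · exact h2 s h5 hs'

theorem Chain.eq_of_in {N n : ℕ} {M M' : ℕ → ℕ → ℕ → ℕ} {C P Q D P' Q' : ℕ → ℕ → Bool}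
    (h : Chain N n M C P Q) (g : Chain N n M' D P' Q')
    (hM : ∀ k < N, ∀ j < N, M 0 k j = M' 0 k j)
    (hC : ∀ t < n, ∀ k < N, C t k = D t k) (t : ℕ) (ht : t ≤ n) :
    (∀ k < N, ∀ j < N, M t k j = M' t k j) ∧
      ∀ s < t, (∀ k < N, P s k = P' s k) ∧ ∀ k < N, Q s k = Q' s k := by
  induction t with
  | zero => exact ⟨hM, fun s hs => by omega⟩
  | succ t ih =>
    obtain ⟨h1, h2⟩ := ih (by omega)
    obtain ⟨h3, h4⟩ := ((h t (by omega)).eq_iff (g t (by omega))).1 ⟨h1, hC t (by omega)⟩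
    refine ⟨h3, fun s hs => ?_⟩
    rcases Nat.lt_or_ge s t with h5 | h5
    · exact h2 s h5
    · obtain rfl : s = t := by omega
      exact h4

/-! ### Weights -/

theorem IsGrid.row_sum {N : ℕ} {A A' : ℕ → ℕ → ℕ} {c y : ℕ → ℕ → Bool}
    (h : IsGrid N A A' c y) {k : ℕ} (hk : k < N) :
    ∑ j ∈ Finset.range N, A k j + (c k N).toNat = ∑ j ∈ Finset.range N, A' k j + (c k 0).toNat := by
  suffices H : ∀ m ≤ N, ∑ j ∈ Finset.range m, A k j + (c k m).toNat =
      ∑ j ∈ Finset.range m, A' k j + (c k 0).toNat from H N le_rfl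
  intro m
  induction m with
  | zero => simp
  | succ m ih =>
    intro hm
    have h1 := ih (by omega)
    have h2 := rule_conserve (h k m hk (by omega))
    rw [Finset.sum_range_succ, Finset.sum_range_succ]
    omega

theorem ColRel.row_sum {N : ℕ} {A A' : ℕ → ℕ → ℕ} {C P Q : ℕ → Bool} (h : ColRel N A C A' P Q)
    {k : ℕ} (hk : k < N) :
    ∑ j ∈ Finset.range N, A k j + (C k).toNat = ∑ j ∈ Finset.range N, A' k j + (P k).toNat := by
  obtain ⟨c, y, h1, h2, h3⟩ := h
  rw [← (h2 k hk).1, ← (h2 k hk).2]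
  exact h1.row_sum hk

theorem ColRel.col_sum {N : ℕ} {A A' : ℕ → ℕ → ℕ} {C P Q : ℕ → Bool} (h : ColRel N A C A' P Q)
    {j : ℕ} (hj : j < N) :
    ∑ k ∈ Finset.range N, A k j = ∑ k ∈ Finset.range N, A' k j + (Q j).toNat := by
  obtain ⟨c, y, h1, h2, h3⟩ := h
  have := h1.transpose.row_sum hj
  simp only [(h3 j hj).1, (h3 j hj).2] at this
  simpa using this

end

end GlInf

namespace GlInf

noncomputable section

/-! ## The insertion algorithm -/

/-- An extra vertical bit that meets a letter of the column is absorbed: the letter disappears and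
the bumped entry grows. If the extra unit sits in the entry itself, the letter stays, which is the
case of a letter bumping an equal one. -/
theorem rule_bump {a a' : ℕ} {c y : Bool} (h : rule (a, c, false) = (a', true, y)) :
    rule (a, c, true) = (a' + 1, false, y) ∧ rule (a + 1, c, false) = (a' + 1, true, y) := by
  cases a <;> cases c <;> simp only [rule, Prod.mk.injEq] at h <;> simp_all [rule]

/-- Where the column has no letter, an extra vertical bit runs on to the next smaller letter; an
extra unit in the entry creates the letter and emits such a bit. -/
theorem rule_pass {a a' : ℕ} {c : Bool} (h : rule (a, c, false) = (a', false, false)) :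
    rule (a, c, true) = (a', false, true) ∧ rule (a + 1, c, false) = (a', true, true) := by
  cases a <;> cases c <;> simp only [rule, Prod.mk.injEq] at h <;> simp_all [rule]

theorem rule_bump_zero {a a' : ℕ} {c y : Bool} (h : rule (a, c, false) = (a', false, y)) :
    y = false := by
  cases a <;> cases c <;> simp only [rule, Prod.mk.injEq] at h <;> simp_all

/-- The effect on a configuration of inserting one more letter `i` with label `j`, where `lo - 1` is
the letter which is bumped (`lo = 0` if there is none). -/
theorem IsGrid.addLetter {N : ℕ} {A A' : ℕ → ℕ → ℕ} {c y : ℕ → ℕ → Bool} (h : IsGrid N A A' c y)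
    (hY : ∀ j < N, y N j = false) {i j lo : ℕ} (hi : i < N) (hj : j < N)
    (hA : ∀ k < N, ∀ j' < N, (j' < j ∨ (j' = j ∧ i < k)) → A k j' = 0) (hlo : lo ≤ i + 1)
    (hc : ∀ k, lo ≤ k → k ≤ i → c k 0 = false) (hc' : ∀ k, k + 1 = lo → c k 0 = true) :
    ∃ c2 y2, IsGrid N (fun k j' => A k j' + if k = i ∧ j' = j then 1 else 0)
      (fun k j' => A' k j' + if k + 1 = lo ∧ j' = j then 1 else 0) c2 y2 ∧
      (∀ j < N, y2 N j = false) ∧ (∀ k < N, c2 k N = c k N) ∧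
      (∀ k, c2 k 0 = if k = i then true else if k + 1 = lo then false else c k 0) ∧
      (∀ j', y2 0 j' = if lo = 0 ∧ j' = j then true else y 0 j') ∧
      (lo = 0 → y 0 j = false) := by
  -- By `hA` there are no entries at labels smaller than `j`, nor at the label `j` in rows beyond
  -- `i`. No vertical bits arise there, and at the smaller labels the horizontal bits run through
  -- unchanged.
  have H1 : ∀ e ≤ N, ∀ j' < j, y (N - e) j' = false := by
    intro e
    induction e with
    | zero => intro _ j' hj'; exact hY j' (by omega)
    | succ e ih =>
      intro he j' hj'
      have h1 := h (N - (e + 1)) j' (by omega) (by omega)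
      rw [hA _ (by omega) _ (by omega) (Or.inl hj'), show N - (e + 1) + 1 = N - e by omega,
        ih (by omega) j' hj'] at h1
      cases hcc : c (N - (e + 1)) (j' + 1) <;> rw [hcc] at h1 <;>
        simp only [rule, Prod.mk.injEq] at h1 <;> exact h1.2.2.symm
  have H1' : ∀ k ≤ N, ∀ j' < j, y k j' = false := by
    intro k hk j' hj'
    have := H1 (N - k) (by omega) j' hj'
    rwa [show N - (N - k) = k by omega] at this
  have H2 : ∀ k < N, ∀ j' < j, A' k j' = 0 ∧ c k j' = c k (j' + 1) := by
    intro k hk j' hj'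
    have h1 := h k j' hk (by omega)
    rw [hA _ hk _ (by omega) (Or.inl hj'), H1' _ hk j' hj'] at h1
    cases hcc : c k (j' + 1) <;> rw [hcc] at h1 <;>
      simp only [rule, Prod.mk.injEq] at h1 <;> exact ⟨h1.1.symm, h1.2.1.symm⟩
  have H3 : ∀ k < N, ∀ j' ≤ j, c k j' = c k 0 := by
    intro k hk j'
    induction j' with
    | zero => intro _; rfl
    | succ j' ih => intro hj'; rw [← (H2 k hk j' (by omega)).2, ih (by omega)]
  have H4 : ∀ e, e + i + 1 ≤ N → y (N - e) j = false := by
    intro e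
    induction e with
    | zero => intro _; exact hY j hj
    | succ e ih =>
      intro he
      have h1 := h (N - (e + 1)) j (by omega) hj
      rw [hA _ (by omega) _ hj (Or.inr ⟨rfl, by omega⟩), show N - (e + 1) + 1 = N - e by omega,
        ih (by omega)] at h1
      cases hcc : c (N - (e + 1)) (j + 1) <;> rw [hcc] at h1 <;>
        simp only [rule, Prod.mk.injEq] at h1 <;> exact h1.2.2.symm
  have H4' : y (i + 1) j = false := by
    have := H4 (N - (i + 1)) (by omega)
    rwa [show N - (N - (i + 1)) = i + 1 by omega] at this
  -- From `lo` up to `i` the column contains no letter, and a vertex with outgoing horizontal bit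
  -- zero and no incoming vertical bit emits no vertical bit either.
  have H5 : ∀ e, e ≤ i + 1 → lo ≤ i + 1 - e → y (i + 1 - e) j = false := by
    intro e
    induction e with
    | zero => intro _ _; exact H4'
    | succ e ih =>
      intro he he'
      have h1 := h (i + 1 - (e + 1)) j (by omega) hj
      have h2 := H3 (i + 1 - (e + 1)) (by omega) j le_rfl
      rw [show i + 1 - (e + 1) + 1 = i + 1 - e by omega, ih (by omega) (by omega), h2,
        hc _ he' (by omega)] at h1
      exact rule_bump_zero h1
  have H5' : ∀ k, lo ≤ k → k ≤ i + 1 → y k j = false := by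
    intro k h1 h2
    have := H5 (i + 1 - k) (by omega) (by omega)
    rwa [show i + 1 - (i + 1 - k) = k by omega] at this
  -- The new vertical bit runs through column `j` from row `i` to row `lo`; it is absorbed in row
  -- `lo - 1` or, for `lo = 0`, leaves as a label. The changed horizontal bits of the rows `i` and
  -- `lo - 1` run through all labels up to `j`.
  refine ⟨fun k j' => if j' ≤ j then
      (if k = i then true else if k + 1 = lo then false else c k 0) else c k j',
    fun k j' => if j' = j ∧ lo ≤ k ∧ k ≤ i then true else y k j', ?_, ?_, ?_, ?_, ?_, ?_⟩
  · intro k j' hk hj'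
    rcases lt_trichotomy j' j with h1 | rfl | h1
    · have e1 : j' ≠ j := by omega
      simp only [e1, and_false, if_false, false_and, h1.le, if_true, show j' + 1 ≤ j by omega,
        add_zero, hA k hk j' hj' (Or.inl h1), H1' k hk.le j' h1, H1' (k + 1) hk j' h1,
        (H2 k hk j' h1).1]
      generalize (if k = i then true else if k + 1 = lo then false else c k 0) = b
      cases b <;> rfl
    · have h0 := h k j' hk hj'
      have e3 := H3 k hk j' le_rfl
      simp only [and_true, true_and, le_refl, if_true, show ¬ (j' + 1 ≤ j') by omega, if_false]
      rcases lt_trichotomy k i with h2 | rfl | h2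
      · rcases Nat.lt_or_ge k lo with h3 | h3
        · rcases Nat.eq_or_lt_of_le (show k + 1 ≤ lo by omega) with h4 | h4
          · have e4 := hc' k h4
            have e5 := H5' (k + 1) (by omega) (by omega)
            rw [e3, e4, e5] at h0
            simp only [h2.ne, h4, if_true, if_false, show lo ≤ i by omega, h3.not_ge, true_and,
              false_and, le_refl, add_zero]
            exact (rule_bump h0).1
          · simp only [h2.ne, h4.ne, if_false, show ¬ lo ≤ k + 1 by omega, h3.not_ge, false_and,
              add_zero, ← e3]
            exact h0
        · have e4 := hc k h3 h2.le
          have e5 := H5' (k + 1) (by omega) (by omega)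
          have e6 := H5' k (by omega) (by omega)
          rw [e3, e4, e5, e6] at h0
          simp only [h2.ne, show k + 1 ≠ lo by omega, if_false, show lo ≤ k + 1 by omega,
            show k + 1 ≤ i by omega, h2.le, h3, and_self, if_true, add_zero, e4]
          exact (rule_pass h0).1
      · rw [H4', e3] at h0
        simp only [if_true, show ¬ (k + 1 ≤ k) by omega, and_false, if_false, H4', le_refl,
          and_true]
        rcases Nat.eq_or_lt_of_le hlo with h4 | h4
        · rw [hc' k h4.symm] at h0
          simp only [h4, if_true, show ¬ (k + 1 ≤ k) by omega, if_false]
          exact (rule_bump h0).2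
        · rw [hc k (by omega) le_rfl, H5' k (by omega) (by omega)] at h0
          simp only [show k + 1 ≠ lo by omega, if_false, show lo ≤ k by omega, if_true]
          exact (rule_pass h0).2
      · simp only [h2.ne', show k + 1 ≠ lo by omega, show ¬ k + 1 ≤ i by omega,
          show ¬ k ≤ i by omega, and_false, if_false, add_zero, ← e3]
        exact h0
    · have e1 : j' ≠ j := by omega
      simp only [e1, and_false, if_false, false_and, h1.not_ge, show ¬ j' + 1 ≤ j by omega,
        add_zero]
      exact h k j' hk hj'
  · intro j' hj'
    simp only [show ¬ N ≤ i by omega, and_false, if_false]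
    exact hY j' hj'
  · intro k _
    simp [show ¬ N ≤ j by omega]
  · intro k; simp
  · intro j'
    simp [and_comm]
  · rintro rfl
    exact H5' 0 le_rfl (by omega)

/-- Insertion of the letters of a biword into one column: the resulting column, the recorded
labels, and the biword of bumped letters. -/
def columnPass : List (ℕ+ × ℕ+) → List ℕ+ → List ℕ+ × List ℕ+ × List (ℕ+ × ℕ+)
  | [], p => (p, [], [])
  | x :: L, p =>
    match (((columnPass L p).1.filter (fun z => z ≤ x.1)).max?) with
    | none => (x.1 :: (columnPass L p).1, x.2 :: (columnPass L p).2.1, (columnPass L p).2.2)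
    | some z => ((columnPass L p).1.replace z x.1, (columnPass L p).2.1,
        (z, x.2) :: (columnPass L p).2.2)

/-- What happens in a column depends only on the letters entering it and their order, so all letters
may be sent through it before the next column is touched. This turns letter-by-letter insertion into
column-by-column insertion. -/
theorem foldr_skewInsert_cons (L : List (ℕ+ × ℕ+)) (p q : List ℕ+)
    (cols : List (List ℕ+ × List ℕ+)) :
    L.foldr (fun x cols => skewInsert x.1 x.2 cols) ((p, q) :: cols) =
      ((columnPass L p).1, (columnPass L p).2.1 ++ q) ::
        (columnPass L p).2.2.foldr (fun x cols => skewInsert x.1 x.2 cols) cols := by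
  induction L with
  | nil => rfl
  | cons x L ih =>
    rw [List.foldr_cons, ih, skewInsert, columnPass]
    cases h : (((columnPass L p).1.filter (fun z => z ≤ x.1)).max?) <;> simp

/-- The letter inserted into nothing creates a column just as it would fill an empty one. This
justifies padding a tableau by empty columns. -/
theorem foldr_skewInsert_nil {L : List (ℕ+ × ℕ+)} (hL : L ≠ []) :
    L.foldr (fun x cols => skewInsert x.1 x.2 cols) [] =
      L.foldr (fun x cols => skewInsert x.1 x.2 cols) [([], [])] := by
  obtain ⟨L', x, rfl⟩ := List.eq_nil_or_concat L |>.resolve_left hL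
  simp [skewInsert]

/-- As `x` is the largest entry that is at most `a`, the entries after it exceed `a` and the entries
before it stay smaller. -/
theorem replace_sorted {p : List ℕ+} (hp : p.Pairwise (· < ·)) {x a : ℕ+} (hx : x ∈ p)
    (hxa : x ≤ a) (hmax : ∀ z ∈ p, z ≤ a → z ≤ x) :
    (p.replace x a).Pairwise (· < ·) ∧ ∀ z, z ∈ p.replace x a ↔ z = a ∨ (z ∈ p ∧ z ≠ x) := by
  induction p with
  | nil => simp at hx
  | cons b p ih =>
    rw [List.pairwise_cons] at hp
    rw [List.replace_cons]
    by_cases hb : b = x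
    · subst hb
      simp only [beq_self_eq_true]
      constructor
      · rw [List.pairwise_cons]
        refine ⟨fun z hz => ?_, hp.2⟩
        by_contra hza
        exact absurd (hmax z (by simp [hz]) (not_lt.1 hza)) (not_le.2 (hp.1 z hz))
      · intro z
        simp only [List.mem_cons]
        constructor
        · rintro (h | h)
          · exact Or.inl h
          · exact Or.inr ⟨Or.inr h, (hp.1 z h).ne'⟩
        · rintro (h | ⟨h | h, h'⟩)
          · exact Or.inl h
          · exact absurd h h'
          · exact Or.inr h
    · have hx' : x ∈ p := by
        rcases List.mem_cons.1 hx with h | h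
        · exact absurd h.symm hb
        · exact h
      obtain ⟨h1, h2⟩ := ih hp.2 hx' (fun z hz => hmax z (by simp [hz]))
      have hbx : (x == b) = false := by simp [Ne.symm hb]
      rw [hbx]
      dsimp only
      constructor
      · rw [List.pairwise_cons]
        refine ⟨fun z hz => ?_, h1⟩
        rcases (h2 z).1 hz with rfl | ⟨h, -⟩
        · exact lt_of_lt_of_le (hp.1 x hx') hxa
        · exact hp.1 z h
      · intro z
        rw [List.mem_cons, h2, List.mem_cons]
        constructor
        · rintro (rfl | h | ⟨h, h'⟩)
          · exact Or.inr ⟨Or.inl rfl, hb⟩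
          · exact Or.inl h
          · exact Or.inr ⟨Or.inr h, h'⟩
        · rintro (h | ⟨h | h, h'⟩)
          · exact Or.inr (Or.inl h)
          · exact Or.inl h
          · exact Or.inr (Or.inr ⟨h, h'⟩)

/-- The order of the pairs in a biword of `Ω`. -/
def omegaLE (x y : ℕ+ × ℕ+) : Prop := x.2 < y.2 ∨ (x.2 = y.2 ∧ y.1 ≤ x.1)

/-- The matrix of a biword. -/
def countFun (L : List (ℕ+ × ℕ+)) (k j : ℕ) : ℕ := L.count (k.succPNat, j.succPNat)

/-- The bits of a column of letters. -/
def bits (p : List ℕ+) (k : ℕ) : Bool := decide (k.succPNat ∈ p)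

theorem succPNat_eq_iff {k : ℕ} {z : ℕ+} : k.succPNat = z ↔ k = z.natPred := by
  constructor
  · rintro rfl; simp
  · rintro rfl; simp

theorem natPred_le_iff {a b : ℕ+} : a.natPred ≤ b.natPred ↔ a ≤ b := by
  rw [← PNat.coe_le_coe]
  have := a.natPred_add_one
  have := b.natPred_add_one
  omega

theorem natPred_lt_iff {a b : ℕ+} : a.natPred < b.natPred ↔ a < b := by
  rw [← not_le, natPred_le_iff, not_le]

/-- The insertion of a sorted biword into a column is described by a configuration of the vertex
model. -/
theorem columnPass_grid (N : ℕ) (L : List (ℕ+ × ℕ+)) (p : List ℕ+) (hL : L.Pairwise omegaLE)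
    (hLN : ∀ x ∈ L, x.1.natPred < N ∧ x.2.natPred < N) (hp : p.Pairwise (· < ·))
    (hpN : ∀ z ∈ p, z.natPred < N) :
    ColRel N (countFun L) (bits p) (countFun (columnPass L p).2.2) (bits (columnPass L p).1)
      (bits (columnPass L p).2.1) ∧
    (columnPass L p).1.Pairwise (· < ·) ∧ (∀ z ∈ (columnPass L p).1, z.natPred < N) ∧
    (columnPass L p).2.1.Pairwise (· < ·) ∧ (∀ z ∈ (columnPass L p).2.1, z.natPred < N) ∧
    (columnPass L p).2.2.Pairwise omegaLE ∧
    (∀ x ∈ (columnPass L p).2.2, x.1.natPred < N ∧ x.2.natPred < N) ∧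
    (∀ x ∈ L.head?, x.1 ∈ (columnPass L p).1 ∧ (∀ z ∈ (columnPass L p).2.1, x.2 ≤ z) ∧
      ∀ z ∈ (columnPass L p).2.2, omegaLE x z) := by
  induction L with
  | nil =>
    refine ⟨⟨fun k _ => bits p k, fun _ _ => false, ?_, fun k _ => ⟨rfl, rfl⟩, fun j _ => ⟨rfl, rfl⟩⟩,
      hp, hpN, by simp [columnPass], by simp [columnPass], by simp [columnPass],
      by simp [columnPass], by simp⟩
    intro k j _ _
    simp only [countFun, columnPass, List.count_nil]
    cases bits p k <;> rfl
  | cons x L ih =>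
    rw [List.pairwise_cons] at hL
    obtain ⟨⟨c, y, g1, g2, g3⟩, ih1, ih2, ih3, ih4, ih5, ih6, ih7⟩ :=
      ih hL.2 (fun z hz => hLN z (by simp [hz]))
    obtain ⟨hxi, hxj⟩ := hLN x (by simp)
    -- The new pair precedes all of `L` in the biword, so `L` has no smaller label and, at the same
    -- label, no larger letter.
    have hA : ∀ k < N, ∀ j' < N, (j' < x.2.natPred ∨ (j' = x.2.natPred ∧ x.1.natPred < k)) →
        countFun L k j' = 0 := by
      intro k _ j' _ h
      refine List.count_eq_zero_of_not_mem fun hm => ?_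
      rcases hL.1 _ hm with h1 | ⟨h1, h2⟩
      · rw [← natPred_lt_iff, Nat.natPred_succPNat] at h1; omega
      · rw [← natPred_le_iff, Nat.natPred_succPNat] at h2
        have := congrArg PNat.natPred h1
        rw [Nat.natPred_succPNat] at this
        omega
    have hcnt : ∀ k j, countFun (x :: L) k j =
        countFun L k j + if k = x.1.natPred ∧ j = x.2.natPred then 1 else 0 := by
      intro k j
      simp only [countFun, List.count_cons]
      congr 1
      have : (x == (k.succPNat, j.succPNat)) = decide (k = x.1.natPred ∧ j = x.2.natPred) := by
        rw [Bool.eq_iff_iff]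
        simp only [beq_iff_eq, decide_eq_true_eq, ← succPNat_eq_iff, Prod.ext_iff]
        constructor <;> rintro ⟨h1, h2⟩ <;> exact ⟨h1.symm, h2.symm⟩
      rw [this]
      simp
    have hq : ∀ z ∈ (columnPass L p).2.1, x.2 ≤ z := by
      intro z hz
      cases L with
      | nil => simp [columnPass] at hz
      | cons x0 L =>
        have h1 := (ih7 x0 (by simp)).2.1 z hz
        rcases hL.1 x0 (by simp) with h2 | ⟨h2, -⟩
        · exact h2.le.trans h1
        · exact h2 ▸ h1
    rw [columnPass]
    cases hm : (((columnPass L p).1.filter (fun z => z ≤ x.1)).max?) with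
    | none =>
      rw [List.max?_eq_none_iff, List.filter_eq_nil_iff] at hm
      simp only [decide_eq_true_eq, not_le] at hm
      obtain ⟨c2, y2, h1, h2, h3, h4, h5, h6⟩ := g1.addLetter (fun j hj => (g3 j hj).1) hxi hxj hA
        (lo := 0) (Nat.zero_le _) (by
          intro k _ hk
          rw [(g2 k (by omega)).2, bits, decide_eq_false_iff_not]
          intro hk'
          have := hm _ hk'
          rw [← natPred_lt_iff, Nat.natPred_succPNat] at this
          omega) (by omega)
      -- Strictness comes from the last clause of `addLetter`: the bit leaving at this label was
      -- still zero, so a column never receives two boxes with the same label.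
      have hqlt : ∀ z ∈ (columnPass L p).2.1, x.2 < z := by
        intro z hz
        refine lt_of_le_of_ne (hq z hz) fun h => ?_
        have := h6 rfl
        rw [(g3 _ hxj).2, bits, decide_eq_false_iff_not] at this
        apply this
        rw [PNat.succPNat_natPred, h]
        exact hz
      refine ⟨⟨c2, y2, ?_, ?_, ?_⟩, ?_, ?_, ?_, ?_, ih5, ih6, ?_⟩
      · intro k j hk hj
        have := h1 k j hk hj
        simp only [Nat.add_eq_zero_iff, one_ne_zero, and_false, false_and, if_false,
          add_zero] at this
        rw [hcnt]
        exact this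
      · intro k hk
        refine ⟨(h3 k hk).trans (g2 k hk).1, ?_⟩
        rw [h4, bits]
        simp only [List.mem_cons, succPNat_eq_iff]
        by_cases hk' : k = x.1.natPred
        · simp [hk']
        · simp [hk', (g2 k hk).2, bits]
      · intro j hj
        refine ⟨h2 j hj, ?_⟩
        rw [h5, bits]
        simp only [List.mem_cons, succPNat_eq_iff]
        by_cases hj' : j = x.2.natPred
        · simp [hj']
        · simp [hj', (g3 j hj).2, bits]
      · exact List.pairwise_cons.2 ⟨hm, ih1⟩
      · intro z hz
        rcases List.mem_cons.1 hz with rfl | hz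
        · exact hxi
        · exact ih2 z hz
      · exact List.pairwise_cons.2 ⟨hqlt, ih3⟩
      · intro z hz
        rcases List.mem_cons.1 hz with rfl | hz
        · exact hxj
        · exact ih4 z hz
      · intro x' hx'
        simp only [List.head?_cons, Option.mem_def, Option.some.injEq] at hx'
        subst hx'
        refine ⟨by simp, ?_, ?_⟩
        · intro z hz
          rcases List.mem_cons.1 hz with rfl | hz
          · exact le_rfl
          · exact hq z hz
        · intro z hz
          cases L with
          | nil => simp [columnPass] at hz
          | cons x0 L =>
            have hz' := (ih7 x0 (by simp)).2.2 z hz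
            rcases hL.1 x0 (by simp) with h | ⟨h, h'⟩ <;> rcases hz' with h8 | ⟨h8, h9⟩
            · exact Or.inl (h.trans h8)
            · exact Or.inl (h8 ▸ h)
            · exact Or.inl (h ▸ h8)
            · exact Or.inr ⟨h.trans h8, h9.trans h'⟩
    | some b =>
      rw [List.max?_eq_some_iff] at hm
      simp only [List.mem_filter, decide_eq_true_eq, and_imp] at hm
      obtain ⟨⟨hb1, hb2⟩, hb3⟩ := hm
      have hbi := natPred_le_iff.2 hb2
      obtain ⟨c2, y2, h1, h2, h3, h4, h5, -⟩ := g1.addLetter (fun j hj => (g3 j hj).1) hxi hxj hA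
        (lo := b.natPred + 1) (by omega) (by
          intro k hk hk'
          rw [(g2 k (by omega)).2, bits, decide_eq_false_iff_not]
          intro hk''
          have := hb3 _ hk'' (natPred_le_iff.1 (by rw [Nat.natPred_succPNat]; exact hk'))
          rw [← natPred_le_iff, Nat.natPred_succPNat] at this
          omega) (by
          intro k hk
          obtain rfl : k = b.natPred := by omega
          rw [(g2 _ (by omega)).2, bits, PNat.succPNat_natPred]
          simpa using hb1)
      obtain ⟨r1, r2⟩ := replace_sorted ih1 hb1 hb2 hb3
      -- At equal labels, the letter `x0.1` inserted just before is in the column and is at most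
      -- `x.1`. The bumped letter `b` is the largest such entry, hence at least `x0.1`, which bounds
      -- what was bumped earlier with this label.
      have hz0 : ∀ z ∈ (columnPass L p).2.2, omegaLE (b, x.2) z := by
        intro z hz
        cases L with
        | nil => simp [columnPass] at hz
        | cons x0 L =>
          obtain ⟨hx0, -, hz'⟩ := ih7 x0 (by simp)
          rcases hL.1 x0 (by simp) with h | ⟨h, h'⟩ <;> rcases hz' z hz with h8 | ⟨h8, h9⟩
          · exact Or.inl (h.trans h8)
          · exact Or.inl (h8 ▸ h)
          · exact Or.inl (h ▸ h8)
          · exact Or.inr ⟨h.trans h8, h9.trans (hb3 _ hx0 h')⟩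
      refine ⟨⟨c2, y2, ?_, ?_, ?_⟩, r1, ?_, ih3, ih4, ?_, ?_, ?_⟩
      · intro k j hk hj
        have := h1 k j hk hj
        rw [hcnt, this]
        simp only [Prod.mk.injEq, and_true]
        simp only [countFun, List.count_cons, add_left_inj]
        congr 1
        have : ((b, x.2) == (k.succPNat, j.succPNat)) = decide (k = b.natPred ∧ j = x.2.natPred) := by
          rw [Bool.eq_iff_iff]
          simp only [beq_iff_eq, decide_eq_true_eq, ← succPNat_eq_iff, Prod.ext_iff]
          constructor <;> rintro ⟨h1, h2⟩ <;> exact ⟨h1.symm, h2.symm⟩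
        rw [this]
        simp
      · intro k hk
        refine ⟨(h3 k hk).trans (g2 k hk).1, ?_⟩
        rw [h4, bits]
        simp only [r2, succPNat_eq_iff, (g2 k hk).2, bits, add_left_inj, ne_eq]
        by_cases hk' : k = x.1.natPred
        · simp [hk']
        · by_cases hk'' : k = b.natPred
          · simp [hk'']
          · simp [hk', hk'']
      · intro j hj
        refine ⟨h2 j hj, ?_⟩
        rw [h5, (g3 j hj).2]
        simp
      · intro z hz
        rcases (r2 z).1 hz with rfl | ⟨hz, -⟩
        · exact hxi
        · exact ih2 z hz
      · exact List.pairwise_cons.2 ⟨hz0, ih5⟩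
      · intro z hz
        rcases List.mem_cons.1 hz with rfl | hz
        · exact ⟨ih2 _ hb1, hxj⟩
        · exact ih6 z hz
      · intro x' hx'
        simp only [List.head?_cons, Option.mem_def, Option.some.injEq] at hx'
        subst hx'
        refine ⟨(r2 _).2 (Or.inl rfl), hq, ?_⟩
        intro z hz
        rcases List.mem_cons.1 hz with rfl | hz
        · exact Or.inr ⟨rfl, hb2⟩
        · rcases hz0 z hz with h | ⟨h, h'⟩
          · exact Or.inl h
          · exact Or.inr ⟨h, h'.trans hb2⟩

end

end GlInf

namespace GlInf

noncomputable section

/-! ## Crystal axioms -/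

theorem coroot_add (i : ℤ) (a b : Wt) : coroot i (a + b) = coroot i a + coroot i b := by
  simp only [coroot, Prod.fst_add, Prod.snd_add, Finsupp.coe_add, Pi.add_apply]
  split_ifs <;> ring

theorem coroot_neg (i : ℤ) (a : Wt) : coroot i (-a) = -coroot i a := by
  simp only [coroot, Prod.fst_neg, Prod.snd_neg, Finsupp.coe_neg, Pi.neg_apply]
  split_ifs <;> ring

theorem coroot_zero (i : ℤ) : coroot i 0 = 0 := by
  simp [coroot]

theorem coroot_epsW (i : ℤ) (k : Zx) :
    coroot i (epsW k) = (if k = lo i then 1 else 0) - (if k = hi i then 1 else 0) := by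
  simp [coroot, epsW, Finsupp.single_apply]

namespace PreCrystal

variable {B C : Type}

/-- A crystal which at the colour `i` has finite non-negative values `ε` and `φ`. -/
structure GoodAt (X : PreCrystal B) (i : ℤ) (ε φ : B → ℕ) : Prop where
  eps : ∀ b, X.eps i b = ((ε b : ℤ) : WithBot ℤ)
  phi : ∀ b, X.phi i b = ((φ b : ℤ) : WithBot ℤ)
  wt : ∀ b, coroot i (X.wt b) = (φ b : ℤ) - ε b
  f_some : ∀ b b', X.f i b = some b' → ε b' = ε b + 1 ∧ φ b = φ b' + 1 ∧ X.wt b' = X.wt b - root i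
  f_iff_e : ∀ b b', X.f i b = some b' ↔ X.e i b' = some b

/-- The crystal axioms at one colour. -/
structure AxiomsAt (X : PreCrystal B) (i : ℤ) : Prop where
  phi_eq : ∀ b, X.phi i b = ((coroot i (X.wt b) : ℤ) : WithBot ℤ) + X.eps i b
  e_some : ∀ b b', X.e i b = some b' →
    X.eps i b' = X.eps i b + ((-1 : ℤ) : WithBot ℤ) ∧
    X.phi i b' = X.phi i b + ((1 : ℤ) : WithBot ℤ) ∧
    X.wt b' = X.wt b + root i
  f_some : ∀ b b', X.f i b = some b' →
    X.eps i b' = X.eps i b + ((1 : ℤ) : WithBot ℤ) ∧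
    X.phi i b' = X.phi i b + ((-1 : ℤ) : WithBot ℤ) ∧
    X.wt b' = X.wt b - root i
  f_iff_e : ∀ b b', X.f i b = some b' ↔ X.e i b' = some b
  bot : ∀ b, X.phi i b = ⊥ → X.e i b = none ∧ X.f i b = none

theorem isCrystal_of_axiomsAt {X : PreCrystal B} (h : ∀ i, X.AxiomsAt i) : X.IsCrystal :=
  ⟨fun i => (h i).phi_eq, fun i => (h i).e_some, fun i => (h i).f_some, fun i => (h i).f_iff_e,
    fun i => (h i).bot⟩

theorem GoodAt.axiomsAt {X : PreCrystal B} {i : ℤ} {ε φ : B → ℕ} (h : X.GoodAt i ε φ) :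
    X.AxiomsAt i where
  phi_eq b := by
    rw [h.phi, h.eps, h.wt, ← WithBot.coe_add]
    congr 1
    ring
  e_some b b' hb := by
    obtain ⟨h1, h2, h3⟩ := h.f_some _ _ ((h.f_iff_e _ _).2 hb)
    simp only [h.eps, h.phi, ← WithBot.coe_add, WithBot.coe_inj]
    refine ⟨by omega, by omega, ?_⟩
    rw [h3]; abel
  f_some b b' hb := by
    obtain ⟨h1, h2, h3⟩ := h.f_some _ _ hb
    simp only [h.eps, h.phi, ← WithBot.coe_add, WithBot.coe_inj]
    exact ⟨by omega, by omega, h3⟩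
  f_iff_e := h.f_iff_e
  bot b hb := by
    rw [h.phi] at hb
    exact absurd hb WithBot.coe_ne_bot

/-- Injectivity makes the chosen preimage the only one, so the transported operator is described
without choice. -/
theorem liftOp_eq_some {g : B → C} (hg : Function.Injective g) (op : C → Option C) (b b' : B) :
    liftOp g op b = some b' ↔ op (g b) = some (g b') := by
  unfold liftOp
  split_ifs with h
  · rw [Option.some_inj]
    have h1 := h.choose_spec
    constructor
    · rintro rfl; exact h1
    · intro h2
      rw [h1, Option.some_inj] at h2
      exact hg h2
  · simp only [false_iff]
    exact fun h' => h ⟨b', h'⟩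

theorem GoodAt.pullback {X : PreCrystal C} {i : ℤ} {ε φ : C → ℕ} (h : X.GoodAt i ε φ) {g : B → C}
    (hg : Function.Injective g) : (X.pullback g).GoodAt i (fun b => ε (g b)) (fun b => φ (g b)) where
  eps b := h.eps _
  phi b := h.phi _
  wt b := h.wt _
  f_some b b' hb := h.f_some _ _ ((liftOp_eq_some hg _ _ _).1 hb)
  f_iff_e b b' := by
    have := h.f_iff_e (g b) (g b')
    exact (liftOp_eq_some hg _ _ _).trans (this.trans (liftOp_eq_some hg _ _ _).symm)

/-- With natural numbers as values the maxima in the definition become truncated differences. A step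
of `f` changes the compared values in such a way that `e` afterwards selects the same factor. -/
theorem GoodAt.tensor {X : PreCrystal B} {Y : PreCrystal C} {i : ℤ} {ε φ : B → ℕ} {ε' φ' : C → ℕ}
    (h : X.GoodAt i ε φ) (g : Y.GoodAt i ε' φ') :
    (X.tensor Y).GoodAt i (fun b => ε b.1 + (ε' b.2 - φ b.1))
      (fun b => φ' b.2 + (φ b.1 - ε' b.2)) where
  eps b := by
    simp only [PreCrystal.tensor, h.eps, g.eps, h.wt, ← WithBot.coe_add, ← WithBot.coe_max,
      WithBot.coe_inj]
    omega
  phi b := by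
    simp only [PreCrystal.tensor, h.phi, g.phi, g.wt, ← WithBot.coe_add, ← WithBot.coe_max,
      WithBot.coe_inj]
    omega
  wt b := by
    simp only [PreCrystal.tensor, coroot_add, h.wt, g.wt]
    omega
  f_some b b' hb := by
    obtain ⟨x, y⟩ := b
    obtain ⟨x', y'⟩ := b'
    simp only [PreCrystal.tensor, h.phi, g.eps, WithBot.coe_lt_coe, Nat.cast_lt] at hb ⊢
    split_ifs at hb with h1
    · simp only [Option.map_eq_some_iff, Prod.mk.injEq] at hb
      obtain ⟨a, h2, rfl, rfl⟩ := hb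
      obtain ⟨h3, h4, h5⟩ := h.f_some _ _ h2
      refine ⟨by omega, by omega, ?_⟩
      rw [h5]; abel
    · simp only [Option.map_eq_some_iff, Prod.mk.injEq] at hb
      obtain ⟨a, h2, rfl, rfl⟩ := hb
      obtain ⟨h3, h4, h5⟩ := g.f_some _ _ h2
      refine ⟨by omega, by omega, ?_⟩
      rw [h5]; abel
  f_iff_e b b' := by
    obtain ⟨x, y⟩ := b
    obtain ⟨x', y'⟩ := b'
    simp only [PreCrystal.tensor, h.phi, g.eps, WithBot.coe_lt_coe, WithBot.coe_le_coe,
      Nat.cast_lt, Nat.cast_le]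
    constructor
    · intro hb
      split_ifs at hb with h1
      · simp only [Option.map_eq_some_iff, Prod.mk.injEq] at hb
        obtain ⟨a, h2, rfl, rfl⟩ := hb
        have := (h.f_some _ _ h2).2.1
        rw [if_pos (by omega), (h.f_iff_e _ _).1 h2]
        rfl
      · simp only [Option.map_eq_some_iff, Prod.mk.injEq] at hb
        obtain ⟨a, h2, rfl, rfl⟩ := hb
        have := (g.f_some _ _ h2).1
        rw [if_neg (by omega), (g.f_iff_e _ _).1 h2]
        rfl
    · intro hb
      split_ifs at hb with h1
      · simp only [Option.map_eq_some_iff, Prod.mk.injEq] at hb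
        obtain ⟨a, h2, rfl, rfl⟩ := hb
        rw [← h.f_iff_e] at h2
        have := (h.f_some _ _ h2).2.1
        rw [if_pos (by omega), h2]
        rfl
      · simp only [Option.map_eq_some_iff, Prod.mk.injEq] at hb
        obtain ⟨a, h2, rfl, rfl⟩ := hb
        rw [← g.f_iff_e] at h2
        have := (g.f_some _ _ h2).1
        rw [if_neg (by omega), h2]
        rfl

/-- The values `ε` and `φ` of a word, as a signature. -/
def listSig (ε φ : B → ℕ) (w : List B) : Fac :=
  (w.map fun b => (⟨ε b, φ b, False, True, False.elim⟩ : Fac)).prod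

theorem listSig_cons (ε φ : B → ℕ) (a : B) (w : List B) :
    (listSig ε φ (a :: w)).e = ε a + ((listSig ε φ w).e - φ a) ∧
    (listSig ε φ (a :: w)).p = (listSig ε φ w).p + (φ a - (listSig ε φ w).e) := ⟨rfl, rfl⟩

/-- A word is an iterated tensor product, hence its signature is the product in `Fac` of the
signatures of its letters. -/
theorem GoodAt.words {X : PreCrystal B} {i : ℤ} {ε φ : B → ℕ} (h : X.GoodAt i ε φ) :
    X.words.GoodAt i (fun w => (listSig ε φ w).e) (fun w => (listSig ε φ w).p) := by
  have hw : ∀ w : List B, coroot i (w.map X.wt).sum = ((listSig ε φ w).p : ℤ) - (listSig ε φ w).e := by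
    intro w
    induction w with
    | nil => simp [coroot_zero, listSig]
    | cons a w ih =>
      rw [List.map_cons, List.sum_cons, coroot_add, ih, h.wt, (listSig_cons ε φ a w).1,
        (listSig_cons ε φ a w).2]
      omega
  have he : ∀ w : List B, wordEps X i w = (((listSig ε φ w).e : ℤ) : WithBot ℤ) := by
    intro w
    induction w with
    | nil => rfl
    | cons a w ih =>
      simp only [wordEps, ih, h.eps, h.wt, ← WithBot.coe_add, ← WithBot.coe_max, WithBot.coe_inj,
        (listSig_cons ε φ a w).1]
      omega
  have hp : ∀ w : List B, wordPhi X i w = (((listSig ε φ w).p : ℤ) : WithBot ℤ) := by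
    intro w
    induction w with
    | nil => rfl
    | cons a w ih =>
      simp only [wordPhi, ih, h.phi, hw, ← WithBot.coe_add, ← WithBot.coe_max, WithBot.coe_inj,
        (listSig_cons ε φ a w).2]
      omega
  have hf : ∀ w w' : List B, wordF X i w = some w' →
      (listSig ε φ w').e = (listSig ε φ w).e + 1 ∧ (listSig ε φ w).p = (listSig ε φ w').p + 1 ∧
      (w'.map X.wt).sum = (w.map X.wt).sum - root i := by
    intro w
    induction w with
    | nil => intro w' hw'; simp [wordF] at hw'
    | cons a w ih =>
      intro w' hw'
      simp only [wordF, he, h.phi, WithBot.coe_lt_coe, Nat.cast_lt] at hw'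
      rw [(listSig_cons ε φ a w).1, (listSig_cons ε φ a w).2]
      split_ifs at hw' with h1
      · simp only [Option.map_eq_some_iff] at hw'
        obtain ⟨a', h2, rfl⟩ := hw'
        obtain ⟨h3, h4, h5⟩ := h.f_some _ _ h2
        rw [(listSig_cons ε φ a' w).1, (listSig_cons ε φ a' w).2]
        refine ⟨by omega, by omega, ?_⟩
        simp only [List.map_cons, List.sum_cons, h5]; abel
      · simp only [Option.map_eq_some_iff] at hw'
        obtain ⟨a', h2, rfl⟩ := hw'
        obtain ⟨h3, h4, h5⟩ := ih _ h2
        rw [(listSig_cons ε φ a a').1, (listSig_cons ε φ a a').2]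
        refine ⟨by omega, by omega, ?_⟩
        simp only [List.map_cons, List.sum_cons, h5]; abel
  refine ⟨he, hp, hw, hf, ?_⟩
  intro w
  change ∀ w', wordF X i w = some w' ↔ wordE X i w' = some w
  induction w with
  | nil =>
    intro w'
    cases w' with
    | nil => simp [wordF, wordE]
    | cons a' w' =>
      simp only [wordF, wordE, reduceCtorEq, false_iff]
      split_ifs <;> simp
  | cons a w ih =>
    intro w'
    cases w' with
    | nil =>
      simp only [wordF, wordE, reduceCtorEq, iff_false]
      split_ifs <;> simp
    | cons a' w' =>
      simp only [wordF, wordE, he, h.phi, WithBot.coe_lt_coe, WithBot.coe_le_coe, Nat.cast_lt,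
        Nat.cast_le]
      constructor
      · intro hb
        split_ifs at hb with h1
        · simp only [Option.map_eq_some_iff, List.cons.injEq] at hb
          obtain ⟨a'', h2, rfl, rfl⟩ := hb
          have := (h.f_some _ _ h2).2.1
          rw [if_pos (by omega), (h.f_iff_e _ _).1 h2]
          rfl
        · simp only [Option.map_eq_some_iff, List.cons.injEq] at hb
          obtain ⟨a'', h2, rfl, rfl⟩ := hb
          have := (hf _ _ h2).1
          rw [if_neg (by omega), (ih _).1 h2]
          rfl
      · intro hb
        split_ifs at hb with h1
        · simp only [Option.map_eq_some_iff, List.cons.injEq] at hb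
          obtain ⟨a'', h2, rfl, rfl⟩ := hb
          rw [← h.f_iff_e] at h2
          have := (h.f_some _ _ h2).2.1
          rw [if_pos (by omega), h2]
          rfl
        · simp only [Option.map_eq_some_iff, List.cons.injEq] at hb
          obtain ⟨a'', h2, rfl, rfl⟩ := hb
          rw [← ih] at h2
          have := (hf _ _ h2).1
          rw [if_neg (by omega), h2]
          rfl

/-- The comparison of two elements at one colour. -/
def GoodAt.fac {X : PreCrystal B} {i : ℤ} {ε φ : B → ℕ} (h : X.GoodAt i ε φ) (b b' : B) : Fac :=
  ⟨ε b, φ b, X.f i b = some b', b = b', fun hb => by have := (h.f_some _ _ hb).2.1; omega⟩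

/-- Equality fails in general: `u ++ v = u' ++ v'` does not force `u = u'` when the lengths are
unspecified. The implication is enough to read off the operator on a concatenated word. -/
theorem GoodAt.words_fac_append {X : PreCrystal B} {i : ℤ} {ε φ : B → ℕ} (h : X.GoodAt i ε φ)
    (u u' v v' : List B) :
    (h.words.fac u u' * h.words.fac v v').Le (h.words.fac (u ++ v) (u' ++ v')) := by
  have hs : listSig ε φ (u ++ v) = listSig ε φ u * listSig ε φ v := by
    simp [listSig]
  refine ⟨?_, ?_, ?_, ?_⟩
  · change _ = (listSig ε φ (u ++ v)).e
    rw [hs]; rfl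
  · change _ = (listSig ε φ (u ++ v)).p
    rw [hs]; rfl
  · rw [Fac.mul_R]
    change (((listSig ε φ v).e < (listSig ε φ u).p ∧ wordF X i u = some u' ∧ v = v') ∨
      ((listSig ε φ u).p ≤ (listSig ε φ v).e ∧ u = u' ∧ wordF X i v = some v')) →
      wordF X i (u ++ v) = some (u' ++ v')
    have he : ∀ w : List B, wordEps X i w = (((listSig ε φ w).e : ℤ) : WithBot ℤ) := h.words.eps
    rintro (⟨h1, h2, rfl⟩ | ⟨h1, rfl, h2⟩)
    · clear hs
      induction u generalizing u' with
      | nil => simp [wordF] at h2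
      | cons a u ih =>
        have hs : listSig ε φ (u ++ v) = listSig ε φ u * listSig ε φ v := by
          simp [listSig]
        rw [(listSig_cons ε φ a u).2] at h1
        simp only [List.cons_append, wordF, he, h.phi, WithBot.coe_lt_coe, Nat.cast_lt] at h2 ⊢
        rw [hs, Fac.mul_e]
        split_ifs at h2 with h3
        · rw [if_pos (by omega)]
          simp only [Option.map_eq_some_iff] at h2 ⊢
          obtain ⟨a', h4, rfl⟩ := h2
          exact ⟨a', h4, rfl⟩
        · rw [if_neg (by omega)]
          simp only [Option.map_eq_some_iff] at h2 ⊢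
          obtain ⟨a', h4, rfl⟩ := h2
          exact ⟨_, ih _ (by omega) h4, rfl⟩
    · clear hs
      induction u with
      | nil => exact h2
      | cons a u ih =>
        have hs : listSig ε φ (u ++ v) = listSig ε φ u * listSig ε φ v := by
          simp [listSig]
        rw [(listSig_cons ε φ a u).2] at h1
        simp only [List.cons_append, wordF, he, h.phi, WithBot.coe_lt_coe, Nat.cast_lt]
        rw [hs, Fac.mul_e, if_neg (by omega), ih (by omega)]
        rfl
  · rw [Fac.mul_E]
    rintro ⟨h1, h2⟩
    change u = u' at h1
    change v = v' at h2
    subst h1 h2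
    exact rfl

/-- The comparison of two words of the same length, letter by letter. -/
theorem GoodAt.words_fac_map {X : PreCrystal B} {i : ℤ} {ε φ : B → ℕ} (h : X.GoodAt i ε φ)
    {ι : Type*} (l : List ι) (T T' : ι → B) :
    h.words.fac (l.map T) (l.map T') = (l.map fun x => h.fac (T x) (T' x)).prod := by
  have he : ∀ w : List B, wordEps X i w = (((listSig ε φ w).e : ℤ) : WithBot ℤ) := h.words.eps
  induction l with
  | nil =>
    apply Fac.ext'
    · rfl
    · rfl
    · simp only [List.map_nil, List.prod_nil, Fac.one_R, iff_false]
      exact fun hh => absurd hh (by simp [GoodAt.fac, PreCrystal.words, wordF])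
    · simp [GoodAt.fac]
  | cons a l ih =>
    rw [List.map_cons (f := fun x => h.fac (T x) (T' x)), List.prod_cons, ← ih]
    apply Fac.ext'
    · rfl
    · rfl
    · rw [Fac.mul_R]
      change wordF X i (T a :: l.map T) = some (T' a :: l.map T') ↔
        ((listSig ε φ (l.map T)).e < φ (T a) ∧ X.f i (T a) = some (T' a) ∧ l.map T = l.map T') ∨
        (φ (T a) ≤ (listSig ε φ (l.map T)).e ∧ T a = T' a ∧
          wordF X i (l.map T) = some (l.map T'))
      simp only [wordF, he, h.phi, WithBot.coe_lt_coe, Nat.cast_lt]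
      split_ifs with h1
      · simp only [Option.map_eq_some_iff, List.cons.injEq, h1, true_and, h1.not_ge, false_and,
          or_false]
        constructor
        · rintro ⟨a', h2, rfl, h3⟩; exact ⟨h2, h3⟩
        · rintro ⟨h2, h3⟩; exact ⟨_, h2, rfl, h3⟩
      · simp only [Option.map_eq_some_iff, List.cons.injEq, h1, not_lt.1 h1, true_and, false_and,
          false_or]
        constructor
        · rintro ⟨a', h2, h3, rfl⟩; exact ⟨h3, h2⟩
        · rintro ⟨h2, h3⟩; exact ⟨_, h3, h2, rfl⟩
    · rw [Fac.mul_E]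
      change T a :: l.map T = T' a :: l.map T' ↔ T a = T' a ∧ l.map T = l.map T'
      rw [List.cons.injEq]

end PreCrystal

end

end GlInf

namespace GlInf

noncomputable section

open PreCrystal

/-! ## The crystals of the statement satisfy the axioms -/

theorem negL_eq_lo {i : ℤ} (hi : i < 0) (k : ℕ+) : negL k = lo i ↔ (k : ℤ) = -i + 1 := by
  simp only [negL, lo, Subtype.mk.injEq]
  split_ifs <;> omega

theorem negL_eq_hi {i : ℤ} (hi' : i < 0) (k : ℕ+) : negL k = hi i ↔ (k : ℤ) = -i := by
  simp only [negL, hi, Subtype.mk.injEq]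
  split_ifs <;> omega

theorem posL_eq_lo {i : ℤ} (hi : 0 < i) (k : ℕ+) : posL k = lo i ↔ (k : ℤ) = i := by
  simp only [posL, lo, Subtype.mk.injEq]
  split_ifs; omega

theorem posL_eq_hi {i : ℤ} (hi' : 0 < i) (k : ℕ+) : posL k = hi i ↔ (k : ℤ) = i + 1 := by
  simp only [posL, hi, Subtype.mk.injEq]
  split_ifs
  · omega
  · omega

theorem coroot_posL_of_neg {i : ℤ} (hi' : i < 0) (k : ℕ+) : coroot i (epsW (posL k)) = 0 := by
  have := k.pos
  rw [coroot_epsW, if_neg, if_neg, sub_zero]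
  · simp only [posL, hi, Subtype.mk.injEq]; split_ifs <;> omega
  · simp only [posL, lo, Subtype.mk.injEq]; split_ifs <;> omega

theorem coroot_negL_of_pos {i : ℤ} (hi' : 0 < i) (k : ℕ+) : coroot i (epsW (negL k)) = 0 := by
  have := k.pos
  rw [coroot_epsW, if_neg, if_neg, sub_zero]
  · simp only [negL, hi, Subtype.mk.injEq]; split_ifs <;> omega
  · simp only [negL, lo, Subtype.mk.injEq]; split_ifs; omega

/-- The values of `ε` on the letters, for the arrow from `m` to `m + 1`. -/
def letE (m : ℤ) (k : ℕ+) : ℕ := if (k : ℤ) = m + 1 then 1 else 0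

/-- The values of `φ` on the letters, for the arrow from `m` to `m + 1`. -/
def letP (m : ℤ) (k : ℕ+) : ℕ := if (k : ℤ) = m then 1 else 0

theorem pnat_sub_one_eq {k : ℕ+} {m : ℕ+} (h : (k : ℤ) = m + 1) : k - 1 = m := by
  have hm := m.pos
  apply PNat.eq
  rw [PNat.sub_coe, if_pos (by rw [← PNat.coe_lt_coe, PNat.one_coe]; omega), PNat.one_coe]
  omega

theorem goodAt_vecNeg {i : ℤ} (hi' : i < 0) : vecNeg.GoodAt i (letE (-i)) (letP (-i)) where
  eps b := by
    simp only [vecNeg, letE, hi', true_and]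
    split_ifs <;> rfl
  phi b := by
    simp only [vecNeg, letP]
    split_ifs <;> rfl
  wt b := by
    simp only [vecNeg, coroot_neg, coroot_epsW, negL_eq_lo hi', negL_eq_hi hi', letE, letP]
    split_ifs <;> simp
  f_some b b' hb := by
    simp only [vecNeg] at hb
    split_ifs at hb with h
    simp only [Option.some.injEq] at hb
    subst hb
    have e1 : negL (b + 1) = lo i := by rw [negL_eq_lo hi', PNat.add_coe]; push_cast; rw [h]
    have e2 : negL b = hi i := by rw [negL_eq_hi hi', h]
    have hc : ((b + 1 : ℕ+) : ℤ) = b + 1 := by rw [PNat.add_coe]; push_cast; rfl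
    refine ⟨?_, ?_, ?_⟩
    · simp only [letE]
      rw [if_pos (by omega), if_neg (by omega)]
    · simp only [letP]
      rw [if_pos h, if_neg (by omega)]
    · simp only [vecNeg, root, e1, e2]; abel
  f_iff_e b b' := by
    simp only [vecNeg, hi', true_and]
    constructor
    · intro h
      split_ifs at h with h1
      simp only [Option.some.injEq] at h
      subst h
      rw [if_pos (by rw [PNat.add_coe, PNat.one_coe]; push_cast; omega), pnat_sub_one_eq (m := b)]
      rw [PNat.add_coe, PNat.one_coe]; push_cast; rfl
    · intro h
      split_ifs at h with h1
      simp only [Option.some.injEq] at h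
      subst h
      have : b' - 1 + 1 = b' := PNat.sub_add_of_lt (by
        rw [← PNat.coe_lt_coe, PNat.one_coe]; omega)
      rw [if_pos, this]
      have := congrArg (fun z : ℕ+ => (z : ℤ)) this
      simp only [PNat.add_coe, PNat.one_coe] at this
      push_cast at this
      omega

theorem goodAt_vecPos {i : ℤ} (hi' : 0 < i) : vecPos.GoodAt i (letE i) (letP i) where
  eps b := by
    simp only [vecPos, letE, hi', true_and]
    split_ifs <;> rfl
  phi b := by
    simp only [vecPos, letP]
    split_ifs <;> rfl
  wt b := by
    simp only [vecPos, coroot_epsW, posL_eq_lo hi', posL_eq_hi hi', letE, letP]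
    split_ifs <;> simp
  f_some b b' hb := by
    simp only [vecPos] at hb
    split_ifs at hb with h
    simp only [Option.some.injEq] at hb
    subst hb
    have e1 : posL (b + 1) = hi i := by rw [posL_eq_hi hi', PNat.add_coe]; push_cast; rw [h]
    have e2 : posL b = lo i := by rw [posL_eq_lo hi', h]
    have hc : ((b + 1 : ℕ+) : ℤ) = b + 1 := by rw [PNat.add_coe]; push_cast; rfl
    refine ⟨?_, ?_, ?_⟩
    · simp only [letE]
      rw [if_pos (by omega), if_neg (by omega)]
    · simp only [letP]
      rw [if_pos h, if_neg (by omega)]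
    · simp only [vecPos, root, e1, e2]; abel
  f_iff_e b b' := by
    simp only [vecPos, hi', true_and]
    constructor
    · intro h
      split_ifs at h with h1
      simp only [Option.some.injEq] at h
      subst h
      rw [if_pos (by rw [PNat.add_coe, PNat.one_coe]; push_cast; omega), pnat_sub_one_eq (m := b)]
      rw [PNat.add_coe, PNat.one_coe]; push_cast; rfl
    · intro h
      split_ifs at h with h1
      simp only [Option.some.injEq] at h
      subst h
      have : b' - 1 + 1 = b' := PNat.sub_add_of_lt (by
        rw [← PNat.coe_lt_coe, PNat.one_coe]; omega)
      rw [if_pos, this]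
      have := congrArg (fun z : ℕ+ => (z : ℤ)) this
      simp only [PNat.add_coe, PNat.one_coe] at this
      push_cast at this
      omega

/-! ### Semi-infinite words -/

/-- A strictly decreasing sequence is determined by its set of values; the order dual makes it
strictly increasing. Semi-infinite words can therefore be treated as sets of letters. -/
theorem FockWord.ext_range {w w' : FockWord} (h : Set.range w.letter = Set.range w'.letter) :
    w = w' := by
  apply FockWord.ext
  have := StrictMono.range_inj (f := fun m => OrderDual.toDual (w.letter m))
    (g := fun m => OrderDual.toDual (w'.letter m)) (fun _ _ h => w.strict h)
    (fun _ _ h => w'.strict h)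
  funext m
  refine OrderDual.toDual.injective (congrFun (this.1 ?_) m)
  exact h

theorem FockWord.mult_eq (w : FockWord) (k : Zx) [Decidable (k ∈ Set.range w.letter)] :
    w.mult k = (if k ∈ Set.range w.letter then 1 else 0) - if (k : ℤ) < 0 then 1 else 0 := by
  unfold FockWord.mult
  congr 1
  split_ifs with h
  · obtain ⟨m, hm⟩ := h
    have : {m' : ℕ | w.letter m' = k} = {m} := by
      ext m'
      simp only [Set.mem_ofPred_eq, Set.mem_singleton_iff]
      exact ⟨fun h' => w.strict.injective (h'.trans hm.symm), fun h' => h' ▸ hm⟩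
    rw [this, Set.ncard_singleton]; rfl
  · have : {m' : ℕ | w.letter m' = k} = ∅ := by
      ext m'
      simp only [Set.mem_ofPred_eq, Set.mem_empty_iff_false, iff_false]
      exact fun h' => h ⟨m', h'⟩
    rw [this, Set.ncard_empty]; rfl

theorem FockWord.letter_injective_map : Function.Injective FockWord.letter :=
  fun _ _ h => FockWord.ext h

theorem lo_ne_hi (i : ℤ) : lo i ≠ hi i := by
  simp only [lo, hi, ne_eq, Subtype.mk.injEq]
  split_ifs <;> omega

theorem range_replace (a b : Zx) (u : ℕ → Zx) (ha : a ∈ Set.range u) :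
    Set.range (fun m => if u m = a then b else u m) = {z | z = b ∨ (z ∈ Set.range u ∧ z ≠ a)} := by
  ext z
  simp only [Set.mem_range, Set.mem_ofPred_eq]
  constructor
  · rintro ⟨m, rfl⟩
    split_ifs with h
    · exact Or.inl rfl
    · exact Or.inr ⟨⟨m, rfl⟩, h⟩
  · rintro (rfl | ⟨⟨m, rfl⟩, h⟩)
    · obtain ⟨m, hm⟩ := ha
      exact ⟨m, by rw [if_pos hm]⟩
    · exact ⟨m, by rw [if_neg h]⟩

/-- The result of an operator on semi-infinite words. -/
theorem fock_replace_iff (a b : Zx) (w w' : FockWord) :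
    liftOp FockWord.letter (replaceLetter a b) w = some w' ↔
      (a ∈ Set.range w.letter ∧ b ∉ Set.range w.letter) ∧
      w'.letter = fun m => if w.letter m = a then b else w.letter m := by
  rw [liftOp_eq_some FockWord.letter_injective_map, replaceLetter]
  split_ifs with h
  · rw [Option.some_inj]
    exact ⟨fun e => ⟨h, e.symm⟩, fun e => e.2.symm⟩
  · exact ⟨fun e => by simp at e, fun e => absurd e.1 h⟩

theorem fock_replace_symm {a b : Zx} (hab : a ≠ b) {w w' : FockWord}
    (h : liftOp FockWord.letter (replaceLetter a b) w = some w') :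
    liftOp FockWord.letter (replaceLetter b a) w' = some w := by
  rw [fock_replace_iff a b] at h
  rw [fock_replace_iff b a]
  obtain ⟨⟨h1, h2⟩, h3⟩ := h
  rw [h3, range_replace a b _ h1]
  refine ⟨⟨Or.inl rfl, ?_⟩, ?_⟩
  · rintro (h | ⟨-, h⟩)
    · exact hab h
    · exact h rfl
  · funext m
    by_cases hm : w.letter m = a
    · simp [hm]
    · have : w.letter m ≠ b := fun h => h2 ⟨m, h⟩
      simp [hm, this]

open Classical in
/-- The value of `ε` on semi-infinite words. -/
def fockE (i : ℤ) (w : FockWord) : ℕ :=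
  if hi i ∈ Set.range w.letter ∧ lo i ∉ Set.range w.letter then 1 else 0

open Classical in
/-- The value of `φ` on semi-infinite words. -/
def fockP (i : ℤ) (w : FockWord) : ℕ :=
  if lo i ∈ Set.range w.letter ∧ hi i ∉ Set.range w.letter then 1 else 0

theorem FockWord.wt_eq_iff (w w' : FockWord) (v : Zx →₀ ℤ)
    (h : ∀ k, w'.mult k = w.mult k - v k) : w'.wt = w.wt - (v, 0) := by
  unfold FockWord.wt
  ext k
  · simp only [lamZero, Finsupp.ofSupportFinite_coe, Prod.fst_add, Prod.fst_sub, Finsupp.coe_add,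
      Finsupp.coe_sub, Pi.add_apply, Pi.sub_apply, h]
    ring
  · simp

theorem goodAt_fock (i : ℤ) : fock.GoodAt i (fockE i) (fockP i) where
  eps b := by
    simp only [fock, fockE]
    split_ifs <;> rfl
  phi b := by
    simp only [fock, fockP]
    split_ifs <;> rfl
  wt b := by
    classical
    simp only [fock, FockWord.wt, coroot, lamZero, Finsupp.ofSupportFinite_coe, Prod.fst_add,
      Prod.snd_add, Finsupp.coe_add, Pi.add_apply, FockWord.mult_eq, fockE, fockP]
    -- The correction `-1` at negative letters cancels between `lo i` and `hi i` for `i < 0` and is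
    -- absent for `i > 0`. For `i = 0` it affects `lo i` only and is compensated by the coefficient
    -- of `Λ_0`.
    have h1 : ((lo i : Zx) : ℤ) < 0 ↔ i ≤ 0 := by
      simp only [lo]; split_ifs <;> omega
    have h2 : ((hi i : Zx) : ℤ) < 0 ↔ i < 0 := by
      simp only [hi]; split_ifs <;> omega
    simp only [h1, h2]
    by_cases h3 : lo i ∈ Set.range b.letter <;> by_cases h4 : hi i ∈ Set.range b.letter <;>
      simp only [h3, h4, not_true, not_false_iff, and_true, and_false, if_true, if_false,
        Finsupp.coe_zero, Pi.zero_apply] <;> split_ifs <;> omega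
  f_some b b' hb := by
    classical
    change liftOp FockWord.letter (replaceLetter (lo i) (hi i)) b = some b' at hb
    rw [fock_replace_iff] at hb
    obtain ⟨⟨h1, h2⟩, h3⟩ := hb
    have hr : ∀ z, z ∈ Set.range b'.letter ↔ z = hi i ∨ (z ∈ Set.range b.letter ∧ z ≠ lo i) := by
      intro z
      rw [h3, range_replace _ _ _ h1]; rfl
    have e1 : hi i ∈ Set.range b'.letter := (hr _).2 (Or.inl rfl)
    have e2 : lo i ∉ Set.range b'.letter := by
      rw [hr]
      rintro (h | ⟨-, h⟩)
      · exact lo_ne_hi i h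
      · exact h rfl
    refine ⟨?_, ?_, ?_⟩
    · simp [fockE, h1, h2, e1, e2]
    · simp [fockP, h1, h2, e1, e2]
    · have : root i = (Finsupp.single (lo i) 1 - Finsupp.single (hi i) 1, 0) := by
        simp [root, epsW]
      rw [this]
      apply FockWord.wt_eq_iff
      intro k
      rw [FockWord.mult_eq, FockWord.mult_eq]
      simp only [hr, Finsupp.coe_sub, Pi.sub_apply, Finsupp.single_apply]
      by_cases h4 : k = lo i
      · subst h4
        simp [lo_ne_hi, (lo_ne_hi i).symm, h1]
      · by_cases h5 : k = hi i
        · subst h5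
          simp [h4, Ne.symm h4, h2]
          ring
        · simp [h4, h5, Ne.symm h4, Ne.symm h5]
  f_iff_e b b' := ⟨fun h => fock_replace_symm (lo_ne_hi i) h,
    fun h => fock_replace_symm (lo_ne_hi i).symm h⟩

/-- Tensoring with a one-point crystal keeps `ε` and the operators but shifts `φ_0`, possibly below
zero, so that `GoodAt` is not available and the axioms are transferred one by one. For `f` to act on
the tableau it is needed that its `φ` is never `-∞`. -/
theorem isCrystal_shiftedB (μ ν : YoungDiagram) (n : ℕ) : (shiftedB μ ν n).IsCrystal := by
  apply isCrystal_of_axiomsAt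
  intro i
  have hinj : Function.Injective (fun w : BSet μ ν n => List.ofFn w.col) := by
    intro w w' h
    exact SemiInfSST.ext (List.ofFn_injective h)
  have h := ((goodAt_fock i).words.pullback hinj).axiomsAt
  have hphi : ∀ b, (semiInfCrystal (lamOf μ ν n)).phi i b ≠ ⊥ := by
    intro b
    have := ((goodAt_fock i).words.pullback hinj).phi b
    change (semiInfCrystal (lamOf μ ν n)).phi i b = _ at this
    rw [this]
    exact WithBot.coe_ne_bot
  have hc : coroot i (-((n : ℤ) • lamZero)) = coroot i (-((n : ℤ) • lamZero)) := rfl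
  change (semiInfCrystal (lamOf μ ν n)).AxiomsAt i at h
  have eps_eq : ∀ b, (shiftedB μ ν n).eps i b = (semiInfCrystal (lamOf μ ν n)).eps i b.1 := by
    intro b
    simp [shiftedB, PreCrystal.tensor, PreCrystal.single]
  have phi_eq : ∀ b, (shiftedB μ ν n).phi i b = (semiInfCrystal (lamOf μ ν n)).phi i b.1 +
      ((coroot i (-((n : ℤ) • lamZero)) : ℤ) : WithBot ℤ) := by
    intro b
    simp [shiftedB, PreCrystal.tensor, PreCrystal.single]
  have e_eq : ∀ b, (shiftedB μ ν n).e i b =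
      ((semiInfCrystal (lamOf μ ν n)).e i b.1).map fun b' => (b', b.2) := by
    intro b
    simp [shiftedB, PreCrystal.tensor, PreCrystal.single]
  have f_eq : ∀ b, (shiftedB μ ν n).f i b =
      ((semiInfCrystal (lamOf μ ν n)).f i b.1).map fun b' => (b', b.2) := by
    intro b
    simp [shiftedB, PreCrystal.tensor, PreCrystal.single, bot_lt_iff_ne_bot, hphi]
  have wt_eq : ∀ b, (shiftedB μ ν n).wt b =
      (semiInfCrystal (lamOf μ ν n)).wt b.1 + -((n : ℤ) • lamZero) := fun b => rfl
  constructor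
  · intro b
    rw [phi_eq, eps_eq, wt_eq, h.phi_eq, coroot_add, WithBot.coe_add]
    abel
  · rintro ⟨b, u⟩ ⟨b', u'⟩ hb
    rw [e_eq] at hb
    simp only [Option.map_eq_some_iff, Prod.mk.injEq] at hb
    obtain ⟨a, h2, rfl, -⟩ := hb
    obtain ⟨h3, h4, h5⟩ := h.e_some _ _ h2
    refine ⟨by rw [eps_eq, eps_eq, h3], ?_, ?_⟩
    · rw [phi_eq, phi_eq, h4]; abel
    · rw [wt_eq, wt_eq, h5]; abel
  · rintro ⟨b, u⟩ ⟨b', u'⟩ hb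
    rw [f_eq] at hb
    simp only [Option.map_eq_some_iff, Prod.mk.injEq] at hb
    obtain ⟨a, h2, rfl, -⟩ := hb
    obtain ⟨h3, h4, h5⟩ := h.f_some _ _ h2
    refine ⟨by rw [eps_eq, eps_eq, h3], ?_, ?_⟩
    · rw [phi_eq, phi_eq, h4]; abel
    · rw [wt_eq, wt_eq, h5]; abel
  · rintro ⟨b, u⟩ ⟨b', u'⟩
    rw [f_eq, e_eq]
    simp [h.f_iff_e]
  · intro b hb
    rw [phi_eq] at hb
    simp [WithBot.add_eq_bot, hphi] at hb

end

end GlInf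

namespace GlInf

noncomputable section

open PreCrystal

/-! ## The words of a matrix -/

/-- The entries of a matrix, with indices starting from `0`. -/
def matFun (A : Mat) (k j : ℕ) : ℕ := A (k.succPNat, j.succPNat)

/-- Reconciles the equality tests on pairs that are used by the two counting functions. -/
theorem coe_count_pair (l : List (ℕ+ × ℕ+)) (p : ℕ+ × ℕ+) :
    Multiset.count p (l : Multiset (ℕ+ × ℕ+)) = l.count p := by
  rw [Multiset.coe_count]
  congr 1
  exact lawful_beq_subsingleton _ _

theorem omegaWord_pairwise (A : Mat) : (omegaWord A).Pairwise omegaLE := by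
  unfold omegaWord
  rw [List.pairwise_map]
  exact Multiset.pairwise_sort (((Finsupp.toMultiset A).map Prod.swap)) readLE

theorem omegaWord_count (A : Mat) (p : ℕ+ × ℕ+) : (omegaWord A).count p = A p := by
  unfold omegaWord
  have h : ((((Finsupp.toMultiset A).map Prod.swap).sort readLE).map Prod.swap : Multiset (ℕ+ × ℕ+))
      = Finsupp.toMultiset A := by
    rw [← Multiset.map_coe, Multiset.sort_eq, Multiset.map_map]
    simp
  rw [← coe_count_pair, h, Finsupp.count_toMultiset]

theorem omegaWord'_pairwise (A : Mat) : (omegaWord' A).Pairwise readLE :=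
  Multiset.pairwise_sort _ _

theorem omegaWord'_count (A : Mat) (p : ℕ+ × ℕ+) : (omegaWord' A).count p = A p := by
  rw [omegaWord', ← coe_count_pair, Multiset.sort_eq, Finsupp.count_toMultiset]

/-- The order `omegaLE` is antisymmetric, so a sorted list is determined by its multiplicities.
Explicit descriptions of the biword are recognised in this way. -/
theorem eq_omegaWord {A : Mat} {L : List (ℕ+ × ℕ+)} (hL : L.Pairwise omegaLE)
    (h : ∀ p, L.count p = A p) : omegaWord A = L := by
  refine List.Perm.eq_of_pairwise ?_ (omegaWord_pairwise A) hL
    (List.perm_iff_count.2 fun p => by rw [omegaWord_count, h])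
  rintro ⟨a, b⟩ ⟨c, d⟩ - - h1 h2
  simp only [omegaLE] at h1 h2
  have h3 : b = d := by
    rcases h1 with h1 | h1 <;> rcases h2 with h2 | h2
    · exact absurd h1 h2.asymm
    · exact h2.1.symm
    · exact h1.1
    · exact h1.1
  subst h3
  simp only [lt_irrefl, true_and, false_or] at h1 h2
  rw [le_antisymm h1 h2]

theorem eq_omegaWord' {A : Mat} {L : List (ℕ+ × ℕ+)} (hL : L.Pairwise readLE)
    (h : ∀ p, L.count p = A p) : omegaWord' A = L :=
  List.Perm.eq_of_pairwise (fun _ _ _ _ h1 h2 => antisymm_of readLE h1 h2)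
    (omegaWord'_pairwise A) hL (List.perm_iff_count.2 fun p => by rw [omegaWord'_count, h])

theorem list_eq_of_fst_snd {α β : Type*} {l l' : List (α × β)} (h1 : l.map Prod.fst = l'.map Prod.fst)
    (h2 : l.map Prod.snd = l'.map Prod.snd) : l = l' := by
  have := congrArg₂ List.zip h1 h2
  rwa [List.zip_map', List.zip_map', List.map_id', List.map_id'] at this

theorem omegaWord_injective : Function.Injective omegaWord := by
  intro A B h
  ext p
  rw [← omegaWord_count, h, omegaWord_count]

theorem biword_injective : Function.Injective biword := by
  intro A B h
  simp only [biword, Prod.mk.injEq] at h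
  exact omegaWord_injective (list_eq_of_fst_snd h.1 h.2)

theorem biword'_injective : Function.Injective biword' := by
  intro A B h
  simp only [biword', Prod.mk.injEq] at h
  have := list_eq_of_fst_snd h.1 h.2
  ext p
  rw [← omegaWord'_count, this, omegaWord'_count]

theorem matWt_eq_sum (A : Mat) : matWt A =
    ((Finsupp.toMultiset A).map fun p => -epsW (negL p.1) + epsW (posL p.2)).sum := by
  unfold matWt
  induction A using Finsupp.induction with
  | zero => simp
  | single_add p a f h1 h2 ih =>
    rw [Finsupp.sum_add_index' (by simp) (by intros; rw [add_smul]), ih, map_add,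
      Multiset.map_add, Multiset.sum_add, Finsupp.sum_single_index (by simp),
      Finsupp.toMultiset_single, Multiset.map_nsmul, Multiset.map_singleton, Multiset.sum_nsmul,
      Multiset.sum_singleton]

theorem sum_words_wt (l : List (ℕ+ × ℕ+)) :
    (l.map fun p => -epsW (negL p.1) + epsW (posL p.2)).sum =
      vecNeg.words.wt (l.map Prod.fst) + vecPos.words.wt (l.map Prod.snd) := by
  induction l with
  | nil => simp [PreCrystal.words]
  | cons a l ih =>
    rw [List.map_cons, List.sum_cons, ih]
    simp only [PreCrystal.words, List.map_cons, List.sum_cons, vecNeg, vecPos]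
    abel

theorem matWt_biword (A : Mat) :
    matWt A = vecNeg.words.wt (biword A).1 + vecPos.words.wt (biword A).2 := by
  rw [biword, ← sum_words_wt, matWt_eq_sum]
  have h : ((omegaWord A : List (ℕ+ × ℕ+)) : Multiset (ℕ+ × ℕ+)) = Finsupp.toMultiset A := by
    ext p
    rw [coe_count_pair, omegaWord_count, Finsupp.count_toMultiset]
  rw [← h, Multiset.map_coe, Multiset.sum_coe]

theorem matWt_biword' (A : Mat) :
    matWt A = vecNeg.words.wt (biword' A).1 + vecPos.words.wt (biword' A).2 := by
  rw [biword', ← sum_words_wt, matWt_eq_sum]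
  have h : ((omegaWord' A : List (ℕ+ × ℕ+)) : Multiset (ℕ+ × ℕ+)) = Finsupp.toMultiset A := by
    ext p
    rw [coe_count_pair, omegaWord'_count, Finsupp.count_toMultiset]
  rw [← h, Multiset.map_coe, Multiset.sum_coe]

theorem coroot_words_neg {i : ℤ} (hi : 0 < i) (w : List ℕ+) : coroot i (vecNeg.words.wt w) = 0 := by
  induction w with
  | nil => simp [PreCrystal.words, coroot_zero]
  | cons a w ih =>
    simp only [PreCrystal.words, List.map_cons, List.sum_cons, coroot_add] at ih ⊢
    rw [ih, vecNeg, coroot_neg, coroot_negL_of_pos hi]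
    rfl

theorem coroot_words_pos {i : ℤ} (hi : i < 0) (w : List ℕ+) : coroot i (vecPos.words.wt w) = 0 := by
  induction w with
  | nil => simp [PreCrystal.words, coroot_zero]
  | cons a w ih =>
    simp only [PreCrystal.words, List.map_cons, List.sum_cons, coroot_add] at ih ⊢
    rw [ih, vecPos, coroot_posL_of_neg hi]
    rfl

theorem mat_f_neg {i : ℤ} (hi : i < 0) (A B : Mat) : matCrystal.f i A = some B ↔
    vecNeg.words.f i (biword A).1 = some (biword B).1 ∧ (biword A).2 = (biword B).2 := by
  simp only [matCrystal, hi, if_true]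
  rw [liftOp_eq_some biword_injective]
  simp only [Option.map_eq_some_iff, Prod.ext_iff]
  constructor
  · rintro ⟨a, h1, h2, h3⟩
    exact ⟨h2 ▸ h1, h3⟩
  · rintro ⟨h1, h3⟩
    exact ⟨_, h1, rfl, h3⟩

theorem mat_f_pos {i : ℤ} (hi : 0 < i) (A B : Mat) : matCrystal.f i A = some B ↔
    vecPos.words.f i (biword' A).2 = some (biword' B).2 ∧ (biword' A).1 = (biword' B).1 := by
  simp only [matCrystal, hi, hi.not_gt, if_true, if_false]
  rw [liftOp_eq_some biword'_injective]
  simp only [Option.map_eq_some_iff, Prod.ext_iff]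
  constructor
  · rintro ⟨a, h1, h2, h3⟩
    exact ⟨h3 ▸ h1, h2⟩
  · rintro ⟨h1, h3⟩
    exact ⟨_, h1, h3, rfl⟩

theorem mat_e_neg {i : ℤ} (hi : i < 0) (A B : Mat) : matCrystal.e i A = some B ↔
    vecNeg.words.e i (biword A).1 = some (biword B).1 ∧ (biword A).2 = (biword B).2 := by
  simp only [matCrystal, hi, if_true]
  rw [liftOp_eq_some biword_injective]
  simp only [Option.map_eq_some_iff, Prod.ext_iff]
  constructor
  · rintro ⟨a, h1, h2, h3⟩
    exact ⟨h2 ▸ h1, h3⟩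
  · rintro ⟨h1, h3⟩
    exact ⟨_, h1, rfl, h3⟩

theorem mat_e_pos {i : ℤ} (hi : 0 < i) (A B : Mat) : matCrystal.e i A = some B ↔
    vecPos.words.e i (biword' A).2 = some (biword' B).2 ∧ (biword' A).1 = (biword' B).1 := by
  simp only [matCrystal, hi, hi.not_gt, if_true, if_false]
  rw [liftOp_eq_some biword'_injective]
  simp only [Option.map_eq_some_iff, Prod.ext_iff]
  constructor
  · rintro ⟨a, h1, h2, h3⟩
    exact ⟨h3 ▸ h1, h2⟩
  · rintro ⟨h1, h3⟩
    exact ⟨_, h1, h3, rfl⟩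

/-- The labels have weights orthogonal to `h_i` for `i < 0`, so the pairing sees the word of letters
only. -/
theorem goodAt_mat_neg {i : ℤ} (hi : i < 0) : matCrystal.GoodAt i
    (fun A => (listSig (letE (-i)) (letP (-i)) (biword A).1).e)
    (fun A => (listSig (letE (-i)) (letP (-i)) (biword A).1).p) where
  eps A := by
    simp only [matCrystal, hi, if_true]
    exact (goodAt_vecNeg hi).words.eps _
  phi A := by
    simp only [matCrystal, hi, if_true]
    exact (goodAt_vecNeg hi).words.phi _
  wt A := by
    change coroot i (matWt A) = _
    rw [matWt_biword, coroot_add, coroot_words_pos hi, add_zero]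
    exact (goodAt_vecNeg hi).words.wt _
  f_some A B h := by
    rw [mat_f_neg hi] at h
    obtain ⟨h1, h2⟩ := h
    obtain ⟨h3, h4, h5⟩ := (goodAt_vecNeg hi).words.f_some _ _ h1
    refine ⟨h3, h4, ?_⟩
    change matWt B = matWt A - _
    rw [matWt_biword, matWt_biword, h5, h2]
    abel
  f_iff_e A B := by
    rw [mat_f_neg hi, mat_e_neg hi, (goodAt_vecNeg hi).words.f_iff_e, eq_comm (a := (biword A).2)]

theorem goodAt_mat_pos {i : ℤ} (hi : 0 < i) : matCrystal.GoodAt i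
    (fun A => (listSig (letE i) (letP i) (biword' A).2).e)
    (fun A => (listSig (letE i) (letP i) (biword' A).2).p) where
  eps A := by
    simp only [matCrystal, hi, hi.not_gt, if_true, if_false]
    exact (goodAt_vecPos hi).words.eps _
  phi A := by
    simp only [matCrystal, hi, hi.not_gt, if_true, if_false]
    exact (goodAt_vecPos hi).words.phi _
  wt A := by
    change coroot i (matWt A) = _
    rw [matWt_biword', coroot_add, coroot_words_neg hi, zero_add]
    exact (goodAt_vecPos hi).words.wt _
  f_some A B h := by
    rw [mat_f_pos hi] at h
    obtain ⟨h1, h2⟩ := h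
    obtain ⟨h3, h4, h5⟩ := (goodAt_vecPos hi).words.f_some _ _ h1
    refine ⟨h3, h4, ?_⟩
    change matWt B = matWt A - _
    rw [matWt_biword', matWt_biword', h5, h2]
    abel
  f_iff_e A B := by
    rw [mat_f_pos hi, mat_e_pos hi, (goodAt_vecPos hi).words.f_iff_e, eq_comm (a := (biword' A).1)]

/-! ### The crystal `ℳ_{μ,ν}` -/

theorem SST.word_injective {D : Finset (ℤ × ℤ)} : Function.Injective (SST.word (D := D)) := by
  intro S T h
  apply SST.ext
  funext p
  by_cases hp : p ∈ D
  · exact List.map_inj_left.1 h p (by simpa using hp)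
  · rw [S.outside p hp, T.outside p hp]

theorem goodAt_sst {L : PreCrystal ℕ+} {i : ℤ} {ε φ : ℕ+ → ℕ} (h : L.GoodAt i ε φ)
    (D : Finset (ℤ × ℤ)) : (sstCrystal L D).GoodAt i
      (fun T => (listSig ε φ T.word).e) (fun T => (listSig ε φ T.word).p) :=
  h.words.pullback SST.word_injective

/-- Pairs are compared componentwise; in contrast to concatenation of words, the comparison is
therefore exactly multiplicative. -/
theorem GoodAt.tensor_fac {B C : Type} {X : PreCrystal B} {Y : PreCrystal C} {i : ℤ} {ε φ : B → ℕ}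
    {ε' φ' : C → ℕ} (h : X.GoodAt i ε φ) (g : Y.GoodAt i ε' φ') (b b' : B) (c c' : C) :
    (PreCrystal.GoodAt.tensor h g).fac (b, c) (b', c') = h.fac b b' * g.fac c c' := by
  apply Fac.ext'
  · rfl
  · rfl
  · rw [Fac.mul_R]
    change (X.tensor Y).f i (b, c) = some (b', c') ↔ (ε' c < φ b ∧ X.f i b = some b' ∧ c = c') ∨
      (φ b ≤ ε' c ∧ b = b' ∧ Y.f i c = some c')
    simp only [PreCrystal.tensor, h.phi, g.eps, WithBot.coe_lt_coe, Nat.cast_lt]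
    split_ifs with h1
    · simp only [Option.map_eq_some_iff, Prod.mk.injEq, h1, h1.not_ge, true_and, false_and, or_false]
      exact ⟨fun ⟨a, h2, h3, h4⟩ => ⟨h3 ▸ h2, h4⟩, fun ⟨h2, h3⟩ => ⟨_, h2, rfl, h3⟩⟩
    · simp only [Option.map_eq_some_iff, Prod.mk.injEq, h1, not_lt.1 h1, true_and, false_and,
        false_or]
      exact ⟨fun ⟨a, h2, h3, h4⟩ => ⟨h3, h4 ▸ h2⟩, fun ⟨h2, h3⟩ => ⟨_, h3, h2, rfl⟩⟩
  · rw [Fac.mul_E]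
    exact Prod.ext_iff

section verma

variable {μ ν : YoungDiagram}

/-- The signature of the part of an element of `ℳ_{μ,ν}` which is seen by a negative colour. -/
def negSig (i : ℤ) (b : Mat × SST (antinormalShape μ)) : Fac :=
  listSig (letE (-i)) (letP (-i)) (biword b.1).1 * listSig (letE (-i)) (letP (-i)) b.2.word

/-- The signature of the part of an element of `ℳ_{μ,ν}` which is seen by a positive colour. -/
def posSig (i : ℤ) (b : Mat × SST (normalShape ν)) : Fac :=
  listSig (letE i) (letP i) (biword' b.1).2 * listSig (letE i) (letP i) b.2.word

theorem goodAt_negPart (μ : YoungDiagram) {i : ℤ} (hi : i < 0) :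
    (matCrystal.tensor (sstCrystal vecNeg (antinormalShape μ))).GoodAt i
      (fun b => (negSig i b).e) (fun b => (negSig i b).p) :=
  (goodAt_mat_neg hi).tensor (goodAt_sst (goodAt_vecNeg hi) _)

theorem goodAt_posPart (ν : YoungDiagram) {i : ℤ} (hi : 0 < i) :
    (matCrystal.tensor (sstCrystal vecPos (normalShape ν))).GoodAt i
      (fun b => (posSig i b).e) (fun b => (posSig i b).p) :=
  (goodAt_mat_pos hi).tensor (goodAt_sst (goodAt_vecPos hi) _)

theorem verma_f_neg {i : ℤ} (hi : i < 0) (x y : Verma μ ν) : (vermaCrystal μ ν).f i x = some y ↔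
    (matCrystal.tensor (sstCrystal vecNeg (antinormalShape μ))).f i (x.1, x.2.1) =
      some (y.1, y.2.1) ∧ x.2.2 = y.2.2 := by
  simp only [vermaCrystal, hi, if_true, Option.map_eq_some_iff]
  obtain ⟨y1, y2, y3⟩ := y
  simp only [Prod.mk.injEq]
  constructor
  · rintro ⟨a, h1, rfl, rfl, rfl⟩
    exact ⟨h1, rfl⟩
  · rintro ⟨h1, rfl⟩
    exact ⟨_, h1, rfl, rfl, rfl⟩

theorem verma_f_pos {i : ℤ} (hi : 0 < i) (x y : Verma μ ν) : (vermaCrystal μ ν).f i x = some y ↔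
    (matCrystal.tensor (sstCrystal vecPos (normalShape ν))).f i (x.1, x.2.2) =
      some (y.1, y.2.2) ∧ x.2.1 = y.2.1 := by
  simp only [vermaCrystal, hi, hi.not_gt, if_true, if_false, Option.map_eq_some_iff]
  obtain ⟨y1, y2, y3⟩ := y
  simp only [Prod.mk.injEq]
  constructor
  · rintro ⟨a, h1, rfl, rfl, rfl⟩
    exact ⟨h1, rfl⟩
  · rintro ⟨h1, rfl⟩
    exact ⟨_, h1, rfl, rfl, rfl⟩

theorem verma_e_neg {i : ℤ} (hi : i < 0) (x y : Verma μ ν) : (vermaCrystal μ ν).e i x = some y ↔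
    (matCrystal.tensor (sstCrystal vecNeg (antinormalShape μ))).e i (x.1, x.2.1) =
      some (y.1, y.2.1) ∧ x.2.2 = y.2.2 := by
  simp only [vermaCrystal, hi, if_true, Option.map_eq_some_iff]
  obtain ⟨y1, y2, y3⟩ := y
  simp only [Prod.mk.injEq]
  constructor
  · rintro ⟨a, h1, rfl, rfl, rfl⟩
    exact ⟨h1, rfl⟩
  · rintro ⟨h1, rfl⟩
    exact ⟨_, h1, rfl, rfl, rfl⟩

theorem verma_e_pos {i : ℤ} (hi : 0 < i) (x y : Verma μ ν) : (vermaCrystal μ ν).e i x = some y ↔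
    (matCrystal.tensor (sstCrystal vecPos (normalShape ν))).e i (x.1, x.2.2) =
      some (y.1, y.2.2) ∧ x.2.1 = y.2.1 := by
  simp only [vermaCrystal, hi, hi.not_gt, if_true, if_false, Option.map_eq_some_iff]
  obtain ⟨y1, y2, y3⟩ := y
  simp only [Prod.mk.injEq]
  constructor
  · rintro ⟨a, h1, rfl, rfl, rfl⟩
    exact ⟨h1, rfl⟩
  · rintro ⟨h1, rfl⟩
    exact ⟨_, h1, rfl, rfl, rfl⟩

theorem goodAt_verma_neg {i : ℤ} (hi : i < 0) : (vermaCrystal μ ν).GoodAt i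
    (fun x => (negSig i (x.1, x.2.1)).e)
    (fun x => (negSig i (x.1, x.2.1)).p) where
  eps x := by
    simp only [vermaCrystal, hi, if_true]
    exact (goodAt_negPart μ hi).eps (x.1, x.2.1)
  phi x := by
    simp only [vermaCrystal, hi, if_true]
    exact (goodAt_negPart μ hi).phi (x.1, x.2.1)
  wt x := by
    change coroot i (vermaWt x) = _
    rw [vermaWt, coroot_add]
    change _ + coroot i (vecPos.words.wt x.2.2.word) = _
    rw [coroot_words_pos hi, add_zero]
    exact (goodAt_negPart μ hi).wt (x.1, x.2.1)
  f_some x y h := by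
    rw [verma_f_neg hi] at h
    obtain ⟨h1, h2⟩ := h
    obtain ⟨h3, h4, h5⟩ := (goodAt_negPart μ hi).f_some (x.1, x.2.1) (y.1, y.2.1) h1
    refine ⟨h3, h4, ?_⟩
    change vermaWt y = vermaWt x - _
    change matWt y.1 + (sstCrystal vecNeg (antinormalShape μ)).wt y.2.1 =
      matWt x.1 + (sstCrystal vecNeg (antinormalShape μ)).wt x.2.1 - root i at h5
    rw [vermaWt, vermaWt, h5, h2]
    abel
  f_iff_e x y := by
    rw [verma_f_neg hi, verma_e_neg hi, (goodAt_negPart μ hi).f_iff_e, eq_comm (a := x.2.2)]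

theorem goodAt_verma_pos {i : ℤ} (hi : 0 < i) : (vermaCrystal μ ν).GoodAt i
    (fun x => (posSig i (x.1, x.2.2)).e)
    (fun x => (posSig i (x.1, x.2.2)).p) where
  eps x := by
    simp only [vermaCrystal, hi, hi.not_gt, if_true, if_false]
    exact (goodAt_posPart ν hi).eps (x.1, x.2.2)
  phi x := by
    simp only [vermaCrystal, hi, hi.not_gt, if_true, if_false]
    exact (goodAt_posPart ν hi).phi (x.1, x.2.2)
  wt x := by
    change coroot i (vermaWt x) = _
    rw [vermaWt, add_right_comm, coroot_add]
    change _ + coroot i (vecNeg.words.wt x.2.1.word) = _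
    rw [coroot_words_neg hi, add_zero]
    exact (goodAt_posPart ν hi).wt (x.1, x.2.2)
  f_some x y h := by
    rw [verma_f_pos hi] at h
    obtain ⟨h1, h2⟩ := h
    obtain ⟨h3, h4, h5⟩ := (goodAt_posPart ν hi).f_some (x.1, x.2.2) (y.1, y.2.2) h1
    refine ⟨h3, h4, ?_⟩
    change vermaWt y = vermaWt x - _
    change matWt y.1 + (sstCrystal vecPos (normalShape ν)).wt y.2.2 =
      matWt x.1 + (sstCrystal vecPos (normalShape ν)).wt x.2.2 - root i at h5
    rw [vermaWt, vermaWt, add_right_comm, h5, h2]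
    abel
  f_iff_e x y := by
    rw [verma_f_pos hi, verma_e_pos hi, (goodAt_posPart ν hi).f_iff_e, eq_comm (a := x.2.1)]

theorem root_zero : root 0 = epsW (negL 1) - epsW (posL 1) := by
  simp [root, lo, hi, negL, posL]

theorem matWt_add_single (A : Mat) : matWt (A + Finsupp.single (1, 1) 1) = matWt A - root 0 := by
  unfold matWt
  rw [Finsupp.sum_add_index' (by simp) (by intros; rw [add_smul]),
    Finsupp.sum_single_index (by simp), one_smul, root_zero]
  abel

theorem verma_f_zero (x y : Verma μ ν) : (vermaCrystal μ ν).f 0 x = some y ↔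
    y = (x.1 + Finsupp.single (1, 1) 1, x.2) := by
  simp [vermaCrystal, matCrystal, eq_comm]

theorem verma_f_zero_iff_e (x y : Verma μ ν) :
    (vermaCrystal μ ν).f 0 x = some y ↔ (vermaCrystal μ ν).e 0 y = some x := by
  rw [verma_f_zero]
  obtain ⟨A, s⟩ := x
  obtain ⟨B, t⟩ := y
  simp only [vermaCrystal, matCrystal, lt_irrefl, if_false, Prod.mk.injEq]
  constructor
  · rintro ⟨rfl, rfl⟩
    rw [if_pos (by simp)]
    simp
  · split_ifs with h
    · simp only [Option.map_some, Option.some.injEq, Prod.mk.injEq]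
      rintro ⟨rfl, rfl⟩
      refine ⟨?_, rfl⟩
      rw [tsub_add_cancel_of_le]
      rw [Finsupp.single_le_iff]
      omega
    · simp

/-- Here `φ_0` is defined through the weight and may be negative, so `GoodAt` does not apply. Its
change under an operator results from `⟨α_0, h_0⟩ = 2` and the change of `ε_0` by one. -/
theorem axiomsAt_verma_zero : (vermaCrystal μ ν).AxiomsAt 0 := by
  have eps_eq : ∀ x : Verma μ ν, (vermaCrystal μ ν).eps 0 x = ((x.1 (1, 1) : ℤ) : WithBot ℤ) := by
    intro x
    simp [vermaCrystal, matCrystal]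
  have phi_eq : ∀ x : Verma μ ν, (vermaCrystal μ ν).phi 0 x =
      ((coroot 0 (vermaWt x) + (x.1 (1, 1) : ℤ) : ℤ) : WithBot ℤ) := by
    intro x
    simp [vermaCrystal, matCrystal]
  have hf : ∀ x y : Verma μ ν, (vermaCrystal μ ν).f 0 x = some y →
      y.1 (1, 1) = x.1 (1, 1) + 1 ∧ vermaWt y = vermaWt x - root 0 := by
    intro x y h
    rw [verma_f_zero] at h
    subst h
    refine ⟨by simp, ?_⟩
    simp only [vermaWt, matWt_add_single]
    abel
  have hr : coroot 0 (root 0) = 2 := by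
    rw [root, sub_eq_add_neg, coroot_add, coroot_neg, coroot_epsW, coroot_epsW]
    simp [lo_ne_hi, (lo_ne_hi 0).symm]
  have hsub : ∀ a b, coroot 0 (a - b) = coroot 0 a - coroot 0 b := by
    intro a b
    rw [sub_eq_add_neg, coroot_add, coroot_neg, sub_eq_add_neg]
  constructor
  · intro x
    rw [phi_eq, eps_eq, ← WithBot.coe_add]
    rfl
  · intro x y h
    rw [← verma_f_zero_iff_e] at h
    obtain ⟨h1, h2⟩ := hf _ _ h
    simp only [eps_eq, phi_eq, ← WithBot.coe_add, WithBot.coe_inj]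
    change _ ∧ _ ∧ vermaWt y = vermaWt x + _
    rw [h1, h2, hsub, hr]
    refine ⟨by omega, by omega, by abel⟩
  · intro x y h
    obtain ⟨h1, h2⟩ := hf _ _ h
    simp only [eps_eq, phi_eq, ← WithBot.coe_add, WithBot.coe_inj]
    change _ ∧ _ ∧ vermaWt y = vermaWt x - _
    rw [h1, h2, hsub, hr]
    refine ⟨by omega, by omega, rfl⟩
  · exact verma_f_zero_iff_e
  · intro x h
    rw [phi_eq] at h
    exact absurd h WithBot.coe_ne_bot

theorem isCrystal_verma (μ ν : YoungDiagram) : (vermaCrystal μ ν).IsCrystal := by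
  apply isCrystal_of_axiomsAt
  intro i
  rcases lt_trichotomy i 0 with h | rfl | h
  · exact (goodAt_verma_neg h).axiomsAt
  · exact axiomsAt_verma_zero
  · exact (goodAt_verma_pos h).axiomsAt

end verma

end

end GlInf

namespace GlInf

noncomputable section

open PreCrystal

/-! ## The signature of a matrix -/

theorem listSig_append {B : Type} (ε φ : B → ℕ) (u v : List B) :
    listSig ε φ (u ++ v) = listSig ε φ u * listSig ε φ v := by
  simp [listSig]

theorem listSig_eq_one {B : Type} (ε φ : B → ℕ) (u : List B) (h : ∀ x ∈ u, ε x = 0 ∧ φ x = 0) :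
    listSig ε φ u = 1 := by
  induction u with
  | nil => rfl
  | cons a u ih =>
    rw [listSig, List.map_cons, List.prod_cons]
    change _ * listSig ε φ u = 1
    rw [ih fun x hx => h x (by simp [hx]), mul_one]
    apply Fac.ext' <;> simp [h a (by simp)]

theorem listSig_replicate_e {B : Type} (ε φ : B → ℕ) (m : ℕ) (x : B) (h1 : ε x = 1) (h2 : φ x = 0) :
    (listSig ε φ (List.replicate m x)).e = m ∧ (listSig ε φ (List.replicate m x)).p = 0 := by
  induction m with
  | zero => exact ⟨rfl, rfl⟩
  | succ m ih =>
    rw [List.replicate_succ, (listSig_cons ε φ _ _).1, (listSig_cons ε φ _ _).2]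
    omega

theorem listSig_replicate_p {B : Type} (ε φ : B → ℕ) (m : ℕ) (x : B) (h1 : ε x = 0) (h2 : φ x = 1) :
    (listSig ε φ (List.replicate m x)).e = 0 ∧ (listSig ε φ (List.replicate m x)).p = m := by
  induction m with
  | zero => exact ⟨rfl, rfl⟩
  | succ m ih =>
    rw [List.replicate_succ, (listSig_cons ε φ _ _).1, (listSig_cons ε φ _ _).2]
    omega

/-- The letters on the left have `φ = 0`, so the rule never stops at them; the word on the right has
`ε = 0`, so nothing cancels the `φ` of `a`. -/
theorem PreCrystal.GoodAt.words_f_change {B : Type} {X : PreCrystal B} {i : ℤ} {ε φ : B → ℕ}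
    (h : X.GoodAt i ε φ) (u v : List B) {a a' : B} (hu : ∀ x ∈ u, φ x = 0)
    (hv : (listSig ε φ v).e = 0) (ha : X.f i a = some a') :
    X.words.f i (u ++ a :: v) = some (u ++ a' :: v) := by
  have he : ∀ w : List B, wordEps X i w = (((listSig ε φ w).e : ℤ) : WithBot ℤ) := h.words.eps
  have ha' := (h.f_some _ _ ha).2.1
  induction u with
  | nil =>
    change wordF X i (a :: v) = _
    simp only [wordF, he, h.phi, WithBot.coe_lt_coe, Nat.cast_lt]
    rw [if_pos (by omega), ha]
    rfl
  | cons b u ih =>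
    change wordF X i (b :: (u ++ a :: v)) = _
    simp only [wordF, he, h.phi, WithBot.coe_lt_coe, Nat.cast_lt]
    rw [hu b (by simp), if_neg (by omega)]
    have := ih fun x hx => hu x (by simp [hx])
    change wordF X i (u ++ a :: v) = _ at this
    rw [this]
    rfl

theorem PreCrystal.GoodAt.words_fac_flatMap {B : Type} {X : PreCrystal B} {i : ℤ} {ε φ : B → ℕ}
    (h : X.GoodAt i ε φ) {ι : Type*} (l : List ι) (u v : ι → List B) :
    Fac.Le ((l.map fun x => h.words.fac (u x) (v x)).prod)
      (h.words.fac (l.flatMap u) (l.flatMap v)) := by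
  induction l with
  | nil => exact ⟨rfl, rfl, fun h => h.elim, fun _ => rfl⟩
  | cons a l ih =>
    rw [List.map_cons, List.prod_cons, List.flatMap_cons, List.flatMap_cons]
    exact ((Fac.Le.refl _).mul ih).trans (h.words_fac_append _ _ _ _)

/-- The weakly decreasing word with `a r` letters `r + 1`. -/
def colWord (N : ℕ) (a : ℕ → ℕ) : List ℕ+ :=
  (List.range N).reverse.flatMap fun r => List.replicate (a r) r.succPNat

theorem range_reverse_split {N k : ℕ} (hk : k + 1 < N) : (List.range N).reverse =
    (List.range' (k + 2) (N - (k + 2))).reverse ++ (k + 1) :: k :: (List.range k).reverse := by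
  have : List.range N = List.range k ++ [k, k + 1] ++ List.range' (k + 2) (N - (k + 2)) := by
    rw [List.range_eq_range', List.range_eq_range',
      show [k, k + 1] = List.range' k 2 by rfl]
    have h1 := List.range'_append_1 (s := 0) (m := k) (n := 2)
    have h2 := List.range'_append_1 (s := 0) (m := k + 2) (n := N - (k + 2))
    simp only [zero_add] at h1 h2
    rw [h1, h2]
    congr 1
    omega
  rw [this]
  simp

theorem colWord_split {N k : ℕ} (hk : k + 1 < N) (a : ℕ → ℕ) : colWord N a =
    (List.range' (k + 2) (N - (k + 2))).reverse.flatMap (fun r => List.replicate (a r) r.succPNat) ++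
    (List.replicate (a (k + 1)) (k + 1).succPNat ++ (List.replicate (a k) k.succPNat ++
      (List.range k).reverse.flatMap fun r => List.replicate (a r) r.succPNat)) := by
  rw [colWord, range_reverse_split hk]
  simp [List.flatMap_append, List.flatMap_cons]

theorem letE_succPNat {m : ℤ} {k : ℕ} (hm : m = k + 1) (r : ℕ) :
    letE m r.succPNat = if r = k + 1 then 1 else 0 := by
  simp only [letE, Nat.succPNat_coe, Nat.succ_eq_add_one, Nat.cast_add, Nat.cast_one]
  split_ifs <;> first | rfl | omega

theorem letP_succPNat {m : ℤ} {k : ℕ} (hm : m = k + 1) (r : ℕ) :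
    letP m r.succPNat = if r = k then 1 else 0 := by
  simp only [letP, Nat.succPNat_coe, Nat.succ_eq_add_one, Nat.cast_add, Nat.cast_one]
  split_ifs <;> first | rfl | omega

section letters

variable {X : PreCrystal ℕ+} {i m : ℤ} {k : ℕ}

/-- In a weakly decreasing word the letters of index `k + 1` stand to the left of those of index
`k`. Nothing cancels, and `f` changes the left-most letter of index `k`, after which the word is
still decreasing. So `f` moves one unit from row `k` to row `k + 1`. -/
theorem pairFac_le_colWord (h : X.GoodAt i (letE m) (letP m)) (hm : m = k + 1)
    (hf : X.f i k.succPNat = some (k + 1).succPNat) {N : ℕ} (hk : k + 1 < N) (a b : ℕ → ℕ) :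
    Fac.Le (pairFac (a k) (a (k + 1)) (b k) (b (k + 1)) *
      Fac.ofProp (∀ r < N, r ≠ k → r ≠ k + 1 → a r = b r))
      (h.words.fac (colWord N a) (colWord N b)) := by
  have hE := letE_succPNat hm
  have hP := letP_succPNat hm
  have key : ∀ a : ℕ → ℕ, (listSig (letE m) (letP m) (colWord N a)).e = a (k + 1) ∧
      (listSig (letE m) (letP m) (colWord N a)).p = a k := by
    intro a
    obtain ⟨h1, h2⟩ := listSig_replicate_e (letE m) (letP m) (a (k + 1)) (k + 1).succPNat
      (by simp [hE]) (by simp [hP])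
    obtain ⟨h3, h4⟩ := listSig_replicate_p (letE m) (letP m) (a k) k.succPNat
      (by simp [hE]) (by simp [hP])
    rw [colWord_split hk, listSig_append, listSig_append, listSig_append, listSig_eq_one,
      listSig_eq_one _ _ (List.flatMap _ (List.range k).reverse), mul_one, one_mul, Fac.mul_e,
      Fac.mul_p, h1, h2, h3, h4]
    · omega
    · intro x hx
      simp only [List.mem_flatMap, List.mem_reverse, List.mem_range, List.mem_replicate] at hx
      obtain ⟨r, h5, -, rfl⟩ := hx
      rw [hE, hP, if_neg (by omega), if_neg (by omega)]
      simp
    · intro x hx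
      simp only [List.mem_flatMap, List.mem_reverse, List.mem_range'_1, List.mem_replicate] at hx
      obtain ⟨r, h5, -, rfl⟩ := hx
      rw [hE, hP, if_neg (by omega), if_neg (by omega)]
      simp
  have hcongr : ∀ l : List ℕ, (∀ r ∈ l, r < N ∧ r ≠ k ∧ r ≠ k + 1) →
      (∀ r < N, r ≠ k → r ≠ k + 1 → a r = b r) →
      l.flatMap (fun r => List.replicate (a r) r.succPNat) =
        l.flatMap (fun r => List.replicate (b r) r.succPNat) := by
    intro l hl hab
    induction l with
    | nil => rfl
    | cons r l ih =>
      obtain ⟨h1, h2, h3⟩ := hl r (by simp)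
      rw [List.flatMap_cons, List.flatMap_cons, hab r h1 h2 h3, ih fun r hr => hl r (by simp [hr])]
  refine ⟨?_, ?_, ?_, ?_⟩
  · change _ = (listSig (letE m) (letP m) (colWord N a)).e
    rw [(key a).1]
    simp [Fac.mul_e, pairFac]
  · change _ = (listSig (letE m) (letP m) (colWord N a)).p
    rw [(key a).2]
    simp [Fac.mul_p, pairFac]
  · rw [Fac.mul_ofProp_R]
    rintro ⟨⟨h1, h2⟩, h3⟩
    change X.words.f i (colWord N a) = some (colWord N b)
    rw [colWord_split hk a, colWord_split hk b, hcongr _ ?_ h3, hcongr (List.range k).reverse ?_ h3,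
      h1, h2, List.replicate_succ' (n := a (k + 1)), List.replicate_succ (n := b k)]
    · have := h.words_f_change
        (((List.range' (k + 2) (N - (k + 2))).reverse.flatMap
          fun r => List.replicate (b r) r.succPNat) ++
          List.replicate (a (k + 1)) (k + 1).succPNat)
        (List.replicate (b k) k.succPNat ++
          (List.range k).reverse.flatMap fun r => List.replicate (b r) r.succPNat)
        (a := k.succPNat) (a' := (k + 1).succPNat) ?_ ?_ hf
      · simpa using this
      · intro x hx
        simp only [List.mem_append, List.mem_flatMap, List.mem_reverse, List.mem_range'_1,
          List.mem_replicate] at hx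
        rcases hx with ⟨r, h5, -, rfl⟩ | ⟨-, rfl⟩
        · rw [hP, if_neg (by omega)]
        · rw [hP, if_neg (by omega)]
      · rw [listSig_append, listSig_eq_one _ _ (List.flatMap _ (List.range k).reverse), mul_one]
        · exact (listSig_replicate_p (letE m) (letP m) (b k) k.succPNat
            (by simp [hE]) (by simp [hP])).1
        · intro x hx
          simp only [List.mem_flatMap, List.mem_reverse, List.mem_range, List.mem_replicate] at hx
          obtain ⟨r, h5, -, rfl⟩ := hx
          rw [hE, hP, if_neg (by omega), if_neg (by omega)]
          simp
    · intro r hr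
      simp only [List.mem_reverse, List.mem_range] at hr
      omega
    · intro r hr
      simp only [List.mem_reverse, List.mem_range'_1] at hr
      omega
  · rw [Fac.mul_E]
    rintro ⟨⟨h1, h2⟩, h3⟩
    change colWord N a = colWord N b
    simp only [Fac.ofProp_E] at h3
    rw [colWord_split hk a, colWord_split hk b, hcongr _ ?_ h3, hcongr (List.range k).reverse ?_ h3,
      h1, h2]
    · intro r hr
      simp only [List.mem_reverse, List.mem_range] at hr
      omega
    · intro r hr
      simp only [List.mem_reverse, List.mem_range'_1] at hr
      omega

/-- The first word of the biword of a matrix. -/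
def blockWord (N : ℕ) (a : ℕ → ℕ → ℕ) : List ℕ+ :=
  (List.range' 0 N).flatMap fun j => colWord N fun r => a r j

/-- The word of letters is a concatenation over the labels, so `matFac` is regrouped as a product
over the columns of the matrix, each with its own equalities in the other rows. -/
theorem matFac_le_blockWord (h : X.GoodAt i (letE m) (letP m)) (hm : m = k + 1)
    (hf : X.f i k.succPNat = some (k + 1).succPNat) {N : ℕ} (hk : k + 1 < N) (a b : ℕ → ℕ → ℕ) :
    Fac.Le (matFac N k a b) (h.words.fac (blockWord N a) (blockWord N b)) := by
  have : matFac N k a b = ((List.range' 0 N).map fun j =>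
      pairFac (a k j) (a (k + 1) j) (b k j) (b (k + 1) j) *
        Fac.ofProp (∀ r < N, r ≠ k → r ≠ k + 1 → a r j = b r j)).prod := by
    rw [Fac.prod_map_mul_ofProp, matFac]
    congr 2
    apply propext
    simp only [List.mem_range'_1, Nat.zero_le, true_and, zero_add]
    exact ⟨fun h j hj r hr h1 h2 => h r hr h1 h2 j hj, fun h r hr h1 h2 j hj => h j hj r hr h1 h2⟩
  rw [this]
  refine Fac.Le.trans (Fac.Le.prod_map _ _ _ fun j _ =>
    pairFac_le_colWord h hm hf hk (fun r => a r j) (fun r => b r j)) ?_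
  exact h.words_fac_flatMap _ _ _

end letters

/-- The second word of the biword of a matrix. -/
def labelWord (N : ℕ) (a : ℕ → ℕ → ℕ) : List ℕ+ :=
  (List.range' 0 N).flatMap fun j =>
    List.replicate (((List.range N).reverse.map fun r => a r j).sum) j.succPNat

/-- A unit moves within one column of the matrix, so the column sums, and with them the word of
labels, do not change. This is what makes the operator on the word of letters an operator on
matrices. -/
theorem labelWord_congr_of_matFac_R {N k : ℕ} (hk : k + 1 < N) {a b : ℕ → ℕ → ℕ}
    (h : (matFac N k a b).R) : labelWord N a = labelWord N b := by
  rw [matFac, Fac.mul_ofProp_R] at h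
  obtain ⟨h1, h2⟩ := h
  have h3 : ∀ j < N, a k j + a (k + 1) j = b k j + b (k + 1) j := by
    obtain ⟨u, x, v, hl, hx, -, hu, hv⟩ := Fac.prod_R_split _ _ h1
    intro j hj
    have : j ∈ List.range' 0 N := by simp [List.mem_range'_1, hj]
    rw [hl, List.mem_append, List.mem_cons] at this
    rcases this with h | rfl | h
    · obtain ⟨h4, h5⟩ := hu j h
      omega
    · obtain ⟨h4, h5⟩ := hx
      omega
    · obtain ⟨h4, h5⟩ := hv j h
      omega
  unfold labelWord
  apply List.flatMap_congr
  intro j hj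
  simp only [List.mem_range'_1] at hj
  congr 1
  rw [range_reverse_split hk]
  simp only [List.map_append, List.map_cons, List.sum_append, List.sum_cons]
  have e1 : (List.range' (k + 2) (N - (k + 2))).reverse.map (fun r => a r j) =
      (List.range' (k + 2) (N - (k + 2))).reverse.map fun r => b r j := by
    refine List.map_congr_left fun r hr => ?_
    simp only [List.mem_reverse, List.mem_range'_1] at hr
    exact h2 r (by omega) (by omega) (by omega) j (by omega)
  have e2 : (List.range k).reverse.map (fun r => a r j) =
      (List.range k).reverse.map fun r => b r j := by
    refine List.map_congr_left fun r hr => ?_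
    simp only [List.mem_reverse, List.mem_range] at hr
    exact h2 r (by omega) (by omega) (by omega) j (by omega)
  rw [e1, e2]
  have := h3 j (by omega)
  omega

/-- The pairs of a matrix in the order of the biword. -/
def pairWord (N : ℕ) (a : ℕ → ℕ → ℕ) : List (ℕ × ℕ) :=
  (List.range' 0 N).flatMap fun j =>
    (List.range N).reverse.flatMap fun r => List.replicate (a r j) (r, j)

theorem pairWord_fst (N : ℕ) (a : ℕ → ℕ → ℕ) :
    (pairWord N a).map (fun p => p.1.succPNat) = blockWord N a := by
  simp [pairWord, blockWord, colWord, List.map_flatMap]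

theorem flatMap_replicate_const {α β : Type*} (l : List α) (f : α → ℕ) (x : β) :
    (l.flatMap fun r => List.replicate (f r) x) = List.replicate ((l.map f).sum) x := by
  induction l with
  | nil => rfl
  | cons a l ih => rw [List.flatMap_cons, ih, List.map_cons, List.sum_cons, List.replicate_add]

theorem pairWord_snd (N : ℕ) (a : ℕ → ℕ → ℕ) :
    (pairWord N a).map (fun p => p.2.succPNat) = labelWord N a := by
  simp [pairWord, labelWord, List.map_flatMap, flatMap_replicate_const]

theorem pairWord_pairwise (N : ℕ) (a : ℕ → ℕ → ℕ) :
    (pairWord N a).Pairwise fun p q => p.2 < q.2 ∨ (p.2 = q.2 ∧ q.1 ≤ p.1) := by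
  unfold pairWord
  rw [List.pairwise_flatMap]
  constructor
  · intro j _
    rw [List.pairwise_flatMap]
    constructor
    · intro r _
      rw [List.pairwise_replicate]
      right; right; simp
    · rw [List.pairwise_reverse]
      refine List.Pairwise.imp ?_ List.pairwise_lt_range
      intro r s hrs x hx y hy
      rw [(List.mem_replicate.1 hx).2, (List.mem_replicate.1 hy).2]
      exact Or.inr ⟨rfl, hrs.le⟩
  · refine List.Pairwise.imp ?_ (List.pairwise_lt_range' (s := 0) (n := N))
    intro i j hij x hx y hy
    simp only [List.mem_flatMap, List.mem_replicate] at hx hy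
    obtain ⟨_, _, _, rfl⟩ := hx
    obtain ⟨_, _, _, rfl⟩ := hy
    exact Or.inl hij

theorem count_flatMap_single {α β : Type*} [BEq β] [LawfulBEq β] (l : List α) (hl : l.Nodup)
    (f : α → List β) (b : β) (x : α) (hx : x ∈ l) (h : ∀ y ∈ l, y ≠ x → (f y).count b = 0) :
    (l.flatMap f).count b = (f x).count b := by
  induction l with
  | nil => simp at hx
  | cons a l ih =>
    rw [List.flatMap_cons, List.count_append]
    rw [List.nodup_cons] at hl
    rcases List.mem_cons.1 hx with rfl | hx
    · have : (l.flatMap f).count b = 0 := by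
        rw [List.count_eq_zero]
        intro hb
        obtain ⟨y, hy, hby⟩ := List.mem_flatMap.1 hb
        have := h y (by simp [hy]) (by rintro rfl; exact hl.1 hy)
        exact List.count_eq_zero.1 this hby
      omega
    · have : (f a).count b = 0 := h a (by simp) (by rintro rfl; exact hl.1 hx)
      rw [ih hl.2 hx fun y hy => h y (by simp [hy])]
      omega

theorem pairWord_count (N : ℕ) (a : ℕ → ℕ → ℕ) (r j : ℕ) :
    (pairWord N a).count (r, j) = if r < N ∧ j < N then a r j else 0 := by
  split_ifs with h
  · unfold pairWord
    rw [count_flatMap_single _ (List.nodup_range') _ _ j (by simp [List.mem_range'_1, h.2]),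
      count_flatMap_single _ (List.nodup_reverse.2 List.nodup_range) _ _ r (by simp [h.1])]
    · simp
    · intro y _ hy
      rw [List.count_replicate, if_neg]
      simpa using hy
    · intro y _ hy
      rw [List.count_eq_zero]
      intro hb
      simp only [List.mem_flatMap, List.mem_replicate, Prod.mk.injEq] at hb
      obtain ⟨_, _, _, _, rfl⟩ := hb
      exact hy rfl
  · rw [List.count_eq_zero]
    intro hb
    simp only [pairWord, List.mem_flatMap, List.mem_replicate, Prod.mk.injEq, List.mem_reverse,
      List.mem_range'_1, List.mem_range] at hb
    obtain ⟨j', h1, r', h2, -, rfl, rfl⟩ := hb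
    omega

/-- The support of a matrix is contained in the square of size `N`. -/
def InBox (N : ℕ) (A : Mat) : Prop := ∀ p, A p ≠ 0 → p.1.natPred < N ∧ p.2.natPred < N

theorem pairWord_count_map (N : ℕ) (a : ℕ → ℕ → ℕ) (f : ℕ × ℕ → ℕ+ × ℕ+) (g : ℕ+ × ℕ+ → ℕ × ℕ)
    (hfg : ∀ p, f (g p) = p) (hgf : ∀ p, g (f p) = p) (p : ℕ+ × ℕ+) :
    ((pairWord N a).map f).count p = if (g p).1 < N ∧ (g p).2 < N then a (g p).1 (g p).2 else 0 := by
  have hinj : Function.Injective f := fun x y h => by rw [← hgf x, h, hgf]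
  conv_lhs => rw [← hfg p]
  rw [← pairWord_count]
  have := List.count_map_of_injective (pairWord N a) f hinj (g p)
  convert this using 2

theorem omegaWord_eq_pairWord {N : ℕ} {A : Mat} (hA : InBox N A) : omegaWord A =
    (pairWord N (matFun A)).map fun p => (p.1.succPNat, p.2.succPNat) := by
  apply eq_omegaWord
  · rw [List.pairwise_map]
    refine (pairWord_pairwise N _).imp ?_
    intro p q h
    simpa [omegaLE, Nat.succPNat_lt_succPNat, Nat.succPNat_inj] using h
  · intro p
    rw [pairWord_count_map N _ _ (fun p => (p.1.natPred, p.2.natPred)) (by simp) (by simp)]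
    simp only [matFun, PNat.succPNat_natPred, Prod.mk.eta]
    split_ifs with h
    · rfl
    · by_contra h'
      exact h (hA p (Ne.symm h'))

/-- Transposing the matrix exchanges the two reading orders, so the second biword is the first one
of the transpose. -/
theorem omegaWord'_eq_pairWord {N : ℕ} {A : Mat} (hA : InBox N A) : omegaWord' A =
    (pairWord N (fun k j => matFun A j k)).map fun p => (p.2.succPNat, p.1.succPNat) := by
  apply eq_omegaWord'
  · rw [List.pairwise_map]
    refine (pairWord_pairwise N _).imp ?_
    intro p q h
    simpa [readLE, Nat.succPNat_lt_succPNat, Nat.succPNat_inj] using h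
  · intro p
    rw [pairWord_count_map N _ _ (fun p => (p.2.natPred, p.1.natPred)) (by simp) (by simp)]
    simp only [matFun, PNat.succPNat_natPred, Prod.mk.eta]
    split_ifs with h
    · rfl
    · by_contra h'
      exact h (hA p (Ne.symm h')).symm

theorem biword_eq {N : ℕ} {A : Mat} (hA : InBox N A) :
    biword A = (blockWord N (matFun A), labelWord N (matFun A)) := by
  rw [biword, omegaWord_eq_pairWord hA, ← pairWord_fst, ← pairWord_snd, List.map_map, List.map_map]
  rfl

theorem biword'_eq {N : ℕ} {A : Mat} (hA : InBox N A) :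
    biword' A = (labelWord N (fun k j => matFun A j k), blockWord N (fun k j => matFun A j k)) := by
  rw [biword', omegaWord'_eq_pairWord hA, ← pairWord_fst, ← pairWord_snd, List.map_map,
    List.map_map]
  rfl

theorem InBox.ext {N : ℕ} {A B : Mat} (hA : InBox N A) (hB : InBox N B)
    (h : ∀ k < N, ∀ j < N, matFun A k j = matFun B k j) : A = B := by
  ext p
  by_cases hp : p.1.natPred < N ∧ p.2.natPred < N
  · simpa [matFun] using h _ hp.1 _ hp.2
  · have h1 : A p = 0 := by by_contra h'; exact hp (hA p h')
    have h2 : B p = 0 := by by_contra h'; exact hp (hB p h')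
    rw [h1, h2]

theorem mul_ofProp_E_congr {N k : ℕ} (hk : k + 1 < N) {a b : ℕ → ℕ → ℕ} (h : (matFac N k a b).E) :
    ∀ r < N, ∀ j < N, a r j = b r j := by
  rw [matFac, Fac.mul_E, Fac.prod_E] at h
  obtain ⟨h1, h2⟩ := h
  intro r hr j hj
  have h3 := h1 j (by simp [List.mem_range'_1, hj])
  by_cases e1 : r = k
  · subst e1; exact h3.1
  by_cases e2 : r = k + 1
  · subst e2; exact h3.2
  exact h2 r hr e1 e2 j hj

theorem vecNeg_f_succPNat {i : ℤ} {k : ℕ} (hi : -i = k + 1) :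
    vecNeg.f i k.succPNat = some (k + 1).succPNat := by
  simp only [vecNeg]
  rw [if_pos (by simp [hi])]
  rfl

theorem vecPos_f_succPNat {i : ℤ} {k : ℕ} (hi : i = k + 1) :
    vecPos.f i k.succPNat = some (k + 1).succPNat := by
  simp only [vecPos]
  rw [if_pos (by simp [hi])]
  rfl

theorem matFac_le_neg {i : ℤ} (hi : i < 0) {k N : ℕ} (hik : -i = k + 1) (hk : k + 1 < N) {A B : Mat}
    (hA : InBox N A) (hB : InBox N B) :
    Fac.Le (matFac N k (matFun A) (matFun B)) ((goodAt_mat_neg hi).fac A B) := by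
  obtain ⟨h1, h2, h3, h4⟩ := matFac_le_blockWord (goodAt_vecNeg hi) hik (vecNeg_f_succPNat hik) hk
    (matFun A) (matFun B)
  refine ⟨?_, ?_, ?_, ?_⟩
  · rw [h1]
    change (listSig _ _ _).e = (listSig _ _ (biword A).1).e
    rw [biword_eq hA]
  · rw [h2]
    change (listSig _ _ _).p = (listSig _ _ (biword A).1).p
    rw [biword_eq hA]
  · intro h
    change matCrystal.f i A = some B
    rw [mat_f_neg hi, biword_eq hA, biword_eq hB]
    exact ⟨h3 h, labelWord_congr_of_matFac_R hk h⟩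
  · intro h
    exact hA.ext hB (mul_ofProp_E_congr hk h)

theorem matFac_le_pos {i : ℤ} (hi : 0 < i) {k N : ℕ} (hik : i = k + 1) (hk : k + 1 < N) {A B : Mat}
    (hA : InBox N A) (hB : InBox N B) :
    Fac.Le (matFac N k (fun k j => matFun A j k) (fun k j => matFun B j k))
      ((goodAt_mat_pos hi).fac A B) := by
  obtain ⟨h1, h2, h3, h4⟩ := matFac_le_blockWord (goodAt_vecPos hi) hik (vecPos_f_succPNat hik) hk
    (fun k j => matFun A j k) (fun k j => matFun B j k)
  refine ⟨?_, ?_, ?_, ?_⟩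
  · rw [h1]
    change (listSig _ _ _).e = (listSig _ _ (biword' A).2).e
    rw [biword'_eq hA]
  · rw [h2]
    change (listSig _ _ _).p = (listSig _ _ (biword' A).2).p
    rw [biword'_eq hA]
  · intro h
    change matCrystal.f i A = some B
    rw [mat_f_pos hi, biword'_eq hA, biword'_eq hB]
    exact ⟨h3 h, labelWord_congr_of_matFac_R hk h⟩
  · intro h
    exact hA.ext hB fun k hk' j hj => mul_ofProp_E_congr hk h j hj k hk'

theorem cornerFac_R {N : ℕ} {A B : Mat} (hN : 0 < N) (hA : InBox N A) (hB : InBox N B)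
    (h : (cornerFac N (matFun A) (matFun B)).R) : B = A + Finsupp.single (1, 1) 1 := by
  obtain ⟨h1, h2⟩ := h
  have h11 : InBox N (A + Finsupp.single (1, 1) 1) := by
    intro p hp
    by_cases h : p = (1, 1)
    · subst h; exact ⟨hN, hN⟩
    · exact hA p (by simpa [Finsupp.single_apply, Ne.symm h] using hp)
  refine hB.ext h11 fun k hk j hj => ?_
  by_cases h : k = 0 ∧ j = 0
  · obtain ⟨rfl, rfl⟩ := h
    rw [h1]
    have : (Nat.succPNat 0) = 1 := rfl
    simp [matFun, this]
  · rw [← h2 k hk j hj (by omega)]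
    simp only [matFun, Finsupp.coe_add, Pi.add_apply, Finsupp.single_apply]
    rw [if_neg, add_zero]
    rw [Prod.mk.injEq, show (1 : ℕ+) = Nat.succPNat 0 from rfl, Nat.succPNat_inj, Nat.succPNat_inj]
    omega

end

end GlInf

namespace GlInf

noncomputable section

open PreCrystal

/-! ## Independence of the reading -/

theorem Fac.eq_ofProp {x : Fac} (he : x.e = 0) (hp : x.p = 0) : x = Fac.ofProp x.E := by
  apply Fac.ext'
  · exact he
  · exact hp
  · simp only [Fac.ofProp_R, iff_false]
    intro h
    have := x.pos h
    omega
  · rfl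

/-- The product of a list of factors of kinds `1` (`φ = 1`) and `2` (`ε = 1`), which cancel each
other, of trivial factors (kind `0`), and of other factors (kind `3`). -/
theorem Fac.prod_cancel {ι : Type*} (F : ι → Fac) (κ : ι → ℕ) (l : List ι)
    (h0 : ∀ x ∈ l, κ x ≠ 1 → κ x ≠ 2 → κ x ≠ 3 → (F x).e = 0 ∧ (F x).p = 0)
    (h1 : ∀ x ∈ l, κ x = 1 → (F x).e = 0 ∧ (F x).p = 1)
    (h2 : ∀ x ∈ l, κ x = 2 → (F x).e = 1 ∧ (F x).p = 0)
    (hs : ∀ v, v <:+ l → v.countP (κ · = 1) ≤ v.countP (κ · = 2))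
    (h3 : ∀ x v, (x :: v) <:+ l → κ x = 3 → v.countP (κ · = 1) = v.countP (κ · = 2)) :
    (l.map F).prod = ⟨l.countP (κ · = 2) - l.countP (κ · = 1), 0, False,
      ∀ x ∈ l, κ x ≠ 3 → (F x).E, False.elim⟩ * ((l.filter (κ · = 3)).map F).prod := by
  induction l with
  | nil =>
    simp only [List.map_nil, List.prod_nil, List.filter_nil, mul_one]
    apply Fac.ext' <;> simp
  | cons x l ih =>
    have ih := ih (fun x hx => h0 x (by simp [hx])) (fun x hx => h1 x (by simp [hx]))
      (fun x hx => h2 x (by simp [hx])) (fun v hv => hs v (hv.trans (List.suffix_cons _ _)))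
      (fun y v hv => h3 y v (hv.trans (List.suffix_cons _ _)))
    have hl := hs l (List.suffix_cons _ _)
    have hxl := hs (x :: l) (List.suffix_refl _)
    have h3 := h3 x l (List.suffix_refl _)
    rw [List.map_cons, List.prod_cons, ih]
    have hE : (∀ y ∈ x :: l, κ y ≠ 3 → (F y).E) ↔
      (κ x ≠ 3 → (F x).E) ∧ ∀ y ∈ l, κ y ≠ 3 → (F y).E := by simp
    -- At a factor of kind `3` everything of kinds `1` and `2` to its right has cancelled
    -- completely. What is left of it is an equality only, and commutes with this factor.
    by_cases e3 : κ x = 3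
    · have h3 := h3 e3
      rw [List.filter_cons_of_pos (by simpa using e3), List.map_cons, List.prod_cons, ← mul_assoc,
        ← mul_assoc]
      congr 1
      have : ∀ (m : ℕ) (E : Prop), m = 0 → (⟨m, 0, False, E, False.elim⟩ : Fac) = Fac.ofProp E := by
        rintro m E rfl; rfl
      rw [this _ _ (by omega), this _ _ (by simp [e3]; omega), Fac.ofProp_comm]
      congr 2
      apply propext
      rw [hE]
      simp [e3]
    · rw [List.filter_cons_of_neg (by simpa using e3), ← mul_assoc]
      congr 1
      by_cases e1 : κ x = 1
      · obtain ⟨h4, h5⟩ := h1 x (by simp) e1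
        simp only [List.countP_cons, e1, decide_true, if_true, OfNat.one_ne_ofNat, decide_false,
          Bool.false_eq_true, if_false] at hxl ⊢
        apply Fac.ext'
        · rw [Fac.mul_e]; dsimp only; omega
        · rw [Fac.mul_p]; dsimp only; omega
        · rw [Fac.mul_R]; dsimp only
          simp only [and_false, or_false, iff_false, not_and]
          omega
        · rw [Fac.mul_E]; dsimp only
          rw [hE]; simp [e1]
      by_cases e2 : κ x = 2
      · obtain ⟨h4, h5⟩ := h2 x (by simp) e2
        simp only [List.countP_cons, e2, decide_true, if_true, OfNat.ofNat_ne_one, decide_false,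
          Bool.false_eq_true, if_false] at hxl ⊢
        apply Fac.ext'
        · rw [Fac.mul_e]; dsimp only; omega
        · rw [Fac.mul_p]; dsimp only; omega
        · rw [Fac.mul_R]; dsimp only
          simp only [and_false, or_false, iff_false, not_and]
          omega
        · rw [Fac.mul_E]; dsimp only
          rw [hE]; simp [e2]
      · obtain ⟨h4, h5⟩ := h0 x (by simp) e1 e2 e3
        simp only [List.countP_cons, e1, e2, decide_false, Bool.false_eq_true, if_false] at hxl ⊢
        rw [Fac.eq_ofProp h4 h5]
        apply Fac.ext'
        · rw [Fac.mul_e]; dsimp only; simp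
        · rw [Fac.mul_p]; dsimp only; simp
        · rw [Fac.mul_R]; dsimp only; simp
        · rw [Fac.mul_E]; dsimp only
          rw [hE]; simp [e3]

/-- The list of cells is a reading: no cell is preceded by a cell which is weakly below and weakly
to the left of it. -/
def IsReading (l : List (ℤ × ℤ)) : Prop :=
  l.Pairwise fun a b => ¬ (b.1 ≤ a.1 ∧ a.2 ≤ b.2)

theorem IsReading.nodup {l : List (ℤ × ℤ)} (h : IsReading l) : l.Nodup :=
  h.imp fun {a b} hab => by rintro rfl; exact hab ⟨le_rfl, le_rfl⟩

/-- A semistandard filling of a skew shape. -/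
structure IsSkewTableau (D : Finset (ℤ × ℤ)) (T : ℤ × ℤ → ℤ) : Prop where
  convex : ∀ r c r' c' : ℤ, (r, c) ∈ D → (r', c') ∈ D → r ≤ r' → c ≤ c' →
    (r, c') ∈ D ∧ (r', c) ∈ D
  row_weak : ∀ r c c' : ℤ, c < c' → (r, c) ∈ D → (r, c') ∈ D → T (r, c) ≤ T (r, c')
  col_strict : ∀ r r' c : ℤ, r < r' → (r, c) ∈ D → (r', c) ∈ D → T (r, c) < T (r', c)

/-! ### Column-wise pairing of the letters `k` and `k + 1` in a skew tableau. -/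

section skew

variable {D : Finset (ℤ × ℤ)} {T : ℤ × ℤ → ℤ} (k : ℤ)

open Classical in
/-- The kind of a cell: `1` or `2` for a letter `k` or `k + 1` whose column contains both of these
letters, `3` for the remaining letters `k` or `k + 1`. -/
def cellKind (D : Finset (ℤ × ℤ)) (T : ℤ × ℤ → ℤ) (p : ℤ × ℤ) : ℕ :=
  if T p = k then (if ∃ q ∈ D, q.2 = p.2 ∧ T q = k + 1 then 1 else 3)
  else if T p = k + 1 then (if ∃ q ∈ D, q.2 = p.2 ∧ T q = k then 2 else 3) else 0

variable {k}

theorem cellKind_eq_one {p : ℤ × ℤ} : cellKind k D T p = 1 ↔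
    T p = k ∧ ∃ q ∈ D, q.2 = p.2 ∧ T q = k + 1 := by
  unfold cellKind
  split_ifs <;> simp_all

theorem cellKind_eq_two {p : ℤ × ℤ} : cellKind k D T p = 2 ↔
    T p = k + 1 ∧ ∃ q ∈ D, q.2 = p.2 ∧ T q = k := by
  unfold cellKind
  split_ifs <;> simp_all

theorem cellKind_eq_three {p : ℤ × ℤ} : cellKind k D T p = 3 ↔
    (T p = k ∧ ∀ q ∈ D, q.2 = p.2 → T q ≠ k + 1) ∨
    (T p = k + 1 ∧ ∀ q ∈ D, q.2 = p.2 → T q ≠ k) := by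
  unfold cellKind
  split_ifs with h1 h2 h2 h3
  · obtain ⟨q, h4, h5, h6⟩ := h2
    simp only [OfNat.one_ne_ofNat, false_iff, not_or, not_and, not_forall]
    exact ⟨fun _ => ⟨q, h4, h5, fun h => h h6⟩, fun h => by omega⟩
  · push Not at h2
    exact ⟨fun _ => Or.inl ⟨h1, h2⟩, fun _ => rfl⟩
  · obtain ⟨q, h4, h5, h6⟩ := h3
    simp only [show ¬ (2 : ℕ) = 3 by decide, false_iff, not_or, not_and, not_forall]
    exact ⟨fun h => absurd h h1, fun _ => ⟨q, h4, h5, fun h => h h6⟩⟩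
  · push Not at h3
    exact ⟨fun _ => Or.inr ⟨h2, h3⟩, fun _ => rfl⟩
  · simp [h1, h2]

namespace IsSkewTableau

theorem cell_eq (h : IsSkewTableau D T) {p q : ℤ × ℤ} (hp : p ∈ D) (hq : q ∈ D)
    (hc : p.2 = q.2) (hT : T p = T q) : p = q := by
  obtain ⟨r, c⟩ := p
  obtain ⟨r', c'⟩ := q
  dsimp only at hc
  subst hc
  rcases lt_trichotomy r r' with h1 | rfl | h1
  · exact absurd hT (h.col_strict _ _ _ h1 hp hq).ne
  · rfl
  · exact absurd hT (h.col_strict _ _ _ h1 hq hp).ne'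

theorem row_lt (h : IsSkewTableau D T) {p q : ℤ × ℤ} (hp : p ∈ D) (hq : q ∈ D)
    (hc : p.2 = q.2) (hT : T p < T q) : p.1 < q.1 := by
  obtain ⟨r, c⟩ := p
  obtain ⟨r', c'⟩ := q
  dsimp only at hc
  subst hc
  rcases lt_trichotomy r r' with h1 | rfl | h1
  · exact h1
  · exact absurd hT (lt_irrefl _)
  · exact absurd hT (h.col_strict _ _ _ h1 hq hp).asymm

/-- Of two relevant cells, one of them without partner, the right one is weakly above the left
one. -/
theorem above (h : IsSkewTableau D T) {a b : ℤ × ℤ} (ha : a ∈ D) (hb : b ∈ D) (hc : b.2 < a.2)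
    (ha' : T a = k ∨ T a = k + 1) (hb' : T b = k ∨ T b = k + 1)
    (hf : cellKind k D T a = 3 ∨ cellKind k D T b = 3) : a.1 ≤ b.1 := by
  by_contra! hr
  obtain ⟨ra, ca⟩ := a
  obtain ⟨rb, cb⟩ := b
  dsimp only at hc hr
  obtain ⟨h1, h2⟩ := h.convex _ _ _ _ hb ha hr.le hc.le
  have h3 := h.row_weak _ _ _ hc h2 ha
  have h4 := h.col_strict _ _ _ hr hb h2
  have h5 := h.row_weak _ _ _ hc hb h1
  have h6 := h.col_strict _ _ _ hr h1 ha
  rw [cellKind_eq_three, cellKind_eq_three] at hf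
  rcases hf with (⟨h7, h8⟩ | ⟨h7, h8⟩) | (⟨h7, h8⟩ | ⟨h7, h8⟩)
  · omega
  · exact h8 _ h1 rfl (by omega)
  · exact h8 _ h2 rfl (by omega)
  · omega

theorem count_le {α : Type*} {v : List α} (hv : v.Nodup) {A B : α → Prop} [DecidablePred A]
    [DecidablePred B]
    (σ : α → α) (h1 : ∀ a ∈ v, A a → σ a ∈ v ∧ B (σ a))
    (h2 : ∀ a ∈ v, A a → ∀ a' ∈ v, A a' → σ a = σ a' → a = a') :
    v.countP (fun x => A x) ≤ v.countP (fun x => B x) := by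
  rw [List.countP_eq_length_filter, List.countP_eq_length_filter]
  have hn : ((v.filter fun x => A x).map σ).Nodup := by
    refine List.Nodup.map_on ?_ (hv.filter _)
    intro x hx y hy hxy
    simp only [List.mem_filter, decide_eq_true_eq] at hx hy
    exact h2 x hx.1 hx.2 y hy.1 hy.2 hxy
  have hs : ((v.filter fun x => A x).map σ) ⊆ v.filter fun x => B x := by
    intro y hy
    simp only [List.mem_map, List.mem_filter, decide_eq_true_eq] at hy ⊢
    obtain ⟨x, ⟨h3, h4⟩, rfl⟩ := hy
    exact h1 x h3 h4
  have := (List.subperm_of_subset hn hs).length_le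
  rwa [List.length_map] at this

/-- The product over a reading. -/
theorem prod_eq (h : IsSkewTableau D T) {l : List (ℤ × ℤ)} (hl : IsReading l)
    (hD : ∀ p, p ∈ l ↔ p ∈ D) (F : ℤ × ℤ → Fac)
    (he : ∀ p ∈ D, (F p).e = if T p = k + 1 then 1 else 0)
    (hp : ∀ p ∈ D, (F p).p = if T p = k then 1 else 0) :
    (l.map F).prod = Fac.ofProp (∀ x ∈ D, cellKind k D T x ≠ 3 → (F x).E) *
      ((l.filter (cellKind k D T · = 3)).map F).prod := by
  classical
  have hσ : ∀ p : ℤ × ℤ, ∃ q : ℤ × ℤ, cellKind k D T p = 1 → q ∈ D ∧ q.2 = p.2 ∧ T q = k + 1 := by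
    intro p
    by_cases h1 : cellKind k D T p = 1
    · obtain ⟨-, q, h2, h3⟩ := cellKind_eq_one.1 h1
      exact ⟨q, fun _ => ⟨h2, h3⟩⟩
    · exact ⟨p, fun h => absurd h h1⟩
  have hτ : ∀ p : ℤ × ℤ, ∃ q : ℤ × ℤ, cellKind k D T p = 2 → q ∈ D ∧ q.2 = p.2 ∧ T q = k := by
    intro p
    by_cases h1 : cellKind k D T p = 2
    · obtain ⟨-, q, h2, h3⟩ := cellKind_eq_two.1 h1
      exact ⟨q, fun _ => ⟨h2, h3⟩⟩
    · exact ⟨p, fun h => absurd h h1⟩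
  choose σ hσ using hσ
  choose τ hτ using hτ
  have hsub : ∀ v, v <:+ l → ∀ x ∈ v, x ∈ D := fun v hv x hx => (hD x).1 (hv.subset hx)
  -- A paired `k` lies above its partner in the same column and is read before it. Hence every
  -- suffix containing the `k` contains the `k + 1`.
  have hle : ∀ v, v <:+ l →
      v.countP (cellKind k D T · = 1) ≤ v.countP (cellKind k D T · = 2) := by
    intro v hv
    refine count_le (hl.nodup.sublist hv.sublist) σ ?_ ?_
    · intro a ha h1
      obtain ⟨h2, h3, h4⟩ := hσ a h1
      obtain ⟨h5, -⟩ := cellKind_eq_one.1 h1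
      refine ⟨?_, cellKind_eq_two.2 ⟨h4, a, hsub v hv a ha, h3.symm, h5⟩⟩
      obtain ⟨u, rfl⟩ := hv
      rcases List.mem_append.1 ((hD _).2 h2) with h6 | h6
      · exact absurd ⟨(h.row_lt ((hD _).1 (by simp [ha])) h2 h3.symm (by omega)).le, h3.le⟩
          ((List.pairwise_append.1 hl).2.2 _ h6 _ ha)
      · exact h6
    · intro a ha h1 a' ha' h1' haa
      obtain ⟨h2, h3, h4⟩ := hσ a h1
      obtain ⟨h2', h3', h4'⟩ := hσ a' h1'
      refine h.cell_eq (hsub v hv a ha) (hsub v hv a' ha') ?_ ?_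
      · rw [← h3, ← h3', haa]
      · rw [(cellKind_eq_one.1 h1).1, (cellKind_eq_one.1 h1').1]
  have hge : ∀ v, v <:+ l → (∀ b ∈ v, cellKind k D T b = 2 → τ b ∈ v) →
      v.countP (cellKind k D T · = 2) ≤ v.countP (cellKind k D T · = 1) := by
    intro v hv hmem
    refine count_le (hl.nodup.sublist hv.sublist) τ ?_ ?_
    · intro a ha h1
      obtain ⟨h2, h3, h4⟩ := hτ a h1
      obtain ⟨h5, -⟩ := cellKind_eq_two.1 h1
      exact ⟨hmem a ha h1, cellKind_eq_one.2 ⟨h4, a, hsub v hv a ha, h3.symm, h5⟩⟩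
    · intro a ha h1 a' ha' h1' haa
      obtain ⟨h2, h3, h4⟩ := hτ a h1
      obtain ⟨h2', h3', h4'⟩ := hτ a' h1'
      refine h.cell_eq (hsub v hv a ha) (hsub v hv a' ha') ?_ ?_
      · rw [← h3, ← h3', haa]
      · rw [(cellKind_eq_two.1 h1).1, (cellKind_eq_two.1 h1').1]
  have hrel : ∀ x, cellKind k D T x = 1 ∨ cellKind k D T x = 2 ∨ cellKind k D T x = 3 ↔
      (T x = k ∨ T x = k + 1) := by
    intro x
    unfold cellKind
    split_ifs <;> simp_all
  rw [Fac.prod_cancel F (cellKind k D T) l ?_ ?_ ?_ hle ?_]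
  · congr 1
    have h1 := hle l (List.suffix_refl _)
    have h2 := hge l (List.suffix_refl _) fun b _ hb => (hD _).2 (hτ b hb).1
    apply Fac.ext'
    · dsimp only; simp only [Fac.ofProp_e]; omega
    · rfl
    · rfl
    · simp [hD]
  · intro x hx h1 h2 h3
    have h4 := (hrel x).not.1 (by tauto)
    rw [not_or] at h4
    rw [he x ((hD x).1 hx), hp x ((hD x).1 hx), if_neg h4.1, if_neg h4.2]
    exact ⟨rfl, rfl⟩
  · intro x hx h1
    have h4 := (cellKind_eq_one.1 h1).1
    rw [he x ((hD x).1 hx), hp x ((hD x).1 hx), if_pos h4, if_neg (by omega)]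
    exact ⟨rfl, rfl⟩
  · intro x hx h1
    have h4 := (cellKind_eq_two.1 h1).1
    rw [he x ((hD x).1 hx), hp x ((hD x).1 hx), if_pos h4, if_neg (by omega)]
    exact ⟨rfl, rfl⟩
  -- No pair straddles an unpaired cell `x`. The pair would lie in another column, and by `above`
  -- either its `k + 1` must be read before `x` or its `k` after `x`, according to the side on which
  -- the column lies.
  · intro x v hv hx
    have hv' : v <:+ l := (List.suffix_cons _ _).trans hv
    refine le_antisymm (hle v hv') (hge v hv' ?_)
    intro b hb hb2
    obtain ⟨h2, h3, h4⟩ := hτ b hb2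
    have hbD := hsub v hv' b hb
    have hxD := hsub _ hv x (by simp)
    obtain ⟨u, rfl⟩ := hv
    have hb5 := (cellKind_eq_two.1 hb2).1
    have hxr := (hrel x).1 (Or.inr (Or.inr hx))
    have hcol : x.2 ≠ b.2 := by
      intro hc
      rcases cellKind_eq_three.1 hx with ⟨-, h6⟩ | ⟨-, h6⟩
      · exact h6 b hbD hc.symm hb5
      · exact h6 (τ b) h2 (h3.trans hc.symm) h4
    rcases List.mem_append.1 ((hD _).2 h2) with h6 | h6
    · exfalso
      rw [IsReading, List.pairwise_append] at hl
      rcases lt_or_gt_of_ne hcol with h7 | h7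
      · have := h.above hbD hxD h7 (Or.inr hb5) hxr (Or.inr hx)
        exact (List.pairwise_cons.1 hl.2.1).1 b hb ⟨this, h7.le⟩
      · have := h.above hxD h2 (by rw [h3]; exact h7) hxr (Or.inl h4) (Or.inl hx)
        exact hl.2.2 _ h6 x (by simp) ⟨this, by rw [h3]; exact h7.le⟩
    · rcases List.mem_cons.1 h6 with h7 | h7
      · exact absurd (h7 ▸ h3) hcol
      · exact h7

/-- The product over a reading does not depend on the reading. -/
theorem prod_congr (h : IsSkewTableau D T) {l l' : List (ℤ × ℤ)} (hl : IsReading l)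
    (hl' : IsReading l') (hD : ∀ p, p ∈ l ↔ p ∈ D) (hD' : ∀ p, p ∈ l' ↔ p ∈ D) (F : ℤ × ℤ → Fac)
    (he : ∀ p ∈ D, (F p).e = if T p = k + 1 then 1 else 0)
    (hp : ∀ p ∈ D, (F p).p = if T p = k then 1 else 0) :
    (l.map F).prod = (l'.map F).prod := by
  rw [h.prod_eq hl hD F he hp, h.prod_eq hl' hD' F he hp]
  congr 3
  -- Unpaired cells lie in different columns, and by `above` every reading meets them from right to
  -- left. Their order is therefore the same in all readings.
  have hs : ∀ l, IsReading l → (∀ p, p ∈ l ↔ p ∈ D) →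
      (l.filter (cellKind k D T · = 3)).Pairwise fun a b => b.2 < a.2 := by
    intro l hl hD
    rw [List.pairwise_filter]
    refine hl.imp_of_mem fun {a b} ha hb hab ha3 hb3 => ?_
    simp only [decide_eq_true_eq] at ha3 hb3
    have ha' := (hD a).1 ha
    have hb' := (hD b).1 hb
    have hra : T a = k ∨ T a = k + 1 := by
      rcases cellKind_eq_three.1 ha3 with h | h <;> tauto
    have hrb : T b = k ∨ T b = k + 1 := by
      rcases cellKind_eq_three.1 hb3 with h | h <;> tauto
    by_contra! hc
    rcases hc.eq_or_lt with hc | hc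
    · apply hab
      have : a = b := by
        refine h.cell_eq ha' hb' hc ?_
        rcases cellKind_eq_three.1 ha3 with ⟨h1, h2⟩ | ⟨h1, h2⟩
        · have := h2 b hb' hc.symm
          rcases hrb with h3 | h3
          · rw [h1, h3]
          · exact absurd h3 this
        · have := h2 b hb' hc.symm
          rcases hrb with h3 | h3
          · exact absurd h3 this
          · rw [h1, h3]
      subst this
      exact ⟨le_rfl, le_rfl⟩
    · exact hab ⟨h.above hb' ha' hc hrb hra (Or.inl hb3), hc.le⟩
  refine List.Perm.eq_of_pairwise (fun a b _ _ h1 h2 => absurd h1 h2.asymm) (hs l hl hD)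
    (hs l' hl' hD') ?_
  refine (List.perm_ext_iff_of_nodup (hl.nodup.filter _) (hl'.nodup.filter _)).2 fun p => ?_
  simp [hD, hD']

end IsSkewTableau

end skew

end

end GlInf

namespace GlInf

noncomputable section

open PreCrystal

/-! ## Columns -/

theorem sorted_split {p : List ℕ+} (hp : p.Pairwise (· < ·)) {x : ℕ+} (hx : x ∈ p) :
    ∃ u v, p = u ++ x :: v ∧ (∀ z ∈ u, z < x) ∧ (∀ z ∈ v, x < z) := by
  obtain ⟨u, v, rfl⟩ := List.append_of_mem hx
  rw [List.pairwise_append, List.pairwise_cons] at hp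
  exact ⟨u, v, rfl, fun z hz => hp.2.2 z hz x (by simp), hp.2.1.1⟩

theorem sorted_ext {p q : List ℕ+} (hp : p.Pairwise (· < ·)) (hq : q.Pairwise (· < ·))
    (h : ∀ z, z ∈ p ↔ z ∈ q) : p = q := by
  refine List.Perm.eq_of_pairwise (fun a b _ _ h1 h2 => absurd h1 h2.asymm) hp hq ?_
  exact (List.perm_ext_iff_of_nodup (hp.imp fun h => h.ne) (hq.imp fun h => h.ne)).2 h

theorem bits_eq_true {p : List ℕ+} {k : ℕ} : bits p k = true ↔ k.succPNat ∈ p := by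
  simp [bits]

theorem bits_eq_false {p : List ℕ+} {k : ℕ} : bits p k = false ↔ k.succPNat ∉ p := by
  simp [bits]

theorem sorted_ext_bits {N : ℕ} {p q : List ℕ+} (hp : p.Pairwise (· < ·)) (hq : q.Pairwise (· < ·))
    (hpN : ∀ z ∈ p, z.natPred < N) (hqN : ∀ z ∈ q, z.natPred < N)
    (h : ∀ k < N, bits p k = bits q k) : p = q := by
  refine sorted_ext hp hq fun z => ?_
  by_cases hz : z.natPred < N
  · have := h _ hz
    simp only [bits, PNat.succPNat_natPred, decide_eq_decide] at this
    exact this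
  · exact ⟨fun h => absurd (hpN z h) hz, fun h => absurd (hqN z h) hz⟩

section letters

variable {X : PreCrystal ℕ+} {i m : ℤ} {k : ℕ}

theorem letE_eq {m : ℤ} {k : ℕ} (hm : m = k + 1) (z : ℕ+) :
    letE m z = if z = (k + 1).succPNat then 1 else 0 := by
  obtain ⟨r, rfl⟩ : ∃ r : ℕ, z = r.succPNat := ⟨z.natPred, z.succPNat_natPred.symm⟩
  rw [letE_succPNat hm]
  simp only [Nat.succPNat_inj]

theorem letP_eq {m : ℤ} {k : ℕ} (hm : m = k + 1) (z : ℕ+) :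
    letP m z = if z = k.succPNat then 1 else 0 := by
  obtain ⟨r, rfl⟩ : ∃ r : ℕ, z = r.succPNat := ⟨z.natPred, z.succPNat_natPred.symm⟩
  rw [letP_succPNat hm]
  simp only [Nat.succPNat_inj]

/-- The signature of a column of letters. -/
theorem listSig_column (hm : m = k + 1) {p : List ℕ+} (hp : p.Pairwise (· < ·)) :
    (listSig (letE m) (letP m) p).e = (!bits p k && bits p (k + 1)).toNat ∧
    (listSig (letE m) (letP m) p).p = (bits p k && !bits p (k + 1)).toNat := by
  have hE := letE_eq hm
  have hP := letP_eq hm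
  have hlt : k.succPNat < (k + 1).succPNat := Nat.succPNat_lt_succPNat.2 (Nat.lt_succ_self k)
  have h1 : ∀ u : List ℕ+, (∀ z ∈ u, z ≠ k.succPNat ∧ z ≠ (k + 1).succPNat) →
      listSig (letE m) (letP m) u = 1 := by
    intro u hu
    apply listSig_eq_one
    intro x hx
    rw [hE, hP, if_neg (hu x hx).1, if_neg (hu x hx).2]
    exact ⟨rfl, rfl⟩
  have h2 : ∀ u : List ℕ+, u.Pairwise (· < ·) → (k + 1).succPNat ∈ u → k.succPNat ∉ u →
      (listSig (letE m) (letP m) u).e = 1 ∧ (listSig (letE m) (letP m) u).p = 0 := by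
    intro u hu hk hk'
    obtain ⟨v, w, rfl, hv, hw⟩ := sorted_split hu hk
    rw [listSig_append, h1 v, one_mul, (listSig_cons _ _ _ _).1, (listSig_cons _ _ _ _).2, h1 w, hE,
      hP, if_pos rfl, if_neg hlt.ne']
    · exact ⟨rfl, rfl⟩
    · intro z hz
      exact ⟨fun h => hk' (by simp [← h, hz]), (hw z hz).ne'⟩
    · intro z hz
      exact ⟨fun h => hk' (by simp [← h, hz]), (hv z hz).ne⟩
  by_cases hk : k.succPNat ∈ p
  · obtain ⟨u, v, rfl, hu, hv⟩ := sorted_split hp hk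
    have hu1 : listSig (letE m) (letP m) u = 1 :=
      h1 u fun z hz => ⟨(hu z hz).ne, ((hu z hz).trans hlt).ne⟩
    rw [bits_eq_true.2 hk, listSig_append, hu1, one_mul, (listSig_cons _ _ _ _).1,
      (listSig_cons _ _ _ _).2, hE, hP, if_pos rfl, if_neg hlt.ne]
    by_cases hk1 : (k + 1).succPNat ∈ v
    · have := h2 v (List.pairwise_cons.1 (List.pairwise_append.1 hp).2.1).2 hk1
        fun h => lt_irrefl _ (hv _ h)
      rw [bits_eq_true.2 (by simp [hk1]), this.1, this.2]
      exact ⟨rfl, rfl⟩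
    · have : (k + 1).succPNat ∉ u ++ k.succPNat :: v := by
        simp only [List.mem_append, List.mem_cons, not_or]
        exact ⟨fun h => (hu _ h).asymm hlt, hlt.ne', hk1⟩
      rw [bits_eq_false.2 this, h1 v fun z hz => ⟨(hv z hz).ne', fun h => hk1 (h ▸ hz)⟩]
      exact ⟨rfl, rfl⟩
  · rw [bits_eq_false.2 hk]
    by_cases hk1 : (k + 1).succPNat ∈ p
    · rw [bits_eq_true.2 hk1]
      exact h2 p hp hk1 hk
    · rw [bits_eq_false.2 hk1, h1 p fun z hz => ⟨fun h => hk (h ▸ hz), fun h => hk1 (h ▸ hz)⟩]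
      exact ⟨rfl, rfl⟩

/-- The comparison of two columns of letters. -/
theorem words_fac_column (h : X.GoodAt i (letE m) (letP m)) (hm : m = k + 1)
    (hf : X.f i k.succPNat = some (k + 1).succPNat) {N : ℕ} (hk : k + 1 < N) {p p' : List ℕ+}
    (hp : p.Pairwise (· < ·)) (hp' : p'.Pairwise (· < ·))
    (hpN : ∀ z ∈ p, z.natPred < N) (hpN' : ∀ z ∈ p', z.natPred < N) :
    h.words.fac p p' = bitsFac N k (bits p) (bits p') := by
  have hE := letE_eq hm
  have hP := letP_eq hm
  have hlt : k.succPNat < (k + 1).succPNat := Nat.succPNat_lt_succPNat.2 (Nat.lt_succ_self k)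
  obtain ⟨he, hph⟩ := listSig_column hm hp
  apply Fac.ext'
  · change (listSig (letE m) (letP m) p).e = _
    rw [he]
    simp [bitsFac, Fac.mul_e, bitFac]
  · change (listSig (letE m) (letP m) p).p = _
    rw [hph]
    simp [bitsFac, Fac.mul_p, bitFac]
  · by_cases hc : k.succPNat ∈ p ∧ (k + 1).succPNat ∉ p
    · obtain ⟨hk0, hk1⟩ := hc
      obtain ⟨u, v, rfl, hu, hv⟩ := sorted_split hp hk0
      have hfp : X.words.f i (u ++ k.succPNat :: v) = some (u ++ (k + 1).succPNat :: v) := by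
        apply h.words_f_change u v _ _ hf
        · intro z hz
          rw [hP, if_neg (hu z hz).ne]
        · rw [listSig_eq_one]
          · rfl
          · intro z hz
            rw [hP, hE, if_neg (hv z hz).ne', if_neg]
            · exact ⟨rfl, rfl⟩
            · rintro rfl; exact hk1 (by simp [hz])
      have hs : (u ++ (k + 1).succPNat :: v).Pairwise (· < ·) := by
        rw [List.pairwise_append, List.pairwise_cons] at hp ⊢
        refine ⟨hp.1, ⟨?_, hp.2.1.2⟩, ?_⟩
        · intro z hz
          have h1 := hv z hz
          rw [← natPred_lt_iff, Nat.natPred_succPNat] at h1 ⊢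
          have : z.natPred ≠ k + 1 := by
            intro h2
            rw [← h2, PNat.succPNat_natPred] at hk1
            exact hk1 (by simp [hz])
          omega
        · intro a ha b hb
          rcases List.mem_cons.1 hb with rfl | hb
          · exact (hu a ha).trans hlt
          · exact hp.2.2 a ha b (by simp [hb])
      change X.words.f i (u ++ k.succPNat :: v) = some p' ↔ _
      rw [hfp, Option.some_inj, bitsFac, Fac.mul_ofProp_R]
      have hmem : ∀ z, z ≠ k.succPNat → z ≠ (k + 1).succPNat →
          (z ∈ u ++ k.succPNat :: v ↔ z ∈ u ++ (k + 1).succPNat :: v) := by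
        intro z h1 h2
        simp [h1, h2]
      have hmem0 : k.succPNat ∉ u ++ (k + 1).succPNat :: v := by
        simp only [List.mem_append, List.mem_cons, not_or]
        exact ⟨fun h => lt_irrefl _ (hu _ h), hlt.ne, fun h => lt_irrefl _ (hv _ h)⟩
      constructor
      · rintro rfl
        refine ⟨⟨bits_eq_true.2 hk0, bits_eq_false.2 hk1, bits_eq_false.2 hmem0,
          bits_eq_true.2 (by simp)⟩, ?_⟩
        intro r _ h1 h2
        simp only [bits, decide_eq_decide]
        exact hmem _ (by rwa [ne_eq, Nat.succPNat_inj]) (by rwa [ne_eq, Nat.succPNat_inj])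
      · rintro ⟨⟨-, -, h1, h2⟩, h3⟩
        rw [bits_eq_false] at h1
        rw [bits_eq_true] at h2
        refine sorted_ext hs hp' fun z => ?_
        by_cases hz0 : z = k.succPNat
        · subst hz0
          exact ⟨fun h => absurd h hmem0, fun h => absurd h h1⟩
        by_cases hz1 : z = (k + 1).succPNat
        · subst hz1
          exact ⟨fun _ => h2, fun _ => by simp⟩
        rw [← hmem z hz0 hz1]
        by_cases hzN : z.natPred < N
        · have := h3 z.natPred hzN (by rintro rfl; simp at hz0) (by
            intro h; rw [← h] at hz1; simp at hz1)
          simpa only [bits, PNat.succPNat_natPred, decide_eq_decide] using this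
        · exact ⟨fun h => absurd (hpN z h) hzN, fun h => absurd (hpN' z h) hzN⟩
    -- In the remaining cases `φ = 0`, and `pos` excludes an action of `f` on both sides of the
    -- equality.
    · have h0 : (listSig (letE m) (letP m) p).p = 0 := by
        rw [hph]
        by_cases h1 : k.succPNat ∈ p
        · have h2 : (k + 1).succPNat ∈ p := by
            by_contra h2; exact hc ⟨h1, h2⟩
          rw [bits_eq_true.2 h2]; simp
        · rw [bits_eq_false.2 h1]; simp
      constructor
      · intro hR
        have := (h.words.fac p p').pos hR
        change 0 < (listSig (letE m) (letP m) p).p at this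
        omega
      · intro hR
        have := (bitsFac N k (bits p) (bits p')).pos hR
        have h1 : (bitsFac N k (bits p) (bits p')).p = (bits p k && !bits p (k + 1)).toNat := by
          simp [bitsFac, Fac.mul_p, bitFac]
        omega
  · change p = p' ↔ _
    rw [bitsFac, Fac.mul_E]
    constructor
    · rintro rfl
      exact ⟨⟨rfl, rfl⟩, fun _ _ _ _ => rfl⟩
    · rintro ⟨⟨h1, h2⟩, h3⟩
      refine sorted_ext_bits hp hp' hpN hpN' fun r hr => ?_
      by_cases e1 : r = k
      · subst e1; exact h1
      by_cases e2 : r = k + 1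
      · subst e2; exact h2
      exact h3 r hr e1 e2

end letters

/-! ## Semi-infinite words and their letters -/

theorem zx_cases (z : Zx) : (∃ k, z = negL k) ∨ ∃ k, z = posL k := by
  obtain ⟨z, hz⟩ := z
  rcases lt_or_gt_of_ne hz with h | h
  · left
    refine ⟨⟨z.natAbs, by omega⟩, ?_⟩
    simp only [negL, Subtype.mk.injEq, PNat.mk_coe]
    omega
  · right
    refine ⟨⟨z.natAbs, by omega⟩, ?_⟩
    simp only [posL, Subtype.mk.injEq, PNat.mk_coe]
    omega

theorem posL_injective : Function.Injective posL := by
  intro a b h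
  simp only [posL, Subtype.mk.injEq] at h
  exact PNat.eq (by exact_mod_cast h)

theorem negL_injective : Function.Injective negL := by
  intro a b h
  simp only [negL, Subtype.mk.injEq, neg_inj] at h
  exact PNat.eq (by exact_mod_cast h)

theorem negL_ne_posL (a b : ℕ+) : negL a ≠ posL b := by
  have := a.pos
  have := b.pos
  simp only [negL, posL, ne_eq, Subtype.mk.injEq]
  omega

/-! ### Counting letters: charges and row conditions in terms of bits. -/

namespace FockWord

/-- The number of letters greater than `a`. -/
def cnt (w : FockWord) (a : ℤ) : ℕ := {m : ℕ | a < (w.letter m : ℤ)}.ncard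

theorem letter_lt_iff (w : FockWord) {m m' : ℕ} : (w.letter m : ℤ) < w.letter m' ↔ m' < m :=
  w.strict.lt_iff_gt

theorem letter_le_sub (w : FockWord) (m : ℕ) : (w.letter m : ℤ) ≤ w.letter 0 - m := by
  induction m with
  | zero => simp
  | succ m ih =>
    have : (w.letter (m + 1) : ℤ) < w.letter m := w.strict (Nat.lt_succ_self m)
    push_cast
    omega

theorem gt_finite (w : FockWord) (a : ℤ) : {m : ℕ | a < (w.letter m : ℤ)}.Finite := by
  refine Set.Finite.subset (Set.finite_Iio ((w.letter 0 : ℤ) - a).toNat) ?_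
  intro m hm
  have h1 := w.letter_le_sub m
  simp only [Set.mem_ofPred_eq, Set.mem_Iio] at hm ⊢
  omega

/-- The letters decrease, so those greater than `a` are exactly the first `cnt a` ones. Statements
about positions become statements about counts. -/
theorem lt_letter_iff (w : FockWord) (a : ℤ) (m : ℕ) : a < w.letter m ↔ m < w.cnt a := by
  have hdown : ∀ m m', m' ≤ m → a < (w.letter m : ℤ) → a < (w.letter m' : ℤ) := by
    intro m m' h1 h2
    have : (w.letter m : ℤ) ≤ w.letter m' := w.strict.antitone h1
    omega
  constructor
  · intro h
    have : Set.Iio (m + 1) ⊆ {m : ℕ | a < (w.letter m : ℤ)} := by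
      intro m' hm'
      simp only [Set.mem_Iio] at hm'
      exact hdown m m' (by omega) h
    have := Set.ncard_le_ncard this (w.gt_finite a)
    rw [← Finset.coe_Iio, Set.ncard_coe_finset, Nat.card_Iio] at this
    exact this
  · intro h
    by_contra h'
    have : {m : ℕ | a < (w.letter m : ℤ)} ⊆ Set.Iio m := by
      intro m' hm'
      simp only [Set.mem_Iio]
      by_contra h3
      exact h' (hdown m' m (by omega) hm')
    have := Set.ncard_le_ncard this (Set.finite_Iio m)
    rw [← Finset.coe_Iio, Set.ncard_coe_finset, Nat.card_Iio] at this
    unfold cnt at h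
    omega

theorem cnt_eq_of (w : FockWord) (a : ℤ) (n : ℕ) (h : ∀ m, a < w.letter m ↔ m < n) :
    w.cnt a = n := by
  have h1 := (w.lt_letter_iff a n).symm.trans (h n)
  have h2 := (w.lt_letter_iff a (w.cnt a)).symm.trans (h (w.cnt a))
  omega

open Classical in
theorem cnt_pred (w : FockWord) (z : Zx) :
    w.cnt (z - 1) = w.cnt z + if z ∈ Set.range w.letter then 1 else 0 := by
  apply cnt_eq_of
  intro m
  split_ifs with h
  · obtain ⟨m', rfl⟩ := h
    have h1 : w.cnt (w.letter m') = m' := by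
      apply cnt_eq_of
      intro m
      exact w.letter_lt_iff
    rw [h1, Int.sub_one_lt_iff, Nat.lt_succ_iff]
    exact w.strict.le_iff_ge
  · rw [add_zero, ← w.lt_letter_iff, Int.sub_one_lt_iff]
    refine ⟨fun h1 => lt_of_le_of_ne h1 fun h2 => h ⟨m, Subtype.ext h2.symm⟩, le_of_lt⟩

theorem cnt_neg_one (w : FockWord) : w.cnt (-1) = w.cnt 0 := by
  apply cnt_eq_of
  intro m
  rw [← w.lt_letter_iff]
  have := (w.letter m).2
  omega

open Classical in
/-- The bits of the negative letters which do not occur. -/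
def negBit (w : FockWord) (k : ℕ) : Bool := decide (negL k.succPNat ∉ Set.range w.letter)

open Classical in
/-- The bits of the positive letters which occur. -/
def posBit (w : FockWord) (k : ℕ) : Bool := decide (posL k.succPNat ∈ Set.range w.letter)

/-- All positive letters and all missing letters have index less than `N`. -/
def Bounded (N : ℕ) (w : FockWord) : Prop :=
  ∀ k, N ≤ k → w.negBit k = false ∧ w.posBit k = false

theorem exists_bounded (w : FockWord) : ∃ N, w.Bounded N := by
  obtain ⟨b, hb⟩ := w.exists_bound
  refine ⟨(-b).toNat + (w.letter 0 : ℤ).toNat + 1, fun k hk => ⟨?_, ?_⟩⟩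
  · simp only [negBit, decide_eq_false_iff_not, not_not]
    apply hb
    simp only [negL, Nat.succPNat_coe, Nat.succ_eq_add_one]
    push_cast
    omega
  · simp only [posBit, decide_eq_false_iff_not]
    rintro ⟨m, hm⟩
    have h1 := w.letter_le_sub m
    rw [hm] at h1
    simp only [posL, Nat.succPNat_coe, Nat.succ_eq_add_one] at h1
    push_cast at h1
    omega

theorem Bounded.mono {w : FockWord} {N N' : ℕ} (h : w.Bounded N) (hN : N ≤ N') : w.Bounded N' :=
  fun k hk => h k (hN.trans hk)

theorem countGe_succ {N k : ℕ} (hk : k < N) (C : ℕ → Bool) :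
    countGe N C k = (C k).toNat + countGe N C (k + 1) := by
  unfold countGe
  rw [Finset.sum_eq_sum_Ico_succ_bot hk]

theorem countGe_self (N : ℕ) (C : ℕ → Bool) : countGe N C N = 0 := by
  simp [countGe]

theorem cnt_pos {w : FockWord} {N : ℕ} (h : w.Bounded N) (a : ℕ) (ha : a ≤ N) :
    w.cnt a = countGe N w.posBit a := by
  induction ha using Nat.decreasingInduction with
  | self =>
    rw [countGe_self]
    apply cnt_eq_of
    intro m
    simp only [Nat.not_lt_zero, iff_false, not_lt]
    by_contra! hm
    have := (h ((w.letter m : ℤ).toNat - 1) (by omega)).2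
    simp only [posBit, decide_eq_false_iff_not] at this
    apply this
    refine ⟨m, Subtype.ext ?_⟩
    simp only [posL, Nat.succPNat_coe, Nat.succ_eq_add_one]
    push_cast
    omega
  | of_succ a ha ih =>
    have := w.cnt_pred (posL a.succPNat)
    have e : ((posL a.succPNat : Zx) : ℤ) = ((a + 1 : ℕ) : ℤ) := by simp [posL]
    rw [e, ih] at this
    rw [countGe_succ ha, show (a : ℤ) = ((a + 1 : ℕ) : ℤ) - 1 by push_cast; ring, this, add_comm]
    congr 1
    simp only [posBit]
    split_ifs with h <;> simp [h]

/-- Lowering the threshold by one increases the count unless the letter is missing, and far down the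
count is fixed by the charge. The correction term therefore counts the letters missing further down.
-/
theorem cnt_neg {w : FockWord} {N : ℕ} (h : w.Bounded N) {c : ℤ} (hc : w.HasCharge c) (k : ℕ)
    (hk : k ≤ N) : (w.cnt (-(k : ℤ) - 1) : ℤ) = c + k + countGe N w.negBit k := by
  have step : ∀ k : ℕ, (w.cnt (-((k + 1 : ℕ) : ℤ) - 1) : ℤ) =
      w.cnt (-(k : ℤ) - 1) + 1 - (w.negBit k).toNat := by
    intro k
    have := w.cnt_pred (negL k.succPNat)
    have e : ((negL k.succPNat : Zx) : ℤ) = -(k : ℤ) - 1 := by simp [negL]; ring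
    rw [e] at this
    rw [show -((k + 1 : ℕ) : ℤ) - 1 = -(k : ℤ) - 1 - 1 by push_cast; ring, this]
    simp only [negBit]
    split_ifs with h <;> simp [h]
  have large : ∀ᶠ k : ℕ in Filter.atTop, (w.cnt (-(k : ℤ) - 1) : ℤ) = c + k := by
    obtain ⟨M, hM⟩ := Filter.eventually_atTop.1 hc
    filter_upwards [Filter.eventually_ge_atTop (M + c.natAbs + 1)] with k hk
    have : w.cnt (-(k : ℤ) - 1) = (c + k).toNat := by
      apply cnt_eq_of
      intro m
      rcases le_or_gt M m with h1 | h1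
      · rw [hM m h1]; omega
      · have h2 : (w.letter M : ℤ) < w.letter m := w.letter_lt_iff.2 h1
        rw [hM M le_rfl] at h2
        omega
    rw [this]
    omega
  -- Beyond `N` no letter is missing, so the count grows by exactly one per step until `large`
  -- applies.
  have hN : ∀ k : ℕ, N ≤ k → (w.cnt (-(k : ℤ) - 1) : ℤ) = c + k := by
    intro k hk
    obtain ⟨M, hM⟩ := Filter.eventually_atTop.1 large
    suffices H : ∀ d : ℕ, (w.cnt (-((k + d : ℕ) : ℤ) - 1) : ℤ) = w.cnt (-(k : ℤ) - 1) + d by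
      have h1 := H M
      rw [hM (k + M) (by omega)] at h1
      push_cast at h1
      omega
    intro d
    induction d with
    | zero => simp
    | succ d ih =>
      have := step (k + d)
      rw [(h (k + d) (by omega)).1] at this
      rw [← add_assoc, this, ih]
      simp
      ring
  induction hk using Nat.decreasingInduction with
  | self => rw [countGe_self, hN N le_rfl]; simp
  | of_succ k hk ih =>
    have := step k
    rw [ih] at this
    rw [countGe_succ hk]
    push_cast at this ⊢
    omega

/-- The number of positive letters of a word of charge `c`. -/
theorem cnt_zero {w : FockWord} {N : ℕ} (h : w.Bounded N) {c : ℤ} (hc : w.HasCharge c) :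
    (w.cnt 0 : ℤ) = c + countGe N w.negBit 0 := by
  have := cnt_neg h hc 0 (Nat.zero_le _)
  rw [← w.cnt_neg_one]
  simpa using this

/-- Entrywise comparison of decreasing sequences with a shift `d` is the comparison, up to `d`, of
the numbers of letters above every threshold. -/
theorem row_iff (w w' : FockWord) (d : ℕ) :
    (∀ m, w'.letter (m + d) ≤ w.letter m) ↔ ∀ a : ℤ, w'.cnt a ≤ w.cnt a + d := by
  constructor
  · intro h a
    have h1 : ¬ a < w.letter (w.cnt a) := by rw [w.lt_letter_iff]; omega
    have h2 : (w'.letter (w.cnt a + d) : ℤ) ≤ w.letter (w.cnt a) := h (w.cnt a)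
    have h3 : ¬ a < w'.letter (w.cnt a + d) := by omega
    rw [w'.lt_letter_iff] at h3
    omega
  · intro h m
    have h1 : ¬ (w.letter m : ℤ) < w.letter m := lt_irrefl _
    rw [w.lt_letter_iff] at h1
    have h2 : ¬ (w.letter m : ℤ) < w'.letter (m + d) := by
      rw [w'.lt_letter_iff]
      have := h (w.letter m)
      omega
    exact not_lt.1 h2

/-- The row condition in terms of the bits. -/
theorem row_iff_bits {w w' : FockWord} {N : ℕ} (h : w.Bounded N) (h' : w'.Bounded N) {c c' : ℤ}
    (hc : w.HasCharge c) (hc' : w'.HasCharge c') (hcc : c ≤ c') :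
    (∀ m, w'.letter (m + (c' - c).toNat) ≤ w.letter m) ↔
      ColLe N w'.negBit w.negBit ∧
      ∀ a ≤ N, (countGe N w'.posBit a : ℤ) - c' ≤ countGe N w.posBit a - c := by
  rw [row_iff]
  constructor
  · intro H
    refine ⟨fun k hk => ?_, fun a ha => ?_⟩
    · have h1 := H (-(k : ℤ) - 1)
      have h2 := cnt_neg h hc k hk
      have h3 := cnt_neg h' hc' k hk
      omega
    · have h1 := H a
      rw [cnt_pos h a ha, cnt_pos h' a ha] at h1
      omega
  · rintro ⟨H1, H2⟩ a
    have hge : ∀ (C : ℕ → Bool) (k : ℕ), N ≤ k → countGe N C k = 0 := by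
      intro C k hk
      rw [countGe, Finset.Ico_eq_empty (by omega), Finset.sum_empty]
    rcases le_or_gt 0 a with ha | ha
    · lift a to ℕ using ha
      rcases le_or_gt a N with haN | haN
      · have := H2 a haN
        rw [cnt_pos h a haN, cnt_pos h' a haN]
        omega
      · rw [cnt_pos (h'.mono haN.le) a le_rfl, countGe_self]
        exact Nat.zero_le _
    · obtain ⟨k, rfl⟩ : ∃ k : ℕ, a = -(k : ℤ) - 1 := ⟨(-a - 1).toNat, by omega⟩
      rcases le_or_gt k N with hk | hk
      · have h1 := H1 k hk
        have h2 := cnt_neg h hc k hk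
        have h3 := cnt_neg h' hc' k hk
        omega
      · have h2 := cnt_neg (h.mono hk.le) hc k le_rfl
        have h3 := cnt_neg (h'.mono hk.le) hc' k le_rfl
        rw [countGe_self] at h2 h3
        omega

theorem exists_insert (w : FockWord) (z : Zx) (hz : z ∉ Set.range w.letter) {c : ℤ}
    (hc : w.HasCharge c) : ∃ w' : FockWord, Set.range w'.letter = insert z (Set.range w.letter) ∧
      w'.HasCharge (c + 1) := by
  set n := w.cnt z with hn
  have hlt : ∀ m, z < w.letter m ↔ m < n := fun m => w.lt_letter_iff z m
  have hgt : ∀ m, n ≤ m → w.letter m < z := by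
    intro m hm
    refine lt_of_le_of_ne (not_lt.1 fun h => ?_) fun h => hz ⟨m, h⟩
    have := (hlt m).1 h
    omega
  set u : ℕ → Zx := fun m => if m < n then w.letter m else if m = n then z else w.letter (m - 1)
    with hu
  have hcu : ∀ᶠ m : ℕ in Filter.atTop, (u m : ℤ) = c + 1 - 1 - m := by
    obtain ⟨M, hM⟩ := Filter.eventually_atTop.1 hc
    filter_upwards [Filter.eventually_ge_atTop (M + n + 1)] with m hm
    simp only [hu]
    rw [if_neg (by omega), if_neg (by omega), hM _ (by omega)]
    omega
  refine ⟨⟨u, ?_, c + 1, hcu⟩, ?_, hcu⟩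
  · refine strictAnti_nat_of_succ_lt fun m => ?_
    simp only [hu]
    rcases lt_trichotomy (m + 1) n with h | h | h
    · rw [if_pos h, if_pos (by omega)]
      exact w.strict (Nat.lt_succ_self m)
    · rw [if_neg (by omega), if_pos h, if_pos (by omega)]
      exact (hlt m).2 (by omega)
    · rw [if_neg (by omega), if_neg (by omega), if_neg (by omega)]
      split_ifs with h1
      · exact hgt _ (by omega)
      · exact w.strict (by omega)
  · ext y
    simp only [Set.mem_range, Set.mem_insert_iff, hu]
    constructor
    · rintro ⟨m, rfl⟩
      split_ifs
      · exact Or.inr ⟨m, rfl⟩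
      · exact Or.inl rfl
      · exact Or.inr ⟨m - 1, rfl⟩
    · rintro (rfl | ⟨m, rfl⟩)
      · exact ⟨n, by simp⟩
      · rcases lt_or_ge m n with h | h
        · exact ⟨m, by rw [if_pos h]⟩
        · exact ⟨m + 1, by rw [if_neg (by omega), if_neg (by omega), Nat.add_sub_cancel]⟩

theorem exists_union (w : FockWord) {c : ℤ} (hc : w.HasCharge c) (s : Finset Zx)
    (hs : ∀ z ∈ s, z ∉ Set.range w.letter) :
    ∃ w' : FockWord, (∀ z, z ∈ Set.range w'.letter ↔ z ∈ s ∨ z ∈ Set.range w.letter) ∧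
      w'.HasCharge (c + s.card) := by
  classical
  induction s using Finset.induction_on with
  | empty => exact ⟨w, by simp, by simpa using hc⟩
  | insert a s ha ih =>
    obtain ⟨w', h1, h2⟩ := ih fun z hz => hs z (by simp [hz])
    obtain ⟨w'', h3, h4⟩ := w'.exists_insert a (by
      rw [h1, not_or]; exact ⟨ha, hs a (by simp)⟩) h2
    refine ⟨w'', fun z => ?_, ?_⟩
    · rw [h3, Set.mem_insert_iff, h1, Finset.mem_insert, or_assoc]
    · rw [Finset.card_insert_of_notMem ha]
      push_cast
      rw [← add_assoc]
      exact h4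

/-- Every pair of finite sets is the pair of the missing letters and of the positive letters of a
semi-infinite word. -/
theorem exists_of_bits (P Q : Finset ℕ+) : ∃ w : FockWord,
    (∀ k, negL k ∉ Set.range w.letter ↔ k ∈ P) ∧ (∀ k, posL k ∈ Set.range w.letter ↔ k ∈ Q) ∧
    w.HasCharge ((Q.card : ℤ) - P.card) := by
  classical
  -- The word is built from that of all letters below `-K` by adding the positive letters from `Q`
  -- and the negative letters down to `-K` that `P` does not exclude. Each addition raises the
  -- charge by one.
  obtain ⟨K, hK⟩ : ∃ K : ℕ, ∀ k ∈ P, (k : ℕ) ≤ K :=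
    ⟨P.sup fun k => (k : ℕ), fun k hk => Finset.le_sup (f := fun k : ℕ+ => (k : ℕ)) hk⟩
  set I : Finset ℕ+ := (Finset.range K).image Nat.succPNat with hI
  have hIc : I.card = K := by
    rw [hI, Finset.card_image_of_injective _ Nat.succPNat_injective, Finset.card_range]
  have hmI : ∀ k : ℕ+, k ∈ I ↔ (k : ℕ) ≤ K := by
    intro k
    simp only [hI, Finset.mem_image, Finset.mem_range]
    constructor
    · rintro ⟨a, ha, rfl⟩; simpa using ha
    · intro h
      exact ⟨k.natPred, by have := k.natPred_add_one; omega, k.succPNat_natPred⟩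
  have hPI : P ⊆ I := fun k hk => (hmI k).2 (hK k hk)
  set s : Finset Zx := Q.image posL ∪ (I \ P).image negL with hs
  have hsc : (s.card : ℤ) = Q.card + (K - P.card) := by
    have h2 : Disjoint (Q.image posL) ((I \ P).image negL) := by
      rw [Finset.disjoint_left]
      intro z h1 h2
      simp only [Finset.mem_image] at h1 h2
      obtain ⟨a, -, rfl⟩ := h1
      obtain ⟨b, -, h⟩ := h2
      exact negL_ne_posL _ _ h
    rw [hs, Finset.card_union_of_disjoint h2, Finset.card_image_of_injective _ posL_injective,
      Finset.card_image_of_injective _ negL_injective, Finset.card_sdiff_of_subset hPI, hIc]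
    have := Finset.card_le_card hPI
    push_cast
    omega
  have hrange : ∀ z : Zx, z ∈ Set.range (highest (-(K : ℤ))).letter ↔ (z : ℤ) < -(K : ℤ) := by
    intro z
    constructor
    · rintro ⟨m, rfl⟩
      simp only [highest]
      split_ifs <;> omega
    · intro h
      refine ⟨(-(K : ℤ) - 1 - z).toNat, Subtype.ext ?_⟩
      simp only [highest]
      split_ifs <;> omega
  obtain ⟨w, h1, h2⟩ := (highest (-(K : ℤ))).exists_union (highest_hasCharge _) s (by
    intro z hz
    rw [hrange, hs] at *
    simp only [Finset.mem_union, Finset.mem_image, Finset.mem_sdiff] at hz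
    rcases hz with ⟨a, -, rfl⟩ | ⟨a, ⟨ha, -⟩, rfl⟩
    · have := a.pos
      simp only [posL]; omega
    · rw [hmI] at ha
      simp only [negL]; omega)
  refine ⟨w, fun k => ?_, fun k => ?_, ?_⟩
  · rw [h1, hrange, hs]
    simp only [Finset.mem_union, Finset.mem_image, Finset.mem_sdiff, not_or]
    have e1 : (¬ ∃ a ∈ Q, posL a = negL k) := by
      rintro ⟨a, -, h⟩; exact negL_ne_posL _ _ h.symm
    have e2 : (∃ a, (a ∈ I ∧ a ∉ P) ∧ negL a = negL k) ↔ k ∈ I ∧ k ∉ P := by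
      constructor
      · rintro ⟨a, h, h'⟩
        rw [← negL_injective h']; exact h
      · exact fun h => ⟨k, h, rfl⟩
    rw [e2, hmI]
    simp only [negL]
    constructor
    · rintro ⟨⟨-, h3⟩, h4⟩
      by_contra h5
      exact h3 ⟨by omega, h5⟩
    · intro h3
      have := hK k h3
      exact ⟨⟨e1, fun h => h.2 h3⟩, by omega⟩
  · rw [h1, hrange, hs]
    simp only [Finset.mem_union, Finset.mem_image]
    have e1 : (∃ a ∈ Q, posL a = posL k) ↔ k ∈ Q := by
      constructor
      · rintro ⟨a, h, h'⟩
        rw [← posL_injective h']; exact h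
      · exact fun h => ⟨k, h, rfl⟩
    have e2 : ¬ ∃ a ∈ I \ P, negL a = posL k := by
      rintro ⟨a, -, h⟩; exact negL_ne_posL _ _ h
    rw [e1]
    have := k.pos
    simp only [e2, or_false]
    refine ⟨fun h => h.resolve_right ?_, Or.inl⟩
    simp only [posL]
    omega
  · rw [hsc] at h2
    convert h2 using 1
    ring

end FockWord

end

end GlInf

namespace GlInf

noncomputable section

open PreCrystal

/-! ## The operators on semi-infinite words in terms of bits -/

section fockfac

variable {N : ℕ} {w w' : FockWord}

/-- The comparison of two semi-infinite words. -/
def fockFac (i : ℤ) (w w' : FockWord) : Fac := (goodAt_fock i).fac w w'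

theorem negBit_eq_true {w : FockWord} {k : ℕ} :
    w.negBit k = true ↔ negL k.succPNat ∉ Set.range w.letter := by
  simp [FockWord.negBit]

theorem negBit_eq_false {w : FockWord} {k : ℕ} :
    w.negBit k = false ↔ negL k.succPNat ∈ Set.range w.letter := by
  simp [FockWord.negBit]

theorem posBit_eq_true {w : FockWord} {k : ℕ} :
    w.posBit k = true ↔ posL k.succPNat ∈ Set.range w.letter := by
  simp [FockWord.posBit]

theorem posBit_eq_false {w : FockWord} {k : ℕ} :
    w.posBit k = false ↔ posL k.succPNat ∉ Set.range w.letter := by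
  simp [FockWord.posBit]

theorem fockFac_R {i : ℤ} (h : (fockFac i w w').R) :
    (lo i ∈ Set.range w.letter ∧ hi i ∉ Set.range w.letter) ∧
    ∀ z, z ∈ Set.range w'.letter ↔ z = hi i ∨ (z ∈ Set.range w.letter ∧ z ≠ lo i) := by
  change liftOp FockWord.letter (replaceLetter (lo i) (hi i)) w = some w' at h
  rw [fock_replace_iff] at h
  obtain ⟨h1, h2⟩ := h
  refine ⟨h1, fun z => ?_⟩
  rw [h2, range_replace _ _ _ h1.1]
  rfl

theorem fockFac_E {i : ℤ} : (fockFac i w w').E ↔ w = w' := Iff.rfl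

theorem fockFac_e (i : ℤ) : (fockFac i w w').e = fockE i w := rfl

theorem fockFac_p (i : ℤ) : (fockFac i w w').p = fockP i w := rfl

/-- Replacing `-(k + 2)` by `-(k + 1)` in a word makes `-(k + 1)` cease to be missing and `-(k + 2)`
become missing. For the dual letters this is the arrow of `𝐁_{<0}^∨`, moving a bit from index `k` to
`k + 1`. -/
theorem fockFac_le_neg {i : ℤ} (hi' : i < 0) {k : ℕ} (hik : -i = k + 1) :
    Fac.Le (fockFac i w w') (bitsFac N k w.negBit w'.negBit * Fac.ofProp (w.posBit = w'.posBit)) := by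
  have hlo : lo i = negL (k + 1).succPNat := ((negL_eq_lo hi' _).2 (by simp; omega)).symm
  have hhi : hi i = negL k.succPNat := ((negL_eq_hi hi' _).2 (by simp; omega)).symm
  refine ⟨?_, ?_, ?_, ?_⟩
  · rw [fockFac_e, fockE, hlo, hhi]
    simp only [bitsFac, Fac.mul_e, Fac.ofProp_e, bitFac, Nat.zero_sub, add_zero,
      FockWord.negBit]
    by_cases h1 : negL k.succPNat ∈ Set.range w.letter <;>
      by_cases h2 : negL (k + 1).succPNat ∈ Set.range w.letter <;>
      simp only [h1, h2, not_true, not_false_iff, and_true, and_false, if_true, if_false,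
        decide_true, decide_false] <;> rfl
  · rw [fockFac_p, fockP, hlo, hhi]
    simp only [bitsFac, Fac.mul_p, Fac.ofProp_e, Fac.ofProp_p, bitFac, Nat.sub_zero, zero_add,
      FockWord.negBit]
    by_cases h1 : negL k.succPNat ∈ Set.range w.letter <;>
      by_cases h2 : negL (k + 1).succPNat ∈ Set.range w.letter <;>
      simp only [h1, h2, not_true, not_false_iff, and_true, and_false, if_true, if_false,
        decide_true, decide_false] <;> rfl
  · intro h
    obtain ⟨⟨h1, h2⟩, h3⟩ := fockFac_R h
    rw [hlo] at h1
    rw [hhi] at h2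
    rw [hlo, hhi] at h3
    rw [Fac.mul_ofProp_R, bitsFac, Fac.mul_ofProp_R]
    refine ⟨⟨⟨negBit_eq_true.2 h2, negBit_eq_false.2 h1, ?_, ?_⟩, ?_⟩, ?_⟩
    · exact negBit_eq_false.2 ((h3 _).2 (Or.inl rfl))
    · rw [negBit_eq_true, h3, not_or]
      refine ⟨fun h => ?_, fun h => h.2 rfl⟩
      have := Nat.succPNat_inj.1 (negL_injective h)
      omega
    · intro r _ hr1 hr2
      simp only [FockWord.negBit, decide_eq_decide, h3]
      have e1 : negL r.succPNat ≠ negL k.succPNat := fun h =>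
        hr1 (Nat.succPNat_inj.1 (negL_injective h))
      have e2 : negL r.succPNat ≠ negL (k + 1).succPNat := fun h =>
        hr2 (Nat.succPNat_inj.1 (negL_injective h))
      simp [e1, e2]
    · funext r
      simp only [FockWord.posBit, decide_eq_decide, h3]
      simp [(negL_ne_posL _ _).symm]
  · rw [fockFac_E]
    rintro rfl
    rw [Fac.mul_E, bitsFac, Fac.mul_E]
    exact ⟨⟨⟨rfl, rfl⟩, fun _ _ _ _ => rfl⟩, rfl⟩

theorem fockFac_le_pos {i : ℤ} (hi' : 0 < i) {k : ℕ} (hik : i = k + 1) :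
    Fac.Le (fockFac i w w') (bitsFac N k w.posBit w'.posBit * Fac.ofProp (w.negBit = w'.negBit)) := by
  have hlo : lo i = posL k.succPNat := ((posL_eq_lo hi' _).2 (by simp; omega)).symm
  have hhi : hi i = posL (k + 1).succPNat := ((posL_eq_hi hi' _).2 (by simp; omega)).symm
  refine ⟨?_, ?_, ?_, ?_⟩
  · rw [fockFac_e, fockE, hlo, hhi]
    simp only [bitsFac, Fac.mul_e, Fac.ofProp_e, bitFac, Nat.zero_sub, add_zero,
      FockWord.posBit]
    by_cases h1 : posL k.succPNat ∈ Set.range w.letter <;>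
      by_cases h2 : posL (k + 1).succPNat ∈ Set.range w.letter <;>
      simp only [h1, h2, not_true, not_false_iff, and_true, and_false, if_true, if_false,
        decide_true, decide_false] <;> rfl
  · rw [fockFac_p, fockP, hlo, hhi]
    simp only [bitsFac, Fac.mul_p, Fac.ofProp_e, Fac.ofProp_p, bitFac, Nat.sub_zero, zero_add,
      FockWord.posBit]
    by_cases h1 : posL k.succPNat ∈ Set.range w.letter <;>
      by_cases h2 : posL (k + 1).succPNat ∈ Set.range w.letter <;>
      simp only [h1, h2, not_true, not_false_iff, and_true, and_false, if_true, if_false,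
        decide_true, decide_false] <;> rfl
  · intro h
    obtain ⟨⟨h1, h2⟩, h3⟩ := fockFac_R h
    rw [hlo] at h1
    rw [hhi] at h2
    rw [hlo, hhi] at h3
    rw [Fac.mul_ofProp_R, bitsFac, Fac.mul_ofProp_R]
    refine ⟨⟨⟨posBit_eq_true.2 h1, posBit_eq_false.2 h2, ?_, ?_⟩, ?_⟩, ?_⟩
    · rw [posBit_eq_false, h3, not_or]
      refine ⟨fun h => ?_, fun h => h.2 rfl⟩
      have := Nat.succPNat_inj.1 (posL_injective h)
      omega
    · exact posBit_eq_true.2 ((h3 _).2 (Or.inl rfl))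
    · intro r _ hr1 hr2
      simp only [FockWord.posBit, decide_eq_decide, h3]
      have e1 : posL r.succPNat ≠ posL k.succPNat := fun h =>
        hr1 (Nat.succPNat_inj.1 (posL_injective h))
      have e2 : posL r.succPNat ≠ posL (k + 1).succPNat := fun h =>
        hr2 (Nat.succPNat_inj.1 (posL_injective h))
      simp [e1, e2]
    · funext r
      simp only [FockWord.negBit, decide_eq_decide, h3]
      simp [negL_ne_posL]
  · rw [fockFac_E]
    rintro rfl
    rw [Fac.mul_E, bitsFac, Fac.mul_E]
    exact ⟨⟨⟨rfl, rfl⟩, fun _ _ _ _ => rfl⟩, rfl⟩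

theorem lo_zero : lo 0 = negL (Nat.succPNat 0) := by
  simp [lo, negL]

theorem hi_zero : hi 0 = posL (Nat.succPNat 0) := by
  simp [hi, posL]

/-- Replacing `-1` by `1` produces a missing and a positive letter at once, so both bits of index
`0` become set. -/
theorem fockFac_le_zero : Fac.Le (fockFac 0 w w')
    (zeroFac N w.negBit w.posBit w'.negBit w'.posBit) := by
  refine ⟨?_, ?_, ?_, ?_⟩
  · rw [fockFac_e, fockE, lo_zero, hi_zero]
    simp only [zeroFac, FockWord.posBit, FockWord.negBit]
    by_cases h1 : negL (Nat.succPNat 0) ∈ Set.range w.letter <;>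
      by_cases h2 : posL (Nat.succPNat 0) ∈ Set.range w.letter <;>
      simp only [h1, h2, not_true, not_false_iff, and_true, and_false, if_true, if_false,
        decide_true, decide_false] <;> rfl
  · rw [fockFac_p, fockP, lo_zero, hi_zero]
    simp only [zeroFac, FockWord.posBit, FockWord.negBit]
    by_cases h1 : negL (Nat.succPNat 0) ∈ Set.range w.letter <;>
      by_cases h2 : posL (Nat.succPNat 0) ∈ Set.range w.letter <;>
      simp only [h1, h2, not_true, not_false_iff, and_true, and_false, if_true, if_false,
        decide_true, decide_false] <;> rfl
  · intro h
    obtain ⟨⟨h1, h2⟩, h3⟩ := fockFac_R h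
    rw [lo_zero] at h1
    rw [hi_zero] at h2
    rw [lo_zero, hi_zero] at h3
    refine ⟨⟨negBit_eq_false.2 h1, posBit_eq_false.2 h2, ?_, ?_⟩, ?_⟩
    · rw [negBit_eq_true, h3, not_or]
      exact ⟨negL_ne_posL _ _, fun h => h.2 rfl⟩
    · exact posBit_eq_true.2 ((h3 _).2 (Or.inl rfl))
    · intro r _ hr
      have e1 : posL r.succPNat ≠ posL (Nat.succPNat 0) := fun h =>
        hr (Nat.succPNat_inj.1 (posL_injective h))
      have e2 : negL r.succPNat ≠ negL (Nat.succPNat 0) := fun h =>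
        hr (Nat.succPNat_inj.1 (negL_injective h))
      simp only [FockWord.negBit, FockWord.posBit, decide_eq_decide, h3]
      constructor
      · simp [e2, negL_ne_posL]
      · simp [e1, (negL_ne_posL _ _).symm]
  · rw [fockFac_E]
    rintro rfl
    exact fun _ _ => ⟨rfl, rfl⟩

end fockfac

/-! ## The positive letters of a semi-infinite word -/

/-- The positive letter with a given value. -/
def toPos (z : Zx) : ℕ+ := (z : ℤ).natAbs.toPNat'

theorem posL_toPos {z : Zx} (hz : 0 < (z : ℤ)) : posL (toPos z) = z := by
  apply Subtype.ext
  simp only [posL, toPos, Nat.toPNat'_coe]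
  split_ifs <;> omega

theorem toPos_posL (k : ℕ+) : toPos (posL k) = k := by
  apply posL_injective
  rw [posL_toPos]
  have := k.pos
  simp only [posL]
  omega

theorem posL_lt_iff {a b : ℕ+} : posL a < posL b ↔ a < b := by
  rw [← Subtype.coe_lt_coe, ← PNat.coe_lt_coe]
  simp [posL]

namespace FockWord

/-- The positive letters in increasing order. -/
def posList (w : FockWord) : List ℕ+ :=
  (List.range (w.cnt 0)).reverse.map fun m => toPos (w.letter m)

theorem letter_pos_iff (w : FockWord) (m : ℕ) : 0 < (w.letter m : ℤ) ↔ m < w.cnt 0 :=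
  w.lt_letter_iff 0 m

theorem posList_map (w : FockWord) :
    w.posList.map posL = (List.range (w.cnt 0)).reverse.map w.letter := by
  rw [posList, List.map_map]
  refine List.map_congr_left fun m hm => ?_
  exact posL_toPos ((w.letter_pos_iff m).2 (by simpa using hm))

theorem posList_length (w : FockWord) : w.posList.length = w.cnt 0 := by
  simp [posList]

theorem mem_posList (w : FockWord) (k : ℕ+) : k ∈ w.posList ↔ posL k ∈ Set.range w.letter := by
  have : k ∈ w.posList ↔ posL k ∈ w.posList.map posL := by
    rw [List.mem_map_of_injective posL_injective]
  rw [this, posList_map]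
  simp only [List.mem_map, List.mem_reverse, List.mem_range, Set.mem_range]
  constructor
  · rintro ⟨m, -, h⟩; exact ⟨m, h⟩
  · rintro ⟨m, h⟩
    refine ⟨m, (w.letter_pos_iff m).1 ?_, h⟩
    rw [h]
    have := k.pos
    simp only [posL]
    omega

theorem posList_sorted (w : FockWord) : w.posList.Pairwise (· < ·) := by
  have : (w.posList.map posL).Pairwise (· < ·) := by
    rw [posList_map, List.pairwise_map, List.pairwise_reverse]
    exact List.pairwise_lt_range.imp fun h => w.strict h
  rw [List.pairwise_map] at this
  exact this.imp posL_lt_iff.1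

theorem bits_posList (w : FockWord) : bits w.posList = w.posBit := by
  funext k
  exact decide_eq_decide.2 (w.mem_posList _)

theorem mem_dualColumn (w : FockWord) (k : ℕ+) : k ∈ w.dualColumn ↔ negL k ∉ Set.range w.letter := by
  simp [dualColumn, missing]

theorem dualColumn_sorted (w : FockWord) : w.dualColumn.Pairwise (· < ·) :=
  (Finset.sortedLT_sort _).pairwise

theorem bits_dualColumn (w : FockWord) : bits w.dualColumn = w.negBit := by
  funext k
  exact decide_eq_decide.2 (w.mem_dualColumn _)

theorem Bounded.posList {w : FockWord} {N : ℕ} (h : w.Bounded N) :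
    ∀ z ∈ w.posList, z.natPred < N := by
  intro z hz
  by_contra! hN
  have := (h _ hN).2
  rw [← bits_posList, bits_eq_false, PNat.succPNat_natPred] at this
  exact this hz

theorem Bounded.dualColumn {w : FockWord} {N : ℕ} (h : w.Bounded N) :
    ∀ z ∈ w.dualColumn, z.natPred < N := by
  intro z hz
  by_contra! hN
  have := (h _ hN).1
  rw [← bits_dualColumn, bits_eq_false, PNat.succPNat_natPred] at this
  exact this hz

/-- A semi-infinite word is determined by its missing and its positive letters. -/
theorem ext_lists {w w' : FockWord} (h : w.dualColumn = w'.dualColumn)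
    (h' : w.posList = w'.posList) : w = w' := by
  apply ext_range
  ext z
  rcases zx_cases z with ⟨k, rfl⟩ | ⟨k, rfl⟩
  · rw [← not_iff_not, ← mem_dualColumn, ← mem_dualColumn, h]
  · rw [← mem_posList, ← mem_posList, h']

theorem length_eq_countGe {N : ℕ} {p : List ℕ+} (hp : p.Pairwise (· < ·))
    (hN : ∀ z ∈ p, z.natPred < N) : p.length = countGe N (bits p) 0 := by
  have h1 : (p.map PNat.natPred).Nodup := by
    refine List.Nodup.map_on ?_ (hp.imp fun h => h.ne)
    intro x _ y _ h
    rw [← x.succPNat_natPred, h, y.succPNat_natPred]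
  have h2 : (p.map PNat.natPred).toFinset = (Finset.range N).filter fun k => bits p k = true := by
    ext k
    simp only [List.mem_toFinset, List.mem_map, Finset.mem_filter, Finset.mem_range, bits_eq_true]
    constructor
    · rintro ⟨z, hz, rfl⟩
      exact ⟨hN z hz, by simpa using hz⟩
    · rintro ⟨_, h⟩
      exact ⟨_, h, by simp⟩
  rw [← List.length_map (as := p) PNat.natPred, ← List.toFinset_card_of_nodup h1, h2,
    Finset.card_filter, countGe, Nat.Ico_zero_eq_range]
  refine Finset.sum_congr rfl fun k _ => ?_
  cases bits p k <;> rfl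

theorem length_posList {w : FockWord} {c : ℤ} (hc : w.HasCharge c) :
    (w.posList.length : ℤ) = c + w.dualColumn.length := by
  obtain ⟨N, hN⟩ := w.exists_bounded
  rw [posList_length, cnt_zero hN hc, length_eq_countGe w.dualColumn_sorted hN.dualColumn,
    bits_dualColumn]

/-- The word with given lists of missing and of positive letters. -/
theorem exists_of_lists {p q : List ℕ+} (hp : p.Pairwise (· < ·)) (hq : q.Pairwise (· < ·)) :
    ∃ w : FockWord, w.dualColumn = p ∧ w.posList = q ∧
      w.HasCharge ((q.length : ℤ) - p.length) := by
  obtain ⟨w, h1, h2, h3⟩ := exists_of_bits p.toFinset q.toFinset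
  refine ⟨w, sorted_ext w.dualColumn_sorted hp fun z => ?_,
    sorted_ext w.posList_sorted hq fun z => ?_, ?_⟩
  · rw [mem_dualColumn, h1, List.mem_toFinset]
  · rw [mem_posList, h2, List.mem_toFinset]
  · rwa [List.toFinset_card_of_nodup (hp.imp fun h => h.ne),
      List.toFinset_card_of_nodup (hq.imp fun h => h.ne)] at h3

/-- The decomposition of the positive letters into the lowest `l` ones and the other ones. -/
theorem posList_eq_append_iff (w : FockWord) {q d : List ℕ+} (hl : d.length ≤ w.cnt 0) :
    w.posList = q ++ d ↔
      q.map posL = ((List.range (w.cnt 0)).drop d.length).reverse.map w.letter ∧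
      d.map posL = (List.range d.length).reverse.map w.letter := by
  have hr : (List.range (w.cnt 0)).reverse =
      ((List.range (w.cnt 0)).drop d.length).reverse ++ (List.range d.length).reverse := by
    rw [← List.reverse_append]
    congr 1
    conv_lhs => rw [← List.take_append_drop d.length (List.range (w.cnt 0))]
    rw [List.take_range, Nat.min_eq_left hl]
  rw [← (List.map_injective_iff.2 posL_injective).eq_iff, posList_map, hr, List.map_append,
    List.map_append]
  constructor
  · intro h
    obtain ⟨h1, h2⟩ := List.append_inj' h (by simp)
    exact ⟨h1.symm, h2.symm⟩
  · rintro ⟨h1, h2⟩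
    rw [h1, h2]

end FockWord

end

end GlInf

namespace GlInf

noncomputable section

open PreCrystal

/-! ## The insertion, column by column -/

/-- The biword which is inserted into the `t`-th column, when `L` is inserted into the columns
`c 0, c 1, …`. -/
def passL (L : List (ℕ+ × ℕ+)) (c : ℕ → List ℕ+) : ℕ → List (ℕ+ × ℕ+)
  | 0 => L
  | t + 1 => passL (columnPass L (c 0)).2.2 (fun s => c (s + 1)) t

theorem passL_succ (t : ℕ) : ∀ (L : List (ℕ+ × ℕ+)) (c : ℕ → List ℕ+),
    passL L c (t + 1) = (columnPass (passL L c t) (c t)).2.2 := by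
  induction t with
  | zero => intro L c; rfl
  | succ t ih => intro L c; exact ih (columnPass L (c 0)).2.2 (fun s => c (s + 1))

theorem passL_nil (c : ℕ → List ℕ+) (t : ℕ) : passL [] c t = [] := by
  induction t with
  | zero => rfl
  | succ t ih => rw [passL_succ, ih]; rfl

/-! ### Insertion letter by letter against insertion column by column. -/

section foldr

variable (cols : List (List ℕ+ × List ℕ+))

/-- An iteration of `foldr_skewInsert_cons`. The default value `([], [])` provides empty columns
beyond the initial tableau, in agreement with the algorithm by `foldr_skewInsert_nil`. -/
theorem foldr_getD (t : ℕ) : ∀ (L : List (ℕ+ × ℕ+)) (cols : List (List ℕ+ × List ℕ+)),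
    (∀ x ∈ cols, x.2 = []) →
    (L.foldr (fun x cols => skewInsert x.1 x.2 cols) cols).getD t ([], []) =
      ((columnPass (passL L (fun s => (cols.getD s ([], [])).1) t) (cols.getD t ([], [])).1).1,
        (columnPass (passL L (fun s => (cols.getD s ([], [])).1) t) (cols.getD t ([], [])).1).2.1) := by
  have hcons : ∀ (t : ℕ) (L : List (ℕ+ × ℕ+)) (p q : List ℕ+)
      (cols : List (List ℕ+ × List ℕ+)), q = [] →
      (∀ s, t = s + 1 → ((columnPass L p).2.2.foldr (fun x cols => skewInsert x.1 x.2 cols)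
        cols).getD s ([], []) =
      ((columnPass (passL (columnPass L p).2.2 (fun s => (cols.getD s ([], [])).1) s)
        (cols.getD s ([], [])).1).1,
        (columnPass (passL (columnPass L p).2.2 (fun s => (cols.getD s ([], [])).1) s)
          (cols.getD s ([], [])).1).2.1)) →
      (L.foldr (fun x cols => skewInsert x.1 x.2 cols) ((p, q) :: cols)).getD t ([], []) =
      ((columnPass (passL L (fun s => (((p, q) :: cols).getD s ([], [])).1) t)
        (((p, q) :: cols).getD t ([], [])).1).1,
        (columnPass (passL L (fun s => (((p, q) :: cols).getD s ([], [])).1) t)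
          (((p, q) :: cols).getD t ([], [])).1).2.1) := by
    intro t L p q cols hq h
    subst hq
    rw [foldr_skewInsert_cons]
    cases t with
    | zero => simp [passL]
    | succ t =>
      rw [List.getD_cons_succ, h t rfl, passL]
      simp
  induction t with
  | zero =>
    intro L cols hq
    cases cols with
    | nil =>
      by_cases hL : L = []
      · subst hL; rfl
      · rw [foldr_skewInsert_nil hL]
        exact hcons 0 L [] [] [] rfl (fun s hs => by omega)
    | cons x cols =>
      obtain ⟨p, q⟩ := x
      exact hcons 0 L p q cols (hq (p, q) (by simp)) (fun s hs => by omega)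
  | succ t ih =>
    intro L cols hq
    cases cols with
    | nil =>
      by_cases hL : L = []
      · subst hL
        simp only [List.foldr_nil, List.getD_nil, passL_nil]
        rfl
      · rw [foldr_skewInsert_nil hL]
        have := hcons (t + 1) L [] [] [] rfl (fun s hs => by
          obtain rfl : t = s := by omega
          exact ih _ [] (by simp))
        simp only [List.getD_cons_succ, List.getD_nil] at this ⊢
        rw [this]
        have e : (fun s => (([(([] : List ℕ+), ([] : List ℕ+))]).getD s ([], [])).1) =
            fun _ => ([] : List ℕ+) := by
          funext s
          cases s <;> simp
        rw [e]
    | cons x cols =>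
      obtain ⟨p, q⟩ := x
      refine hcons (t + 1) L p q cols (hq (p, q) (by simp)) (fun s hs => ?_)
      obtain rfl : t = s := by omega
      exact ih _ cols fun y hy => hq y (by simp [hy])

theorem foldr_skewInsert_ne_nil {L : List (ℕ+ × ℕ+)} (hL : L ≠ [])
    (cols : List (List ℕ+ × List ℕ+)) :
    L.foldr (fun x cols => skewInsert x.1 x.2 cols) cols ≠ [] := by
  cases L with
  | nil => exact absurd rfl hL
  | cons x L =>
    rw [List.foldr_cons]
    cases h : L.foldr (fun x cols => skewInsert x.1 x.2 cols) cols with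
    | nil => simp [skewInsert]
    | cons y cols =>
      obtain ⟨p, q⟩ := y
      rw [skewInsert]
      split <;> simp

theorem foldr_length_le (n : ℕ) : ∀ (L : List (ℕ+ × ℕ+)) (cols : List (List ℕ+ × List ℕ+)),
    (L.foldr (fun x cols => skewInsert x.1 x.2 cols) cols).length ≤ n ↔
      passL L (fun s => (cols.getD s ([], [])).1) n = [] ∧ cols.length ≤ n := by
  induction n with
  | zero =>
    intro L cols
    rw [Nat.le_zero, List.length_eq_zero_iff, Nat.le_zero, List.length_eq_zero_iff, passL]
    constructor
    · intro h
      have hL : L = [] := by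
        by_contra hL
        exact foldr_skewInsert_ne_nil hL _ h
      subst hL
      exact ⟨rfl, h⟩
    · rintro ⟨rfl, rfl⟩
      rfl
  | succ n ih =>
    intro L cols
    cases cols with
    | nil =>
      by_cases hL : L = []
      · subst hL
        simp [passL_nil]
      · rw [foldr_skewInsert_nil hL, foldr_skewInsert_cons, List.length_cons,
          Nat.add_le_add_iff_right, ih, passL]
        simp
    | cons x cols =>
      obtain ⟨p, q⟩ := x
      rw [foldr_skewInsert_cons, List.length_cons, Nat.add_le_add_iff_right, ih, passL]
      simp

end foldr

/-! ### Skew RSK as a chain of grids. -/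

section rsk

variable {μ ν : YoungDiagram}

theorem colLen_eq_zero (μ : YoungDiagram) {t : ℕ} (h : μ.rowLen 0 ≤ t) : μ.colLen t = 0 := by
  by_contra h'
  have : (0, t) ∈ μ := by rw [YoungDiagram.mem_iff_lt_colLen]; omega
  rw [YoungDiagram.mem_iff_lt_rowLen] at this
  omega

/-- The `t`-th column from the right of a tableau of anti-normal shape, from top to bottom. -/
def colS (S : SST (antinormalShape μ)) (t : ℕ) : List ℕ+ :=
  (List.range (μ.colLen t)).reverse.map fun r : ℕ => S.entry (-(r : ℤ), -(t : ℤ))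

/-- The column with index `c` of a tableau of normal shape, from top to bottom. -/
def colT (T : SST (normalShape ν)) (c : ℕ) : List ℕ+ :=
  (List.range (ν.colLen c)).map fun r : ℕ => T.entry ((r : ℤ), (c : ℤ))

/-- The biword which is inserted into the `t`-th column. -/
def rskL (S : SST (antinormalShape μ)) (A : Mat) (t : ℕ) : List (ℕ+ × ℕ+) :=
  passL (omegaWord A) (colS S) t

/-- The columns of the insertion tableau. -/
def rskP (S : SST (antinormalShape μ)) (A : Mat) (t : ℕ) : List ℕ+ :=
  (columnPass (rskL S A t) (colS S t)).1

/-- The columns of the recording tableau. -/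
def rskQ (S : SST (antinormalShape μ)) (A : Mat) (t : ℕ) : List ℕ+ :=
  (columnPass (rskL S A t) (colS S t)).2.1

theorem startColumns_getD (S : SST (antinormalShape μ)) (t : ℕ) :
    ((startColumns S).getD t ([], [])).1 = colS S t := by
  unfold startColumns
  rcases lt_or_ge t (μ.rowLen 0) with h | h
  · rw [List.getD_eq_getElem _ _ (by simpa using h)]
    simp only [List.getElem_map, List.getElem_range, colS, List.bind_eq_flatMap, List.pure_def,
      ← List.map_eq_flatMap, List.map_map]
    rfl
  · rw [List.getD_eq_default _ _ (by simpa using h)]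
    simp [colS, colLen_eq_zero μ h]

theorem skewRSK_getD (S : SST (antinormalShape μ)) (A : Mat) (t : ℕ) :
    (skewRSK S A).getD t ([], []) = (rskP S A t, rskQ S A t) := by
  have h := foldr_getD t (omegaWord A) (startColumns S) (by
    intro x hx
    simp only [startColumns, List.mem_map] at hx
    obtain ⟨_, _, rfl⟩ := hx
    rfl)
  simp only [startColumns_getD] at h
  exact h

theorem skewRSK_length_le (S : SST (antinormalShape μ)) (A : Mat) (n : ℕ) :
    (skewRSK S A).length ≤ n ↔ rskL S A n = [] ∧ μ.rowLen 0 ≤ n := by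
  have h := foldr_length_le n (omegaWord A) (startColumns S)
  simp only [startColumns_getD] at h
  have hlen : (startColumns S).length = μ.rowLen 0 := by simp [startColumns]
  rw [hlen] at h
  exact h

theorem antinormal_mem {r t : ℕ} : (-(r : ℤ), -(t : ℤ)) ∈ antinormalShape μ ↔ r < μ.colLen t := by
  simp only [antinormalShape, Finset.mem_image, YoungDiagram.mem_cells, Prod.mk.injEq, neg_inj,
    Nat.cast_inj, Prod.exists, exists_eq_right_right, exists_eq_right,
    YoungDiagram.mem_iff_lt_colLen]

theorem normal_mem {r c : ℕ} : ((r : ℤ), (c : ℤ)) ∈ normalShape ν ↔ r < ν.colLen c := by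
  simp only [normalShape, Finset.mem_image, YoungDiagram.mem_cells, Prod.mk.injEq,
    Nat.cast_inj, Prod.exists, exists_eq_right_right, exists_eq_right,
    YoungDiagram.mem_iff_lt_colLen]

theorem colS_sorted (S : SST (antinormalShape μ)) (t : ℕ) : (colS S t).Pairwise (· < ·) := by
  rw [colS, List.pairwise_map, List.pairwise_reverse]
  refine List.pairwise_lt_range.imp_of_mem fun {a b} ha hb hab => ?_
  simp only [List.mem_range] at ha hb
  exact S.col_strict _ _ _ (by omega) (antinormal_mem.2 hb) (antinormal_mem.2 ha)

theorem colT_sorted (T : SST (normalShape ν)) (c : ℕ) : (colT T c).Pairwise (· < ·) := by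
  rw [colT, List.pairwise_map]
  refine List.pairwise_lt_range.imp_of_mem fun {a b} ha hb hab => ?_
  simp only [List.mem_range] at ha hb
  exact T.col_strict _ _ _ (by omega) (normal_mem.2 ha) (normal_mem.2 hb)

theorem colS_length (S : SST (antinormalShape μ)) (t : ℕ) : (colS S t).length = μ.colLen t := by
  simp [colS]

theorem colT_length (T : SST (normalShape ν)) (c : ℕ) : (colT T c).length = ν.colLen c := by
  simp [colT]

theorem rskL_succ (S : SST (antinormalShape μ)) (A : Mat) (t : ℕ) :
    rskL S A (t + 1) = (columnPass (rskL S A t) (colS S t)).2.2 := passL_succ _ _ _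

/-- All indices which occur in `(A, S_{<0}, S_{>0})` are less than `N`. -/
def SBounded (N : ℕ) (A : Mat) (S : SST (antinormalShape μ)) : Prop :=
  InBox N A ∧ ∀ t, ∀ z ∈ colS S t, z.natPred < N

theorem exists_sBounded (A : Mat) (S : SST (antinormalShape μ)) : ∃ N, SBounded N A S := by
  refine ⟨(A.support.sup fun p => p.1.natPred + p.2.natPred + 1) +
    (antinormalShape μ).sup (fun p => (S.entry p).natPred + 1), fun p hp => ?_, fun t z hz => ?_⟩
  · have := Finset.le_sup (f := fun p : ℕ+ × ℕ+ => p.1.natPred + p.2.natPred + 1)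
      (Finsupp.mem_support_iff.2 hp)
    omega
  · simp only [colS, List.mem_map, List.mem_reverse, List.mem_range] at hz
    obtain ⟨r, hr, rfl⟩ := hz
    have := Finset.le_sup (f := fun p : ℤ × ℤ => (S.entry p).natPred + 1) (antinormal_mem.2 hr)
    omega

theorem SBounded.mono {A : Mat} {S : SST (antinormalShape μ)} {N N' : ℕ} (h : SBounded N A S)
    (hN : N ≤ N') : SBounded N' A S :=
  ⟨fun p hp => ⟨(h.1 p hp).1.trans_le hN, (h.1 p hp).2.trans_le hN⟩,
    fun t z hz => (h.2 t z hz).trans_le hN⟩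

theorem rskL_spec {N : ℕ} {A : Mat} {S : SST (antinormalShape μ)} (h : SBounded N A S) (t : ℕ) :
    (rskL S A t).Pairwise omegaLE ∧ ∀ x ∈ rskL S A t, x.1.natPred < N ∧ x.2.natPred < N := by
  induction t with
  | zero =>
    refine ⟨omegaWord_pairwise A, fun x hx => h.1 x ?_⟩
    rw [← omegaWord_count]
    exact (List.count_pos_iff.2 hx).ne'
  | succ t ih =>
    rw [rskL_succ]
    obtain ⟨-, -, -, -, -, h1, h2, -⟩ := columnPass_grid N _ _ ih.1 ih.2 (colS_sorted S t) (h.2 t)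
    exact ⟨h1, h2⟩

/-- One box size serves all columns, because bumping creates neither new letters nor new labels. -/
theorem rsk_spec {N : ℕ} {A : Mat} {S : SST (antinormalShape μ)} (h : SBounded N A S) (t : ℕ) :
    ColRel N (countFun (rskL S A t)) (bits (colS S t)) (countFun (rskL S A (t + 1)))
      (bits (rskP S A t)) (bits (rskQ S A t)) ∧
    (rskP S A t).Pairwise (· < ·) ∧ (∀ z ∈ rskP S A t, z.natPred < N) ∧
    (rskQ S A t).Pairwise (· < ·) ∧ (∀ z ∈ rskQ S A t, z.natPred < N) := by
  have ih := rskL_spec h t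
  obtain ⟨h1, h2, h3, h4, h5, -⟩ := columnPass_grid N _ _ ih.1 ih.2 (colS_sorted S t) (h.2 t)
  rw [rskL_succ]
  exact ⟨h1, h2, h3, h4, h5⟩

theorem rsk_chain {N : ℕ} {A : Mat} {S : SST (antinormalShape μ)} (h : SBounded N A S) (n : ℕ) :
    Chain N n (fun t => countFun (rskL S A t)) (fun t => bits (colS S t))
      (fun t => bits (rskP S A t)) (fun t => bits (rskQ S A t)) :=
  fun t _ => (rsk_spec h t).1

theorem countFun_rskL_zero (A : Mat) (S : SST (antinormalShape μ)) :
    countFun (rskL S A 0) = matFun A := by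
  funext k j
  exact omegaWord_count A _

theorem rskL_eq_nil_iff {N : ℕ} {A : Mat} {S : SST (antinormalShape μ)} (h : SBounded N A S)
    (t : ℕ) : rskL S A t = [] ↔ ∀ k < N, ∀ j < N, countFun (rskL S A t) k j = 0 := by
  constructor
  · intro h1
    rw [h1]
    exact fun _ _ _ _ => rfl
  · intro h1
    rw [List.eq_nil_iff_forall_not_mem]
    intro x hx
    obtain ⟨h2, h3⟩ := (rskL_spec h t).2 x hx
    have := h1 _ h2 _ h3
    rw [countFun, PNat.succPNat_natPred, PNat.succPNat_natPred, List.count_eq_zero] at this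
    exact this hx

/-! ### The relation in terms of lists -/

theorem lamOf_rev (μ ν : YoungDiagram) {n : ℕ} (k : Fin n) :
    lamOf μ ν n k.rev = (ν.colLen (n - 1 - k) : ℤ) - μ.colLen k := by
  rw [lamOf, Fin.rev_rev, Fin.val_rev]
  congr 3
  omega

/-- The columns of `μ`, placed from the right, and those of `ν`, placed from the left, do not
overlap when `n` is at least the sum of the widths. -/
theorem colLen_zero_or (μ ν : YoungDiagram) {n t : ℕ} (hn : μ.rowLen 0 + ν.rowLen 0 ≤ n)
    (ht : t < n) : ν.colLen (n - 1 - t) = 0 ∨ μ.colLen t = 0 := by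
  rcases le_or_gt (μ.rowLen 0) t with h | h
  · exact Or.inr (colLen_eq_zero μ h)
  · exact Or.inl (colLen_eq_zero ν (by omega))

/-- By position, the positive letters of a column split into an upper part, which is recorded by the
insertion, and a lower part, which is a column of `S_{>0}`. The two conditions on letters merge into
one concatenation of lists, and the bound on the number of columns says that no letters are left
over. -/
theorem rel_iff {n : ℕ} (hn : μ.rowLen 0 + ν.rowLen 0 ≤ n) (w : BSet μ ν n) (x : Verma μ ν) :
    SkewRSKRel w x ↔ rskL x.2.1 x.1 n = [] ∧ ∀ t : Fin n,
      (w.col t).dualColumn = rskP x.2.1 x.1 t ∧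
      (w.col t).posList = rskQ x.2.1 x.1 t ++ colT x.2.2 (n - 1 - t) := by
  have hlam : ∀ t : Fin n, (lamOf μ ν n t.rev).toNat = ν.colLen (n - 1 - t) := by
    intro t
    rw [lamOf_rev]
    rcases colLen_zero_or μ ν hn t.2 with h | h <;> rw [h] <;> simp
  -- If the column of `ν` is nonempty, `μ` has no column there, and the charge alone forces enough
  -- positive letters.
  have hle : ∀ t : Fin n, (colT x.2.2 (n - 1 - t)).length ≤ (w.col t).cnt 0 := by
    intro t
    have h1 := FockWord.length_posList (w.charge t)
    rw [FockWord.posList_length, lamOf_rev] at h1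
    rw [colT_length]
    rcases colLen_zero_or μ ν hn t.2 with h | h
    · omega
    · rw [h] at h1; omega
  have hpos : ∀ t : Fin n, (colT x.2.2 (n - 1 - t)).map posL =
      (List.range (colT x.2.2 (n - 1 - t)).length).reverse.map (w.col t).letter ↔
      ∀ r : ℕ, r < ν.colLen (n - 1 - t) → posL (x.2.2.entry ((r : ℤ), ((n - 1 - t : ℕ) : ℤ))) =
        (w.col t).letter (ν.colLen (n - 1 - t) - 1 - r) := by
    intro t
    rw [colT_length]
    constructor
    · intro h r hr
      have := congrArg (fun l => l[r]?) h
      simp only [colT, List.map_map, List.getElem?_map] at this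
      rw [List.getElem?_range hr, List.getElem?_reverse (by simpa using hr), List.length_range,
        List.getElem?_range (by omega)] at this
      simpa using this
    · intro h
      refine List.ext_getElem (by simp [colT]) fun r h1 h2 => ?_
      have hr : r < ν.colLen (n - 1 - t) := by simpa [colT] using h1
      simpa [colT] using h r hr
  constructor
  · intro h
    refine ⟨((skewRSK_length_le _ _ _).1 h.length_le).1, fun t => ⟨?_, ?_⟩⟩
    · rw [← h.insertion t, skewRSK_getD]
    · rw [FockWord.posList_eq_append_iff _ (hle t), hpos t]
      constructor
      · have := h.recording t
        rw [skewRSK_getD, hlam] at this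
        rw [colT_length]
        exact this
      · intro r hr
        have := h.positive t.rev r
        rw [Fin.val_rev, Fin.rev_rev, show n - (t + 1) = n - 1 - t by omega] at this
        exact this hr
  · rintro ⟨h1, h2⟩
    refine ⟨(skewRSK_length_le _ _ _).2 ⟨h1, by omega⟩, fun t => ?_, fun t => ?_, fun c r hr => ?_⟩
    · rw [skewRSK_getD, (h2 t).1]
    · have := ((FockWord.posList_eq_append_iff _ (hle t)).1 (h2 t).2).1
      rw [skewRSK_getD, hlam]
      rw [colT_length] at this
      exact this
    · have := (hpos c.rev).1 ((FockWord.posList_eq_append_iff _ (hle c.rev)).1 (h2 c.rev).2).2 r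
      rw [Fin.val_rev, show n - 1 - (n - (c + 1)) = c by omega] at this
      exact this hr

end rsk

end

end GlInf

namespace GlInf

noncomputable section

open PreCrystal

/-! ## Reading tableaux column by column -/

theorem prod_map_flatMap {ι κ M : Type*} [Monoid M] (l : List ι) (c : ι → List κ) (F : κ → M) :
    ((l.flatMap c).map F).prod = (l.map fun t => ((c t).map F).prod).prod := by
  induction l with
  | nil => rfl
  | cons a l ih => rw [List.flatMap_cons, List.map_append, List.prod_append, ih, List.map_cons,
      List.prod_cons]

theorem isReading_sort (D : Finset (ℤ × ℤ)) : IsReading (D.sort readLE) := by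
  refine ((Finset.pairwise_sort D readLE).and (Finset.sort_nodup D readLE)).imp ?_
  rintro ⟨a, b⟩ ⟨c, d⟩ ⟨h, hne⟩ ⟨h1, h2⟩
  simp only [readLE] at h h1 h2
  apply hne
  rw [Prod.mk.injEq]
  rcases h with h | ⟨rfl, h⟩ <;> constructor <;> omega

theorem isReading_columns (n : ℕ) (c : ℕ → List (ℤ × ℤ)) (col : ℕ → ℤ)
    (hcol : ∀ s t, s < t → t < n → col t < col s) (hc : ∀ t < n, ∀ p ∈ c t, p.2 = col t)
    (hp : ∀ t < n, (c t).Pairwise fun a b => a.1 < b.1) :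
    IsReading ((List.range' 0 n).flatMap c) := by
  rw [IsReading, List.pairwise_flatMap]
  constructor
  · intro t ht
    refine (hp t (by simpa using ht)).imp fun {a b} h h' => ?_
    omega
  · refine (List.pairwise_lt_range' (s := 0) (n := n)).imp_of_mem ?_
    intro s t hs ht hst a ha b hb h
    simp only [List.mem_range'_1, zero_add] at hs ht
    rw [hc _ hs.2 a ha, hc _ ht.2 b hb] at h
    have := hcol _ _ hst ht.2
    omega

section sst

variable {μ ν : YoungDiagram}

theorem isSkewTableau_antinormal (S : SST (antinormalShape μ)) :
    IsSkewTableau (antinormalShape μ) fun p => S.entry p where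
  convex r c r' c' h h' hr hc := by
    simp only [antinormalShape, Finset.mem_image, YoungDiagram.mem_cells, Prod.mk.injEq,
      Prod.exists] at h h' ⊢
    obtain ⟨a, b, h, rfl, rfl⟩ := h
    obtain ⟨a', b', h', rfl, rfl⟩ := h'
    exact ⟨⟨a, b', μ.up_left_mem le_rfl (by omega) h, rfl, rfl⟩,
      ⟨a', b, μ.up_left_mem (by omega) le_rfl h, rfl, rfl⟩⟩
  row_weak r c c' hc h h' := by exact_mod_cast S.row_weak r c c' hc h h'
  col_strict r r' c hr h h' := by exact_mod_cast S.col_strict r r' c hr h h'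

/-- The cells of a column of an anti-normal shape, from top to bottom. -/
def cellsS (μ : YoungDiagram) (t : ℕ) : List (ℤ × ℤ) :=
  (List.range (μ.colLen t)).reverse.map fun r : ℕ => (-(r : ℤ), -(t : ℤ))

/-- The cells of a column of a normal shape, from top to bottom. -/
def cellsT (ν : YoungDiagram) (c : ℕ) : List (ℤ × ℤ) :=
  (List.range (ν.colLen c)).map fun r : ℕ => ((r : ℤ), (c : ℤ))

theorem map_cellsS (S : SST (antinormalShape μ)) (t : ℕ) : (cellsS μ t).map S.entry = colS S t := by
  simp [cellsS, colS]

theorem map_cellsT (T : SST (normalShape ν)) (c : ℕ) : (cellsT ν c).map T.entry = colT T c := by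
  simp [cellsT, colT]

theorem isReading_cellsS (μ : YoungDiagram) (n : ℕ) :
    IsReading ((List.range' 0 n).flatMap (cellsS μ)) := by
  refine isReading_columns n _ (fun t => -(t : ℤ)) (fun s t h _ => by omega) ?_ ?_
  · intro t _ p hp
    simp only [cellsS, List.mem_map] at hp
    obtain ⟨r, _, rfl⟩ := hp
    rfl
  · intro t _
    rw [cellsS, List.pairwise_map, List.pairwise_reverse]
    exact List.pairwise_lt_range.imp fun h => by dsimp only; omega

theorem isReading_cellsT (ν : YoungDiagram) (n : ℕ) :
    IsReading ((List.range' 0 n).flatMap fun t => cellsT ν (n - 1 - t)) := by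
  refine isReading_columns n _ (fun t => ((n - 1 - t : ℕ) : ℤ)) (fun s t h _ => by omega) ?_ ?_
  · intro t _ p hp
    simp only [cellsT, List.mem_map] at hp
    obtain ⟨r, _, rfl⟩ := hp
    rfl
  · intro t _
    rw [cellsT, List.pairwise_map]
    exact List.pairwise_lt_range.imp fun h => by dsimp only; omega

theorem mem_cellsS {n : ℕ} (hn : μ.rowLen 0 ≤ n) (p : ℤ × ℤ) :
    p ∈ (List.range' 0 n).flatMap (cellsS μ) ↔ p ∈ antinormalShape μ := by
  simp only [List.mem_flatMap, cellsS, List.mem_map, List.mem_reverse, List.mem_range]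
  constructor
  · rintro ⟨t, _, r, hr, rfl⟩
    exact antinormal_mem.2 hr
  · intro hp
    obtain ⟨⟨r, t⟩, h, rfl⟩ := Finset.mem_image.1 hp
    rw [YoungDiagram.mem_cells, YoungDiagram.mem_iff_lt_colLen] at h
    refine ⟨t, ?_, r, h, rfl⟩
    simp only [List.mem_range'_1, zero_add, Nat.zero_le, true_and]
    by_contra! ht
    rw [colLen_eq_zero μ (hn.trans ht)] at h
    omega

theorem mem_cellsT {n : ℕ} (hn : ν.rowLen 0 ≤ n) (p : ℤ × ℤ) :
    p ∈ ((List.range' 0 n).flatMap fun t => cellsT ν (n - 1 - t)) ↔ p ∈ normalShape ν := by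
  simp only [List.mem_flatMap, cellsT, List.mem_map, List.mem_range]
  constructor
  · rintro ⟨t, _, r, hr, rfl⟩
    exact normal_mem.2 hr
  · intro hp
    obtain ⟨⟨r, c⟩, h, rfl⟩ := Finset.mem_image.1 hp
    rw [YoungDiagram.mem_cells, YoungDiagram.mem_iff_lt_colLen] at h
    have hc : c < n := by
      by_contra! ht
      rw [colLen_eq_zero ν (hn.trans ht)] at h
      omega
    exact ⟨n - 1 - c, by simp only [List.mem_range'_1]; omega, r,
      by rwa [show n - 1 - (n - 1 - c) = c by omega],
      by rw [show n - 1 - (n - 1 - c) = c by omega]⟩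

theorem sst_fac {L : PreCrystal ℕ+} {i : ℤ} {ε φ : ℕ+ → ℕ} (h : L.GoodAt i ε φ)
    {D : Finset (ℤ × ℤ)} (S S' : SST D) : (goodAt_sst h D).fac S S' =
      ((D.sort readLE).map fun p => h.fac (S.entry p) (S'.entry p)).prod := by
  rw [← h.words_fac_map]
  apply Fac.ext'
  · rfl
  · rfl
  · exact liftOp_eq_some SST.word_injective _ _ _
  · exact SST.word_injective.eq_iff.symm

/-- The comparison of two tableaux of anti-normal shape, column by column. -/
theorem sst_fac_antinormal {L : PreCrystal ℕ+} {i m : ℤ} (h : L.GoodAt i (letE m) (letP m)) {n : ℕ}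
    (hn : μ.rowLen 0 ≤ n) (S S' : SST (antinormalShape μ)) : (goodAt_sst h _).fac S S' =
      ((List.range' 0 n).map fun t => h.words.fac (colS S t) (colS S' t)).prod := by
  rw [sst_fac h, (isSkewTableau_antinormal S).prod_congr (k := m) (isReading_sort _)
    (isReading_cellsS μ n) (by simp) (mem_cellsS hn) _ (fun _ _ => rfl) (fun _ _ => rfl),
    prod_map_flatMap]
  simp only [← h.words_fac_map, map_cellsS]

theorem sum_word_eq {M : Type*} [AddCommMonoid M] {D : Finset (ℤ × ℤ)} (f : ℤ × ℤ → M)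
    {l : List (ℤ × ℤ)} (hl : IsReading l) (hD : ∀ p, p ∈ l ↔ p ∈ D) :
    ((D.sort readLE).map f).sum = (l.map f).sum := by
  refine List.Perm.sum_eq (List.Perm.map _ ?_)
  rw [List.perm_ext_iff_of_nodup (Finset.sort_nodup _ _) hl.nodup]
  intro p
  rw [Finset.mem_sort, hD]

theorem sst_wt {L : PreCrystal ℕ+} {D : Finset (ℤ × ℤ)} (S : SST D) {l : List ℕ}
    {c : ℕ → List (ℤ × ℤ)} (hl : IsReading (l.flatMap c)) (hD : ∀ p, p ∈ l.flatMap c ↔ p ∈ D) :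
    (sstCrystal L D).wt S = (l.map fun t => L.words.wt ((c t).map S.entry)).sum := by
  change ((S.word).map L.wt).sum = _
  rw [SST.word, List.map_map, sum_word_eq _ hl hD]
  clear hl hD
  induction l with
  | nil => rfl
  | cons a l ih => rw [List.flatMap_cons, List.map_append, List.sum_append, ih, List.map_cons,
      List.sum_cons]; simp [words]

theorem sst_wt_antinormal {L : PreCrystal ℕ+} {n : ℕ} (hn : μ.rowLen 0 ≤ n)
    (S : SST (antinormalShape μ)) : (sstCrystal L _).wt S =
      ((List.range' 0 n).map fun t => L.words.wt (colS S t)).sum := by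
  rw [sst_wt S (isReading_cellsS μ n) (mem_cellsS hn)]
  simp only [map_cellsS]

theorem sst_wt_normal {L : PreCrystal ℕ+} {n : ℕ} (hn : ν.rowLen 0 ≤ n)
    (T : SST (normalShape ν)) : (sstCrystal L _).wt T =
      ((List.range' 0 n).map fun t => L.words.wt (colT T (n - 1 - t))).sum := by
  rw [sst_wt T (isReading_cellsT ν n) (mem_cellsT hn)]
  simp only [map_cellsT]

/-! ## Weights -/

/-- The weight of a biword. -/
def pairsWt (L : List (ℕ+ × ℕ+)) : Wt := (L.map fun p => -epsW (negL p.1) + epsW (posL p.2)).sum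

theorem words_wt_cons (L : PreCrystal ℕ+) (a : ℕ+) (l : List ℕ+) :
    L.words.wt (a :: l) = L.wt a + L.words.wt l := by
  simp [words]

theorem words_wt_append (L : PreCrystal ℕ+) (l l' : List ℕ+) :
    L.words.wt (l ++ l') = L.words.wt l + L.words.wt l' := by
  simp [words]

theorem words_wt_replace (L : PreCrystal ℕ+) {p : List ℕ+} {x : ℕ+} (hx : x ∈ p) (a : ℕ+) :
    L.words.wt (p.replace x a) + L.wt x = L.words.wt p + L.wt a := by
  induction p with
  | nil => simp at hx
  | cons y p ih =>
    by_cases h : x = y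
    · subst h
      rw [List.replace_cons_self, words_wt_cons, words_wt_cons]
      abel
    · rw [List.replace_cons]
      have h' : (x == y) = false := by simpa using h
      simp only [h']
      rw [words_wt_cons, words_wt_cons, add_assoc, ih (by simpa [h] using hx), add_assoc]

/-- Bumping exchanges a letter of the biword with one of the column, and creating a box turns a pair
into a letter and a label. The total weight is unaffected by either. -/
theorem columnPass_wt (L : List (ℕ+ × ℕ+)) (p : List ℕ+) :
    pairsWt L + vecNeg.words.wt p = pairsWt (columnPass L p).2.2 +
      vecNeg.words.wt (columnPass L p).1 + vecPos.words.wt (columnPass L p).2.1 := by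
  induction L with
  | nil => simp [columnPass, words]
  | cons x L ih =>
    have h1 : pairsWt (x :: L) = vecNeg.wt x.1 + vecPos.wt x.2 + pairsWt L := by
      simp [pairsWt, vecNeg, vecPos]
    rw [h1, add_assoc, ih, columnPass]
    cases h : (((columnPass L p).1.filter (fun z => z ≤ x.1)).max?) with
    | none =>
      dsimp only
      rw [words_wt_cons, words_wt_cons]
      abel
    | some z =>
      have hz : z ∈ (columnPass L p).1 := (List.mem_filter.1 (List.max?_mem h)).1
      have h2 : ∀ L', pairsWt ((z, x.2) :: L') = vecNeg.wt z + vecPos.wt x.2 + pairsWt L' := by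
        intro L'
        simp [pairsWt, vecNeg, vecPos]
      dsimp only
      rw [h2]
      have h3 := words_wt_replace vecNeg hz x.1
      rw [add_comm] at h3
      calc _ = vecPos.wt x.2 + pairsWt (columnPass L p).2.2 + vecPos.words.wt (columnPass L p).2.1
            + (vecNeg.words.wt (columnPass L p).1 + vecNeg.wt x.1) := by abel
        _ = _ := by rw [← h3]; abel

theorem matWt_eq_pairsWt (A : Mat) : matWt A = pairsWt (omegaWord A) := by
  rw [matWt_biword, pairsWt, sum_words_wt]
  rfl

theorem rsk_wt (S : SST (antinormalShape μ)) (A : Mat) (n : ℕ) :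
    matWt A + ((List.range' 0 n).map fun t => vecNeg.words.wt (colS S t)).sum =
      pairsWt (rskL S A n) + ((List.range' 0 n).map fun t =>
        vecNeg.words.wt (rskP S A t) + vecPos.words.wt (rskQ S A t)).sum := by
  induction n with
  | zero => simp [matWt_eq_pairsWt, rskL, passL]
  | succ n ih =>
    simp only [List.range'_1_concat, List.map_append, List.sum_append, List.map_cons, List.map_nil,
      List.sum_cons, List.sum_nil, zero_add, add_zero]
    rw [← add_assoc, ih, rskL_succ]
    have := columnPass_wt (rskL S A n) (colS S n)
    rw [rskP, rskQ]
    calc _ = (pairsWt (rskL S A n) + vecNeg.words.wt (colS S n)) + ((List.range' 0 n).map fun t =>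
        vecNeg.words.wt (rskP S A t) + vecPos.words.wt (rskQ S A t)).sum := by abel
      _ = _ := by rw [this]; abel

theorem words_wt_neg_apply {p : List ℕ+} (hp : p.Nodup) (z : Zx) :
    (vecNeg.words.wt p).1 z = if ∃ k ∈ p, z = negL k then -1 else 0 := by
  induction p with
  | nil => simp [words]
  | cons a p ih =>
    rw [List.nodup_cons] at hp
    rw [words_wt_cons, Prod.fst_add, Finsupp.add_apply, ih hp.2]
    by_cases h : z = negL a
    · subst h
      rw [if_neg, if_pos ⟨a, by simp⟩]
      · simp [vecNeg, epsW]
      · rintro ⟨k, hk, h⟩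
        rw [negL_injective h] at hp
        exact hp.1 hk
    · simp [vecNeg, epsW, h]

theorem words_wt_pos_apply {p : List ℕ+} (hp : p.Nodup) (z : Zx) :
    (vecPos.words.wt p).1 z = if ∃ k ∈ p, z = posL k then 1 else 0 := by
  induction p with
  | nil => simp [words]
  | cons a p ih =>
    rw [List.nodup_cons] at hp
    rw [words_wt_cons, Prod.fst_add, Finsupp.add_apply, ih hp.2]
    by_cases h : z = posL a
    · subst h
      rw [if_neg, if_pos ⟨a, by simp⟩]
      · simp [vecPos, epsW]
      · rintro ⟨k, hk, h⟩
        rw [posL_injective h] at hp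
        exact hp.1 hk
    · simp [vecPos, epsW, h]

theorem words_wt_snd (p : List ℕ+) : (vecNeg.words.wt p).2 = 0 ∧ (vecPos.words.wt p).2 = 0 := by
  induction p with
  | nil => simp [words]
  | cons a p ih =>
    rw [words_wt_cons, words_wt_cons, Prod.snd_add, Prod.snd_add, ih.1, ih.2]
    simp [vecNeg, vecPos, epsW]

/-- Subtracting `1` at negative letters makes those which occur invisible and gives each missing one
the coefficient `-1`. -/
theorem FockWord.wt_eq (w : FockWord) :
    w.wt = lamZero + (vecNeg.words.wt w.dualColumn + vecPos.words.wt w.posList) := by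
  classical
  unfold FockWord.wt
  congr 1
  refine Prod.ext (Finsupp.ext fun z => ?_) ?_
  · rw [Prod.fst_add, Finsupp.add_apply,
      words_wt_neg_apply (w.dualColumn_sorted.imp fun h => h.ne),
      words_wt_pos_apply (w.posList_sorted.imp fun h => h.ne), Finsupp.ofSupportFinite_coe,
      FockWord.mult_eq]
    rcases zx_cases z with ⟨k, rfl⟩ | ⟨k, rfl⟩
    · have h1 : ((negL k : Zx) : ℤ) < 0 := by have := k.pos; simp [negL]
      have h2 : (∃ k' ∈ w.dualColumn, negL k = negL k') ↔ negL k ∉ Set.range w.letter := by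
        rw [← mem_dualColumn]
        exact ⟨fun ⟨k', h, h'⟩ => negL_injective h' ▸ h, fun h => ⟨k, h, rfl⟩⟩
      have h3 : ¬ ∃ k' ∈ w.posList, negL k = posL k' := fun ⟨k', _, h⟩ => negL_ne_posL _ _ h
      rw [if_neg h3, if_pos h1]
      simp only [h2]
      by_cases h : negL k ∈ Set.range w.letter
      · rw [if_pos h, if_neg (not_not.2 h)]; rfl
      · rw [if_neg h, if_pos h]; rfl
    · have h1 : ¬ ((posL k : Zx) : ℤ) < 0 := by have := k.pos; simp [posL]
      have h2 : (∃ k' ∈ w.posList, posL k = posL k') ↔ posL k ∈ Set.range w.letter := by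
        rw [← mem_posList]
        exact ⟨fun ⟨k', h, h'⟩ => posL_injective h' ▸ h, fun h => ⟨k, h, rfl⟩⟩
      have h3 : ¬ ∃ k' ∈ w.dualColumn, posL k = negL k' := fun ⟨k', _, h⟩ => negL_ne_posL _ _ h.symm
      rw [if_neg h3, if_neg h1]
      simp only [h2]
      simp
  · rw [Prod.snd_add, (words_wt_snd _).1, (words_wt_snd _).2]
    rfl

end sst

end

end GlInf

namespace GlInf

noncomputable section

open PreCrystal

/-! ## Comparing sorted columns -/

theorem countGe_bits_cons {N : ℕ} {z : ℕ+} {p : List ℕ+} (hz : z ∉ p) (hN : z.natPred < N) (a : ℕ) :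
    countGe N (bits (z :: p)) a = countGe N (bits p) a + if a ≤ z.natPred then 1 else 0 := by
  have h : ∀ k, (bits (z :: p) k).toNat = (bits p k).toNat + if k = z.natPred then 1 else 0 := by
    intro k
    split_ifs with hk
    · subst hk
      rw [bits_eq_true.2 (by simp), bits_eq_false.2 (by simpa using hz)]
      rfl
    · rw [add_zero]
      congr 1
      have : k.succPNat ≠ z := fun h => hk (by rw [← h, Nat.natPred_succPNat])
      simp [bits, this]
  unfold countGe
  simp only [h, Finset.sum_add_distrib, Finset.sum_ite_eq', Finset.mem_Ico]
  simp [hN]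

theorem countGe_bits {N : ℕ} {p : List ℕ+} (hp : p.Nodup) (hN : ∀ z ∈ p, z.natPred < N) (a : ℕ) :
    countGe N (bits p) a = p.countP fun z => a ≤ z.natPred := by
  induction p with
  | nil => simp [countGe, bits]
  | cons z p ih =>
    rw [List.nodup_cons] at hp
    rw [countGe_bits_cons hp.1 (hN z (by simp)), ih hp.2 fun y hy => hN y (by simp [hy]),
      List.countP_cons]
    simp

theorem countGe_bits_append {N : ℕ} {p q : List ℕ+} (hp : (p ++ q).Nodup)
    (hN : ∀ z ∈ p ++ q, z.natPred < N) (a : ℕ) :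
    countGe N (bits (p ++ q)) a = countGe N (bits p) a + countGe N (bits q) a := by
  rw [countGe_bits hp hN, countGe_bits (List.nodup_append.1 hp).1 fun z hz => hN z (by simp [hz]),
    countGe_bits (List.nodup_append.1 hp).2.1 fun z hz => hN z (by simp [hz]), List.countP_append]

theorem countLt_add_countGe {N : ℕ} (C : ℕ → Bool) {a : ℕ} (ha : a ≤ N) :
    countLt C a + countGe N C a = countGe N C 0 := by
  unfold countLt countGe
  rw [Nat.Ico_zero_eq_range, Finset.sum_range_add_sum_Ico _ ha]

/-- In an increasing list the entries of index at least `a` form a final segment, whose length is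
the count. This translates entrywise comparison of columns into counts. -/
theorem getElem_lt_iff {p : List ℕ+} (hp : p.Pairwise (· < ·)) (a : ℕ) : ∀ (r : ℕ) (hr : r < p.length),
    p[r].natPred < a ↔ r + p.countP (fun z => a ≤ z.natPred) < p.length := by
  induction p with
  | nil => intro r hr; simp at hr
  | cons z p ih =>
    rw [List.pairwise_cons] at hp
    have hall : a ≤ z.natPred → p.countP (fun z => a ≤ z.natPred) = p.length := by
      intro h
      rw [List.countP_eq_length]
      intro y hy
      have := natPred_lt_iff.2 (hp.1 y hy)
      simp only [decide_eq_true_eq]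
      omega
    have hle := List.countP_le_length (p := fun z : ℕ+ => decide (a ≤ z.natPred)) (l := p)
    intro r hr
    rw [List.countP_cons, List.length_cons]
    cases r with
    | zero =>
      simp only [List.getElem_cons_zero, decide_eq_true_eq]
      split_ifs with h
      · rw [hall h]; omega
      · omega
    | succ r =>
      have hr' : r < p.length := by simpa using hr
      rw [List.getElem_cons_succ, ih hp.2 r hr']
      simp only [decide_eq_true_eq]
      split_ifs with h
      · rw [hall h]; omega
      · omega

/-- Two columns of a tableau of normal shape. -/
theorem forall_countGe_le_iff {N : ℕ} {d d' : List ℕ+} (hd : d.Pairwise (· < ·))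
    (hd' : d'.Pairwise (· < ·)) (hN : ∀ z ∈ d, z.natPred < N) (hN' : ∀ z ∈ d', z.natPred < N)
    (hl : d.length ≤ d'.length) :
    (∀ a ≤ N, countGe N (bits d') a + d.length ≤ countGe N (bits d) a + d'.length) ↔
      ∀ (r : ℕ) (hr : r < d.length), d'[r] ≤ d[r] := by
  simp only [countGe_bits (hd.imp fun h => h.ne) hN, countGe_bits (hd'.imp fun h => h.ne) hN']
  constructor
  · intro h r hr
    have h1 := hN _ (List.getElem_mem hr)
    have h2 := (getElem_lt_iff hd (d[r].natPred + 1) r hr).1 (by omega)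
    have h3 := h (d[r].natPred + 1) (by omega)
    have h4 := (getElem_lt_iff hd' (d[r].natPred + 1) r (by omega)).2 (by omega)
    by_contra! h5
    have := natPred_lt_iff.2 h5
    omega
  · intro h a _
    have hle := List.countP_le_length (p := fun z : ℕ+ => decide (a ≤ z.natPred)) (l := d')
    rcases Nat.eq_zero_or_pos (d.length - d.countP fun z => a ≤ z.natPred) with h0 | h0
    · omega
    · set r := d.length - d.countP (fun z => a ≤ z.natPred) - 1 with hr
      have h1 := (getElem_lt_iff hd a r (by omega)).2 (by omega)
      have h2 : d'[r]'(by omega) ≤ d[r]'(by omega) := h r (by omega)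
      have h3 : (d'[r]'(by omega)).natPred < a := by
        by_contra! h5
        have := natPred_lt_iff.1 (h1.trans_le h5)
        exact absurd this (not_lt.2 h2)
      have h4 := (getElem_lt_iff hd' a r (by omega)).1 h3
      omega

/-- Two columns of a tableau of anti-normal shape. -/
theorem colLe_bits_iff {N : ℕ} {d d' : List ℕ+} (hd : d.Pairwise (· < ·))
    (hd' : d'.Pairwise (· < ·)) (hN : ∀ z ∈ d, z.natPred < N) (hN' : ∀ z ∈ d', z.natPred < N)
    (hl : d'.length ≤ d.length) :
    ColLe N (bits d') (bits d) ↔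
      ∀ (r : ℕ) (hr : r < d'.length), d'[d'.length - 1 - r] ≤ d[d.length - 1 - r] := by
  simp only [ColLe, countGe_bits (hd.imp fun h => h.ne) hN, countGe_bits (hd'.imp fun h => h.ne) hN']
  constructor
  · intro h r hr
    by_contra! h5
    have h6 := natPred_lt_iff.2 h5
    set a := d'[d'.length - 1 - r].natPred with ha
    have h1 := hN' _ (List.getElem_mem (show d'.length - 1 - r < d'.length by omega))
    have h2 := (getElem_lt_iff hd a (d.length - 1 - r) (by omega)).1 h6
    have h3 := (getElem_lt_iff hd' a (d'.length - 1 - r) (by omega)).not.1 (by omega)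
    have h4 := h a (by omega)
    omega
  · intro h a _
    rcases Nat.eq_zero_or_pos (d'.countP fun z => a ≤ z.natPred) with h0 | h0
    · omega
    · have hle := List.countP_le_length (p := fun z : ℕ+ => decide (a ≤ z.natPred)) (l := d')
      set r := d'.countP (fun z => a ≤ z.natPred) - 1 with hr
      have h1 := (getElem_lt_iff hd' a (d'.length - 1 - r) (by omega)).not.2 (by omega)
      have h2 := h r (by omega)
      have h3 : ¬ (d[d.length - 1 - r]'(by omega)).natPred < a := by
        intro h5
        have := natPred_lt_iff.1 (h5.trans_le (not_lt.1 h1))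
        exact absurd this (not_lt.2 h2)
      have h4 := (getElem_lt_iff hd a (d.length - 1 - r) (by omega)).not.1 h3
      omega

/-- The conservation laws for rows and for columns are summed over the grid and compared: each label
stands for a unit of the matrix that has become a new letter of the column. -/
theorem ColRel.countGe_eq {N : ℕ} {A A' : ℕ → ℕ → ℕ} {C P Q : ℕ → Bool} (h : ColRel N A C A' P Q) :
    countGe N P 0 = countGe N C 0 + countGe N Q 0 := by
  unfold countGe
  rw [Nat.Ico_zero_eq_range]
  have h1 := Finset.sum_congr rfl fun k (hk : k ∈ Finset.range N) => h.row_sum (Finset.mem_range.1 hk)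
  have h2 := Finset.sum_congr rfl fun k (hk : k ∈ Finset.range N) => h.col_sum (Finset.mem_range.1 hk)
  rw [Finset.sum_add_distrib, Finset.sum_add_distrib] at h1
  rw [Finset.sum_add_distrib, Finset.sum_comm, Finset.sum_comm (f := fun j k => A' k j)] at h2
  omega

theorem columnPass_length (L : List (ℕ+ × ℕ+)) (p : List ℕ+) :
    (columnPass L p).1.length = p.length + (columnPass L p).2.1.length := by
  induction L with
  | nil => simp [columnPass]
  | cons x L ih =>
    rw [columnPass]
    cases h : (((columnPass L p).1.filter (fun z => z ≤ x.1)).max?) with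
    | none => simp only [List.length_cons]; omega
    | some z => simp only [List.length_replace]; exact ih

/-- The list of the set bits. -/
def ofBits (N : ℕ) (C : ℕ → Bool) : List ℕ+ := ((List.range N).filter (C ·)).map Nat.succPNat

theorem ofBits_sorted (N : ℕ) (C : ℕ → Bool) : (ofBits N C).Pairwise (· < ·) := by
  rw [ofBits, List.pairwise_map]
  exact (List.pairwise_lt_range.filter _).imp fun h => Nat.succPNat_lt_succPNat.2 h

theorem mem_ofBits {N : ℕ} {C : ℕ → Bool} {z : ℕ+} :
    z ∈ ofBits N C ↔ z.natPred < N ∧ C z.natPred = true := by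
  simp only [ofBits, List.mem_map, List.mem_filter, List.mem_range]
  constructor
  · rintro ⟨k, h, rfl⟩
    simpa using h
  · intro h
    exact ⟨_, h, z.succPNat_natPred⟩

theorem bits_ofBits {N : ℕ} {C : ℕ → Bool} {k : ℕ} (hk : k < N) : bits (ofBits N C) k = C k := by
  rw [Bool.eq_iff_iff, bits_eq_true, mem_ofBits, Nat.natPred_succPNat]
  simp [hk]

theorem countGe_congr {N : ℕ} {C D : ℕ → Bool} (h : ∀ k < N, C k = D k) (a : ℕ) :
    countGe N C a = countGe N D a :=
  Finset.sum_congr rfl fun k hk => by rw [h k (Finset.mem_Ico.1 hk).2]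

/-! ### Tableaux recovered from their columns. -/

section tableaux

variable {μ ν : YoungDiagram}

theorem rskP_length (S : SST (antinormalShape μ)) (A : Mat) (t : ℕ) :
    (rskP S A t).length = μ.colLen t + (rskQ S A t).length := by
  rw [rskP, rskQ, columnPass_length, colS_length]

theorem le_of_succ {f : ℕ → ℕ+} {m : ℕ} (h : ∀ t, t + 1 < m → f (t + 1) ≤ f t) {t t' : ℕ}
    (ht : t ≤ t') (ht' : t' < m) : f t' ≤ f t := by
  induction ht with
  | refl => exact le_rfl
  | step hle ih => exact (h _ ht').trans (ih (by omega))

theorem le_of_succ' {f : ℕ → ℕ+} {m : ℕ} (h : ∀ t, t + 1 < m → f t ≤ f (t + 1)) {t t' : ℕ}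
    (ht : t ≤ t') (ht' : t' < m) : f t ≤ f t' := by
  induction ht with
  | refl => exact le_rfl
  | step hle ih => exact (ih (by omega)).trans (h _ ht')

/-- A tableau of anti-normal shape with given columns. -/
theorem exists_antinormal {s : ℕ → List ℕ+} (hs : ∀ t, (s t).Pairwise (· < ·))
    (hl : ∀ t, (s t).length = μ.colLen t) {N : ℕ} (hN : ∀ t, ∀ z ∈ s t, z.natPred < N)
    (h : ∀ t, ColLe N (bits (s (t + 1))) (bits (s t))) :
    ∃ S : SST (antinormalShape μ), ∀ t, colS S t = s t := by
  have hmono : ∀ r t t', t ≤ t' → r < μ.colLen t' →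
      (s t').getD ((s t').length - 1 - r) 1 ≤ (s t).getD ((s t).length - 1 - r) 1 := by
    intro r t t' htt hr
    refine le_of_succ (f := fun t => (s t).getD ((s t).length - 1 - r) 1) (m := t' + 1)
      (fun u hu => ?_) htt (Nat.lt_succ_self _)
    have h1 := μ.colLen_anti (u + 1) t' (by omega)
    have h2 := μ.colLen_anti u (u + 1) (by omega)
    have := (colLe_bits_iff (hs u) (hs (u + 1)) (hN u) (hN (u + 1)) (by rw [hl, hl]; exact h2)).1
      (h u) r (by rw [hl]; omega)
    rw [List.getD_eq_getElem _ _ (by rw [hl]; omega), List.getD_eq_getElem _ _ (by rw [hl]; omega)]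
    exact this
  classical
  -- Rows of an anti-normal shape are numbered upwards from the bottom by nonpositive integers,
  -- while the lists run from top to bottom; hence the reversed position.
  let e : ℤ × ℤ → ℕ+ := fun p => if p ∈ antinormalShape μ then
    (s (-p.2).toNat).getD ((s (-p.2).toNat).length - 1 - (-p.1).toNat) 1 else 1
  have hcell : ∀ p ∈ antinormalShape μ, ∃ r t : ℕ, p = (-(r : ℤ), -(t : ℤ)) ∧ r < μ.colLen t := by
    intro p hp
    obtain ⟨⟨r, t⟩, h, rfl⟩ := Finset.mem_image.1 hp
    rw [YoungDiagram.mem_cells, YoungDiagram.mem_iff_lt_colLen] at h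
    exact ⟨r, t, rfl, h⟩
  have he : ∀ r t : ℕ, r < μ.colLen t →
      e (-(r : ℤ), -(t : ℤ)) = (s t).getD ((s t).length - 1 - r) 1 := by
    intro r t hr
    simp only [e, if_pos (antinormal_mem.2 hr), neg_neg, Int.toNat_natCast]
  refine ⟨⟨e, ?_, ?_, fun p hp => if_neg hp⟩, fun t => ?_⟩
  · intro r c c' hc h1 h2
    obtain ⟨r1, t1, h3, h4⟩ := hcell _ h1
    obtain ⟨r2, t2, h5, h6⟩ := hcell _ h2
    simp only [Prod.mk.injEq] at h3 h5
    obtain ⟨rfl, rfl⟩ := h3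
    obtain ⟨h7, rfl⟩ := h5
    obtain rfl : r1 = r2 := by omega
    rw [he _ _ h4, he _ _ h6]
    exact hmono r1 t2 t1 (by omega) h4
  · intro r r' c hr h1 h2
    obtain ⟨r1, t1, h3, h4⟩ := hcell _ h1
    obtain ⟨r2, t2, h5, h6⟩ := hcell _ h2
    simp only [Prod.mk.injEq] at h3 h5
    obtain ⟨rfl, rfl⟩ := h3
    obtain ⟨rfl, h7⟩ := h5
    obtain rfl : t1 = t2 := by omega
    rw [he _ _ h4, he _ _ h6, List.getD_eq_getElem _ _ (by rw [hl]; omega),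
      List.getD_eq_getElem _ _ (by rw [hl]; omega)]
    exact List.pairwise_iff_getElem.1 (hs t1) _ _ _ _ (by rw [hl]; omega)
  · refine List.ext_getElem (by rw [colS_length, hl]) fun r h1 h2 => ?_
    rw [hl] at h2
    simp only [colS, List.getElem_map, List.getElem_reverse, List.getElem_range, List.length_range]
    rw [he _ _ (by omega), List.getD_eq_getElem _ _ (by rw [hl]; omega)]
    congr 1
    rw [hl]
    omega

/-- A tableau of normal shape with given columns. -/
theorem exists_normal {d : ℕ → List ℕ+} (hs : ∀ c, (d c).Pairwise (· < ·))
    (hl : ∀ c, (d c).length = ν.colLen c)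
    (h : ∀ c r, (h1 : r < (d c).length) → (h2 : r < (d (c + 1)).length) → (d c)[r] ≤ (d (c + 1))[r]) :
    ∃ T : SST (normalShape ν), ∀ c, colT T c = d c := by
  have hmono : ∀ r t t', t ≤ t' → r < ν.colLen t' → (d t).getD r 1 ≤ (d t').getD r 1 := by
    intro r t t' htt hr
    refine le_of_succ' (f := fun t => (d t).getD r 1) (m := t' + 1)
      (fun u hu => ?_) htt (Nat.lt_succ_self _)
    have h1 := ν.colLen_anti (u + 1) t' (by omega)
    have h2 := ν.colLen_anti u (u + 1) (by omega)
    rw [List.getD_eq_getElem _ _ (by rw [hl]; omega), List.getD_eq_getElem _ _ (by rw [hl]; omega)]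
    exact h _ _ _ _
  classical
  let e : ℤ × ℤ → ℕ+ := fun p => if p ∈ normalShape ν then (d p.2.toNat).getD p.1.toNat 1 else 1
  have hcell : ∀ p ∈ normalShape ν, ∃ r t : ℕ, p = ((r : ℤ), (t : ℤ)) ∧ r < ν.colLen t := by
    intro p hp
    obtain ⟨⟨r, t⟩, h, rfl⟩ := Finset.mem_image.1 hp
    rw [YoungDiagram.mem_cells, YoungDiagram.mem_iff_lt_colLen] at h
    exact ⟨r, t, rfl, h⟩
  have he : ∀ r t : ℕ, r < ν.colLen t → e ((r : ℤ), (t : ℤ)) = (d t).getD r 1 := by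
    intro r t hr
    simp only [e, if_pos (normal_mem.2 hr), Int.toNat_natCast]
  refine ⟨⟨e, ?_, ?_, fun p hp => if_neg hp⟩, fun t => ?_⟩
  · intro r c c' hc h1 h2
    obtain ⟨r1, t1, h3, h4⟩ := hcell _ h1
    obtain ⟨r2, t2, h5, h6⟩ := hcell _ h2
    simp only [Prod.mk.injEq] at h3 h5
    obtain ⟨rfl, rfl⟩ := h3
    obtain ⟨h7, rfl⟩ := h5
    obtain rfl : r1 = r2 := by omega
    rw [he _ _ h4, he _ _ h6]
    exact hmono r1 t1 t2 (by omega) h6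
  · intro r r' c hr h1 h2
    obtain ⟨r1, t1, h3, h4⟩ := hcell _ h1
    obtain ⟨r2, t2, h5, h6⟩ := hcell _ h2
    simp only [Prod.mk.injEq] at h3 h5
    obtain ⟨rfl, rfl⟩ := h3
    obtain ⟨rfl, h7⟩ := h5
    obtain rfl : t1 = t2 := by omega
    rw [he _ _ h4, he _ _ h6, List.getD_eq_getElem _ _ (by rw [hl]; omega),
      List.getD_eq_getElem _ _ (by rw [hl]; omega)]
    exact List.pairwise_iff_getElem.1 (hs t1) _ _ _ _ (by omega)
  · refine List.ext_getElem (by rw [colT_length, hl]) fun r h1 h2 => ?_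
    rw [hl] at h2
    simp only [colT, List.getElem_map, List.getElem_range]
    rw [he _ _ h2, List.getD_eq_getElem _ _ (by rw [hl]; omega)]

theorem ext_colS {S S' : SST (antinormalShape μ)} (h : ∀ t, t < μ.rowLen 0 → colS S t = colS S' t) :
    S = S' := by
  apply SST.ext
  funext p
  by_cases hp : p ∈ antinormalShape μ
  · have h1 := (mem_cellsS le_rfl p).2 hp
    simp only [List.mem_flatMap, List.mem_range'_1, zero_add, Nat.zero_le, true_and] at h1
    obtain ⟨t, ht, hm⟩ := h1
    have := h t ht
    rw [← map_cellsS, ← map_cellsS] at this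
    exact List.map_inj_left.1 this p hm
  · rw [S.outside p hp, S'.outside p hp]

theorem ext_colT {n : ℕ} (hn : ν.rowLen 0 ≤ n) {T T' : SST (normalShape ν)}
    (h : ∀ t, t < n → colT T (n - 1 - t) = colT T' (n - 1 - t)) : T = T' := by
  apply SST.ext
  funext p
  by_cases hp : p ∈ normalShape ν
  · have h1 := (mem_cellsT hn p).2 hp
    simp only [List.mem_flatMap, List.mem_range'_1, zero_add, Nat.zero_le, true_and] at h1
    obtain ⟨t, ht, hm⟩ := h1
    have := h t ht
    rw [← map_cellsT, ← map_cellsT] at this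
    exact List.map_inj_left.1 this p hm
  · rw [T.outside p hp, T'.outside p hp]

theorem colLe_colS {N : ℕ} {S : SST (antinormalShape μ)} (hN : ∀ t, ∀ z ∈ colS S t, z.natPred < N)
    (t : ℕ) : ColLe N (bits (colS S (t + 1))) (bits (colS S t)) := by
  rw [colLe_bits_iff (colS_sorted S t) (colS_sorted S _) (hN t) (hN _)
    (by rw [colS_length, colS_length]; exact μ.colLen_anti _ _ (by omega))]
  intro r hr
  have h1 := μ.colLen_anti t (t + 1) (by omega)
  rw [colS_length] at hr
  simp only [colS_length]
  simp only [colS, List.getElem_map, List.getElem_reverse, List.getElem_range, List.length_range]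
  rw [show μ.colLen (t + 1) - 1 - (μ.colLen (t + 1) - 1 - r) = r by omega,
    show μ.colLen t - 1 - (μ.colLen t - 1 - r) = r by omega]
  exact S.row_weak _ _ _ (by push_cast; omega) (antinormal_mem.2 hr) (antinormal_mem.2 (by omega))

theorem colT_le (T : SST (normalShape ν)) (c r : ℕ) (h1 : r < (colT T c).length)
    (h2 : r < (colT T (c + 1)).length) : (colT T c)[r] ≤ (colT T (c + 1))[r] := by
  rw [colT_length] at h1 h2
  simp only [colT, List.getElem_map, List.getElem_range]
  exact T.row_weak _ _ _ (by push_cast; omega) (normal_mem.2 h1) (normal_mem.2 h2)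

end tableaux

end

end GlInf

namespace GlInf

noncomputable section

open PreCrystal

/-! ## The correspondence -/

theorem FockWord.lists_highest_zero :
    (FockWord.highest 0).dualColumn = [] ∧ (FockWord.highest 0).posList = [] := by
  constructor
  · rw [List.eq_nil_iff_forall_not_mem]
    intro k hk
    rw [mem_dualColumn] at hk
    apply hk
    refine ⟨k.natPred, ?_⟩
    apply Subtype.ext
    have := k.natPred_add_one
    simp only [highest, negL]
    rw [if_pos (by omega)]
    omega
  · rw [List.eq_nil_iff_forall_not_mem]
    intro k hk
    rw [mem_posList] at hk
    obtain ⟨m, hm⟩ := hk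
    have h1 := congrArg Subtype.val hm
    have := k.pos
    simp only [highest, posL] at h1
    split_ifs at h1 <;> omega

/-- The letters of `d` exceed those of `q`, so once a letter of `d` lies below a threshold, all of
`q` does; likewise for `q'` and `d'`. This lets a single comparison of counts separate into one for
the recording parts and one for the lower parts. If `d` has a letter below the threshold, `h0` and
`hm` give `m = m' = 0`, which removes the only obstruction to the separation. -/
theorem FockWord.row_iff_split {w w' : FockWord} {N : ℕ} (h : w.Bounded N) (h' : w'.Bounded N)
    {c c' : ℤ} (hc : w.HasCharge c) (hc' : w'.HasCharge c') {q d q' d' : List ℕ+}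
    (hw : w.posList = q ++ d) (hw' : w'.posList = q' ++ d') {m m' : ℕ}
    (hcm : c = d.length - m) (hcm' : c' = d'.length - m') (hm : m' ≤ m)
    (hd : d.length ≤ d'.length) (h0 : d.length = 0 ∨ m = 0) :
    (∀ j, w'.letter (j + (c' - c).toNat) ≤ w.letter j) ↔
      PairLe N (bits w'.dualColumn) (bits q') (bits w.dualColumn) (bits q) ∧
      ∀ a ≤ N, countGe N (bits d') a + d.length ≤ countGe N (bits d) a + d'.length := by
  have hs := w.posList_sorted
  have hs' := w'.posList_sorted
  have hN := h.posList
  have hN' := h'.posList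
  have hl := length_posList hc
  have hl' := length_posList hc'
  rw [row_iff_bits h h' hc hc' (by omega), ← bits_posList, ← bits_posList, ← bits_dualColumn,
    ← bits_dualColumn, PairLe, ← length_eq_countGe w.dualColumn_sorted h.dualColumn,
    ← length_eq_countGe w'.dualColumn_sorted h'.dualColumn, and_assoc]
  refine and_congr_right fun _ => ?_
  rw [hw] at hs hN hl ⊢
  rw [hw'] at hs' hN' hl' ⊢
  have hsep : ∀ {q d : List ℕ+}, (q ++ d).Pairwise (· < ·) → (∀ z ∈ q ++ d, z.natPred < N) →
      ∀ a, countGe N (bits d) a ≤ d.length ∧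
        (countGe N (bits d) a < d.length → countGe N (bits q) a = 0) := by
    intro q d hs hN a
    rw [List.pairwise_append] at hs
    rw [countGe_bits (hs.2.1.imp fun h => h.ne) fun z hz => hN z (by simp [hz]),
      countGe_bits (hs.1.imp fun h => h.ne) fun z hz => hN z (by simp [hz])]
    refine ⟨List.countP_le_length, fun h => ?_⟩
    rw [List.countP_eq_zero]
    intro y hy hya
    refine h.ne (List.countP_eq_length.2 fun z hz => ?_)
    have := natPred_lt_iff.2 (hs.2.2 y hy z hz)
    simp only [decide_eq_true_eq] at hya ⊢
    omega
  have hlen : ∀ {q d : List ℕ+}, (q ++ d).Pairwise (· < ·) → (∀ z ∈ q ++ d, z.natPred < N) →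
      q.length = countGe N (bits q) 0 := by
    intro q d hs hN
    exact length_eq_countGe (List.pairwise_append.1 hs).1 fun z hz => hN z (by simp [hz])
  have e1 := hlen hs hN
  have e2 := hlen hs' hN'
  rw [List.length_append] at hl hl'
  push_cast at hl hl'
  have ha : ∀ a ≤ N,
      (((countGe N (bits (q' ++ d')) a : ℤ) - c' ≤ countGe N (bits (q ++ d)) a - c) ↔
        (w'.dualColumn.length + countLt (bits q) a ≤ w.dualColumn.length + countLt (bits q') a ∧
        countGe N (bits d') a + d.length ≤ countGe N (bits d) a + d'.length)) := by
    intro a ha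
    rw [countGe_bits_append (hs.imp fun h => h.ne) hN, countGe_bits_append (hs'.imp fun h => h.ne) hN']
    have h1 := hsep hs hN a
    have h2 := hsep hs' hN' a
    have h3 := countLt_add_countGe (bits q) ha
    have h4 := countLt_add_countGe (bits q') ha
    omega
  constructor
  · intro H
    exact ⟨fun a h => ((ha a h).1 (H a h)).1, fun a h => ((ha a h).1 (H a h)).2⟩
  · rintro ⟨H1, H2⟩ a h
    exact (ha a h).2 ⟨H1 a h, H2 a h⟩

/-! ### The bijection between semi-infinite tableaux and triples. -/

section correspondence

variable {μ ν : YoungDiagram} {n : ℕ}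

/-- The columns of a semi-infinite tableau, extended by the vacuum. -/
def wcol (w : BSet μ ν n) (t : ℕ) : FockWord :=
  if h : t < n then w.col ⟨t, h⟩ else FockWord.highest 0

theorem wcol_of_lt (w : BSet μ ν n) {t : ℕ} (h : t < n) : wcol w t = w.col ⟨t, h⟩ := dif_pos h

theorem wcol_charge (w : BSet μ ν n) {t : ℕ} (h : t < n) :
    (wcol w t).HasCharge ((ν.colLen (n - 1 - t) : ℤ) - μ.colLen t) := by
  rw [wcol_of_lt w h, ← lamOf_rev μ ν ⟨t, h⟩]
  exact w.charge ⟨t, h⟩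

theorem exists_wcol_bounded (w : BSet μ ν n) : ∃ N, ∀ t < n, (wcol w t).Bounded N := by
  choose b hb using fun t => (wcol w t).exists_bounded
  refine ⟨(Finset.range n).sup b, fun t ht => (hb t).mono ?_⟩
  exact Finset.le_sup (f := b) (Finset.mem_range.2 ht)

theorem rel_iff' (hn : μ.rowLen 0 + ν.rowLen 0 ≤ n) (w : BSet μ ν n) (x : Verma μ ν) :
    SkewRSKRel w x ↔ rskL x.2.1 x.1 n = [] ∧ ∀ t < n,
      (wcol w t).dualColumn = rskP x.2.1 x.1 t ∧
      (wcol w t).posList = rskQ x.2.1 x.1 t ++ colT x.2.2 (n - 1 - t) := by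
  rw [rel_iff hn]
  refine and_congr_right fun _ => ?_
  constructor
  · intro h t ht
    rw [wcol_of_lt w ht]
    exact h ⟨t, ht⟩
  · intro h t
    have := h t t.2
    rwa [wcol_of_lt w t.2] at this

theorem colLen_split (μ ν : YoungDiagram) {n t : ℕ} (hn : μ.rowLen 0 + ν.rowLen 0 ≤ n)
    (ht : t < n) {a p : ℕ} (h : (a : ℤ) = (ν.colLen (n - 1 - t) : ℤ) - μ.colLen t + p) :
    ν.colLen (n - 1 - t) ≤ a := by
  rcases colLen_zero_or μ ν hn ht with h1 | h1
  · omega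
  · rw [h1] at h; omega

/-- A matrix with given entries in a box. -/
theorem exists_mat (N : ℕ) (M : ℕ → ℕ → ℕ) :
    ∃ A : Mat, InBox N A ∧ ∀ k < N, ∀ j < N, matFun A k j = M k j := by
  classical
  let f : ℕ+ × ℕ+ → ℕ := fun p => if p.1.natPred < N ∧ p.2.natPred < N then
    M p.1.natPred p.2.natPred else 0
  have hf : ∀ p, f p ≠ 0 → p.1.natPred < N ∧ p.2.natPred < N := by
    intro p hp
    by_contra h
    exact hp (if_neg h)
  refine ⟨Finsupp.onFinset (((Finset.range N ×ˢ Finset.range N)).image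
    fun p => (p.1.succPNat, p.2.succPNat)) f fun p hp => ?_, fun p hp => hf p hp,
    fun k hk j hj => ?_⟩
  · rw [Finset.mem_image]
    refine ⟨(p.1.natPred, p.2.natPred), ?_, by simp⟩
    simpa using hf p hp
  · simp [matFun, f, hk, hj]

/-- Every semi-infinite tableau corresponds to a triple. -/
theorem exists_rel (hn : μ.rowLen 0 + ν.rowLen 0 ≤ n) (w : BSet μ ν n) :
    ∃ x : Verma μ ν, SkewRSKRel w x := by
  obtain ⟨N, hN⟩ := exists_wcol_bounded w
  -- The lowest positive letters, as many as the column of `ν` has cells, become the column of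
  -- `S_{>0}`; the others become labels.
  set k : ℕ → ℕ := fun t => (wcol w t).posList.length - ν.colLen (n - 1 - t) with hk
  set q : ℕ → List ℕ+ := fun t => (wcol w t).posList.take (k t) with hq
  set d : ℕ → List ℕ+ := fun t => (wcol w t).posList.drop (k t) with hd
  have hqd : ∀ t, (wcol w t).posList = q t ++ d t := fun t => (List.take_append_drop _ _).symm
  have hlen : ∀ t < n, (d t).length = ν.colLen (n - 1 - t) ∧
      (wcol w t).dualColumn.length = μ.colLen t + (q t).length := by
    intro t ht
    have h1 := FockWord.length_posList (wcol_charge w ht)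
    have h2 := colLen_split μ ν hn ht h1
    have h3 : (d t).length = ν.colLen (n - 1 - t) := by
      simp only [hd, hk, List.length_drop]
      omega
    have h4 := congrArg List.length (hqd t)
    rw [List.length_append] at h4
    omega
  have hsort : ∀ t, (q t).Pairwise (· < ·) ∧ (d t).Pairwise (· < ·) ∧ ∀ a ∈ q t, ∀ b ∈ d t, a < b := by
    intro t
    have := (wcol w t).posList_sorted
    rwa [hqd, List.pairwise_append] at this
  have hbd : ∀ t < n, (∀ z ∈ q t, z.natPred < N) ∧ ∀ z ∈ d t, z.natPred < N := by
    intro t ht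
    have := (hN t ht).posList
    rw [hqd] at this
    exact ⟨fun z hz => this z (by simp [hz]), fun z hz => this z (by simp [hz])⟩
  have hvac : ∀ t, n ≤ t → (wcol w t).dualColumn = [] ∧ q t = [] := by
    intro t ht
    have e : wcol w t = FockWord.highest 0 := dif_neg (by omega)
    refine ⟨by rw [e]; exact FockWord.lists_highest_zero.1, ?_⟩
    simp only [hq, e, FockWord.lists_highest_zero.2, List.take_nil]
  have hrow : ∀ t, t + 1 < n →
      PairLe N (bits (wcol w (t + 1)).dualColumn) (bits (q (t + 1)))
        (bits (wcol w t).dualColumn) (bits (q t)) ∧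
      ∀ (r : ℕ) (h1 : r < (d (t + 1)).length) (h2 : r < (d t).length), (d (t + 1))[r] ≤ (d t)[r] := by
    intro t ht
    have ht' : t < n := by omega
    have h1 := ν.colLen_anti (n - 1 - (t + 1)) (n - 1 - t) (by omega)
    have h2 := μ.colLen_anti t (t + 1) (by omega)
    have hdl : (d t).length ≤ (d (t + 1)).length := by
      rw [(hlen t ht').1, (hlen _ ht).1]
      exact h1
    have := (FockWord.row_iff_split (hN t ht') (hN _ ht) (wcol_charge w ht') (wcol_charge w ht)
      (hqd t) (hqd (t + 1)) (by rw [(hlen t ht').1]) (by rw [(hlen _ ht).1]) h2 hdl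
      (by rw [(hlen t ht').1]; exact colLen_zero_or μ ν hn ht')).1 (by
        intro j
        have := w.row_weak ⟨t, ht'⟩ ⟨t + 1, ht⟩ rfl j
        rw [lamOf_rev, lamOf_rev] at this
        rwa [wcol_of_lt w ht', wcol_of_lt w ht])
    refine ⟨this.1, fun r _ hr => ?_⟩
    exact (forall_countGe_le_iff (hsort t).2.1 (hsort _).2.1 (hbd t ht').2 (hbd _ ht).2 hdl).1
      this.2 r hr
  -- The last column is compared with the vacuum, which has neither missing nor positive letters.
  -- The condition holds there because a column has at least as many missing letters as labels.
  have hpair : ∀ t < n, PairLe N (bits (wcol w (t + 1)).dualColumn) (bits (q (t + 1)))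
        (bits (wcol w t).dualColumn) (bits (q t)) := by
    intro t ht
    rcases Nat.lt_or_ge (t + 1) n with h | h
    · exact (hrow t h).1
    · rw [(hvac _ h).1, (hvac _ h).2]
      have h0 : ∀ a, countGe N (bits []) a = 0 := by
        intro a
        rw [countGe_bits List.nodup_nil (by simp)]
        rfl
      refine ⟨fun a _ => by rw [h0]; exact Nat.zero_le _, fun a ha => ?_⟩
      have h1 := countLt_add_countGe (bits (q t)) ha
      rw [← FockWord.length_eq_countGe (hsort t).1 (hbd t ht).1] at h1
      rw [h0, ← FockWord.length_eq_countGe (wcol w t).dualColumn_sorted (hN t ht).dualColumn,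
        (hlen t ht).2]
      omega
  obtain ⟨M, C, hch, hM⟩ := Chain.exists_of_pairLe (N := N) (n := n)
    (P := fun t => bits (wcol w t).dualColumn) (Q := fun t => bits (q t))
    (fun k _ => by rw [(hvac n le_rfl).1]; rfl) (fun k _ => by rw [(hvac n le_rfl).2]; rfl) hpair
  obtain ⟨A, hA, hAM⟩ := exists_mat N (M 0)
  have hb : ∀ t, ∀ k < N, bits (ofBits N (C t)) k = C t k := fun t k hk => bits_ofBits hk
  -- The column lengths are right by conservation of letters in the grids, and the rows fit because
  -- `colLe_iff` can be read from the result back to the input.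
  obtain ⟨S, hS⟩ := exists_antinormal (μ := μ) (N := N)
    (s := fun t => if t < n then ofBits N (C t) else []) (by
      intro t
      split_ifs
      · exact ofBits_sorted _ _
      · exact List.Pairwise.nil) (by
      intro t
      split_ifs with ht
      · rw [FockWord.length_eq_countGe (ofBits_sorted _ _) (fun z hz => (mem_ofBits.1 hz).1),
          countGe_congr (hb t)]
        have h1 := (hch t ht).countGe_eq
        rw [← FockWord.length_eq_countGe (wcol w t).dualColumn_sorted (hN t ht).dualColumn,
          ← FockWord.length_eq_countGe (hsort t).1 (hbd t ht).1, (hlen t ht).2] at h1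
        omega
      · rw [colLen_eq_zero μ (by omega)]
        rfl) (by
      intro t z hz
      split_ifs at hz with ht
      · exact (mem_ofBits.1 hz).1
      · simp at hz) (by
      intro t a _
      split_ifs with h1 h2
      · rw [countGe_congr (hb t), countGe_congr (hb (t + 1))]
        exact ((hch t h2).colLe_iff (hch (t + 1) h1)).2 (hpair t h2) a ‹_›
      · omega
      all_goals exact (countGe_bits List.nodup_nil (by simp) a).le.trans (Nat.zero_le _))
  obtain ⟨T, hT⟩ := exists_normal (ν := ν) (d := fun c => if c < n then d (n - 1 - c) else []) (by
      intro c
      split_ifs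
      · exact (hsort _).2.1
      · exact List.Pairwise.nil) (by
      intro c
      split_ifs with hc
      · rw [(hlen _ (by omega)).1]
        congr 1
        omega
      · rw [colLen_eq_zero ν (by omega)]
        rfl) (by
      intro c r h1 h2
      have hc : c + 1 < n := by
        by_contra hc
        rw [if_neg hc] at h2
        simp at h2
      have e1 : (if c < n then d (n - 1 - c) else []) = d (n - 1 - (c + 1) + 1) := by
        rw [if_pos (by omega)]
        congr 1
        omega
      have e2 : (if c + 1 < n then d (n - 1 - (c + 1)) else []) = d (n - 1 - (c + 1)) := if_pos hc
      simp only [e1, e2] at h1 h2 ⊢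
      exact (hrow _ (by omega)).2 r h1 h2)
  have hSB : SBounded N A S := by
    refine ⟨hA, fun t z hz => ?_⟩
    rw [hS] at hz
    split_ifs at hz with ht
    · exact (mem_ofBits.1 hz).1
    · simp at hz
  refine ⟨(A, S, T), (rel_iff' hn w _).2 ?_⟩
  -- Grids are determined by their incoming data, so the algorithm, started from the matrix and the
  -- tableau just found, reproduces the chain that was constructed backwards.
  have key := (rsk_chain hSB n).eq_of_in hch (by rw [countFun_rskL_zero]; exact hAM)
    (fun t ht k hk => by rw [hS, if_pos ht, hb t k hk]) n le_rfl
  refine ⟨(rskL_eq_nil_iff hSB n).2 fun k hk j hj => by rw [key.1 k hk j hj, hM], fun t ht => ?_⟩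
  obtain ⟨h1, h2⟩ := key.2 t ht
  obtain ⟨-, g1, g2, g3, g4⟩ := rsk_spec hSB t
  constructor
  · exact (sorted_ext_bits g1 (wcol w t).dualColumn_sorted g2 (hN t ht).dualColumn h1).symm
  · rw [hqd, hT, if_pos (by omega), show n - 1 - (n - 1 - t) = t by omega,
      sorted_ext_bits g3 (hsort t).1 g4 (hbd t ht).1 h2]

theorem rel_append_inj {w : BSet μ ν n} {x x' : Verma μ ν} (hn : μ.rowLen 0 + ν.rowLen 0 ≤ n)
    (h : SkewRSKRel w x) (h' : SkewRSKRel w x') {t : ℕ} (ht : t < n) :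
    rskP x.2.1 x.1 t = rskP x'.2.1 x'.1 t ∧ rskQ x.2.1 x.1 t = rskQ x'.2.1 x'.1 t ∧
      colT x.2.2 (n - 1 - t) = colT x'.2.2 (n - 1 - t) := by
  obtain ⟨h1, h2⟩ := ((rel_iff' hn w x).1 h).2 t ht
  obtain ⟨h3, h4⟩ := ((rel_iff' hn w x').1 h').2 t ht
  refine ⟨h1.symm.trans h3, ?_⟩
  exact List.append_inj' (h2.symm.trans h4) (by rw [colT_length, colT_length])

theorem exists_sBounded₂ (x x' : Verma μ ν) :
    ∃ N, SBounded N x.1 x.2.1 ∧ SBounded N x'.1 x'.2.1 := by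
  obtain ⟨N, hN⟩ := exists_sBounded x.1 x.2.1
  obtain ⟨N', hN'⟩ := exists_sBounded x'.1 x'.2.1
  exact ⟨max N N', hN.mono (le_max_left _ _), hN'.mono (le_max_right _ _)⟩

/-- The triple which corresponds to a semi-infinite tableau is unique. -/
theorem rel_unique_right (hn : μ.rowLen 0 + ν.rowLen 0 ≤ n) {w : BSet μ ν n} {x x' : Verma μ ν}
    (h : SkewRSKRel w x) (h' : SkewRSKRel w x') : x = x' := by
  obtain ⟨N, hN, hN'⟩ := exists_sBounded₂ x x'
  have h1 := ((rel_iff' hn w x).1 h).1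
  have h2 := ((rel_iff' hn w x').1 h').1
  have hinj := fun {t} ht => rel_append_inj (t := t) hn h h' ht
  have key := (rsk_chain hN n).eq_of_out (rsk_chain hN' n)
    (fun k hk j hj => by rw [h1, h2]) (fun t ht k _ => by rw [(hinj ht).1])
    (fun t ht k _ => by rw [(hinj ht).2.1])
  rw [countFun_rskL_zero, countFun_rskL_zero] at key
  refine Prod.ext (hN.1.ext hN'.1 key.1) (Prod.ext (ext_colS fun t ht => ?_)
    (ext_colT (n := n) (by omega) fun t ht => (hinj ht).2.2))
  exact sorted_ext_bits (colS_sorted _ _) (colS_sorted _ _) (hN.2 t) (hN'.2 t)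
    (key.2 t (by omega))

/-- The semi-infinite tableau which corresponds to a triple is unique. -/
theorem rel_unique_left (hn : μ.rowLen 0 + ν.rowLen 0 ≤ n) {w w' : BSet μ ν n} {x : Verma μ ν}
    (h : SkewRSKRel w x) (h' : SkewRSKRel w' x) : w = w' := by
  apply SemiInfSST.ext
  funext t
  obtain ⟨h1, h2⟩ := ((rel_iff hn w x).1 h).2 t
  obtain ⟨h3, h4⟩ := ((rel_iff hn w' x).1 h').2 t
  exact FockWord.ext_lists (h1.trans h3.symm) (h2.trans h4.symm)

/-- The triples which correspond to a semi-infinite tableau with `n` columns. -/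
theorem exists_rel_iff (hn : μ.rowLen 0 + ν.rowLen 0 ≤ n) (x : Verma μ ν) :
    (∃ w : BSet μ ν n, SkewRSKRel w x) ↔ rskL x.2.1 x.1 n = [] ∧
      ∀ t < n, (rskQ x.2.1 x.1 t ++ colT x.2.2 (n - 1 - t)).Pairwise (· < ·) := by
  constructor
  · rintro ⟨w, h⟩
    rw [rel_iff' hn] at h
    refine ⟨h.1, fun t ht => ?_⟩
    rw [← (h.2 t ht).2]
    exact FockWord.posList_sorted _
  · rintro ⟨h1, h2⟩
    obtain ⟨N0, hN0⟩ := exists_sBounded x.1 x.2.1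
    have hw : ∀ t : Fin n, ∃ w : FockWord, w.dualColumn = rskP x.2.1 x.1 t ∧
        w.posList = rskQ x.2.1 x.1 t ++ colT x.2.2 (n - 1 - t) ∧
        w.HasCharge ((ν.colLen (n - 1 - t) : ℤ) - μ.colLen t) := by
      intro t
      obtain ⟨w, g1, g2, g3⟩ := FockWord.exists_of_lists (rsk_spec hN0 t).2.1 (h2 t t.2)
      refine ⟨w, g1, g2, ?_⟩
      convert g3 using 1
      rw [List.length_append, rskP_length, colT_length]
      push_cast
      ring
    choose col hc1 hc2 hc3 using hw
    choose b hb using fun t => (col t).exists_bounded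
    have hrow : ∀ i j : Fin n, (j : ℕ) = (i : ℕ) + 1 → ∀ m : ℕ,
        (col j).letter (m + (lamOf μ ν n j.rev - lamOf μ ν n i.rev).toNat) ≤ (col i).letter m := by
      intro i j hij
      set N := max N0 (max (b i) (b j)) with hN
      have hbi : (col i).Bounded N := (hb i).mono ((le_max_left _ _).trans (le_max_right _ _))
      have hbj : (col j).Bounded N := (hb j).mono ((le_max_right _ _).trans (le_max_right _ _))
      have hSN := hN0.mono (le_max_left N0 (max (b i) (b j)))
      have e : n - 1 - (i : ℕ) = n - 1 - (j : ℕ) + 1 := by have := j.2; omega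
      have hdl : (colT x.2.2 (n - 1 - i)).length ≤ (colT x.2.2 (n - 1 - j)).length := by
        rw [colT_length, colT_length]
        exact ν.colLen_anti _ _ (by omega)
      rw [lamOf_rev, lamOf_rev]
      rw [FockWord.row_iff_split hbi hbj (hc3 i) (hc3 j) (hc2 i) (hc2 j) (by rw [colT_length])
        (by rw [colT_length]) (μ.colLen_anti _ _ (by omega)) hdl
        (by rw [colT_length]; exact colLen_zero_or μ ν hn i.2)]
      have hTi := hbi.posList
      have hTj := hbj.posList
      rw [hc2] at hTi hTj
      constructor
      · rw [hc1, hc1, hij]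
        exact ((rsk_spec hSN i).1.colLe_iff (rsk_spec hSN (i + 1)).1).1 (colLe_colS hSN.2 i)
      · rw [forall_countGe_le_iff (colT_sorted _ _) (colT_sorted _ _)
          (fun z hz => hTi z (by simp [hz])) (fun z hz => hTj z (by simp [hz])) hdl]
        intro r hr
        simp only [e] at hr ⊢
        exact colT_le _ _ _ _ _
    refine ⟨⟨col, fun t => ?_, hrow⟩, (rel_iff hn _ x).2 ⟨h1, fun t => ⟨hc1 t, hc2 t⟩⟩⟩
    rw [lamOf_rev]
    exact hc3 t

/-- With one more column, the labels of column `t` stand above the next column of `S_{>0}` to the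
right. It is not longer and its entries are weakly larger in each row, so the strict increase
persists. The new column `n` carries no labels. -/
theorem exists_rel_succ (hn : μ.rowLen 0 + ν.rowLen 0 ≤ n) {x : Verma μ ν}
    (h : ∃ w : BSet μ ν n, SkewRSKRel w x) : ∃ w : BSet μ ν (n + 1), SkewRSKRel w x := by
  rw [exists_rel_iff hn] at h
  rw [exists_rel_iff (by omega)]
  obtain ⟨h1, h2⟩ := h
  refine ⟨by rw [rskL_succ, h1]; rfl, fun t ht => ?_⟩
  rcases Nat.lt_or_ge t n with h | h
  · have h3 := h2 t h
    rw [List.pairwise_append] at h3 ⊢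
    refine ⟨h3.1, colT_sorted _ _, fun a ha z hz => ?_⟩
    obtain ⟨r, hr, rfl⟩ := List.getElem_of_mem hz
    have e : n + 1 - 1 - t = n - 1 - t + 1 := by omega
    have hr' : r < (colT x.2.2 (n - 1 - t)).length := by
      rw [colT_length] at hr ⊢
      exact hr.trans_le (ν.colLen_anti _ _ (by omega))
    refine (h3.2.2 a ha _ (List.getElem_mem hr')).trans_le ?_
    simp only [e] at hr ⊢
    exact colT_le _ _ _ _ _
  · obtain rfl : t = n := by omega
    have : rskQ x.2.1 x.1 t = [] := by rw [rskQ, h1]; rfl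
    rw [this]
    exact colT_sorted _ _

/-- The number of columns is chosen so that `S_{>0}` lies entirely to the left of the insertion
tableau: where labels can occur, the column of `ν` is empty. -/
theorem exists_rel_of_large (x : Verma μ ν) : ∃ n, μ.rowLen 0 + ν.rowLen 0 ≤ n ∧
    ∃ w : BSet μ ν n, SkewRSKRel w x := by
  refine ⟨(skewRSK x.2.1 x.1).length + μ.rowLen 0 + ν.rowLen 0, by omega, ?_⟩
  rw [exists_rel_iff (by omega)]
  refine ⟨((skewRSK_length_le _ _ _).1 (by omega)).1, fun t ht => ?_⟩
  obtain ⟨N, hN⟩ := exists_sBounded x.1 x.2.1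
  rcases Nat.lt_or_ge t (skewRSK x.2.1 x.1).length with h | h
  · have : colT x.2.2 ((skewRSK x.2.1 x.1).length + μ.rowLen 0 + ν.rowLen 0 - 1 - t) = [] := by
      rw [← List.length_eq_zero_iff, colT_length, colLen_eq_zero ν (by omega)]
    rw [this, List.append_nil]
    exact (rsk_spec hN t).2.2.2.1
  · have h1 := skewRSK_getD x.2.1 x.1 t
    rw [List.getD_eq_default _ _ h, Prod.mk.injEq] at h1
    rw [← h1.2]
    exact colT_sorted _ _

/-! ### The highest weight elements -/

theorem rskL_zero (S : SST (antinormalShape μ)) (t : ℕ) : rskL S 0 t = [] := by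
  have : omegaWord 0 = [] := by simp [omegaWord]
  rw [rskL, this, passL_nil]

theorem mem_of_entry {l : ℕ} {f : ℕ → ℕ+} (hf : ∀ r < l, (f r : ℕ) = r + 1) (z : ℕ+) :
    z ∈ (List.range l).map f ↔ (z : ℕ) ≤ l := by
  simp only [List.mem_map, List.mem_range]
  constructor
  · rintro ⟨r, hr, rfl⟩
    rw [hf r hr]
    exact hr
  · intro hz
    have := z.pos
    exact ⟨z - 1, by omega, PNat.eq (by rw [hf _ (by omega)]; omega)⟩

theorem highest_antinormal_entry (μ : YoungDiagram) {r t : ℕ} (h : r < μ.colLen t) :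
    ((SST.highest _ (isStacked_antinormalShape μ)).entry (-(r : ℤ), -(t : ℤ)) : ℕ) =
      μ.colLen t - r := by
  have hs : (antinormalShape μ).filter (fun q => q.2 = -(t : ℤ) ∧ q.1 ≤ -(r : ℤ)) =
      (Finset.Ico r (μ.colLen t)).image fun r' : ℕ => (-(r' : ℤ), -(t : ℤ)) := by
    ext p
    simp only [Finset.mem_filter, Finset.mem_image, Finset.mem_Ico]
    constructor
    · rintro ⟨h1, h2, h3⟩
      obtain ⟨⟨r', t'⟩, h4, rfl⟩ := Finset.mem_image.1 h1
      rw [YoungDiagram.mem_cells, YoungDiagram.mem_iff_lt_colLen] at h4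
      dsimp only at h2 h3
      obtain rfl : t' = t := by omega
      exact ⟨r', ⟨by omega, h4⟩, rfl⟩
    · rintro ⟨r', ⟨h1, h2⟩, rfl⟩
      exact ⟨antinormal_mem.2 h2, rfl, by dsimp only; omega⟩
  simp only [SST.highest, if_pos (antinormal_mem.2 h), hs]
  rw [Finset.card_image_of_injective _ (fun a b hab => by simpa using hab), Nat.card_Ico,
    Nat.toPNat'_coe, if_pos (by omega)]

theorem highest_normal_entry (ν : YoungDiagram) {r t : ℕ} (h : r < ν.colLen t) :
    ((SST.highest _ (isStacked_normalShape ν)).entry ((r : ℤ), (t : ℤ)) : ℕ) = r + 1 := by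
  have hs : (normalShape ν).filter (fun q => q.2 = (t : ℤ) ∧ q.1 ≤ (r : ℤ)) =
      (Finset.range (r + 1)).image fun r' : ℕ => ((r' : ℤ), (t : ℤ)) := by
    ext p
    simp only [Finset.mem_filter, Finset.mem_image, Finset.mem_range]
    constructor
    · rintro ⟨h1, h2, h3⟩
      obtain ⟨⟨r', t'⟩, h4, rfl⟩ := Finset.mem_image.1 h1
      dsimp only at h2 h3
      obtain rfl : t' = t := by omega
      exact ⟨r', by omega, rfl⟩
    · rintro ⟨r', h1, rfl⟩
      exact ⟨normal_mem.2 (by omega), rfl, by dsimp only; omega⟩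
  simp only [SST.highest, if_pos (normal_mem.2 h), hs]
  rw [Finset.card_image_of_injective _ (fun a b hab => by simpa using hab), Finset.card_range,
    Nat.toPNat'_coe, if_pos (by omega)]

theorem FockWord.mem_lists_highest (c : ℤ) (k : ℕ+) :
    (k ∈ (FockWord.highest c).dualColumn ↔ (k : ℤ) ≤ -c) ∧
    (k ∈ (FockWord.highest c).posList ↔ (k : ℤ) ≤ c) := by
  have hk := k.pos
  rw [mem_dualColumn, mem_posList]
  constructor
  · rw [not_iff_comm]
    constructor
    · intro h
      refine ⟨(c - 1 + k).toNat, Subtype.ext ?_⟩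
      simp only [highest, negL]
      rw [if_pos (by omega)]
      omega
    · rintro ⟨m, hm⟩
      have h1 := congrArg Subtype.val hm
      simp only [highest, negL] at h1
      split_ifs at h1 <;> omega
  · constructor
    · rintro ⟨m, hm⟩
      have h1 := congrArg Subtype.val hm
      simp only [highest, posL] at h1
      split_ifs at h1 <;> omega
    · intro h
      refine ⟨(c - k).toNat, Subtype.ext ?_⟩
      simp only [highest, posL]
      rw [if_neg (by omega)]
      omega

/-- Nothing is inserted, so the insertion tableau is `S_{<0}` itself and there are no labels. The
letters of the highest weight elements can then be compared column by column. -/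
theorem rel_top (hn : μ.rowLen 0 + ν.rowLen 0 ≤ n) : SkewRSKRel (BSet.top μ ν n) (vermaTop μ ν) := by
  rw [rel_iff hn]
  simp only [vermaTop]
  refine ⟨rskL_zero _ _, fun t => ?_⟩
  rw [rskP, rskQ, rskL_zero]
  change (FockWord.highest (lamOf μ ν n t.rev)).dualColumn = colS _ _ ∧
    (FockWord.highest (lamOf μ ν n t.rev)).posList = [] ++ colT _ _
  rw [lamOf_rev, List.nil_append]
  have h0 := colLen_zero_or μ ν hn t.2
  constructor
  · refine sorted_ext (FockWord.dualColumn_sorted _) (colS_sorted _ _) fun z => ?_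
    rw [(FockWord.mem_lists_highest _ z).1, colS]
    have hz := z.pos
    rw [show z ∈ (List.range (μ.colLen t)).reverse.map _ ↔ _ from by
      rw [List.map_reverse, List.mem_reverse]]
    simp only [List.mem_map, List.mem_range]
    constructor
    · intro h
      refine ⟨μ.colLen t - z, by omega, PNat.eq ?_⟩
      rw [highest_antinormal_entry μ (by omega)]
      omega
    · rintro ⟨r, hr, rfl⟩
      rw [highest_antinormal_entry μ hr]
      rcases h0 with h0 | h0 <;> omega
  · refine sorted_ext (FockWord.posList_sorted _) (colT_sorted _ _) fun z => ?_
    rw [(FockWord.mem_lists_highest _ z).2, colT,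
      mem_of_entry fun r hr => highest_normal_entry ν hr]
    have hz := z.pos
    rcases h0 with h0 | h0 <;> omega

end correspondence

end

end GlInf

namespace GlInf

noncomputable section

open PreCrystal

theorem Fac.Le.ofProp {E E' : Prop} (h : E → E') : Fac.Le (Fac.ofProp E) (Fac.ofProp E') :=
  ⟨rfl, rfl, id, h⟩

section operators

variable {μ ν : YoungDiagram} {n : ℕ}

/-! ## The comparison of semi-infinite tableaux -/

/-- The comparison of two semi-infinite tableaux, column by column. -/
def wFac (i : ℤ) (w w' : BSet μ ν n) : Fac :=
  ((List.range' 0 n).map fun t => fockFac i (wcol w t) (wcol w' t)).prod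

theorem ofFn_col (w : BSet μ ν n) : List.ofFn w.col = (List.range' 0 n).map (wcol w) := by
  refine List.ext_getElem (by simp) fun t h1 h2 => ?_
  have ht : t < n := by simpa using h1
  simp [wcol_of_lt w ht]

theorem ofFn_col_injective : Function.Injective (fun w : BSet μ ν n => List.ofFn w.col) :=
  fun _ _ h => SemiInfSST.ext (List.ofFn_injective h)

theorem wFac_eq (i : ℤ) (w w' : BSet μ ν n) :
    wFac i w w' = ((goodAt_fock i).words.pullback ofFn_col_injective).fac w w' := by
  have h : wFac i w w' = (goodAt_fock i).words.fac (List.ofFn w.col) (List.ofFn w'.col) := by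
    rw [ofFn_col, ofFn_col, (goodAt_fock i).words_fac_map]
    rfl
  rw [h]
  apply Fac.ext'
  · rfl
  · rfl
  · exact (liftOp_eq_some ofFn_col_injective _ _ _).symm
  · exact ofFn_col_injective.eq_iff

theorem semiInf_eps (i : ℤ) (w w' : BSet μ ν n) :
    (semiInfCrystal (lamOf μ ν n)).eps i w = (((wFac i w w').e : ℤ) : WithBot ℤ) := by
  rw [wFac_eq]
  exact ((goodAt_fock i).words.pullback ofFn_col_injective).eps w

theorem semiInf_f (i : ℤ) (w w' : BSet μ ν n) :
    (semiInfCrystal (lamOf μ ν n)).f i w = some w' ↔ (wFac i w w').R := by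
  rw [wFac_eq]
  rfl

/-! ## Negative colours -/

variable {w w' : BSet μ ν n} {x x' : Verma μ ν}

/-- A negative colour sees the missing letters only, that is, the insertion tableau, and keeps the
labels and `S_{>0}`. The chain of grids converts the product over the new columns into the matrix
times the old columns, which is the crystal of `A ⊗ S_{<0}`. -/
theorem wFac_le_neg (hn : μ.rowLen 0 + ν.rowLen 0 ≤ n) (h : SkewRSKRel w x)
    (h' : SkewRSKRel w' x') {i : ℤ} (hi : i < 0) :
    Fac.Le (wFac i w w') ((goodAt_negPart μ hi).fac (x.1, x.2.1) (x'.1, x'.2.1) *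
      Fac.ofProp (x.2.2 = x'.2.2)) := by
  obtain ⟨k, hik⟩ : ∃ k : ℕ, -i = k + 1 := ⟨(-i - 1).toNat, by omega⟩
  obtain ⟨N0, hN0, hN0'⟩ := exists_sBounded₂ x x'
  set N := max N0 (k + 2) with hNdef
  have hN := hN0.mono (le_max_left N0 (k + 2))
  have hN' := hN0'.mono (le_max_left N0 (k + 2))
  have hk : k + 1 < N := by have := le_max_right N0 (k + 2); omega
  rw [rel_iff' hn] at h h'
  have step1 : Fac.Le (wFac i w w') ((List.range' 0 n).map fun t =>
      bitsFac N k (bits (rskP x.2.1 x.1 t)) (bits (rskP x'.2.1 x'.1 t)) *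
        Fac.ofProp (∀ j < N, bits (rskQ x.2.1 x.1 t) j = bits (rskQ x'.2.1 x'.1 t) j) *
        Fac.ofProp (colT x.2.2 (n - 1 - t) = colT x'.2.2 (n - 1 - t))).prod := by
    refine Fac.Le.prod_map _ _ _ fun t ht => ?_
    obtain ⟨h1, h2⟩ := h.2 t (by simpa using ht)
    obtain ⟨h3, h4⟩ := h'.2 t (by simpa using ht)
    refine (fockFac_le_neg (N := N) hi hik).trans ?_
    rw [mul_assoc, Fac.ofProp_mul, ← FockWord.bits_dualColumn, ← FockWord.bits_dualColumn, h1, h3]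
    refine (Fac.Le.refl _).mul (Fac.Le.ofProp fun hb => ?_)
    have : (wcol w t).posList = (wcol w' t).posList :=
      sorted_ext (FockWord.posList_sorted _) (FockWord.posList_sorted _) fun z => by
        have := congrFun hb z.natPred
        rw [← FockWord.bits_posList, ← FockWord.bits_posList, bits, bits, decide_eq_decide,
          PNat.succPNat_natPred] at this
        exact this
    rw [h2, h4] at this
    obtain ⟨e1, e2⟩ := List.append_inj' this (by rw [colT_length, colT_length])
    exact ⟨fun j _ => by rw [e1], e2⟩
  refine step1.trans ?_
  rw [Fac.prod_map_mul_ofProp, ← (rsk_chain hN n).fac_neg (rsk_chain hN' n)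
    (fun k _ j _ => by rw [h.1]; rfl) (fun k _ j _ => by rw [h'.1]; rfl) hk,
    countFun_rskL_zero, countFun_rskL_zero]
  refine Fac.Le.mul ?_ (Fac.Le.ofProp fun hT => ext_colT (n := n) (by omega)
    fun t ht => hT t (by simpa using ht))
  have e : (goodAt_negPart μ hi).fac (x.1, x.2.1) (x'.1, x'.2.1) =
      (goodAt_mat_neg hi).fac x.1 x'.1 *
        (goodAt_sst (goodAt_vecNeg hi) (antinormalShape μ)).fac x.2.1 x'.2.1 :=
    GoodAt.tensor_fac (goodAt_mat_neg hi) (goodAt_sst (goodAt_vecNeg hi) _) _ _ _ _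
  rw [e, sst_fac_antinormal (goodAt_vecNeg hi) (n := n) (by omega)]
  refine (matFac_le_neg hi hik hk hN.1 hN'.1).mul (Fac.Le.prod_map _ _ _ fun t _ => ?_)
  rw [words_fac_column (goodAt_vecNeg hi) hik (vecNeg_f_succPNat hik) hk (colS_sorted _ _)
    (colS_sorted _ _) (hN.2 t) (hN'.2 t)]
  exact Fac.Le.refl _

/-! ## Positive colours -/

/-- The cell of a letter of a semi-infinite tableau. -/
def wCell (μ ν : YoungDiagram) (n t m : ℕ) : ℤ × ℤ :=
  ((ν.colLen (n - 1 - t) : ℤ) - μ.colLen t - 1 - m, -(t : ℤ))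

/-- The letter in a cell of a semi-infinite tableau. -/
def wEntry (w : BSet μ ν n) (p : ℤ × ℤ) : ℕ+ :=
  toPos ((wcol w (-p.2).toNat).letter ((ν.colLen (n - 1 - (-p.2).toNat) : ℤ) -
    μ.colLen (-p.2).toNat - 1 - p.1).toNat)

theorem wEntry_wCell (w : BSet μ ν n) (t m : ℕ) :
    wEntry w (wCell μ ν n t m) = toPos ((wcol w t).letter m) := by
  simp only [wEntry, wCell, neg_neg, Int.toNat_natCast]
  congr 2
  omega

/-- The cells of the positive letters of a column, from top to bottom. -/
def wCells (w : BSet μ ν n) (t : ℕ) : List (ℤ × ℤ) :=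
  (List.range ((wcol w t).cnt 0)).reverse.map (wCell μ ν n t)

theorem map_wCells (w : BSet μ ν n) (t : ℕ) :
    (wCells w t).map (wEntry w) = (wcol w t).posList := by
  rw [wCells, List.map_map, FockWord.posList]
  exact List.map_congr_left fun m _ => wEntry_wCell w t m

theorem toPos_lt_iff {y z : Zx} (hy : 0 < (y : ℤ)) (hz : 0 < (z : ℤ)) :
    toPos y < toPos z ↔ (y : ℤ) < z := by
  rw [← posL_lt_iff, posL_toPos hy, posL_toPos hz]
  rfl

/-- The row condition is iterated. With rows indexed by `r`, the shift by the difference of charges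
is absorbed into the position within the column. -/
theorem wcol_row (w : BSet μ ν n) {t t' : ℕ} (htt : t ≤ t') (ht : t' < n) {r : ℤ}
    (hr : r ≤ (ν.colLen (n - 1 - t) : ℤ) - μ.colLen t - 1) :
    r ≤ (ν.colLen (n - 1 - t') : ℤ) - μ.colLen t' - 1 ∧
    ((wcol w t').letter ((ν.colLen (n - 1 - t') : ℤ) - μ.colLen t' - 1 - r).toNat : ℤ) ≤
      (wcol w t).letter ((ν.colLen (n - 1 - t) : ℤ) - μ.colLen t - 1 - r).toNat := by
  induction htt with
  | refl => exact ⟨hr, le_rfl⟩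
  | @step s hs ih =>
    simp only [Nat.succ_eq_add_one] at ht ⊢
    obtain ⟨h1, h2⟩ := ih (by omega)
    have h3 := ν.colLen_anti (n - 1 - (s + 1)) (n - 1 - s) (by omega)
    have h4 := μ.colLen_anti s (s + 1) (by omega)
    refine ⟨by omega, le_trans ?_ h2⟩
    have h5 := w.row_weak ⟨s, by omega⟩ ⟨s + 1, ht⟩ rfl
      ((ν.colLen (n - 1 - s) : ℤ) - μ.colLen s - 1 - r).toNat
    rw [lamOf_rev, lamOf_rev, ← wcol_of_lt w, ← wcol_of_lt w] at h5
    dsimp only at h5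
    have e : ((ν.colLen (n - 1 - (s + 1)) : ℤ) - μ.colLen (s + 1) - 1 - r).toNat =
        ((ν.colLen (n - 1 - s) : ℤ) - μ.colLen s - 1 - r).toNat +
          ((ν.colLen (n - 1 - (s + 1)) : ℤ) - μ.colLen (s + 1) -
            ((ν.colLen (n - 1 - s) : ℤ) - μ.colLen s)).toNat := by omega
    rw [e]
    exact h5

theorem mem_wCells (w : BSet μ ν n) (p : ℤ × ℤ) :
    p ∈ (List.range' 0 n).flatMap (wCells w) ↔ ∃ t < n, ∃ r : ℤ, p = (r, -(t : ℤ)) ∧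
      r ≤ (ν.colLen (n - 1 - t) : ℤ) - μ.colLen t - 1 ∧
      0 < ((wcol w t).letter ((ν.colLen (n - 1 - t) : ℤ) - μ.colLen t - 1 - r).toNat : ℤ) := by
  simp only [List.mem_flatMap, List.mem_range'_1, zero_add, Nat.zero_le, true_and, wCells,
    List.mem_map, List.mem_reverse, List.mem_range, wCell]
  refine exists_congr fun t => and_congr_right fun _ => ?_
  constructor
  · rintro ⟨m, hm, rfl⟩
    refine ⟨_, rfl, by omega, ?_⟩
    rw [(wcol w t).letter_pos_iff]
    convert hm using 1
    omega
  · rintro ⟨r, rfl, h1, h2⟩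
    exact ⟨_, ((wcol w t).letter_pos_iff _).1 h2, by rw [Prod.mk.injEq]; omega⟩

/-- Letters grow weakly to the right and strictly downwards, so positivity propagates in both
directions. This gives the convexity of the set of cells with positive letters. -/
theorem isSkewTableau_wEntry (w : BSet μ ν n) :
    IsSkewTableau ((List.range' 0 n).flatMap (wCells w)).toFinset fun p => wEntry w p := by
  have hval : ∀ (t : ℕ) (r : ℤ), wEntry w (r, -(t : ℤ)) = toPos ((wcol w t).letter
      ((ν.colLen (n - 1 - t) : ℤ) - μ.colLen t - 1 - r).toNat) := by
    intro t r
    simp only [wEntry, neg_neg, Int.toNat_natCast]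
  have hmem : ∀ p, p ∈ ((List.range' 0 n).flatMap (wCells w)).toFinset → ∃ t < n, ∃ r : ℤ,
      p = (r, -(t : ℤ)) ∧ r ≤ (ν.colLen (n - 1 - t) : ℤ) - μ.colLen t - 1 ∧
      0 < ((wcol w t).letter ((ν.colLen (n - 1 - t) : ℤ) - μ.colLen t - 1 - r).toNat : ℤ) :=
    fun p hp => (mem_wCells w p).1 (List.mem_toFinset.1 hp)
  have hlet : ∀ (t m m' : ℕ), m ≤ m' → ((wcol w t).letter m' : ℤ) ≤ (wcol w t).letter m :=
    fun t m m' h => (wcol w t).strict.antitone h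
  constructor
  · intro r c r' c' h1 h2 hr hc
    obtain ⟨t, ht, r1, e, g1, g2⟩ := hmem _ h1
    obtain ⟨t', ht', r2, e', g1', g2'⟩ := hmem _ h2
    simp only [Prod.mk.injEq] at e e'
    obtain ⟨rfl, rfl⟩ := e
    obtain ⟨rfl, rfl⟩ := e'
    obtain ⟨a1, a2⟩ := wcol_row w (show t' ≤ t by omega) ht (hr.trans g1')
    obtain ⟨b1, b2⟩ := wcol_row w (show t' ≤ t by omega) ht g1'
    simp only [List.mem_toFinset, mem_wCells]
    refine ⟨⟨t', ht', r, rfl, hr.trans g1', g2.trans_le a2⟩, ⟨t, ht, r', rfl, b1, g2.trans_le ?_⟩⟩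
    exact hlet _ _ _ (by omega)
  · intro r c c' hc h1 h2
    obtain ⟨t, ht, r1, e, g1, g2⟩ := hmem _ h1
    obtain ⟨t', ht', r2, e', g1', g2'⟩ := hmem _ h2
    simp only [Prod.mk.injEq] at e e'
    obtain ⟨rfl, rfl⟩ := e
    obtain ⟨rfl, rfl⟩ := e'
    obtain ⟨a1, a2⟩ := wcol_row w (show t' ≤ t by omega) ht g1'
    rw [hval, hval, Nat.cast_le, PNat.coe_le_coe, ← not_lt, toPos_lt_iff g2' g2]
    omega
  · intro r r' c hr h1 h2
    obtain ⟨t, ht, r1, e, g1, g2⟩ := hmem _ h1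
    obtain ⟨t', ht', r2, e', g1', g2'⟩ := hmem _ h2
    simp only [Prod.mk.injEq] at e e'
    obtain ⟨rfl, rfl⟩ := e
    obtain ⟨rfl, h3⟩ := e'
    obtain rfl : t = t' := by omega
    rw [hval, hval, Nat.cast_lt, PNat.coe_lt_coe, toPos_lt_iff g2 g2', FockWord.letter_lt_iff]
    omega

/-- The cells of `w_{>0}^-` in a column, from top to bottom. -/
def wCellsQ (w : BSet μ ν n) (t : ℕ) : List (ℤ × ℤ) :=
  ((List.range ((wcol w t).cnt 0)).drop (ν.colLen (n - 1 - t))).reverse.map (wCell μ ν n t)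

/-- The cell of `w_{>0}^+` which corresponds to a cell of a normal shape. -/
def shiftCell (n : ℕ) (p : ℤ × ℤ) : ℤ × ℤ := (p.1, p.2 - ((n : ℤ) - 1))

theorem isReading_wCells (w : BSet μ ν n) : IsReading ((List.range' 0 n).flatMap (wCells w)) := by
  refine isReading_columns n _ (fun t => -(t : ℤ)) (fun s t h _ => by omega) ?_ ?_
  · intro t _ p hp
    simp only [wCells, List.mem_map] at hp
    obtain ⟨r, _, rfl⟩ := hp
    rfl
  · intro t _
    rw [wCells, List.pairwise_map, List.pairwise_reverse]
    exact List.pairwise_lt_range.imp fun h => by simp only [wCell]; omega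

theorem mem_drop_range {l m : ℕ} {k : ℕ} : k ∈ (List.range m).drop l ↔ l ≤ k ∧ k < m := by
  rw [List.range_eq_range', List.drop_range', List.mem_range'_1]
  omega

/-- The cells of `𝐰_{>0}^-` have negative row index and those of `𝐰_{>0}^+` nonnegative row index.
Reading the former by columns before the latter by rows is therefore admissible. -/
theorem isReading_split (w : BSet μ ν n) : IsReading ((List.range' 0 n).flatMap (wCellsQ w) ++
    ((normalShape ν).sort readLE).map (shiftCell n)) := by
  rw [IsReading, List.pairwise_append]
  refine ⟨?_, ?_, ?_⟩
  · refine isReading_columns n _ (fun t => -(t : ℤ)) (fun s t h _ => by omega) ?_ ?_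
    · intro t _ p hp
      simp only [wCellsQ, List.mem_map] at hp
      obtain ⟨r, _, rfl⟩ := hp
      rfl
    · intro t _
      rw [wCellsQ, List.pairwise_map, List.pairwise_reverse]
      exact (List.pairwise_lt_range.sublist (List.drop_sublist _ _)).imp fun h => by
        simp only [wCell]; omega
  · rw [List.pairwise_map]
    refine (isReading_sort _).imp fun {a b} h h' => h ?_
    simp only [shiftCell] at h'
    omega
  · intro a ha b hb
    simp only [List.mem_flatMap, wCellsQ, List.mem_map, List.mem_reverse, mem_drop_range] at ha
    obtain ⟨t, _, m, hm, rfl⟩ := ha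
    simp only [List.mem_map, Finset.mem_sort] at hb
    obtain ⟨p, hp, rfl⟩ := hb
    obtain ⟨q, _, rfl⟩ := Finset.mem_image.1 hp
    simp only [wCell, shiftCell]
    omega

theorem rel_lists (hn : μ.rowLen 0 + ν.rowLen 0 ≤ n) (h : SkewRSKRel w x) {t : ℕ} (ht : t < n) :
    ν.colLen (n - 1 - t) ≤ (wcol w t).cnt 0 ∧ (wCellsQ w t).map (wEntry w) = rskQ x.2.1 x.1 t ∧
      ∀ r < ν.colLen (n - 1 - t), wEntry w (shiftCell n ((r : ℤ), ((n - 1 - t : ℕ) : ℤ))) =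
        x.2.2.entry ((r : ℤ), ((n - 1 - t : ℕ) : ℤ)) := by
  have h2 := (((rel_iff' hn w x).1 h).2 t ht).2
  have hle : ν.colLen (n - 1 - t) ≤ (wcol w t).cnt 0 := by
    rw [← FockWord.posList_length, h2, List.length_append, colT_length]
    omega
  rw [FockWord.posList_eq_append_iff _ (by rwa [colT_length]), colT_length] at h2
  refine ⟨hle, ?_, fun r hr => ?_⟩
  · apply List.map_injective_iff.2 posL_injective
    rw [h2.1, wCellsQ, List.map_map, List.map_map]
    refine List.map_congr_left fun m hm => ?_
    simp only [List.mem_reverse, mem_drop_range] at hm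
    rw [Function.comp_apply, Function.comp_apply, wEntry_wCell, posL_toPos]
    exact ((wcol w t).letter_pos_iff _).2 hm.2
  · have e : shiftCell n ((r : ℤ), ((n - 1 - t : ℕ) : ℤ)) =
        wCell μ ν n t (ν.colLen (n - 1 - t) - 1 - r) := by
      have h0 := colLen_zero_or μ ν hn ht
      simp only [shiftCell, wCell, Prod.mk.injEq]
      rcases h0 with h0 | h0 <;> omega
    have h3 := congrArg (fun l => l[r]?) h2.2
    simp only [colT, List.map_map, List.getElem?_map] at h3
    rw [List.getElem?_range hr, List.getElem?_reverse (by simpa using hr), List.length_range,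
      List.getElem?_range (by omega)] at h3
    simp only [Option.map_some, Function.comp_apply, Option.some_inj] at h3
    rw [e, wEntry_wCell, ← h3, toPos_posL]

theorem mem_split (hn : μ.rowLen 0 + ν.rowLen 0 ≤ n) (h : SkewRSKRel w x) (p : ℤ × ℤ) :
    p ∈ (List.range' 0 n).flatMap (wCellsQ w) ++ ((normalShape ν).sort readLE).map (shiftCell n) ↔
      p ∈ (List.range' 0 n).flatMap (wCells w) := by
  have e : ∀ t < n, ∀ r < ν.colLen (n - 1 - t), shiftCell n ((r : ℤ), ((n - 1 - t : ℕ) : ℤ)) =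
      wCell μ ν n t (ν.colLen (n - 1 - t) - 1 - r) := by
    intro t ht r hr
    have h0 := colLen_zero_or μ ν hn ht
    simp only [shiftCell, wCell, Prod.mk.injEq]
    rcases h0 with h0 | h0 <;> omega
  simp only [List.mem_append, List.mem_flatMap, List.mem_range'_1, zero_add, Nat.zero_le, true_and,
    wCellsQ, wCells, List.mem_map, List.mem_reverse, mem_drop_range, List.mem_range,
    Finset.mem_sort]
  constructor
  · rintro (⟨t, ht, m, hm, rfl⟩ | ⟨q, hq, rfl⟩)
    · exact ⟨t, ht, m, hm.2, rfl⟩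
    · obtain ⟨t, ht, hq⟩ := List.mem_flatMap.1 ((mem_cellsT (n := n) (by omega) q).2 hq)
      simp only [List.mem_range'_1, zero_add, Nat.zero_le, true_and] at ht
      simp only [cellsT, List.mem_map, List.mem_range] at hq
      obtain ⟨r, hr, rfl⟩ := hq
      rw [e t ht r hr]
      have := (rel_lists hn h ht).1
      exact ⟨t, ht, _, by omega, rfl⟩
  · rintro ⟨t, ht, m, hm, rfl⟩
    rcases Nat.lt_or_ge m (ν.colLen (n - 1 - t)) with h1 | h1
    · right
      refine ⟨((((ν.colLen (n - 1 - t) - 1 - m : ℕ)) : ℤ), ((n - 1 - t : ℕ) : ℤ)),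
        normal_mem.2 (by omega), ?_⟩
      rw [e t ht _ (by omega)]
      congr 1
      omega
    · exact Or.inl ⟨t, ht, m, ⟨h1, hm⟩, rfl⟩

/-- Letters can be compared cell by cell only if both tableaux have the same cells with positive
letters. This is what `hlen` ensures: a positive colour keeps the missing letters, and by the charge
also the number of positive letters in each column. -/
theorem wFac_le_pos (hn : μ.rowLen 0 + ν.rowLen 0 ≤ n) (h : SkewRSKRel w x)
    (h' : SkewRSKRel w' x') {i : ℤ} (hi : 0 < i)
    (hlen : w = w' ∨ (wFac i w w').R) :
    Fac.Le (wFac i w w') ((goodAt_posPart ν hi).fac (x.1, x.2.2) (x'.1, x'.2.2) *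
      Fac.ofProp (x.2.1 = x'.2.1)) := by
  obtain ⟨k, hik⟩ : ∃ k : ℕ, i = k + 1 := ⟨(i - 1).toNat, by omega⟩
  obtain ⟨N0, hN0, hN0'⟩ := exists_sBounded₂ x x'
  obtain ⟨N1, hN1⟩ := exists_wcol_bounded w
  obtain ⟨N2, hN2⟩ := exists_wcol_bounded w'
  obtain ⟨N, hk, hNN⟩ : ∃ N, k + 1 < N ∧ N0 ≤ N ∧ N1 ≤ N ∧ N2 ≤ N :=
    ⟨N0 + N1 + N2 + k + 2, by omega, by omega, by omega, by omega⟩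
  have hN := hN0.mono hNN.1
  have hN' := hN0'.mono hNN.1
  set hv := goodAt_vecPos hi with hvdef
  have step1 : Fac.Le (wFac i w w') (((List.range' 0 n).map fun t =>
      hv.words.fac (wcol w t).posList (wcol w' t).posList).prod *
        Fac.ofProp (∀ t ∈ List.range' 0 n, (wcol w t).dualColumn = (wcol w' t).dualColumn)) := by
    rw [← Fac.prod_map_mul_ofProp]
    refine Fac.Le.prod_map _ _ _ fun t ht => ?_
    have ht' : t < n := by simpa using ht
    refine (fockFac_le_pos (N := N) hi hik).trans ?_
    rw [words_fac_column hv hik (vecPos_f_succPNat hik) hk (FockWord.posList_sorted _)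
      (FockWord.posList_sorted _) ((hN1 t ht').mono hNN.2.1).posList
      ((hN2 t ht').mono hNN.2.2).posList, FockWord.bits_posList, FockWord.bits_posList]
    refine (Fac.Le.refl _).mul (Fac.Le.ofProp fun hb => ?_)
    refine sorted_ext (FockWord.dualColumn_sorted _) (FockWord.dualColumn_sorted _) fun z => ?_
    have := congrFun hb z.natPred
    rwa [← FockWord.bits_dualColumn, ← FockWord.bits_dualColumn, bits, bits, decide_eq_decide,
      PNat.succPNat_natPred] at this
  have hdual : ∀ t < n, (wcol w t).dualColumn = (wcol w' t).dualColumn := by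
    rcases hlen with rfl | hR
    · exact fun _ _ => rfl
    · have := step1.2.2.1 hR
      rw [Fac.mul_ofProp_R] at this
      exact fun t ht => this.2 t (by simpa using ht)
  have hcnt : ∀ t < n, (wcol w t).cnt 0 = (wcol w' t).cnt 0 := by
    intro t ht
    have h1 := FockWord.length_posList (wcol_charge w ht)
    have h2 := FockWord.length_posList (wcol_charge w' ht)
    rw [hdual t ht] at h1
    rw [← FockWord.posList_length, ← FockWord.posList_length]
    omega
  -- The change of reading: whole columns from right to left on one side; on the other the recording
  -- part by columns, followed by `S_{>0}` in its row reading.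
  have step2 : ((List.range' 0 n).map fun t =>
      hv.words.fac (wcol w t).posList (wcol w' t).posList).prod =
      ((List.range' 0 n).map fun t =>
        hv.words.fac (rskQ x.2.1 x.1 t) (rskQ x'.2.1 x'.1 t)).prod *
      (goodAt_sst hv (normalShape ν)).fac x.2.2 x'.2.2 := by
    have key := (isSkewTableau_wEntry w).prod_congr (k := i) (isReading_wCells w)
      (isReading_split w) (by simp) (fun p => by rw [mem_split hn h, List.mem_toFinset])
      (fun p => hv.fac (wEntry w p) (wEntry w' p)) (fun _ _ => rfl) (fun _ _ => rfl)
    rw [prod_map_flatMap, List.map_append, List.prod_append, prod_map_flatMap] at key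
    have e1 : ∀ t ∈ List.range' 0 n, hv.words.fac (wcol w t).posList (wcol w' t).posList =
        ((wCells w t).map fun p => hv.fac (wEntry w p) (wEntry w' p)).prod := by
      intro t ht
      have ht' : t < n := by simpa using ht
      rw [← hv.words_fac_map, map_wCells]
      congr 1
      rw [← map_wCells, wCells, wCells, hcnt t ht']
    have e2 : ∀ t ∈ List.range' 0 n, hv.words.fac (rskQ x.2.1 x.1 t) (rskQ x'.2.1 x'.1 t) =
        ((wCellsQ w t).map fun p => hv.fac (wEntry w p) (wEntry w' p)).prod := by
      intro t ht
      have ht' : t < n := by simpa using ht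
      rw [← hv.words_fac_map, (rel_lists hn h ht').2.1]
      congr 1
      rw [← (rel_lists hn h' ht').2.1, wCellsQ, wCellsQ, hcnt t ht']
    have e3 : ∀ p ∈ (normalShape ν).sort readLE,
        hv.fac (wEntry w (shiftCell n p)) (wEntry w' (shiftCell n p)) =
          hv.fac (x.2.2.entry p) (x'.2.2.entry p) := by
      intro p hp
      rw [Finset.mem_sort, ← mem_cellsT (n := n) (by omega)] at hp
      obtain ⟨t, ht, hq⟩ := List.mem_flatMap.1 hp
      have ht' : t < n := by simpa using ht
      simp only [cellsT, List.mem_map, List.mem_range] at hq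
      obtain ⟨r, hr, rfl⟩ := hq
      rw [(rel_lists hn h ht').2.2 r hr, (rel_lists hn h' ht').2.2 r hr]
    rw [List.map_congr_left e1, List.map_congr_left e2, sst_fac hv, ← List.map_congr_left e3, key,
      List.map_map]
    rfl
  rw [rel_iff' hn] at h h'
  refine step1.trans ?_
  rw [step2, mul_assoc, ← Fac.ofProp_comm, ← mul_assoc, ← Fac.prod_map_mul_ofProp]
  have e : (goodAt_posPart ν hi).fac (x.1, x.2.2) (x'.1, x'.2.2) =
      (goodAt_mat_pos hi).fac x.1 x'.1 * (goodAt_sst hv (normalShape ν)).fac x.2.2 x'.2.2 :=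
    GoodAt.tensor_fac (goodAt_mat_pos hi) (goodAt_sst hv _) _ _ _ _
  rw [e, mul_assoc, ← Fac.ofProp_comm, ← mul_assoc]
  refine Fac.Le.mul ?_ (Fac.Le.refl _)
  have step3 : Fac.Le ((List.range' 0 n).map fun t =>
      hv.words.fac (rskQ x.2.1 x.1 t) (rskQ x'.2.1 x'.1 t) *
        Fac.ofProp ((wcol w t).dualColumn = (wcol w' t).dualColumn)).prod
      ((List.range' 0 n).map fun t =>
        bitsFac N k (bits (rskQ x.2.1 x.1 t)) (bits (rskQ x'.2.1 x'.1 t)) *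
        Fac.ofProp (∀ j < N, bits (rskP x.2.1 x.1 t) j = bits (rskP x'.2.1 x'.1 t) j)).prod := by
    refine Fac.Le.prod_map _ _ _ fun t ht => ?_
    have ht' : t < n := by simpa using ht
    obtain ⟨-, -, -, g3, g4⟩ := rsk_spec hN t
    obtain ⟨-, -, -, g3', g4'⟩ := rsk_spec hN' t
    rw [words_fac_column hv hik (vecPos_f_succPNat hik) hk g3 g3' g4 g4', (h.2 t ht').1,
      (h'.2 t ht').1]
    exact (Fac.Le.refl _).mul (Fac.Le.ofProp fun hb j _ => by rw [hb])
  refine step3.trans ?_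
  rw [← (rsk_chain hN n).fac_pos (rsk_chain hN' n)
    (fun k _ j _ => by rw [h.1]; rfl) (fun k _ j _ => by rw [h'.1]; rfl) hk,
    countFun_rskL_zero, countFun_rskL_zero]
  refine (matFac_le_pos hi hik hk hN.1 hN'.1).mul (Fac.Le.ofProp fun hS => ext_colS fun t ht => ?_)
  exact sorted_ext_bits (colS_sorted _ _) (colS_sorted _ _) (hN.2 t) (hN'.2 t)
    (hS t (by omega))

end operators

end

end GlInf

namespace GlInf

noncomputable section

open PreCrystal

section operators

variable {μ ν : YoungDiagram} {n : ℕ} {w w' : BSet μ ν n} {x x' : Verma μ ν}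

/-! ## The colour `0` -/

theorem fockFac_zero_R {u u' : FockWord} (h : (fockFac 0 u u').R) : u'.posList = 1 :: u.posList := by
  obtain ⟨⟨-, h2⟩, h3⟩ := fockFac_R h
  rw [hi_zero] at h2 h3
  rw [lo_zero] at h3
  have h1 : (1 : ℕ+) ∉ u.posList := fun hm => h2 ((u.mem_posList 1).1 hm)
  refine sorted_ext u'.posList_sorted (List.pairwise_cons.2 ⟨fun z hz => ?_, u.posList_sorted⟩)
    fun z => ?_
  · refine lt_of_le_of_ne one_le ?_
    rintro rfl
    exact h1 hz
  · rw [FockWord.mem_posList, h3, List.mem_cons, FockWord.mem_posList]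
    refine or_congr posL_injective.eq_iff (and_iff_left fun h => ?_)
    exact negL_ne_posL _ _ h.symm

theorem rel_posList_colT (hn : μ.rowLen 0 + ν.rowLen 0 ≤ n) (h : SkewRSKRel w x)
    (h' : SkewRSKRel w' x') {t : ℕ} (ht : t < n)
    (hw : (wcol w t).posList = (wcol w' t).posList ∨
      (wcol w' t).posList = 1 :: (wcol w t).posList) :
    colT x.2.2 (n - 1 - t) = colT x'.2.2 (n - 1 - t) ∧
    (rskQ x.2.1 x.1 t = rskQ x'.2.1 x'.1 t ∧ (wcol w t).posList = (wcol w' t).posList ∨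
      rskQ x'.2.1 x'.1 t = 1 :: rskQ x.2.1 x.1 t) := by
  have hl : (colT x.2.2 (n - 1 - t)).length = (colT x'.2.2 (n - 1 - t)).length := by
    rw [colT_length, colT_length]
  have h1 := (((rel_iff' hn w x).1 h).2 t ht).2
  have h2 := (((rel_iff' hn w' x').1 h').2 t ht).2
  rcases hw with hw | hw
  · have := hw
    rw [h1, h2] at this
    obtain ⟨e1, e2⟩ := List.append_inj' this hl
    exact ⟨e2, Or.inl ⟨e1, hw⟩⟩
  · rw [h1, h2, ← List.cons_append] at hw
    obtain ⟨e1, e2⟩ := List.append_inj' hw hl.symm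
    exact ⟨e2.symm, Or.inr e1⟩

/-- If `1` does not occur in the column of `S_{>0}`, the positive bit of index `0` is decided by the
labels, so the column is described by its insertion data. -/
theorem fockFac_le_zeroFac (hn : μ.rowLen 0 + ν.rowLen 0 ≤ n) (h : SkewRSKRel w x)
    (h' : SkewRSKRel w' x') {t : ℕ} (ht : t < n) (h1 : 1 ∉ colT x.2.2 (n - 1 - t)) (N : ℕ) :
    Fac.Le (fockFac 0 (wcol w t) (wcol w' t))
      (zeroFac N (bits (rskP x.2.1 x.1 t)) (bits (rskQ x.2.1 x.1 t))
        (bits (rskP x'.2.1 x'.1 t)) (bits (rskQ x'.2.1 x'.1 t))) := by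
  obtain ⟨g1, g2, g3, g4⟩ := fockFac_le_zero (N := N) (w := wcol w t) (w' := wcol w' t)
  have hP := (((rel_iff' hn w x).1 h).2 t ht).1
  have hP' := (((rel_iff' hn w' x').1 h').2 t ht).1
  have hQ := (((rel_iff' hn w x).1 h).2 t ht).2
  rw [← FockWord.bits_dualColumn, ← FockWord.bits_dualColumn, hP, hP'] at g1 g2 g3 g4
  have h0 : (wcol w t).posBit 0 = bits (rskQ x.2.1 x.1 t) 0 := by
    rw [← FockWord.bits_posList, hQ, bits, bits, decide_eq_decide, List.mem_append]
    exact or_iff_left h1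
  refine ⟨g1.trans ?_, g2.trans ?_, fun hR => ?_, fun hE => ?_⟩
  · simp only [zeroFac, h0]
  · simp only [zeroFac, h0]
  · obtain ⟨⟨q1, q2, q3, -⟩, q5⟩ := g3 hR
    rw [h0] at q2
    obtain ⟨-, e | e⟩ := rel_posList_colT hn h h' ht (Or.inr (fockFac_zero_R hR))
    · have := congrArg List.length (fockFac_zero_R hR)
      rw [e.2, List.length_cons] at this
      omega
    · refine ⟨⟨q1, q2, q3, ?_⟩, fun k hk hk0 => ⟨(q5 k hk hk0).1, ?_⟩⟩
      · rw [e, bits_eq_true]; exact List.mem_cons.2 (Or.inl rfl)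
      · rw [e]
        have : k.succPNat ≠ 1 := fun h => hk0 (Nat.succPNat_inj.1 (h : k.succPNat = Nat.succPNat 0))
        simp [bits, this]
  · have hE' : wcol w t = wcol w' t := hE
    obtain ⟨-, e | e⟩ := rel_posList_colT hn h h' ht (Or.inl (by rw [hE']))
    · exact fun k hk => ⟨(g4 hE k hk).1, by rw [e.1]⟩
    · have := congrArg List.length e
      have h3 := rskP_length x.2.1 x.1 t
      have h4 := rskP_length x'.2.1 x'.1 t
      rw [← hP, hE', hP'] at h3
      rw [List.length_cons] at this
      omega

/-- A `1` in the column of `S_{>0}` leaves no room for smaller labels, and `μ` has no column there,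
so no letter is missing. Both `-1` and `1` occur in the word and cancel each other. -/
theorem fockFac_of_one_mem (hn : μ.rowLen 0 + ν.rowLen 0 ≤ n) (h : SkewRSKRel w x) {t : ℕ}
    (ht : t < n) (h1 : 1 ∈ colT x.2.2 (n - 1 - t)) :
    rskP x.2.1 x.1 t = [] ∧ rskQ x.2.1 x.1 t = [] ∧
      fockFac 0 (wcol w t) (wcol w' t) = Fac.ofProp (wcol w t = wcol w' t) := by
  obtain ⟨hP, hQ⟩ := ((rel_iff' hn w x).1 h).2 t ht
  have hs := (wcol w t).posList_sorted
  rw [hQ, List.pairwise_append] at hs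
  have hQ0 : rskQ x.2.1 x.1 t = [] := by
    rw [List.eq_nil_iff_forall_not_mem]
    intro z hz
    exact absurd (hs.2.2 z hz 1 h1) (not_lt.2 one_le)
  have hP0 : rskP x.2.1 x.1 t = [] := by
    rw [← List.length_eq_zero_iff, rskP_length, hQ0]
    have h3 := List.length_pos_of_mem h1
    rw [colT_length] at h3
    have := colLen_zero_or μ ν hn ht
    simp only [List.length_nil]
    omega
  refine ⟨hP0, hQ0, ?_⟩
  have hlo : lo 0 ∈ Set.range (wcol w t).letter := by
    rw [lo_zero]
    by_contra hc
    have := (FockWord.mem_dualColumn _ _).2 hc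
    rw [hP, hP0] at this
    simp at this
  have hhi : hi 0 ∈ Set.range (wcol w t).letter := by
    rw [hi_zero, ← FockWord.mem_posList, hQ]
    exact List.mem_append_right _ h1
  refine Fac.eq_ofProp ?_ ?_
  · rw [fockFac_e, fockE, if_neg fun h => h.2 hlo]
  · rw [fockFac_p, fockP, if_neg fun h => h.2 hhi]

theorem one_mem_colT_succ {T : SST (normalShape ν)} {c : ℕ} (h : 1 ∈ colT T (c + 1)) :
    1 ∈ colT T c := by
  obtain ⟨r, hr, he⟩ := List.getElem_of_mem h
  have hr' : r < (colT T c).length := by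
    rw [colT_length] at hr ⊢
    exact hr.trans_le (ν.colLen_anti _ _ (by omega))
  have h1 := colT_le T c r hr' hr
  rw [he] at h1
  rw [← le_antisymm h1 one_le]
  exact List.getElem_mem hr'

/-- The comparison of two semi-infinite tableaux at the colour `0`, in terms of the insertion. -/
theorem wFac_zero (hn : μ.rowLen 0 + ν.rowLen 0 ≤ n) (h : SkewRSKRel w x)
    (h' : SkewRSKRel w' x') (N : ℕ) (X : Fac) (he : X.e = 0) (hE : X.E) (d : ℕ) :
    ∀ t, t + d = n →
    (((List.range' t d).map fun t => fockFac 0 (wcol w t) (wcol w' t)).prod.e =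
      (((List.range' t d).map fun t => zeroFac N (bits (rskP x.2.1 x.1 t))
        (bits (rskQ x.2.1 x.1 t)) (bits (rskP x'.2.1 x'.1 t)) (bits (rskQ x'.2.1 x'.1 t))).prod *
        X).e) ∧
    (((List.range' t d).map fun t => fockFac 0 (wcol w t) (wcol w' t)).prod.R →
      (((List.range' t d).map fun t => zeroFac N (bits (rskP x.2.1 x.1 t))
        (bits (rskQ x.2.1 x.1 t)) (bits (rskP x'.2.1 x'.1 t)) (bits (rskQ x'.2.1 x'.1 t))).prod *
        X).R) ∧
    (((List.range' t d).map fun t => fockFac 0 (wcol w t) (wcol w' t)).prod.E →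
      (((List.range' t d).map fun t => zeroFac N (bits (rskP x.2.1 x.1 t))
        (bits (rskQ x.2.1 x.1 t)) (bits (rskP x'.2.1 x'.1 t)) (bits (rskQ x'.2.1 x'.1 t))).prod *
        X).E) ∧
    (d = 0 ∨ 1 ∈ colT x.2.2 (n - 1 - t) →
      ((List.range' t d).map fun t => fockFac 0 (wcol w t) (wcol w' t)).prod.e = 0 ∧
      ¬ ((List.range' t d).map fun t => fockFac 0 (wcol w t) (wcol w' t)).prod.R) := by
  induction d with
  | zero => intro t ht; simp [he, hE]
  | succ d ih =>
    intro t ht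
    obtain ⟨i1, i2, i3, i4⟩ := ih (t + 1) (by omega)
    simp only [List.range'_succ, List.map_cons, List.prod_cons, mul_assoc]
    -- Once `1` lies in a column of `S_{>0}`, it lies in all columns further to the left, which form
    -- a tail without action. There the two products may have different `φ`, but a tail enters the
    -- tensor product rule only through `ε`, `R` and `E`.
    by_cases h1 : 1 ∈ colT x.2.2 (n - 1 - t)
    · obtain ⟨e1, e2, e3⟩ := fockFac_of_one_mem (w' := w') hn h (t := t) (by omega) h1
      have hnext : d = 0 ∨ 1 ∈ colT x.2.2 (n - 1 - (t + 1)) := by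
        rcases Nat.eq_zero_or_pos d with hd | hd
        · exact Or.inl hd
        · refine Or.inr (one_mem_colT_succ ?_)
          rwa [show n - 1 - (t + 1) + 1 = n - 1 - t by omega]
      obtain ⟨j1, j2⟩ := i4 hnext
      have hz : (zeroFac N (bits (rskP x.2.1 x.1 t)) (bits (rskQ x.2.1 x.1 t))
          (bits (rskP x'.2.1 x'.1 t)) (bits (rskQ x'.2.1 x'.1 t))).e = 0 := by
        rw [e1]; rfl
      have k1 : (Fac.ofProp (wcol w t = wcol w' t) * ((List.range' (t + 1) d).map fun t =>
          fockFac 0 (wcol w t) (wcol w' t)).prod).e = 0 := by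
        rw [Fac.mul_e, j1]; rfl
      have k2 : ¬ (Fac.ofProp (wcol w t = wcol w' t) * ((List.range' (t + 1) d).map fun t =>
          fockFac 0 (wcol w t) (wcol w' t)).prod).R := by
        rw [Fac.ofProp_mul_R]
        exact fun hh => j2 hh.2
      rw [e3]
      refine ⟨?_, fun hR => absurd hR k2, fun hh => ?_, fun _ => ⟨k1, k2⟩⟩
      · rw [k1, Fac.mul_e, hz, ← i1, j1, Nat.zero_sub]
      · rw [Fac.mul_E] at hh ⊢
        refine ⟨?_, i3 hh.2⟩
        have hw : wcol w t = wcol w' t := hh.1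
        obtain ⟨hP, -⟩ := ((rel_iff' hn w x).1 h).2 t (by omega)
        obtain ⟨hP', -⟩ := ((rel_iff' hn w' x').1 h').2 t (by omega)
        have hPP : rskP x.2.1 x.1 t = rskP x'.2.1 x'.1 t := by rw [← hP, ← hP', hw]
        have hQQ : rskQ x'.2.1 x'.1 t = [] := by
          have := rskP_length x'.2.1 x'.1 t
          rw [← hPP, e1, List.length_nil] at this
          rw [← List.length_eq_zero_iff]
          omega
        exact fun k _ => ⟨by rw [hPP], by rw [e2, hQQ]⟩
    · have hle := (fockFac_le_zeroFac hn h h' (t := t) (by omega) h1 N)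
      obtain ⟨l1, l2, l3, l4⟩ := hle
      refine ⟨?_, fun hR => ?_, fun hh => ?_, fun hh => absurd hh (by simp [h1])⟩
      · rw [Fac.mul_e, Fac.mul_e, l1, l2, i1]
      · rw [Fac.mul_R, l2, i1] at hR
        rw [Fac.mul_R]
        tauto
      · rw [Fac.mul_E] at hh ⊢
        exact ⟨l4 hh.1, i3 hh.2⟩

theorem wFac_zero_e (hn : μ.rowLen 0 + ν.rowLen 0 ≤ n) (h : SkewRSKRel w x) :
    (wFac 0 w w).e = x.1 (1, 1) := by
  obtain ⟨N0, hN0⟩ := exists_sBounded x.1 x.2.1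
  have hN := hN0.mono (show N0 ≤ N0 + 1 by omega)
  have hnil := ((rel_iff' hn w x).1 h).1
  have key := (wFac_zero hn h h (N0 + 1) (cornerFac (N0 + 1) (countFun (rskL x.2.1 x.1 n))
    (countFun (rskL x.2.1 x.1 n))) (by rw [hnil]; rfl) (fun _ _ _ _ => rfl) n 0 (by omega)).1
  have := Chain.fac_zero_e (M' := fun t => countFun (rskL x.2.1 x.1 t))
    (P' := fun t => bits (rskP x.2.1 x.1 t)) (Q' := fun t => bits (rskQ x.2.1 x.1 t))
    (Nat.succ_pos N0) (rsk_chain hN n) n 0 (by omega)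
  rw [wFac, key, ← this, countFun_rskL_zero]
  rfl

theorem wFac_zero_R (hn : μ.rowLen 0 + ν.rowLen 0 ≤ n) (h : SkewRSKRel w x)
    (h' : SkewRSKRel w' x') (hR : (wFac 0 w w').R) :
    x' = (x.1 + Finsupp.single (1, 1) 1, x.2) := by
  obtain ⟨N0, hN0, hN0'⟩ := exists_sBounded₂ x x'
  have hN := hN0.mono (show N0 ≤ N0 + 1 by omega)
  have hN' := hN0'.mono (show N0 ≤ N0 + 1 by omega)
  have hnil := ((rel_iff' hn w x).1 h).1
  have hnil' := ((rel_iff' hn w' x').1 h').1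
  have key := (wFac_zero hn h h' (N0 + 1) (cornerFac (N0 + 1) (countFun (rskL x.2.1 x.1 n))
    (countFun (rskL x'.2.1 x'.1 n))) (by rw [hnil]; rfl) (by rw [hnil, hnil']; exact fun _ _ _ _ => rfl)
    n 0 (by omega)).2.1 hR
  obtain ⟨h1, h2⟩ := (rsk_chain hN n).fac_zero_R (Nat.succ_pos N0) (rsk_chain hN' n) key
  rw [countFun_rskL_zero, countFun_rskL_zero] at h1
  refine Prod.ext (cornerFac_R (Nat.succ_pos N0) hN.1 hN'.1 h1) (Prod.ext ?_ ?_)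
  · refine (ext_colS fun t ht => ?_).symm
    exact sorted_ext_bits (colS_sorted _ _) (colS_sorted _ _) (hN.2 t) (hN'.2 t)
      (h2 t (by omega))
  -- In one column the letter `1` is added in front of the positive letters. It enlarges the labels
  -- and leaves the column of `S_{>0}`, whose length is prescribed, unchanged.
  · refine (ext_colT (n := n) (by omega) fun t ht => ?_).symm
    obtain ⟨u, s, v, hl, hs, -, hu, hv⟩ := Fac.prod_R_split _ _ hR
    have hmem : t ∈ u ++ s :: v := hl ▸ (by simpa using ht)
    refine (rel_posList_colT hn h h' ht ?_).1
    rcases List.mem_append.1 hmem with hm | hm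
    · exact Or.inl (congrArg FockWord.posList (hu t hm))
    · rcases List.mem_cons.1 hm with rfl | hm
      · exact Or.inr (fockFac_zero_R hs)
      · exact Or.inl (congrArg FockWord.posList (hv t hm))

/-! ## The correspondence is compatible with the crystal structures -/

theorem rel_eps (hn : μ.rowLen 0 + ν.rowLen 0 ≤ n) (h : SkewRSKRel w x) (i : ℤ) :
    (vermaCrystal μ ν).eps i x = (semiInfCrystal (lamOf μ ν n)).eps i w := by
  rw [semiInf_eps i w w]
  rcases lt_trichotomy i 0 with hi | rfl | hi
  · rw [(wFac_le_neg hn h h hi).1, (goodAt_verma_neg hi).eps, Fac.mul_e,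
      Fac.ofProp_e, Nat.zero_sub, add_zero]
    rfl
  · rw [wFac_zero_e hn h]
    simp [vermaCrystal, matCrystal]
  · rw [(wFac_le_pos hn h h hi (Or.inl rfl)).1, (goodAt_verma_pos hi).eps,
      Fac.mul_e, Fac.ofProp_e, Nat.zero_sub, add_zero]
    rfl

theorem rel_f (hn : μ.rowLen 0 + ν.rowLen 0 ≤ n) (h : SkewRSKRel w x) (h' : SkewRSKRel w' x')
    {i : ℤ} (hf : (semiInfCrystal (lamOf μ ν n)).f i w = some w') :
    (vermaCrystal μ ν).f i x = some x' := by
  rw [semiInf_f] at hf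
  rcases lt_trichotomy i 0 with hi | rfl | hi
  · have := (wFac_le_neg hn h h' hi).2.2.1 hf
    rw [Fac.mul_ofProp_R] at this
    exact (verma_f_neg hi x x').2 this
  · rw [verma_f_zero]
    exact wFac_zero_R hn h h' hf
  · have := (wFac_le_pos hn h h' hi (Or.inr hf)).2.2.1 hf
    rw [Fac.mul_ofProp_R] at this
    exact (verma_f_pos hi x x').2 this

/-- Each semi-infinite word contributes one `Λ_0`, which `T_{-nΛ_0}` will remove; the rest is the
conservation of weight under insertion. -/
theorem rel_wt (hn : μ.rowLen 0 + ν.rowLen 0 ≤ n) (h : SkewRSKRel w x) :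
    vermaWt x + (n : ℤ) • lamZero = (semiInfCrystal (lamOf μ ν n)).wt w := by
  obtain ⟨h1, h2⟩ := (rel_iff' hn w x).1 h
  have h3 := rsk_wt x.2.1 x.1 n
  rw [h1, ← sst_wt_antinormal (L := vecNeg) (show μ.rowLen 0 ≤ n by omega)] at h3
  have h4 : (semiInfCrystal (lamOf μ ν n)).wt w =
      ((List.range' 0 n).map fun t => (wcol w t).wt).sum := by
    change ((List.ofFn w.col).map FockWord.wt).sum = _
    rw [ofFn_col, List.map_map]
    rfl
  have h5 : ∀ t ∈ List.range' 0 n, (wcol w t).wt = (lamZero +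
      (vecNeg.words.wt (rskP x.2.1 x.1 t) + vecPos.words.wt (rskQ x.2.1 x.1 t))) +
        vecPos.words.wt (colT x.2.2 (n - 1 - t)) := by
    intro t ht
    obtain ⟨g1, g2⟩ := h2 t (by simpa using ht)
    rw [FockWord.wt_eq, g1, g2, words_wt_append]
    abel
  rw [h4, List.map_congr_left h5, List.sum_map_add, List.sum_map_add,
    ← sst_wt_normal (L := vecPos) (show ν.rowLen 0 ≤ n by omega), vermaWt, h3, List.map_const',
    List.sum_replicate, List.length_range', natCast_zsmul, pairsWt]
  simp only [List.map_nil, List.sum_nil]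
  abel

end operators

end

end GlInf

namespace GlInf

noncomputable section

open PreCrystal

/-! ### The embedding and its images. -/

section psi

variable {μ ν : YoungDiagram} {n : ℕ}

open Classical in
/-- The embedding of `𝐁(Λ_{μ,ν;n}) ⊗ T_{-nΛ_0}` into `ℳ_{μ,ν}`. -/
def psi (μ ν : YoungDiagram) (n : ℕ) (o : Option (BSet μ ν n × Unit)) : Option (Verma μ ν) :=
  o.bind fun b => if hn : μ.rowLen 0 + ν.rowLen 0 ≤ n then some (exists_rel hn b.1).choose else none

theorem psi_some (hn : μ.rowLen 0 + ν.rowLen 0 ≤ n) (b : BSet μ ν n × Unit) (x : Verma μ ν) :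
    psi μ ν n (some b) = some x ↔ SkewRSKRel b.1 x := by
  have h := (exists_rel hn b.1).choose_spec
  simp only [psi, Option.bind_some, hn, dif_pos, Option.some_inj]
  exact ⟨fun e => e ▸ h, fun h' => rel_unique_right hn h h'⟩

theorem psi_ne_none (hn : μ.rowLen 0 + ν.rowLen 0 ≤ n) (b : BSet μ ν n × Unit) :
    psi μ ν n (some b) ≠ none := by
  simp [psi, hn]

theorem shiftedB_f {i : ℤ} {b b' : BSet μ ν n × Unit} (h : (shiftedB μ ν n).f i b = some b') :
    (semiInfCrystal (lamOf μ ν n)).f i b.1 = some b'.1 := by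
  change (if (⊥ : WithBot ℤ) < (semiInfCrystal (lamOf μ ν n)).phi i b.1 then
    ((semiInfCrystal (lamOf μ ν n)).f i b.1).map (fun b' => (b', b.2))
    else (none : Option Unit).map (fun c' => (b.1, c'))) = some b' at h
  by_cases hc : (⊥ : WithBot ℤ) < (semiInfCrystal (lamOf μ ν n)).phi i b.1
  · rw [if_pos hc] at h
    obtain ⟨a, h1, rfl⟩ := Option.map_eq_some_iff.1 h
    exact h1
  · rw [if_neg hc] at h
    simp at h

theorem psi_f (hn : μ.rowLen 0 + ν.rowLen 0 ≤ n) {i : ℤ} {b b' : BSet μ ν n × Unit}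
    {x x' : Verma μ ν} (h : psi μ ν n (some b) = some x) (h' : psi μ ν n (some b') = some x')
    (hf : (shiftedB μ ν n).f i b = some b') : (vermaCrystal μ ν).f i x = some x' :=
  rel_f hn ((psi_some hn b x).1 h) ((psi_some hn b' x').1 h') (shiftedB_f hf)

/-- No separate comparison of `φ` is needed, since in a crystal it is determined by the weight and
`ε`. -/
theorem psi_data (hn : μ.rowLen 0 + ν.rowLen 0 ≤ n) {b : BSet μ ν n × Unit} {x : Verma μ ν}
    (h : psi μ ν n (some b) = some x) : (vermaCrystal μ ν).wt x = (shiftedB μ ν n).wt b ∧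
      ∀ i, (vermaCrystal μ ν).eps i x = (shiftedB μ ν n).eps i b ∧
        (vermaCrystal μ ν).phi i x = (shiftedB μ ν n).phi i b := by
  have hr := (psi_some hn b x).1 h
  have hwt : (vermaCrystal μ ν).wt x = (shiftedB μ ν n).wt b := by
    change vermaWt x = (semiInfCrystal (lamOf μ ν n)).wt b.1 + -((n : ℤ) • lamZero)
    rw [← rel_wt hn hr]
    abel
  have heps : ∀ i, (vermaCrystal μ ν).eps i x = (shiftedB μ ν n).eps i b := by
    intro i
    rw [rel_eps hn hr i]
    simp [shiftedB, PreCrystal.tensor, PreCrystal.single]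
  refine ⟨hwt, fun i => ⟨heps i, ?_⟩⟩
  rw [(isCrystal_verma μ ν).phi_eq, (isCrystal_shiftedB μ ν n).phi_eq, hwt, heps i]

/-- Compatibility with `e` is reduced to that with `f`, as the two operators are inverse to each
other in both crystals. Injectivity is the uniqueness of the tableau belonging to a triple. -/
theorem isEmbedding_psi (hn : μ.rowLen 0 + ν.rowLen 0 ≤ n) :
    (shiftedB μ ν n).IsEmbedding (vermaCrystal μ ν) (psi μ ν n) := by
  refine ⟨⟨rfl, fun b x h => psi_data hn h, fun i b x h he => ?_, fun i b x h hf => ?_⟩, ?_⟩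
  · cases hb : (shiftedB μ ν n).e i b with
    | none => rw [hb] at he; exact absurd rfl he
    | some b' =>
      obtain ⟨x', hx'⟩ := Option.ne_none_iff_exists'.1 (psi_ne_none hn b')
      rw [hx']
      have hf := ((isCrystal_shiftedB μ ν n).f_iff_e i b' b).2 hb
      exact (((isCrystal_verma μ ν).f_iff_e i x' x).1 (psi_f hn hx' h hf)).symm
  · cases hb : (shiftedB μ ν n).f i b with
    | none => rw [hb] at hf; exact absurd rfl hf
    | some b' =>
      obtain ⟨x', hx'⟩ := Option.ne_none_iff_exists'.1 (psi_ne_none hn b')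
      rw [hx']
      exact (psi_f hn h hx' hb).symm
  · rintro (_ | b) (_ | b') hbb
    · rfl
    · exact absurd hbb.symm (psi_ne_none hn b')
    · exact absurd hbb (psi_ne_none hn b)
    · obtain ⟨x, hx⟩ := Option.ne_none_iff_exists'.1 (psi_ne_none hn b)
      have h1 := (psi_some hn b x).1 hx
      have h2 := (psi_some hn b' x).1 (hbb ▸ hx)
      exact congrArg some (Prod.ext (rel_unique_left hn h1 h2) rfl)

theorem some_mem_range_psi (hn : μ.rowLen 0 + ν.rowLen 0 ≤ n) (x : Verma μ ν) :
    some x ∈ Set.range (psi μ ν n) ↔ ∃ w : BSet μ ν n, SkewRSKRel w x := by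
  constructor
  · rintro ⟨_ | b, h⟩
    · exact absurd h (by simp [psi])
    · exact ⟨b.1, (psi_some hn b x).1 h⟩
  · rintro ⟨w, h⟩
    exact ⟨some (w, ()), (psi_some hn _ x).2 h⟩

theorem range_psi_subset (hn : μ.rowLen 0 + ν.rowLen 0 ≤ n) :
    Set.range (psi μ ν n) ⊆ Set.range (psi μ ν (n + 1)) := by
  rintro (_ | x) hx
  · exact ⟨none, rfl⟩
  · rw [some_mem_range_psi (by omega)]
    exact exists_rel_succ hn ((some_mem_range_psi hn x).1 hx)

end psi

end

end GlInf

/-! ### The embeddings and their union. -/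

theorem mainTheorem3 (μ ν : YoungDiagram) :
    (GlInf.vermaCrystal μ ν).IsCrystal ∧
    ∃ Ψ : ∀ n : ℕ, Option (GlInf.BSet μ ν n × Unit) → Option (GlInf.Verma μ ν),
      (∀ n : ℕ, μ.rowLen 0 + ν.rowLen 0 ≤ n →
        (GlInf.shiftedB μ ν n).IsCrystal ∧
        (GlInf.shiftedB μ ν n).IsEmbedding (GlInf.vermaCrystal μ ν) (Ψ n) ∧
        Ψ n (some (GlInf.BSet.top μ ν n, ())) = some (GlInf.vermaTop μ ν) ∧
        (∀ (w : GlInf.BSet μ ν n) (x : GlInf.Verma μ ν),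
          Ψ n (some (w, ())) = some x ↔ GlInf.SkewRSKRel w x) ∧
        Set.range (Ψ n) ⊆ Set.range (Ψ (n + 1))) ∧
      ∀ x : GlInf.Verma μ ν, ∃ n : ℕ, μ.rowLen 0 + ν.rowLen 0 ≤ n ∧
        some x ∈ Set.range (Ψ n) := by
  refine ⟨GlInf.isCrystal_verma μ ν, GlInf.psi μ ν, fun n hn => ⟨GlInf.isCrystal_shiftedB μ ν n,
    GlInf.isEmbedding_psi hn, (GlInf.psi_some hn _ _).2 (GlInf.rel_top hn),
    fun w x => GlInf.psi_some hn _ x, GlInf.range_psi_subset hn⟩, fun x => ?_⟩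
  obtain ⟨n, hn, h⟩ := GlInf.exists_rel_of_large x
  exact ⟨n, hn, (GlInf.some_mem_range_psi hn x).2 h⟩
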